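/- Let $n,m$ be positive integers, let $q_0,\dots,q_{m-1}\in\mathbb{C}\setminus\{0\}$ and $\delta_i=q_i+q_i^{-1}$. When $q_i$ is a root of unity, let $l_i$ be the least positive integer with $q_i^{2l_i}=1$. The bubble algebra $T=\mathbb{T}_{n,m}(\delta_0,\dots,\delta_{m-1})$ is the $\mathbb{C}$-algebra whose basis consists of the diagrams with $n$ nodes on the top row and $n$ nodes on the bottom row, each node having one of the colours $0,\dots,m-1$, together with a partition of the nodes into pairs of equal colour such that pairs of the same colour do not cross (pairs of different colours may cross). The product of two diagrams is zero unless the colours on the bottom row of the first agree with those on the top row of the second; otherwise they are stacked, and each closed loop of colour $i$ is removed and replaced by the factor $\delta_i$. For $\lambda\in\mathbb{Z}_{\ge 0}^m$, the cell module $\Delta_n(\lambda)$ is the $T$-module whose basis consists of the top halves of diagrams having exactly $\lambda_j$ propagating lines of colour $j$ for every $j$ (the cut propagating lines are called defects); $T$ acts by stacking, the result being zero if the number of defects of some colour drops. It carries the bilinear form $\langle x,y\rangle$ given on half-diagrams by gluing the reflection of $x$ to $y$: it is zero unless the colours of the nodes agree and every defect of $x$ is joined to a defect of $y$, and then it is the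 product of the $\delta_i$ over all closed loops (of colour $i$). Put $L_n(\lambda)=\Delta_n(\lambda)/\{x:\langle x,y\rangle=0\text{ for all }y\}$, so that $L_n(\lambda)=0$ if $\sum_j\lambda_j>n$. For a $T$-module $M$ let $\operatorname{Rad}^0M=M$ and let $\operatorname{Rad}^{k+1}M$ be the radical (the intersection of the maximal submodules) of $\operatorname{Rad}^kM$. Theorem. Let $\lambda\in\mathbb{Z}_{\ge0}^m$ with $\sum_j\lambda_j=n-2v$ for an integer $v\ge 0$, and assume that the form on $\Delta_n(\lambda)$ is not identically zero (this excludes exactly the case where $\lambda=0$ and all $\delta_i=0$). Let $0\le s<m$. Assume that for each $0\le j\le s$ the number $q_j$ is a root of unity and $t_j$ is an integer with $0<t_j<l_j$ and $\lambda_j+t_j+1\equiv 0 \pmod{l_j}$, and that for each $s<i<m$ either $q_i$ is not a root of unity, or $q_i$ is a root of unity and $\lambda_i+1\equiv 0\pmod{l_i}$. Then $$\operatorname{Rad}^{s+2}(\Delta_n(\lambda))=0,$$ that is, $\operatorname{Rad}^k(\Delta_n(\lambda))\neq 0$ only for $k\le s+1$, and for $0\le k\le s+1$ there is an isomorphism of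 $T$-modules $$\operatorname{Rad}^{k}(\Delta_n(\lambda))/\operatorname{Rad}^{k+1}(\Delta_n(\lambda))\;\cong\;\bigoplus_{\lambda'\in\Xi_k}L_n(\lambda'),$$ where $\Xi_k$ is the set of tuples $\lambda'$ for which there are exactly $k$ indices $j\in\{0,\dots,s\}$ with $\lambda'_j=\lambda_j+2t_j$, while $\lambda'_i=\lambda_i$ for all other indices $i\in\{0,\dots,m-1\}$. -/

import Mathlib

open Finset
open scoped DirectSum

namespace Bubble

/-! ### Coloured partition diagrams and their stacking -/

/-- An `m`-coloured partition diagram with top row `X` and bottom row `Y`: a colouring of the nodes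
together with a set partition of the nodes (given as an equivalence relation, whose classes are the
parts) all of whose parts are monochromatic. -/
@[ext]
structure ColPart (m : ℕ) (X Y : Type) where
  colour : X ⊕ Y → Fin m
  rel : Setoid (X ⊕ Y)
  colour_eq : ∀ p q, rel p q → colour p = colour q

section Stack

variable {m : ℕ} {X Y Z W : Type}

/-- Inclusion of the upper diagram's nodes into the nodes of two stacked diagrams. -/
def upper : X ⊕ Y → X ⊕ (Y ⊕ Z) := Sum.elim Sum.inl (fun y => Sum.inr (Sum.inl y))

/-- Inclusion of the lower diagram's nodes into the nodes of two stacked diagrams. -/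
def lower : Y ⊕ Z → X ⊕ (Y ⊕ Z) := Sum.inr

/-- Inclusion of the outer nodes (first and third row) into the nodes of two stacked diagrams. -/
def outer : X ⊕ Z → X ⊕ (Y ⊕ Z) := Sum.elim Sum.inl (fun z => Sum.inr (Sum.inr z))

/-- Two nodes of the stack (`a` above `b`) that lie in one part of `a` or in one part of `b`. -/
inductive StackStep (a : ColPart m X Y) (b : ColPart m Y Z) : X ⊕ (Y ⊕ Z) → X ⊕ (Y ⊕ Z) → Prop
  | up (p q : X ⊕ Y) : a.rel p q → StackStep a b (upper p) (upper q)
  | low (p q : Y ⊕ Z) : b.rel p q → StackStep a b (lower p) (lower q)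

/-- Connectedness in the stack of `a` above `b`. Its classes are the connected components. -/
def stack (a : ColPart m X Y) (b : ColPart m Y Z) : Setoid (X ⊕ (Y ⊕ Z)) :=
  Relation.EqvGen.setoid (StackStep a b)

/-- The colour distribution on the bottom of `a` is that on the top of `b`. -/
def Match (a : ColPart m X Y) (b : ColPart m Y Z) : Prop :=
  ∀ y, a.colour (Sum.inr y) = b.colour (Sum.inl y)

/-- Colours of the nodes of the stack. -/
def stackColour (a : ColPart m X Y) (b : ColPart m Y Z) : X ⊕ (Y ⊕ Z) → Fin m :=
  Sum.elim (fun x => a.colour (Sum.inl x)) b.colour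

theorem stackColour_upper {a : ColPart m X Y} {b : ColPart m Y Z} (h : Match a b) (p : X ⊕ Y) :
    stackColour a b (upper p) = a.colour p := by
  rcases p with x | y
  · rfl
  · exact (h y).symm

theorem stackColour_lower (a : ColPart m X Y) (b : ColPart m Y Z) (p : Y ⊕ Z) :
    stackColour a b (lower p) = b.colour p := rfl

/-- A function on the nodes of the stack that is constant on the parts of `a` and of `b` is
constant on the components. -/
theorem stack_const {a : ColPart m X Y} {b : ColPart m Y Z} {T : Type*} (f : X ⊕ (Y ⊕ Z) → T)
    (ha : ∀ p q, a.rel p q → f (upper p) = f (upper q))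
    (hb : ∀ p q, b.rel p q → f (lower p) = f (lower q)) {u v : X ⊕ (Y ⊕ Z)}
    (h : stack a b u v) : f u = f v := by
  have h' : Relation.EqvGen (StackStep a b) u v := h
  clear h
  induction h' with
  | rel u v h =>
    cases h with
    | up p q h => exact ha p q h
    | low p q h => exact hb p q h
  | refl => rfl
  | symm u v _ ih => exact ih.symm
  | trans u v w _ _ ih1 ih2 => exact ih1.trans ih2

theorem stack_up {a : ColPart m X Y} {b : ColPart m Y Z} {p q : X ⊕ Y} (h : a.rel p q) :
    stack a b (upper p) (upper q) := Relation.EqvGen.rel _ _ (StackStep.up p q h)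

theorem stack_low {a : ColPart m X Y} {b : ColPart m Y Z} {p q : Y ⊕ Z} (h : b.rel p q) :
    stack a b (lower p) (lower q) := Relation.EqvGen.rel _ _ (StackStep.low p q h)

theorem stack_colour {a : ColPart m X Y} {b : ColPart m Y Z} (h : Match a b)
    {u v : X ⊕ (Y ⊕ Z)} (huv : stack a b u v) : stackColour a b u = stackColour a b v :=
  stack_const _ (fun p q hpq => by
    rw [stackColour_upper h, stackColour_upper h]; exact a.colour_eq p q hpq)
    (fun p q hpq => b.colour_eq p q hpq) huv

/-- The composite diagram: `a` is placed above `b`, and two outer nodes lie in the same part when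
they are connected in the stack. -/
def comp (a : ColPart m X Y) (b : ColPart m Y Z) (h : Match a b) : ColPart m X Z where
  colour := fun p => stackColour a b (outer p)
  rel := (stack a b).comap outer
  colour_eq := fun _ _ hpq => stack_colour h hpq

/-- The components of the stack that consist of middle nodes with colours in `P`. -/
def Closed (a : ColPart m X Y) (b : ColPart m Y Z) (P : Set (Fin m)) : Type :=
  {K : Quotient (stack a b) // ∀ u, Quotient.mk (stack a b) u = K →
    ∃ y : Y, u = Sum.inr (Sum.inl y) ∧ b.colour (Sum.inl y) ∈ P}

/-- The number of components of colour `i` that are removed from the middle row when `a` is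
stacked above `b`. -/
noncomputable def loops (a : ColPart m X Y) (b : ColPart m Y Z) (i : Fin m) : ℕ :=
  Nat.card (Closed a b {i})

/-- The scalar that replaces the removed components. -/
noncomputable def weight (δ : Fin m → ℂ) (a : ColPart m X Y) (b : ColPart m Y Z) : ℂ :=
  ∏ i, δ i ^ loops a b i

/-- The reflection of a diagram in a horizontal line. -/
def ColPart.reflect (a : ColPart m X Y) : ColPart m Y X where
  colour := fun p => a.colour p.swap
  rel := a.rel.comap Sum.swap
  colour_eq := fun _ _ h => a.colour_eq _ _ h

/-- The diagram that connects every node only to the node below it, coloured by `c`. -/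
def idPart (c : X → Fin m) : ColPart m X X where
  colour := Sum.elim c c
  rel := Setoid.ker (Sum.elim id id)
  colour_eq := by
    rintro (p | p) (q | q) h <;> exact congrArg c h

end Stack

/-! ### Associativity of stacking, by counting labellings of the nodes by `Bool` -/

section Assoc

variable {m : ℕ} {X Y Z W : Type}

/-- A labelling that is constant on the parts of `a` and is `false` outside the colours in `P`. -/
def Good (P : Set (Fin m)) (a : ColPart m X Y) (f : X ⊕ Y → Bool) : Prop :=
  (∀ p q, a.rel p q → f p = f q) ∧ ∀ p, a.colour p ∉ P → f p = false

theorem good_glue {P : Set (Fin m)} {a : ColPart m X Y} {b : ColPart m Y Z}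
    {x : X → Bool} {y : Y → Bool} {z : Z → Bool}
    (ha : Good P a (Sum.elim x y)) (hb : Good P b (Sum.elim y z)) {u v : X ⊕ (Y ⊕ Z)}
    (huv : stack a b u v) :
    Sum.elim x (Sum.elim y z) u = Sum.elim x (Sum.elim y z) v := by
  refine stack_const _ ?_ ?_ huv
  · intro p q hpq
    have := ha.1 p q hpq
    rcases p with p | p <;> rcases q with q | q <;> exact this
  · intro p q hpq
    exact hb.1 p q hpq

theorem good_comp {P : Set (Fin m)} {a : ColPart m X Y} {b : ColPart m Y Z} (h : Match a b)
    {x : X → Bool} {y : Y → Bool} {z : Z → Bool}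
    (ha : Good P a (Sum.elim x y)) (hb : Good P b (Sum.elim y z)) :
    Good P (comp a b h) (Sum.elim x z) := by
  refine ⟨fun p q hpq => ?_, fun p hp => ?_⟩
  · have := good_glue ha hb hpq
    rcases p with p | p <;> rcases q with q | q <;> exact this
  · rcases p with p | p
    · exact ha.2 (Sum.inl p) hp
    · exact hb.2 (Sum.inr p) hp

open Classical in
theorem good_count [Finite X] [Finite Y] [Finite Z] (P : Set (Fin m)) (a : ColPart m X Y)
    (b : ColPart m Y Z) (h : Match a b) (x : X → Bool) (z : Z → Bool)
    (hxz : Good P (comp a b h) (Sum.elim x z)) :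
    Nat.card {y : Y → Bool // Good P a (Sum.elim x y) ∧ Good P b (Sum.elim y z)} =
      2 ^ Nat.card (Closed a b P) := by
  have hfin : Finite (Closed a b P) := by unfold Closed; infer_instance
  have hc : Nat.card (Closed a b P → Bool) = 2 ^ Nat.card (Closed a b P) := by
    rw [Nat.card_fun]; simp
  rw [← hc]
  let F : {y : Y → Bool // Good P a (Sum.elim x y) ∧ Good P b (Sum.elim y z)} →
      (Closed a b P → Bool) := fun y K =>
    Quotient.lift (Sum.elim x (Sum.elim y.1 z))
      (fun u v huv => good_glue y.2.1 y.2.2 huv) K.1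
  refine Nat.card_congr (Equiv.ofBijective F ⟨?_, ?_⟩)
  · rintro ⟨y, hy⟩ ⟨y', hy'⟩ hF
    apply Subtype.ext
    funext w
    change y w = y' w
    by_cases ho : ∃ o : X ⊕ Z, stack a b (Sum.inr (Sum.inl w)) (outer o)
    · obtain ⟨o, ho⟩ := ho
      have h1 := good_glue hy.1 hy.2 ho
      have h2 := good_glue hy'.1 hy'.2 ho
      rcases o with o | o <;> exact h1.trans h2.symm
    · by_cases hP : b.colour (Sum.inl w) ∈ P
      · have := congrFun hF ⟨Quotient.mk _ (Sum.inr (Sum.inl w)), ?_⟩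
        · exact this
        · intro u hu
          have hu' : stack a b u (Sum.inr (Sum.inl w)) := Quotient.exact hu
          rcases u with u | u | u
          · exact absurd ⟨Sum.inl u, (stack a b).symm hu'⟩ ho
          · refine ⟨u, rfl, ?_⟩
            have := stack_colour h hu'
            change b.colour _ = b.colour _ at this
            rwa [this]
          · exact absurd ⟨Sum.inr u, (stack a b).symm hu'⟩ ho
      · exact (hy.2.2 (Sum.inl w) hP).trans (hy'.2.2 (Sum.inl w) hP).symm
  · intro g
    let G : Quotient (stack a b) → Bool := fun K =>
      if ho : ∃ o : X ⊕ Z, Quotient.mk _ (outer o) = K then Sum.elim x z ho.choose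
      else if hK : ∀ u, Quotient.mk (stack a b) u = K →
        ∃ y : Y, u = Sum.inr (Sum.inl y) ∧ b.colour (Sum.inl y) ∈ P then g ⟨K, hK⟩ else false
    have hG : ∀ o : X ⊕ Z, G (Quotient.mk _ (outer o)) = Sum.elim x z o := by
      intro o
      have ho : ∃ o' : X ⊕ Z, Quotient.mk (stack a b) (outer o') = Quotient.mk _ (outer o) :=
        ⟨o, rfl⟩
      simp only [G, dif_pos ho]
      exact hxz.1 _ _ (Quotient.exact ho.choose_spec : stack a b _ _)
    have hGP : ∀ u, stackColour a b u ∉ P → G (Quotient.mk _ u) = false := by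
      intro u hu
      by_cases ho : ∃ o : X ⊕ Z, Quotient.mk (stack a b) (outer o) = Quotient.mk _ u
      · obtain ⟨o, ho⟩ := ho
        rw [← ho, hG]
        apply hxz.2
        have := stack_colour h (Quotient.exact ho : stack a b _ _)
        change stackColour a b (outer o) ∉ P
        rwa [this]
      · simp only [G, dif_neg ho]
        rw [dif_neg]
        intro hK
        obtain ⟨y, rfl, hy⟩ := hK u rfl
        exact hu hy
    let y : Y → Bool := fun w => G (Quotient.mk _ (Sum.inr (Sum.inl w)))
    have hup : ∀ p : X ⊕ Y, Sum.elim x y p = G (Quotient.mk _ (upper p)) := by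
      rintro (p | p)
      · exact (hG (Sum.inl p)).symm
      · rfl
    have hlow : ∀ p : Y ⊕ Z, Sum.elim y z p = G (Quotient.mk _ (lower p)) := by
      rintro (p | p)
      · rfl
      · exact (hG (Sum.inr p)).symm
    have hy1 : Good P a (Sum.elim x y) := by
      refine ⟨fun p q hpq => ?_, fun p hp => ?_⟩
      · rw [hup, hup]
        exact congrArg G (Quotient.sound (stack_up hpq))
      · rw [hup]
        apply hGP
        rwa [stackColour_upper h]
    have hy2 : Good P b (Sum.elim y z) := by
      refine ⟨fun p q hpq => ?_, fun p hp => ?_⟩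
      · rw [hlow, hlow]
        exact congrArg G (Quotient.sound (stack_low hpq))
      · rw [hlow]
        exact hGP _ hp
    refine ⟨⟨y, hy1, hy2⟩, ?_⟩
    funext K
    obtain ⟨K, hK⟩ := K
    induction K using Quotient.inductionOn with
    | h u =>
      obtain ⟨w, rfl, hw⟩ := hK u rfl
      change G (Quotient.mk _ (Sum.inr (Sum.inl w))) = _
      have ho : ¬ ∃ o : X ⊕ Z, Quotient.mk (stack a b) (outer o) =
          Quotient.mk _ (Sum.inr (Sum.inl w)) := by
        rintro ⟨o, ho⟩
        obtain ⟨y', hy', _⟩ := hK _ ho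
        rcases o with o | o <;> simp [outer] at hy'
      simp only [G, dif_neg ho]
      rw [dif_pos hK]

open Classical in
/-- The matrix of a diagram on labellings. -/
noncomputable def labelMat (P : Set (Fin m)) (a : ColPart m X Y) :
    Matrix (X → Bool) (Y → Bool) ℕ :=
  fun x y => if Good P a (Sum.elim x y) then 1 else 0

theorem labelMat_mul [Fintype X] [Fintype Y] [Fintype Z] [DecidableEq Y] (P : Set (Fin m))
    (a : ColPart m X Y) (b : ColPart m Y Z) (h : Match a b) :
    labelMat P a * labelMat P b = 2 ^ Nat.card (Closed a b P) • labelMat P (comp a b h) := by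
  classical
  ext x z
  rw [Matrix.mul_apply, Matrix.smul_apply]
  have h1 : ∑ y, labelMat P a x y * labelMat P b y z =
      Nat.card {y : Y → Bool // Good P a (Sum.elim x y) ∧ Good P b (Sum.elim y z)} := by
    rw [Nat.card_eq_fintype_card, Fintype.card_subtype, Finset.card_filter]
    refine Finset.sum_congr rfl fun y _ => ?_
    unfold labelMat
    by_cases h1 : Good P a (Sum.elim x y) <;> by_cases h2 : Good P b (Sum.elim y z) <;>
      simp [h1, h2]
  rw [h1]
  by_cases hg : Good P (comp a b h) (Sum.elim x z)
  · rw [good_count P a b h x z hg]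
    simp [labelMat, hg]
  · have : IsEmpty {y : Y → Bool // Good P a (Sum.elim x y) ∧ Good P b (Sum.elim y z)} :=
      ⟨fun y => hg (good_comp h y.2.1 y.2.2)⟩
    simp [labelMat, hg]

theorem good_false (P : Set (Fin m)) (a : ColPart m X Y) :
    Good P a (Sum.elim (fun _ => false) (fun _ => false)) := by
  refine ⟨?_, ?_⟩
  · rintro (p | p) (q | q) _ <;> rfl
  · rintro (p | p) _ <;> rfl

theorem smul_labelMat_cancel {P : Set (Fin m)} {a b : ColPart m X Y} {k l : ℕ}
    (h : 2 ^ k • labelMat P a = 2 ^ l • labelMat P b) : k = l ∧ labelMat P a = labelMat P b := by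
  have h0 := congrFun (congrFun h (fun _ => false)) (fun _ => false)
  simp only [Matrix.smul_apply, labelMat, good_false, if_true, smul_eq_mul, mul_one] at h0
  have hk := Nat.pow_right_injective (le_refl 2) h0
  refine ⟨hk, ?_⟩
  subst hk
  ext x y
  have h1 := congrFun (congrFun h x) y
  simp only [Matrix.smul_apply, smul_eq_mul] at h1
  exact Nat.eq_of_mul_eq_mul_left (by positivity) h1

open Classical in
theorem rel_of_labelMat {a b : ColPart m X Y} (h : labelMat Set.univ a = labelMat Set.univ b) :
    ∀ p q, b.rel p q → a.rel p q := by
  intro p q hpq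
  let f : X ⊕ Y → Bool := fun r => decide (a.rel p r)
  have hf : Sum.elim (fun x => f (Sum.inl x)) (fun y => f (Sum.inr y)) = f := by
    funext r; rcases r with r | r <;> rfl
  have ha : Good Set.univ a f := by
    refine ⟨fun r s hrs => ?_, fun r hr => absurd (Set.mem_univ _) hr⟩
    have : a.rel p r ↔ a.rel p s :=
      ⟨fun h => a.rel.trans h hrs, fun h => a.rel.trans h (a.rel.symm hrs)⟩
    simp [f, this]
  have h1 := congrFun (congrFun h (fun x => f (Sum.inl x))) (fun y => f (Sum.inr y))
  unfold labelMat at h1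
  rw [hf, if_pos ha] at h1
  have hb : Good Set.univ b f := by
    by_contra hb
    rw [if_neg hb] at h1
    exact one_ne_zero h1
  have h2 := hb.1 p q hpq
  have h3 : a.rel p p := a.rel.refl p
  simpa [f, h3] using h2.symm

theorem eq_of_labelMat {a b : ColPart m X Y} (hc : a.colour = b.colour)
    (h : labelMat Set.univ a = labelMat Set.univ b) : a = b := by
  refine ColPart.ext hc (Setoid.ext fun p q => ⟨?_, ?_⟩)
  · exact rel_of_labelMat h.symm p q
  · exact rel_of_labelMat h p q

theorem comp_assoc_key [Fintype X] [Fintype Y] [Fintype Z] [Fintype W] (P : Set (Fin m))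
    (a : ColPart m X Y) (b : ColPart m Y Z) (c : ColPart m Z W) (hab : Match a b)
    (hbc : Match b c) (h1 : Match (comp a b hab) c) (h2 : Match a (comp b c hbc)) :
    Nat.card (Closed a b P) + Nat.card (Closed (comp a b hab) c P) =
      Nat.card (Closed b c P) + Nat.card (Closed a (comp b c hbc) P) ∧
    labelMat P (comp (comp a b hab) c h1) = labelMat P (comp a (comp b c hbc) h2) := by
  classical
  have h := Matrix.mul_assoc (labelMat P a) (labelMat P b) (labelMat P c)
  rw [labelMat_mul P a b hab, labelMat_mul P b c hbc, Matrix.smul_mul, Matrix.mul_smul,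
    labelMat_mul P _ c h1, labelMat_mul P a _ h2, smul_smul, smul_smul, ← pow_add, ← pow_add] at h
  exact smul_labelMat_cancel h

theorem comp_assoc [Fintype X] [Fintype Y] [Fintype Z] [Fintype W]
    (a : ColPart m X Y) (b : ColPart m Y Z) (c : ColPart m Z W) (hab : Match a b)
    (hbc : Match b c) (h1 : Match (comp a b hab) c) (h2 : Match a (comp b c hbc)) :
    comp (comp a b hab) c h1 = comp a (comp b c hbc) h2 := by
  refine eq_of_labelMat ?_ (comp_assoc_key _ a b c hab hbc h1 h2).2
  funext p
  rcases p with p | p <;> rfl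

theorem weight_assoc [Fintype X] [Fintype Y] [Fintype Z] [Fintype W] (δ : Fin m → ℂ)
    (a : ColPart m X Y) (b : ColPart m Y Z) (c : ColPart m Z W) (hab : Match a b)
    (hbc : Match b c) (h1 : Match (comp a b hab) c) (h2 : Match a (comp b c hbc)) :
    weight δ a b * weight δ (comp a b hab) c = weight δ b c * weight δ a (comp b c hbc) := by
  unfold weight
  rw [← Finset.prod_mul_distrib, ← Finset.prod_mul_distrib]
  refine Finset.prod_congr rfl fun i _ => ?_
  rw [← pow_add, ← pow_add]
  exact congrArg _ (comp_assoc_key {i} a b c hab hbc h1 h2).1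

theorem labelMat_id_mul [Fintype X] [Fintype Y] [DecidableEq X] (P : Set (Fin m))
    (a : ColPart m X Y) :
    labelMat P (idPart fun x => a.colour (Sum.inl x)) * labelMat P a = labelMat P a := by
  classical
  ext x y
  rw [Matrix.mul_apply, Finset.sum_eq_single x]
  · by_cases h : Good P a (Sum.elim x y)
    · have : Good P (idPart fun x => a.colour (Sum.inl x)) (Sum.elim x x) := by
        refine ⟨?_, ?_⟩
        · rintro (p | p) (q | q) hpq <;> exact congrArg x hpq
        · rintro (p | p) hp <;> exact h.2 (Sum.inl p) hp
      simp [labelMat, this]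
    · simp [labelMat, h]
  · intro x' _ hx'
    have : ¬ Good P (idPart fun x => a.colour (Sum.inl x)) (Sum.elim x x') := by
      intro h
      apply hx'
      funext p
      exact (h.1 (Sum.inl p) (Sum.inr p) rfl).symm
    simp [labelMat, this]
  · simp

theorem labelMat_mul_id [Fintype X] [Fintype Y] [DecidableEq Y] (P : Set (Fin m))
    (a : ColPart m X Y) :
    labelMat P a * labelMat P (idPart fun y => a.colour (Sum.inr y)) = labelMat P a := by
  classical
  ext x y
  rw [Matrix.mul_apply, Finset.sum_eq_single y]
  · by_cases h : Good P a (Sum.elim x y)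
    · have : Good P (idPart fun y => a.colour (Sum.inr y)) (Sum.elim y y) := by
        refine ⟨?_, ?_⟩
        · rintro (p | p) (q | q) hpq <;> exact congrArg y hpq
        · rintro (p | p) hp <;> exact h.2 (Sum.inr p) hp
      simp [labelMat, this]
    · simp [labelMat, h]
  · intro y' _ hy'
    have : ¬ Good P (idPart fun y => a.colour (Sum.inr y)) (Sum.elim y' y) := by
      intro h
      apply hy'
      funext p
      exact h.1 (Sum.inl p) (Sum.inr p) rfl
    simp [labelMat, this]
  · simp

theorem id_comp_key [Fintype X] [Fintype Y] (P : Set (Fin m)) (a : ColPart m X Y)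
    (h : Match (idPart fun x => a.colour (Sum.inl x)) a) :
    Nat.card (Closed (idPart fun x => a.colour (Sum.inl x)) a P) = 0 ∧
      labelMat P (comp _ a h) = labelMat P a := by
  classical
  have h1 := labelMat_id_mul P a
  rw [labelMat_mul P _ a h] at h1
  exact smul_labelMat_cancel (l := 0) (by simpa using h1)

theorem comp_id_key [Fintype X] [Fintype Y] (P : Set (Fin m)) (a : ColPart m X Y)
    (h : Match a (idPart fun y => a.colour (Sum.inr y))) :
    Nat.card (Closed a (idPart fun y => a.colour (Sum.inr y)) P) = 0 ∧
      labelMat P (comp a _ h) = labelMat P a := by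
  classical
  have h1 := labelMat_mul_id P a
  rw [labelMat_mul P a _ h] at h1
  exact smul_labelMat_cancel (l := 0) (by simpa using h1)

theorem id_comp [Fintype X] [Fintype Y] (a : ColPart m X Y)
    (h : Match (idPart fun x => a.colour (Sum.inl x)) a) : comp _ a h = a := by
  refine eq_of_labelMat ?_ (id_comp_key _ a h).2
  funext p
  rcases p with p | p <;> rfl

theorem comp_id [Fintype X] [Fintype Y] (a : ColPart m X Y)
    (h : Match a (idPart fun y => a.colour (Sum.inr y))) : comp a _ h = a := by
  refine eq_of_labelMat ?_ (comp_id_key _ a h).2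
  funext p
  rcases p with p | p <;> rfl

theorem weight_id_comp [Fintype X] [Fintype Y] (δ : Fin m → ℂ) (a : ColPart m X Y) :
    weight δ (idPart fun x => a.colour (Sum.inl x)) a = 1 := by
  unfold weight
  refine Finset.prod_eq_one fun i _ => ?_
  have := (id_comp_key {i} a fun _ => rfl).1
  unfold loops
  rw [this, pow_zero]

theorem weight_comp_id [Fintype X] [Fintype Y] (δ : Fin m → ℂ) (a : ColPart m X Y) :
    weight δ a (idPart fun y => a.colour (Sum.inr y)) = 1 := by
  unfold weight
  refine Finset.prod_eq_one fun i _ => ?_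
  have := (comp_id_key {i} a fun _ => rfl).1
  unfold loops
  rw [this, pow_zero]

end Assoc

/-! ### Bubble diagrams -/

section Planar

variable {m : ℕ} {X Y Z W : Type}

/-- The order of the nodes along the boundary of the frame: the top row from left to right, then
the bottom row from right to left. -/
def Before [LinearOrder X] [LinearOrder Y] : X ⊕ Y → X ⊕ Y → Prop
  | Sum.inl x, Sum.inl x' => x < x'
  | Sum.inl _, Sum.inr _ => True
  | Sum.inr _, Sum.inl _ => False
  | Sum.inr y, Sum.inr y' => y' < y

/-- All parts have size two, and edges of the same colour do not cross. -/
structure IsBubble [LinearOrder X] [LinearOrder Y] (a : ColPart m X Y) : Prop where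
  two : ∀ p, ∃! q, q ≠ p ∧ a.rel p q
  planar : ∀ p q r s, Before p q → Before q r → Before r s → a.rel p r → a.rel q s →
    a.colour p = a.colour q → a.rel p q

theorem Before.trans [LinearOrder X] [LinearOrder Y] {p q r : X ⊕ Y} (h : Before p q)
    (h' : Before q r) : Before p r := by
  rcases p with p | p <;> rcases q with q | q <;> rcases r with r | r <;>
    simp only [Before] at * <;> first | exact lt_trans h h' | exact lt_trans h' h

theorem Before.irrefl [LinearOrder X] [LinearOrder Y] (p : X ⊕ Y) : ¬ Before p p := by
  rcases p with p | p <;> simp [Before]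

theorem Before.total [LinearOrder X] [LinearOrder Y] {p q : X ⊕ Y} (h : p ≠ q) :
    Before p q ∨ Before q p := by
  rcases p with p | p <;> rcases q with q | q
  · exact lt_or_gt_of_ne fun e => h (congrArg _ e)
  · exact Or.inl trivial
  · exact Or.inr trivial
  · exact lt_or_gt_of_ne fun e => h (congrArg _ e.symm)

theorem idPart_isBubble [LinearOrder X] (c : X → Fin m) : IsBubble (idPart c) where
  two := by
    rintro (p | p)
    · refine ⟨Sum.inr p, ⟨by simp, rfl⟩, ?_⟩
      rintro (q | q) ⟨h1, h2⟩
      · exact absurd (congrArg Sum.inl (show p = q from h2).symm) h1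
      · exact congrArg Sum.inr (show p = q from h2).symm
    · refine ⟨Sum.inl p, ⟨by simp, rfl⟩, ?_⟩
      rintro (q | q) ⟨h1, h2⟩
      · exact congrArg Sum.inl (show p = q from h2).symm
      · exact absurd (congrArg Sum.inr (show p = q from h2).symm) h1
  planar := by
    intro p q r s hpq hqr hrs hpr hqs _
    have e1 : Sum.elim id id p = Sum.elim id id r := hpr
    have e2 : Sum.elim id id q = Sum.elim id id s := hqs
    rcases p with p | p <;> rcases q with q | q <;> rcases r with r | r <;>
      rcases s with s | s <;> simp [Before] at hpq hqr hrs e1 e2 <;> subst e1 <;> subst e2 <;>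
      first
        | exact absurd (hpq.trans hrs) (lt_irrefl _)
        | exact absurd (hpq.trans hqr) (lt_irrefl _)
        | exact absurd (hqr.trans hrs) (lt_irrefl _)

theorem reflect_before [LinearOrder X] [LinearOrder Y] (p q : Y ⊕ X) :
    Before p.swap q.swap ↔ Before q p := by
  rcases p with p | p <;> rcases q with q | q <;> simp [Before]

theorem IsBubble.reflect [LinearOrder X] [LinearOrder Y] {a : ColPart m X Y} (h : IsBubble a) :
    IsBubble a.reflect where
  two := by
    intro p
    obtain ⟨q, ⟨h1, h2⟩, h3⟩ := h.two p.swap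
    refine ⟨q.swap, ⟨?_, ?_⟩, ?_⟩
    · rintro rfl; simp at h1
    · change a.rel p.swap q.swap.swap
      rwa [Sum.swap_swap]
    · rintro r ⟨hr1, hr2⟩
      rw [← h3 r.swap ⟨fun e => hr1 (Sum.swap_leftInverse.injective e), hr2⟩, Sum.swap_swap]
  planar := by
    intro p q r s hpq hqr hrs hpr hqs hc
    have hpr' : a.rel p.swap r.swap := hpr
    have hqs' : a.rel q.swap s.swap := hqs
    have h1 : a.rel s.swap r.swap := by
      refine h.planar s.swap r.swap q.swap p.swap ((reflect_before _ _).2 hrs)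
        ((reflect_before _ _).2 hqr) ((reflect_before _ _).2 hpq) (a.rel.symm hqs')
        (a.rel.symm hpr') ?_
      rw [← a.colour_eq _ _ hpr', ← a.colour_eq _ _ hqs']
      exact hc.symm
    exact a.rel.trans hpr' (a.rel.trans (a.rel.symm h1) (a.rel.symm hqs'))

/-! #### Parts of size two and planarity are preserved by stacking -/

theorem sum_partner [LinearOrder X] [LinearOrder Y] [Fintype X] [Fintype Y] {a : ColPart m X Y}
    (h : IsBubble a) (g : X ⊕ Y → ZMod 2)
    (hg : ∀ p q, p ≠ q → a.rel p q → g p + g q = 0) : ∑ p, g p = 0 := by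
  classical
  choose f hf using fun p => (h.two p).exists
  refine Finset.sum_involution (fun p _ => f p) (fun p _ => hg p (f p) (hf p).1.symm (hf p).2)
    (fun p _ _ => (hf p).1) (fun _ _ => Finset.mem_univ _) fun p _ => ?_
  exact (h.two (f p)).unique (hf (f p)) ⟨(hf p).1.symm, a.rel.symm (hf p).2⟩

open Classical in
/-- The indicator function of a relation, with values in `ZMod 2`. -/
noncomputable def ind (p : Prop) : ZMod 2 := if p then 1 else 0

theorem ind_true {p : Prop} (h : p) : ind p = 1 := if_pos h

theorem ind_false {p : Prop} (h : ¬ p) : ind p = 0 := if_neg h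

theorem ind_congr {p q : Prop} (h : p ↔ q) : ind p = ind q := by rw [propext h]

theorem z2 (x : ZMod 2) : x + x = 0 := by
  revert x; decide

theorem cross_zero_aux [LinearOrder X] [LinearOrder Y] {a : ColPart m X Y} (h : IsBubble a)
    {p p' q q' : X ⊕ Y} (hp : Before p p') (hq : Before q q') (hpp : a.rel p p')
    (hqq : a.rel q q') (hpq : ¬ a.rel p q) (hc : a.colour p = a.colour q) :
    ind (Before p q) + ind (Before p' q) + (ind (Before p q') + ind (Before p' q')) = 0 := by
  have n1 : p ≠ q := by rintro rfl; exact hpq (a.rel.refl _)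
  have n2 : p' ≠ q := by rintro rfl; exact hpq hpp
  have n3 : p ≠ q' := by rintro rfl; exact hpq (a.rel.symm hqq)
  have n4 : p' ≠ q' := by rintro rfl; exact hpq (a.rel.trans hpp (a.rel.symm hqq))
  have neg : ∀ {x y : X ⊕ Y}, x ≠ y → ¬ Before x y → Before y x := fun hxy h =>
    (Before.total hxy).resolve_left h
  have one1 : (1 : ZMod 2) + 1 = 0 := by decide
  by_cases b21 : Before p' q
  · rw [ind_true b21, ind_true (hp.trans b21), ind_true (b21.trans hq),
      ind_true (hp.trans (b21.trans hq)), one1, add_zero]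
  · by_cases b11 : Before p q
    · have b22 : ¬ Before p' q' := fun h3 =>
        hpq (h.planar p q p' q' b11 (neg n2 b21) h3 hpp hqq hc)
      rw [ind_false b21, ind_true b11, ind_true (b11.trans hq), ind_false b22, add_zero, one1]
    · rw [ind_false b21, ind_false b11]
      by_cases b22 : Before p' q'
      · rw [ind_true b22, ind_true (hp.trans b22), one1, add_zero, add_zero]
      · have b12 : ¬ Before p q' := fun h2 =>
          hpq (a.rel.symm (h.planar q p q' p' (neg n1 b11) h2 (neg n4 b22) hqq hpp hc.symm))
        rw [ind_false b22, ind_false b12, add_zero, add_zero]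

theorem cross_zero [LinearOrder X] [LinearOrder Y] {a : ColPart m X Y} (h : IsBubble a)
    {p p' q q' : X ⊕ Y} (hp : p ≠ p') (hq : q ≠ q') (hpp : a.rel p p')
    (hqq : a.rel q q') (hpq : ¬ a.rel p q) (hc : a.colour p = a.colour q) :
    ind (Before p q) + ind (Before p' q) + (ind (Before p q') + ind (Before p' q')) = 0 := by
  have hc1 := a.colour_eq _ _ hpp
  have hc2 := a.colour_eq _ _ hqq
  have hpp' := a.rel.symm hpp
  have hqq' := a.rel.symm hqq
  have m1 : ¬ a.rel p' q := fun h => hpq (a.rel.trans hpp h)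
  have m2 : ¬ a.rel p q' := fun h => hpq (a.rel.trans h hqq')
  have m3 : ¬ a.rel p' q' := fun h => m1 (a.rel.trans h hqq')
  rcases Before.total hp with hp | hp <;> rcases Before.total hq with hq | hq
  · exact cross_zero_aux h hp hq hpp hqq hpq hc
  · rw [← cross_zero_aux h hp hq hpp hqq' m2 (hc.trans hc2)]; ring
  · rw [← cross_zero_aux h hp hq hpp' hqq m1 (hc1.symm.trans hc)]; ring
  · rw [← cross_zero_aux h hp hq hpp' hqq' m3 (hc1.symm.trans (hc.trans hc2))]; ring

/-- Two disjoint unions of parts of the same colour cross an even number of times. -/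
theorem cross_sum [LinearOrder X] [LinearOrder Y] [Fintype X] [Fintype Y] {a : ColPart m X Y}
    (h : IsBubble a) (A B : X ⊕ Y → Prop) (hA : ∀ p q, a.rel p q → (A p ↔ A q))
    (hB : ∀ p q, a.rel p q → (B p ↔ B q)) (hAB : ∀ p, A p → ¬ B p)
    (hc : ∀ p q, A p → B q → a.colour p = a.colour q) :
    ∑ p, ∑ q, ind (A p) * ind (B q) * ind (Before p q) = 0 := by
  refine sum_partner h _ fun p p' hp hpp => ?_
  rw [← Finset.sum_add_distrib]
  refine sum_partner h _ fun q q' hq hqq => ?_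
  rw [ind_congr (hA p p' hpp), ind_congr (hB q q' hqq)]
  by_cases hp' : A p'
  · by_cases hq' : B q'
    · have hpA := (hA p p' hpp).2 hp'
      have hqB := (hB q q' hqq).2 hq'
      have := cross_zero h hp hq hpp hqq (fun e => hAB p hpA ((hB p q e).2 hqB)) (hc p q hpA hqB)
      rw [ind_true hp', ind_true hq']
      linear_combination this
    · rw [ind_false hq']; ring
  · rw [ind_false hp']; ring

theorem even_part [LinearOrder X] [LinearOrder Y] [Fintype X] [Fintype Y] {a : ColPart m X Y}
    (h : IsBubble a) (A : X ⊕ Y → Prop) (hA : ∀ p q, a.rel p q → (A p ↔ A q)) :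
    ∑ p, ind (A p) = 0 :=
  sum_partner h _ fun p q _ hpq => by rw [ind_congr (hA p q hpq)]; exact z2 _

open Classical in
/-- A component of the stack of two bubble diagrams has at most two outer nodes. -/
theorem outer_le_two [LinearOrder X] [LinearOrder Y] [LinearOrder Z] [Fintype X] [Fintype Y]
    [Fintype Z] {a : ColPart m X Y} {b : ColPart m Y Z} (ha : IsBubble a) (hb : IsBubble b)
    (u : X ⊕ (Y ⊕ Z)) : #{o : X ⊕ Z | stack a b u (outer o)} ≤ 2 := by
  choose f hf using fun p => (ha.two p)
  choose g hg using fun p => (hb.two p)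
  let S : Type := {v : X ⊕ (Y ⊕ Z) // stack a b u v}
  let G : SimpleGraph S := SimpleGraph.fromRel fun v w => StackStep a b v.1 w.1
  have hu : stack a b u u := (stack a b).refl u
  have hconn : G.Connected := by
    have key : ∀ v w, Relation.EqvGen (StackStep a b) v w → ∀ (hv : stack a b u v)
        (hw : stack a b u w), G.Reachable ⟨v, hv⟩ ⟨w, hw⟩ := by
      intro v w hvw
      induction hvw with
      | rel v w h =>
        intro hv hw
        by_cases e : v = w
        · subst e; exact SimpleGraph.Reachable.refl _
        · refine SimpleGraph.Adj.reachable ?_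
          rw [SimpleGraph.fromRel_adj]
          exact ⟨fun h => e (congrArg Subtype.val h), Or.inl h⟩
      | refl => intro hv hw; exact SimpleGraph.Reachable.refl _
      | symm v w _ ih => intro hv hw; exact (ih hw hv).symm
      | trans v w x h1 h2 ih1 ih2 =>
        intro hv hx
        have hw : stack a b u w := (stack a b).trans hv h1
        exact (ih1 hv hw).trans (ih2 hw hx)
    have : Nonempty S := ⟨⟨u, hu⟩⟩
    refine ⟨fun v w => ?_⟩
    exact key v.1 w.1 ((stack a b).trans ((stack a b).symm v.2) w.2) v.2 w.2
  have hadj : ∀ v w : S, G.Adj v w → (∃ p, v.1 = upper p ∧ w.1 = upper (f p)) ∨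
      (∃ p, v.1 = lower p ∧ w.1 = lower (g p)) := by
    intro v w hvw
    rw [SimpleGraph.fromRel_adj] at hvw
    obtain ⟨hne, h⟩ := hvw
    have hne' : v.1 ≠ w.1 := fun e => hne (Subtype.ext e)
    have hcase : StackStep a b v.1 w.1 := by
      rcases h with h | h
      · exact h
      · generalize v.1 = v' at *
        generalize w.1 = w' at *
        cases h with
        | up p q h => exact StackStep.up q p (a.rel.symm h)
        | low p q h => exact StackStep.low q p (b.rel.symm h)
    clear h
    generalize v.1 = v' at *
    generalize w.1 = w' at *
    cases hcase with
    | up p q h =>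
      refine Or.inl ⟨p, rfl, ?_⟩
      rw [(hf p).2 q ⟨fun e => hne' (by rw [e]), h⟩]
    | low p q h =>
      refine Or.inr ⟨p, rfl, ?_⟩
      rw [(hg p).2 q ⟨fun e => hne' (by rw [e]), h⟩]
  have hupper : Function.Injective (upper : X ⊕ Y → X ⊕ (Y ⊕ Z)) := by
    rintro (p | p) (q | q) h <;> simp [upper] at h <;> simp [h]
  have hlower : Function.Injective (lower : Y ⊕ Z → X ⊕ (Y ⊕ Z)) := Sum.inr_injective
  let out : S → Prop := fun v => ∃ o : X ⊕ Z, v.1 = outer o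
  have hdeg : ∀ v : S, G.degree v + (if out v then 1 else 0) ≤ 2 := by
    intro v
    let U : Finset S := {w | ∃ p, v.1 = upper p ∧ w.1 = upper (f p)}
    let L : Finset S := {w | ∃ p, v.1 = lower p ∧ w.1 = lower (g p)}
    have hU : #U ≤ 1 := by
      rw [Finset.card_le_one]
      intro w hw w' hw'
      obtain ⟨p, hp, hw⟩ := (Finset.mem_filter.1 hw).2
      obtain ⟨p', hp', hw'⟩ := (Finset.mem_filter.1 hw').2
      apply Subtype.ext
      rw [hw, hw', hupper (hp.symm.trans hp')]
    have hL : #L ≤ 1 := by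
      rw [Finset.card_le_one]
      intro w hw w' hw'
      obtain ⟨p, hp, hw⟩ := (Finset.mem_filter.1 hw).2
      obtain ⟨p', hp', hw'⟩ := (Finset.mem_filter.1 hw').2
      apply Subtype.ext
      rw [hw, hw', hlower (hp.symm.trans hp')]
    have hsub : G.neighborFinset v ⊆ U ∪ L := by
      intro w hw
      rw [SimpleGraph.mem_neighborFinset] at hw
      rw [Finset.mem_union]
      rcases hadj v w hw with h | h
      · exact Or.inl (Finset.mem_filter.2 ⟨Finset.mem_univ _, h⟩)
      · exact Or.inr (Finset.mem_filter.2 ⟨Finset.mem_univ _, h⟩)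
    have h1 : G.degree v ≤ #U + #L := by
      rw [← SimpleGraph.card_neighborFinset_eq_degree]
      exact (Finset.card_le_card hsub).trans (Finset.card_union_le _ _)
    split_ifs with ho
    · obtain ⟨o, ho⟩ := ho
      rcases o with o | o
      · have : #L = 0 := by
          rw [Finset.card_eq_zero, Finset.filter_eq_empty_iff]
          rintro w - ⟨p, hp, -⟩
          rw [ho] at hp
          simp [outer, lower] at hp
        omega
      · have : #U = 0 := by
          rw [Finset.card_eq_zero, Finset.filter_eq_empty_iff]
          rintro w - ⟨p, hp, -⟩
          rw [ho] at hp
          rcases p with p | p <;> simp [outer, upper] at hp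
        omega
    · omega
  have hsum := G.sum_degrees_eq_twice_card_edges
  have hE := hconn.card_vert_le_card_edgeSet_add_one
  rw [Nat.card_eq_fintype_card, Nat.card_eq_fintype_card, ← SimpleGraph.edgeFinset_card] at hE
  have htot : ∑ v : S, (G.degree v + (if out v then 1 else 0)) ≤ ∑ _v : S, 2 :=
    Finset.sum_le_sum fun v _ => hdeg v
  rw [Finset.sum_add_distrib, hsum, ← Finset.card_filter, Finset.sum_const, Finset.card_univ,
    smul_eq_mul] at htot
  have hout : #{o : X ⊕ Z | stack a b u (outer o)} ≤ #{v : S | out v} := by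
    have houter : Function.Injective (outer : X ⊕ Z → X ⊕ (Y ⊕ Z)) := by
      rintro (p | p) (q | q) h <;> simp [outer] at h <;> simp [h]
    rw [← Finset.card_image_of_injective _ houter]
    refine (Finset.card_le_card ?_).trans
      (Finset.card_image_le (s := {v : S | out v}) (f := Subtype.val))
    intro w hw
    obtain ⟨o, ho, rfl⟩ := Finset.mem_image.1 hw
    exact Finset.mem_image.2 ⟨⟨outer o, (Finset.mem_filter.1 ho).2⟩,
      Finset.mem_filter.2 ⟨Finset.mem_univ _, o, rfl⟩, rfl⟩
  omega

theorem comp_isBubble [LinearOrder X] [LinearOrder Y] [LinearOrder Z] [Fintype X] [Fintype Y]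
    [Fintype Z] {a : ColPart m X Y} {b : ColPart m Y Z} (ha : IsBubble a) (hb : IsBubble b)
    (h : Match a b) : IsBubble (comp a b h) := by
  classical
  -- the parts of a component, row by row
  have sym := fun {u v} (huv : stack a b u v) => (stack a b).symm huv
  have hCu : ∀ u p q, a.rel p q → (stack a b u (upper p) ↔ stack a b u (upper q)) :=
    fun u p q hpq => ⟨fun e => (stack a b).trans e (stack_up hpq),
      fun e => (stack a b).trans e (sym (stack_up hpq))⟩
  have hCl : ∀ u p q, b.rel p q → (stack a b u (lower p) ↔ stack a b u (lower q)) :=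
    fun u p q hpq => ⟨fun e => (stack a b).trans e (stack_low hpq),
      fun e => (stack a b).trans e (sym (stack_low hpq))⟩
  have ev1 : ∀ u, ∑ x, ind (stack a b u (Sum.inl x)) + ∑ y, ind (stack a b u (Sum.inr (Sum.inl y)))
      = 0 := by
    intro u
    have := even_part ha (fun p => stack a b u (upper p)) (hCu u)
    rwa [Fintype.sum_sum_type] at this
  have ev2 : ∀ u, ∑ y, ind (stack a b u (Sum.inr (Sum.inl y))) +
      ∑ z, ind (stack a b u (Sum.inr (Sum.inr z))) = 0 := by
    intro u
    have := even_part hb (fun p => stack a b u (lower p)) (hCl u)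
    rwa [Fintype.sum_sum_type] at this
  have htwo : ∀ p : X ⊕ Z, ∃! q, q ≠ p ∧ (comp a b h).rel p q := by
    intro p
    let F : Finset (X ⊕ Z) := {o : X ⊕ Z | stack a b (outer p) (outer o)}
    have hp : p ∈ F := Finset.mem_filter.2 ⟨Finset.mem_univ _, (stack a b).refl _⟩
    have hle : #F ≤ 2 := outer_le_two ha hb (outer p)
    have heven : ((#F : ℕ) : ZMod 2) = 0 := by
      have h1 : ((#F : ℕ) : ZMod 2) = ∑ o : X ⊕ Z, ind (stack a b (outer p) (outer o)) := by
        rw [Finset.card_filter]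
        push_cast
        rfl
      rw [h1, Fintype.sum_sum_type]
      have e1 := ev1 (outer p)
      have e2 := ev2 (outer p)
      have e3 := z2 (∑ y, ind (stack a b (outer p) (Sum.inr (Sum.inl y))))
      change ∑ x, ind (stack a b (outer p) (Sum.inl x)) +
        ∑ z, ind (stack a b (outer p) (Sum.inr (Sum.inr z))) = 0
      linear_combination e1 + e2 - e3
    have hcard : #F = 2 := by
      have hpos : 0 < #F := Finset.card_pos.2 ⟨p, hp⟩
      have hne : #F ≠ 1 := by
        intro e
        rw [e] at heven
        exact absurd heven (by decide)
      omega
    obtain ⟨q, hq, hqp⟩ := Finset.exists_mem_ne (by omega : 1 < #F) p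
    refine ⟨q, ⟨hqp, (Finset.mem_filter.1 hq).2⟩, ?_⟩
    rintro r ⟨hr1, hr2⟩
    by_contra hrq
    have : #({p, q, r} : Finset (X ⊕ Z)) ≤ #F := by
      refine Finset.card_le_card ?_
      intro o ho
      rw [Finset.mem_insert, Finset.mem_insert, Finset.mem_singleton] at ho
      rcases ho with rfl | rfl | rfl
      · exact hp
      · exact hq
      · exact Finset.mem_filter.2 ⟨Finset.mem_univ _, hr2⟩
    rw [Finset.card_eq_three.2 ⟨p, q, r, hqp.symm, hr1.symm, Ne.symm hrq, rfl⟩] at this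
    omega
  refine ⟨htwo, ?_⟩
  intro p q r s hpq hqr hrs hpr hqs hc
  by_contra hn
  -- the two components through the supposedly crossing strands
  let A : X ⊕ (Y ⊕ Z) → Prop := fun u => stack a b (outer p) u
  let B : X ⊕ (Y ⊕ Z) → Prop := fun u => stack a b (outer q) u
  have hAB : ∀ u, A u → ¬ B u := fun u h1 h2 => hn ((stack a b).trans h1 (sym h2))
  have hcol : ∀ u v, A u → B v → stackColour a b u = stackColour a b v := fun u v h1 h2 =>
    (stack_colour h h1).symm.trans (hc.trans (stack_colour h h2))
  have c1 := cross_sum ha (fun o => A (upper o)) (fun o => B (upper o)) (hCu _) (hCu _)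
    (fun o => hAB _) (fun o o' h1 h2 => by
      rw [← stackColour_upper h, ← stackColour_upper h]; exact hcol _ _ h1 h2)
  have c2 := cross_sum hb (fun o => A (lower o)) (fun o => B (lower o)) (hCl _) (hCl _)
    (fun o => hAB _) (fun o o' h1 h2 => hcol _ _ h1 h2)
  have hne : ∀ {o o' : X ⊕ Z}, Before o o' → o ≠ o' := fun h e => by
    subst e; exact Before.irrefl _ h
  -- the composite strands cross an odd number of times
  have c3 : ∑ o : X ⊕ Z, ∑ o' : X ⊕ Z, ind (A (outer o)) * ind (B (outer o')) *
      ind (Before o o') = 1 := by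
    have hA : ∀ o, A (outer o) ↔ o = p ∨ o = r := by
      intro o
      refine ⟨fun e => ?_, ?_⟩
      · by_contra hcon
        rw [not_or] at hcon
        exact hcon.2 ((htwo p).unique ⟨hcon.1, e⟩ ⟨(hne (hpq.trans hqr)).symm, hpr⟩)
      · rintro (rfl | rfl)
        · exact (stack a b).refl _
        · exact hpr
    have hB : ∀ o, B (outer o) ↔ o = q ∨ o = s := by
      intro o
      refine ⟨fun e => ?_, ?_⟩
      · by_contra hcon
        rw [not_or] at hcon
        exact hcon.2 ((htwo q).unique ⟨hcon.1, e⟩ ⟨(hne (hqr.trans hrs)).symm, hqs⟩)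
      · rintro (rfl | rfl)
        · exact (stack a b).refl _
        · exact hqs
    have hpick : ∀ (i j : X ⊕ Z) (C : X ⊕ Z → Prop), i ≠ j → (∀ o, C o ↔ o = i ∨ o = j) →
        ∀ G : X ⊕ Z → ZMod 2, ∑ o, ind (C o) * G o = G i + G j := by
      intro i j C hij hC G
      rw [← Finset.sum_subset (Finset.subset_univ {i, j}), Finset.sum_pair hij,
        ind_true ((hC i).2 (Or.inl rfl)), ind_true ((hC j).2 (Or.inr rfl)), one_mul, one_mul]
      intro o _ ho
      rw [ind_false, zero_mul]
      intro h1
      rw [hC] at h1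
      exact ho (by simpa using h1)
    have step : ∀ o : X ⊕ Z, ∑ o' : X ⊕ Z, ind (A (outer o)) * ind (B (outer o')) *
        ind (Before o o') = ind (A (outer o)) * (ind (Before o q) + ind (Before o s)) := by
      intro o
      rw [← hpick q s (fun o => B (outer o)) (hne (hqr.trans hrs)) hB (fun o' => ind (Before o o')),
        Finset.mul_sum]
      exact Finset.sum_congr rfl fun _ _ => by ring
    rw [Finset.sum_congr rfl fun o _ => step o,
      hpick p r (fun o => A (outer o)) (hne (hpq.trans hqr)) hA
        (fun o => ind (Before o q) + ind (Before o s)),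
      ind_true hpq, ind_true (hpq.trans (hqr.trans hrs)), ind_true hrs,
      ind_false fun e => Before.irrefl _ (hqr.trans e)]
    decide
  -- comparison, row by row
  have a1 := ev1 (outer p)
  have a2 := ev2 (outer q)
  set AX : X → ZMod 2 := fun x => ind (A (Sum.inl x)) with hAX
  set AY : Y → ZMod 2 := fun y => ind (A (Sum.inr (Sum.inl y))) with hAY
  set AZ : Z → ZMod 2 := fun z => ind (A (Sum.inr (Sum.inr z))) with hAZ
  set BX : X → ZMod 2 := fun x => ind (B (Sum.inl x)) with hBX
  set BY : Y → ZMod 2 := fun y => ind (B (Sum.inr (Sum.inl y))) with hBY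
  set BZ : Z → ZMod 2 := fun z => ind (B (Sum.inr (Sum.inr z))) with hBZ
  have a1' : ∑ x, AX x + ∑ y, AY y = 0 := a1
  have a2' : ∑ y, BY y + ∑ z, BZ z = 0 := a2
  have e1 : ∑ x, ∑ x', AX x * BX x' * ind (x < x') + (∑ x, AX x) * (∑ y, BY y) +
      ∑ y, ∑ y', AY y * BY y' * ind (y' < y) = 0 := by
    rw [← c1, Fintype.sum_sum_type]
    simp only [Fintype.sum_sum_type, Finset.sum_add_distrib]
    rw [Finset.sum_mul_sum]
    simp [Before, upper, ind_true, ind_false, hAX, hAY, hBX, hBY]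
  have e2 : ∑ y, ∑ y', AY y * BY y' * ind (y < y') + (∑ y, AY y) * (∑ z, BZ z) +
      ∑ z, ∑ z', AZ z * BZ z' * ind (z' < z) = 0 := by
    rw [← c2, Fintype.sum_sum_type]
    simp only [Fintype.sum_sum_type, Finset.sum_add_distrib]
    rw [Finset.sum_mul_sum]
    simp [Before, lower, ind_true, ind_false, hAZ, hAY, hBZ, hBY]
  have e3 : ∑ x, ∑ x', AX x * BX x' * ind (x < x') + (∑ x, AX x) * (∑ z, BZ z) +
      ∑ z, ∑ z', AZ z * BZ z' * ind (z' < z) = 1 := by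
    rw [← c3, Fintype.sum_sum_type]
    simp only [Fintype.sum_sum_type, Finset.sum_add_distrib]
    rw [Finset.sum_mul_sum]
    simp [Before, outer, ind_true, ind_false, hAZ, hAX, hBZ, hBX]
  have e4 : ∑ y, ∑ y', AY y * BY y' * ind (y < y') + ∑ y, ∑ y', AY y * BY y' * ind (y' < y) =
      (∑ y, AY y) * (∑ y, BY y) := by
    rw [Finset.sum_mul_sum, ← Finset.sum_add_distrib]
    refine Finset.sum_congr rfl fun y _ => ?_
    rw [← Finset.sum_add_distrib]
    refine Finset.sum_congr rfl fun y' _ => ?_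
    rcases lt_trichotomy y y' with h1 | h1 | h1
    · rw [ind_true h1, ind_false h1.asymm]; ring
    · subst h1
      have : AY y * BY y = 0 := by
        by_cases h2 : A (Sum.inr (Sum.inl y))
        · simp only [hBY, ind_false (hAB _ h2), mul_zero]
        · simp only [hAY, ind_false h2, zero_mul]
      rw [this]; ring
    · rw [ind_true h1, ind_false h1.asymm]; ring
  have e5 : (∑ x, AX x + ∑ y, AY y) * (∑ y, BY y + ∑ z, BZ z) = 0 := by rw [a1', zero_mul]
  generalize ∑ x, ∑ x', AX x * BX x' * ind (x < x') = txx at *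
  generalize ∑ y, ∑ y', AY y * BY y' * ind (y < y') = tyy at *
  generalize ∑ y, ∑ y', AY y * BY y' * ind (y' < y) = tyr at *
  generalize ∑ z, ∑ z', AZ z * BZ z' * ind (z' < z) = tzz at *
  generalize ∑ x, AX x = sx at *
  generalize ∑ y, AY y = sy at *
  generalize ∑ y, BY y = ty at *
  generalize ∑ z, BZ z = tz at *
  have : (1 : ZMod 2) = 0 := by
    linear_combination e1 + e2 - e3 + e5 - e4 - z2 (sx * ty) - z2 (sy * tz) - z2 (sy * ty)
  exact absurd this (by decide)

end Planar

/-- Bubble diagrams with top row `X` and bottom row `Y`. -/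
@[ext]
structure Diagram (m : ℕ) (X Y : Type) [LinearOrder X] [LinearOrder Y] where
  part : ColPart m X Y
  isBubble : IsBubble part

section Linear

variable {m : ℕ} {X Y Z W : Type} [LinearOrder X] [LinearOrder Y] [LinearOrder Z] [LinearOrder W]
  [Fintype X] [Fintype Y] [Fintype Z] [Fintype W]

/-- The reflection of a bubble diagram in a horizontal line. -/
def Diagram.reflect (a : Diagram m X Y) : Diagram m Y X := ⟨a.1.reflect, a.2.reflect⟩

/-- The composite of two bubble diagrams. -/
def Diagram.comp (a : Diagram m X Y) (b : Diagram m Y Z) (h : Match a.1 b.1) : Diagram m X Z :=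
  ⟨Bubble.comp a.1 b.1 h, comp_isBubble a.2 b.2 h⟩

open Classical in
/-- The product of two diagrams: zero unless the colour distributions in the middle agree, and
otherwise the composite, times the scalar `δ i` for each removed loop of colour `i`. -/
noncomputable def diagMul (δ : Fin m → ℂ) (a : Diagram m X Y) (b : Diagram m Y Z) :
    Diagram m X Z →₀ ℂ :=
  if h : Match a.1 b.1 then Finsupp.single (a.comp b h) (weight δ a.1 b.1) else 0

/-- The bilinear extension of the product of diagrams. -/
noncomputable def mulL (δ : Fin m → ℂ) :
    (Diagram m X Y →₀ ℂ) →ₗ[ℂ] (Diagram m Y Z →₀ ℂ) →ₗ[ℂ] (Diagram m X Z →₀ ℂ) :=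
  Finsupp.linearCombination ℂ fun a => Finsupp.linearCombination ℂ fun b => diagMul δ a b

theorem mulL_single (δ : Fin m → ℂ) (a : Diagram m X Y) (b : Diagram m Y Z) (r s : ℂ) :
    mulL δ (Finsupp.single a r) (Finsupp.single b s) = (r * s) • diagMul δ a b := by
  simp [mulL, mul_smul]

theorem mulL_assoc (δ : Fin m → ℂ) (x : Diagram m X Y →₀ ℂ) (y : Diagram m Y Z →₀ ℂ)
    (z : Diagram m Z W →₀ ℂ) : mulL δ (mulL δ x y) z = mulL δ x (mulL δ y z) := by
  induction x using Finsupp.induction_linear with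
  | zero => simp
  | add x x' hx hx' => simp [hx, hx']
  | single a r =>
  induction y using Finsupp.induction_linear with
  | zero => simp
  | add y y' hy hy' => simp [hy, hy']
  | single b s =>
  induction z using Finsupp.induction_linear with
  | zero => simp
  | add z z' hz hz' => simp [hz, hz']
  | single c t =>
  rw [mulL_single, mulL_single]
  by_cases hab : Match a.1 b.1
  · by_cases hbc : Match b.1 c.1
    · have h1 : Match (a.comp b hab).1 c.1 := hbc
      have h2 : Match a.1 (b.comp c hbc).1 := hab
      have e1 : diagMul δ a b = Finsupp.single (a.comp b hab) (weight δ a.1 b.1) := dif_pos hab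
      have e2 : diagMul δ b c = Finsupp.single (b.comp c hbc) (weight δ b.1 c.1) := dif_pos hbc
      have e3 : diagMul δ (a.comp b hab) c = Finsupp.single ((a.comp b hab).comp c h1)
        (weight δ (a.comp b hab).1 c.1) := dif_pos h1
      have e4 : diagMul δ a (b.comp c hbc) = Finsupp.single (a.comp (b.comp c hbc) h2)
        (weight δ a.1 (b.comp c hbc).1) := dif_pos h2
      have e5 : (a.comp b hab).comp c h1 = a.comp (b.comp c hbc) h2 :=
        Diagram.ext (comp_assoc a.1 b.1 c.1 hab hbc h1 h2)
      have e6 : weight δ a.1 b.1 * weight δ (a.comp b hab).1 c.1 =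
        weight δ b.1 c.1 * weight δ a.1 (b.comp c hbc).1 :=
        weight_assoc δ a.1 b.1 c.1 hab hbc h1 h2
      rw [e1, e2, Finsupp.smul_single, Finsupp.smul_single, mulL_single, mulL_single, e3, e4, e5,
        Finsupp.smul_single, Finsupp.smul_single]
      congr 1
      simp only [smul_eq_mul]
      linear_combination (r * s * t) * e6
    · have h1 : ¬ Match (a.comp b hab).1 c.1 := hbc
      have e1 : diagMul δ a b = Finsupp.single (a.comp b hab) (weight δ a.1 b.1) := dif_pos hab
      have e2 : diagMul δ b c = 0 := dif_neg hbc
      have e3 : diagMul δ (a.comp b hab) c = 0 := dif_neg h1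
      rw [e1, e2, Finsupp.smul_single, mulL_single, e3]
      simp
  · have e1 : diagMul δ a b = 0 := dif_neg hab
    rw [e1]
    by_cases hbc : Match b.1 c.1
    · have h2 : ¬ Match a.1 (b.comp c hbc).1 := hab
      have e2 : diagMul δ b c = Finsupp.single (b.comp c hbc) (weight δ b.1 c.1) := dif_pos hbc
      have e4 : diagMul δ a (b.comp c hbc) = 0 := dif_neg h2
      rw [e2, Finsupp.smul_single, mulL_single, e4]
      simp
    · have e2 : diagMul δ b c = 0 := dif_neg hbc
      rw [e2]
      simp

/-- The sum of all coloured versions of the identity diagram. -/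
noncomputable def oneL : Diagram m X X →₀ ℂ :=
  ∑ c : X → Fin m, Finsupp.single ⟨idPart c, idPart_isBubble c⟩ 1

theorem oneL_mul (δ : Fin m → ℂ) (x : Diagram m X Y →₀ ℂ) : mulL δ oneL x = x := by
  classical
  induction x using Finsupp.induction_linear with
  | zero => simp
  | add x x' hx hx' => simp [hx, hx']
  | single a r =>
  unfold oneL
  rw [map_sum, LinearMap.sum_apply, Finset.sum_eq_single fun x => a.1.colour (Sum.inl x)]
  · rw [mulL_single]
    have h : Match (idPart fun x => a.1.colour (Sum.inl x)) a.1 := fun _ => rfl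
    unfold diagMul
    rw [dif_pos h, one_mul, Finsupp.smul_single]
    congr 1
    · exact Diagram.ext (id_comp a.1 h)
    · rw [weight_id_comp]; simp
  · intro c _ hc
    rw [mulL_single]
    unfold diagMul
    rw [dif_neg, smul_zero]
    exact fun h => hc (funext h)
  · simp

theorem mul_oneL (δ : Fin m → ℂ) (x : Diagram m X Y →₀ ℂ) : mulL δ x oneL = x := by
  classical
  induction x using Finsupp.induction_linear with
  | zero => simp
  | add x x' hx hx' => simp [hx, hx']
  | single a r =>
  unfold oneL
  rw [map_sum, Finset.sum_eq_single fun y => a.1.colour (Sum.inr y)]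
  · rw [mulL_single]
    have h : Match a.1 (idPart fun y => a.1.colour (Sum.inr y)) := fun _ => rfl
    unfold diagMul
    rw [dif_pos h, mul_one, Finsupp.smul_single]
    congr 1
    · exact Diagram.ext (comp_id a.1 h)
    · rw [weight_comp_id]; simp
  · intro c _ hc
    rw [mulL_single]
    unfold diagMul
    rw [dif_neg, smul_zero]
    exact fun h => hc (funext fun y => (h y).symm)
  · simp

end Linear

/-! ### The bubble algebra -/

/-- The bubble algebra with `n` nodes in each row and colours indexed by `Fin m`, a loop of colour
`i` being worth `δ i`: the vector space over `ℂ` with basis the bubble diagrams. -/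
def Alg {m : ℕ} (_δ : Fin m → ℂ) (n : ℕ) : Type := Diagram m (Fin n) (Fin n) →₀ ℂ

section Algebra

variable {m : ℕ} (δ : Fin m → ℂ) (n : ℕ)

noncomputable instance : AddCommGroup (Alg δ n) :=
  inferInstanceAs (AddCommGroup (Diagram m (Fin n) (Fin n) →₀ ℂ))

noncomputable instance : Module ℂ (Alg δ n) :=
  inferInstanceAs (Module ℂ (Diagram m (Fin n) (Fin n) →₀ ℂ))

/-- The multiplication of the bubble algebra. -/
noncomputable def algMul : Alg δ n →ₗ[ℂ] Alg δ n →ₗ[ℂ] Alg δ n :=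
  mulL (X := Fin n) (Y := Fin n) (Z := Fin n) δ

noncomputable instance : Ring (Alg δ n) :=
  { (inferInstance : AddCommGroup (Alg δ n)) with
    mul := fun x y => algMul δ n x y
    one := oneL (X := Fin n)
    mul_assoc := fun x y z => mulL_assoc (X := Fin n) (Y := Fin n) (Z := Fin n) (W := Fin n) δ x y z
    one_mul := fun x => oneL_mul (X := Fin n) (Y := Fin n) δ x
    mul_one := fun x => mul_oneL (X := Fin n) (Y := Fin n) δ x
    zero_mul := fun x => LinearMap.map_zero₂ (algMul δ n) x
    mul_zero := fun x => map_zero (algMul δ n x)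
    left_distrib := fun x y z => map_add (algMul δ n x) y z
    right_distrib := fun x y z => LinearMap.map_add₂ (algMul δ n) x y z }

noncomputable instance : Algebra ℂ (Alg δ n) :=
  Algebra.ofModule (fun r x y => LinearMap.map_smul₂ (algMul δ n) r x y)
    (fun r x y => map_smul (algMul δ n x) r y)

end Algebra

/-! ### Cell modules -/

section CellModule

variable {m : ℕ}

/-- The cut: `lam j` cut points of each colour `j`. (Only the order among cut points of the same
colour is relevant.) -/
abbrev Cut (lam : Fin m → ℕ) : Type := Σₗ j : Fin m, Fin (lam j)

variable {n : ℕ} {lam : Fin m → ℕ}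

/-- A half-diagram with `lam j` defects of colour `j` is the upper piece of a bubble diagram that
is cut along a line meeting every propagating edge once, and no other edge. Its lower row consists
of the cut points, `lam j` of them of colour `j`, each one joined to a node of the top row; the
top nodes that are joined to the cut are the defects. -/
def IsHalf (h : Diagram m (Fin n) (Cut lam)) : Prop :=
  (∀ y, h.1.colour (Sum.inr y) = (ofLex y).1) ∧ ∀ y, ∃ x, h.1.rel (Sum.inr y) (Sum.inl x)

/-- Half-diagrams on `n` nodes with `lam j` defects of each colour `j`. -/
structure Half (n : ℕ) (lam : Fin m → ℕ) where
  diag : Diagram m (Fin n) (Cut lam)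
  isHalf : IsHalf diag

/-- The cell module attached to `lam`: the vector space with basis the half-diagrams that have
`lam j` defects of each colour `j`. It is zero when there are no such half-diagrams. -/
def Cell (_δ : Fin m → ℂ) (n : ℕ) (lam : Fin m → ℕ) : Type := Half n lam →₀ ℂ

noncomputable instance (δ : Fin m → ℂ) : AddCommGroup (Cell δ n lam) :=
  inferInstanceAs (AddCommGroup (Half n lam →₀ ℂ))

noncomputable instance (δ : Fin m → ℂ) : Module ℂ (Cell δ n lam) :=
  inferInstanceAs (Module ℂ (Half n lam →₀ ℂ))

/-- Half-diagrams as diagrams from the top row to the cut. -/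
noncomputable def halfIncl : (Half n lam →₀ ℂ) →ₗ[ℂ] (Diagram m (Fin n) (Cut lam) →₀ ℂ) :=
  Finsupp.linearCombination ℂ fun h => Finsupp.single h.diag 1

open Classical in
/-- The projection that kills the diagrams in which some cut point is no longer joined to the top
row. -/
noncomputable def halfProj : (Diagram m (Fin n) (Cut lam) →₀ ℂ) →ₗ[ℂ] (Half n lam →₀ ℂ) :=
  Finsupp.linearCombination ℂ fun h => if hh : IsHalf h then Finsupp.single ⟨h, hh⟩ 1 else 0

/-- The action of the bubble algebra: a diagram is stacked on top of a half-diagram, loops are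
replaced by scalars, and the result is zero if the colour distributions do not match or if the
number of defects of some colour drops. -/
noncomputable def act (δ : Fin m → ℂ) : Alg δ n →ₗ[ℂ] Cell δ n lam →ₗ[ℂ] Cell δ n lam :=
  ((mulL (X := Fin n) (Y := Fin n) (Z := Cut lam) δ).compr₂ halfProj).compl₂ halfIncl

theorem halfProj_single (h : Half n lam) (r : ℂ) :
    halfProj (Finsupp.single h.1 r) = Finsupp.single h r := by
  unfold halfProj
  rw [Finsupp.linearCombination_single, dif_pos h.2, Finsupp.smul_single_one]

theorem halfProj_single_of_not {h : Diagram m (Fin n) (Cut lam)} (hh : ¬ IsHalf h)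
    (r : ℂ) : halfProj (Finsupp.single h r) = 0 := by
  unfold halfProj
  rw [Finsupp.linearCombination_single, dif_neg hh, smul_zero]

theorem halfIncl_single (h : Half n lam) (r : ℂ) :
    halfIncl (Finsupp.single h r) = Finsupp.single h.1 r := by
  unfold halfIncl
  rw [Finsupp.linearCombination_single, Finsupp.smul_single_one]

theorem halfProj_incl (x : Half n lam →₀ ℂ) : halfProj (halfIncl x) = x := by
  induction x using Finsupp.induction_linear with
  | zero => simp
  | add x y hx hy => simp [hx, hy]
  | single h r => rw [halfIncl_single, halfProj_single]

/-- A bottom node that is joined to the top in the stack is joined to the top of the lower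
diagram. -/
theorem low_of_stack {X Y Z : Type} {a : ColPart m X Y} {b : ColPart m Y Z} {z : Z} {x : X}
    (h : stack a b (Sum.inr (Sum.inr z)) (Sum.inl x)) : ∃ y, b.rel (Sum.inr z) (Sum.inl y) := by
  by_contra hcon
  let f : X ⊕ (Y ⊕ Z) → Prop := Sum.elim (fun _ => False) (fun p => b.rel (Sum.inr z) p)
  have hf : f (Sum.inr (Sum.inr z)) = f (Sum.inl x) := by
    refine stack_const f ?_ ?_ h
    · rintro (p | p) (q | q) _
      · rfl
      · exact propext ⟨fun h => h.elim, fun h => hcon ⟨_, h⟩⟩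
      · exact propext ⟨fun h => hcon ⟨_, h⟩, fun h => h.elim⟩
      · exact propext ⟨fun h => (hcon ⟨_, h⟩).elim, fun h => (hcon ⟨_, h⟩).elim⟩
    · intro p q hpq
      exact propext ⟨fun h => b.rel.trans h hpq, fun h => b.rel.trans h (b.rel.symm hpq)⟩
  exact hf.mp (b.rel.refl _)

/-- A top node that is joined to the bottom in the stack is joined to the bottom of the upper
diagram. -/
theorem up_of_stack {X Y Z : Type} {a : ColPart m X Y} {b : ColPart m Y Z} {z : Z} {x : X}
    (h : stack a b (Sum.inl x) (Sum.inr (Sum.inr z))) : ∃ y, a.rel (Sum.inl x) (Sum.inr y) := by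
  by_contra hcon
  let f : X ⊕ (Y ⊕ Z) → Prop :=
    Sum.elim (fun p => a.rel (Sum.inl x) (Sum.inl p)) (fun _ => False)
  have hf : f (Sum.inl x) = f (Sum.inr (Sum.inr z)) := by
    refine stack_const f ?_ ?_ h
    · rintro (p | p) (q | q) hpq
      · exact propext ⟨fun h => a.rel.trans h hpq, fun h => a.rel.trans h (a.rel.symm hpq)⟩
      · exact propext ⟨fun h => hcon ⟨_, a.rel.trans h hpq⟩, fun h => h.elim⟩
      · exact propext ⟨fun h => h.elim, fun h => hcon ⟨_, a.rel.trans h (a.rel.symm hpq)⟩⟩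
      · rfl
    · intro p q _
      rfl
  exact hf.mp (a.rel.refl _)

theorem isHalf_of_comp {a : Diagram m (Fin n) (Fin n)} {b : Diagram m (Fin n) (Cut lam)}
    (h : Match a.1 b.1) (hh : IsHalf (a.comp b h)) : IsHalf b := by
  refine ⟨hh.1, fun y => ?_⟩
  obtain ⟨x, hx⟩ := hh.2 y
  exact low_of_stack (x := x) hx

theorem halfProj_mul (δ : Fin m → ℂ) (a : Diagram m (Fin n) (Fin n) →₀ ℂ)
    (b : Diagram m (Fin n) (Cut lam) →₀ ℂ) :
    halfProj (mulL δ a (halfIncl (halfProj b))) = halfProj (mulL δ a b) := by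
  induction b using Finsupp.induction_linear with
  | zero => simp
  | add x y hx hy => simp [hx, hy]
  | single b s =>
  by_cases hb : IsHalf b
  · rw [halfProj_single ⟨b, hb⟩, halfIncl_single]
  · rw [halfProj_single_of_not hb]
    induction a using Finsupp.induction_linear with
    | zero => simp
    | add x y hx hy =>
      rw [map_add, LinearMap.add_apply, LinearMap.add_apply, map_add, map_add, hx, hy]
    | single a r =>
    rw [mulL_single]
    by_cases h : Match a.1 b.1
    · have e : diagMul δ a b = Finsupp.single (a.comp b h) (weight δ a.1 b.1) := dif_pos h
      rw [e, Finsupp.smul_single, halfProj_single_of_not fun hh => hb (isHalf_of_comp h hh)]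
      simp
    · have e : diagMul δ a b = 0 := dif_neg h
      rw [e]
      simp

noncomputable instance (δ : Fin m → ℂ) : Module (Alg δ n) (Cell δ n lam) where
  smul a x := act δ a x
  one_smul x := (congrArg halfProj (oneL_mul (X := Fin n) δ (halfIncl x))).trans (halfProj_incl x)
  mul_smul a b x :=
    (congrArg halfProj (mulL_assoc (X := Fin n) (Y := Fin n) (Z := Fin n) δ a b (halfIncl x))).trans
      (halfProj_mul δ a (mulL (X := Fin n) (Y := Fin n) δ b (halfIncl x))).symm
  smul_zero a := map_zero (act δ a)
  smul_add a x y := map_add (act δ a) x y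
  add_smul a b x := LinearMap.map_add₂ (act δ) a b x
  zero_smul x := LinearMap.map_zero₂ (act δ) x

noncomputable instance (δ : Fin m → ℂ) : IsScalarTower ℂ (Alg δ n) (Cell δ n lam) where
  smul_assoc r a x := LinearMap.map_smul₂ (act δ) r a x

/-! ### The bilinear form and the simple heads -/

open Classical in
/-- The functional on diagrams from cut to cut that is `1` on a diagram in which every node of the
top row is joined to the bottom row, and `0` on the others. -/
noncomputable def propagating : (Diagram m (Cut lam) (Cut lam) →₀ ℂ) →ₗ[ℂ] ℂ :=
  Finsupp.linearCombination ℂ fun d =>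
    if ∀ y, ∃ y', d.part.rel (Sum.inl y) (Sum.inr y') then (1 : ℂ) else 0

/-- The bilinear form on the half-diagrams. For half-diagrams `x` and `y`, the reflection of `x` is
glued to `y`; the value is zero unless the colour distributions agree and every defect of `x` is
joined to a defect of `y`, and then it is the product of the scalars of the closed loops. -/
noncomputable def halfForm (δ : Fin m → ℂ) : (Half n lam →₀ ℂ) →ₗ[ℂ] (Half n lam →₀ ℂ) →ₗ[ℂ] ℂ :=
  Finsupp.linearCombination ℂ fun x =>
    Finsupp.linearCombination ℂ fun y => propagating (diagMul δ x.diag.reflect y.diag)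

/-- The bilinear form on the cell module. -/
noncomputable def form (δ : Fin m → ℂ) (n : ℕ) (lam : Fin m → ℕ) :
    Cell δ n lam →ₗ[ℂ] Cell δ n lam →ₗ[ℂ] ℂ :=
  halfForm δ

theorem propagating_bottom {d : Diagram m (Cut lam) (Cut lam)}
    (h : ∀ y, ∃ y', d.part.rel (Sum.inl y) (Sum.inr y')) (z : Cut lam) :
    ∃ y, d.part.rel (Sum.inr z) (Sum.inl y) := by
  choose f hf using h
  have hinj : Function.Injective f := by
    intro y y' e
    by_contra hne
    have h1 := hf y
    have h2 := d.part.rel.symm (hf y')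
    rw [← e] at h2
    have h3 := (d.isBubble.two (Sum.inl y)).unique (y₁ := Sum.inl y') (y₂ := Sum.inr (f y))
      ⟨fun e => hne (Sum.inl_injective e).symm, d.part.rel.trans h1 h2⟩ ⟨by simp, h1⟩
    simp at h3
  obtain ⟨y, rfl⟩ := Finite.surjective_of_injective hinj z
  exact ⟨y, d.part.rel.symm (hf y)⟩

theorem propagating_single (d : Diagram m (Cut lam) (Cut lam)) (r : ℂ)
    (h : ¬ ∀ y, ∃ y', d.part.rel (Sum.inl y) (Sum.inr y')) :
    propagating (Finsupp.single d r) = 0 := by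
  unfold propagating
  rw [Finsupp.linearCombination_single, if_neg h, smul_zero]

theorem halfForm_single (δ : Fin m → ℂ) (y : Half n lam) (z : Half n lam →₀ ℂ) :
    halfForm δ (Finsupp.single y 1) z =
      propagating (mulL δ (Finsupp.single y.diag.reflect 1) (halfIncl z)) := by
  induction z using Finsupp.induction_linear with
  | zero => simp
  | add z z' hz hz' => simp [hz, hz']
  | single z r =>
    rw [halfIncl_single, mulL_single, map_smul]
    simp [halfForm]

/-- Pairing with a half-diagram does not see the terms in which the number of defects drops. -/
theorem propagating_proj (δ : Fin m → ℂ) (w : Diagram m (Cut lam) (Fin n))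
    (a : Diagram m (Fin n) (Fin n)) (x : Half n lam →₀ ℂ) :
    propagating (mulL δ (Finsupp.single w 1)
        (halfIncl (halfProj (mulL δ (Finsupp.single a 1) (halfIncl x))))) =
      propagating (mulL δ (Finsupp.single w 1) (mulL δ (Finsupp.single a 1) (halfIncl x))) := by
  induction x using Finsupp.induction_linear with
  | zero => simp
  | add z z' hz hz' => simp only [map_add, hz, hz']
  | single x r =>
  rw [halfIncl_single, mulL_single]
  by_cases h : Match a.part x.diag.part
  · have e : diagMul δ a x.diag = Finsupp.single (a.comp x.diag h) (weight δ a.1 x.1.1) := dif_pos h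
    rw [e, Finsupp.smul_single]
    by_cases hh : IsHalf (a.comp x.diag h)
    · rw [halfProj_single ⟨_, hh⟩, halfIncl_single]
    · rw [halfProj_single_of_not hh, map_zero, map_zero, map_zero, mulL_single, map_smul]
      by_cases h' : Match w.part (a.comp x.diag h).part
      · have e' : diagMul δ w (a.comp x.diag h) = Finsupp.single (w.comp _ h') (weight δ w.1 _) :=
          dif_pos h'
        rw [e', propagating_single, smul_zero]
        intro hp
        refine hh ⟨x.isHalf.1, fun y => ?_⟩
        obtain ⟨y', hy'⟩ := propagating_bottom hp y
        exact low_of_stack (x := y') hy'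
      · have e' : diagMul δ w (a.comp x.diag h) = 0 := dif_neg h'
        rw [e', map_zero, smul_zero]
  · have e : diagMul δ a x.diag = 0 := dif_neg h
    rw [e]
    simp

theorem propagating_rad (δ : Fin m → ℂ) (x : Half n lam →₀ ℂ)
    (hx : ∀ y, halfForm δ y x = 0) (w : Diagram m (Cut lam) (Fin n))
    (hw : ∀ y, w.part.colour (Sum.inl y) = (ofLex y).1) (r : ℂ) :
    propagating (mulL δ (Finsupp.single w r) (halfIncl x)) = 0 := by
  have hr : (Finsupp.single w r : Diagram m (Cut lam) (Fin n) →₀ ℂ) = r • Finsupp.single w 1 := by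
    simp
  rw [hr, map_smul, LinearMap.smul_apply, map_smul]
  suffices h : propagating (mulL δ (Finsupp.single w 1) (halfIncl x)) = 0 by rw [h, smul_zero]
  by_cases hh : IsHalf w.reflect
  · have hrefl : w.reflect.reflect = w := by
      refine Diagram.ext (ColPart.ext ?_ (Setoid.ext fun p q => ?_))
      · funext p
        exact congrArg w.part.colour (Sum.swap_swap p)
      · change w.part.rel p.swap.swap q.swap.swap ↔ _
        rw [Sum.swap_swap, Sum.swap_swap]
    have := hx (Finsupp.single ⟨w.reflect, hh⟩ 1)
    rw [halfForm_single] at this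
    change propagating (mulL δ (Finsupp.single w.reflect.reflect 1) (halfIncl x)) = 0 at this
    rwa [hrefl] at this
  · clear hx
    induction x using Finsupp.induction_linear with
    | zero => simp
    | add z z' hz hz' => rw [map_add, map_add, map_add, hz, hz', add_zero]
    | single x r =>
    rw [halfIncl_single, mulL_single, map_smul]
    by_cases h' : Match w.part x.diag.part
    · have e' : diagMul δ w x.diag = Finsupp.single (w.comp _ h') (weight δ w.1 _) := dif_pos h'
      rw [e', propagating_single, smul_zero]
      intro hp
      refine hh ⟨hw, fun y => ?_⟩
      obtain ⟨y', hy'⟩ := hp y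
      exact up_of_stack (z := y') hy'
    · have e' : diagMul δ w x.diag = 0 := dif_neg h'
      rw [e', map_zero, smul_zero]

theorem halfForm_act (δ : Fin m → ℂ) (x : Half n lam →₀ ℂ) (hx : ∀ y, halfForm δ y x = 0)
    (a : Diagram m (Fin n) (Fin n) →₀ ℂ) (y : Half n lam →₀ ℂ) :
    halfForm δ y (halfProj (mulL δ a (halfIncl x))) = 0 := by
  induction y using Finsupp.induction_linear with
  | zero => simp
  | add z z' hz hz' => rw [map_add, LinearMap.add_apply, hz, hz', add_zero]
  | single y s =>
  induction a using Finsupp.induction_linear with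
  | zero => simp
  | add z z' hz hz' => rw [map_add, LinearMap.add_apply, map_add, map_add, hz, hz', add_zero]
  | single a r =>
  have hs : (Finsupp.single y s : Half n lam →₀ ℂ) = s • Finsupp.single y 1 := by simp
  have hr : (Finsupp.single a r : Diagram m (Fin n) (Fin n) →₀ ℂ) = r • Finsupp.single a 1 := by
    simp
  rw [hs, hr, map_smul, map_smul, LinearMap.smul_apply, LinearMap.smul_apply, map_smul, map_smul,
    halfForm_single, propagating_proj, ← mulL_assoc, mulL_single]
  by_cases h : Match y.diag.reflect.part a.part
  · have e : diagMul δ y.diag.reflect a =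
        Finsupp.single (y.diag.reflect.comp a h) (weight δ y.diag.reflect.part a.part) := dif_pos h
    rw [e, Finsupp.smul_single, propagating_rad δ x hx _ fun z => y.isHalf.1 z]
    simp
  · have e : diagMul δ y.diag.reflect a = 0 := dif_neg h
    rw [e]
    simp

/-- The radical of the bilinear form, as a submodule over the bubble algebra. (The form is
symmetric.) -/
noncomputable def formRad (δ : Fin m → ℂ) (n : ℕ) (lam : Fin m → ℕ) :
    Submodule (Alg δ n) (Cell δ n lam) where
  carrier := {x | ∀ y, form δ n lam y x = 0}
  zero_mem' y := map_zero _
  add_mem' {x x'} hx hx' y := by rw [map_add, hx y, hx' y, add_zero]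
  smul_mem' a x hx y := halfForm_act δ x hx a y

/-- The quotient of the cell module by the radical of its form. When the form is not zero, this is
the simple head of the cell module. -/
abbrev Simple (δ : Fin m → ℂ) (n : ℕ) (lam : Fin m → ℕ) : Type :=
  Cell δ n lam ⧸ formRad δ n lam

end CellModule

/-! ### Radical series -/

/-- The radical series of a module: `Rad⁰ M = M`, and `Radᵏ⁺¹ M` is the radical of `Radᵏ M`, that
is, the intersection of the maximal submodules of `Radᵏ M`. -/
def radSeries (R M : Type*) [Ring R] [AddCommGroup M] [Module R M] : ℕ → Submodule R M
  | 0 => ⊤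
  | k + 1 => (Module.jacobson R (radSeries R M k)).map (radSeries R M k).subtype

/-- The layer `Radᵏ M / Radᵏ⁺¹ M` of the radical series. -/
abbrev RadLayer (R M : Type*) [Ring R] [AddCommGroup M] [Module R M] (k : ℕ) : Type _ :=
  radSeries R M k ⧸ (radSeries R M (k + 1)).submoduleOf (radSeries R M k)

/-- The tuples obtained from `lam` by adding `2 * t j` in exactly `k` of the coordinates `j ≤ s`. -/
def Xi {m : ℕ} (s : ℕ) (t lam : Fin m → ℕ) (k : ℕ) : Set (Fin m → ℕ) :=
  {lam' | ∃ S : Finset (Fin m), (∀ j ∈ S, (j : ℕ) ≤ s) ∧ #S = k ∧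
    (∀ j ∈ S, lam' j = lam j + 2 * t j) ∧ ∀ j ∉ S, lam' j = lam j}

end Bubble

/-!
The proof translates the diagram calculus into linear algebra by means of a vertex model. For each
colour `i` a fourth root `ρ i` of `q i` is chosen; the nodes carry signs, and a diagram acts on
signs by the matrix `amp`, which vanishes unless every edge is consistently oriented and otherwise
counts the turning of the edges with powers of the `ρ i`. A loop of colour `i` then has the value
`q i + (q i)⁻¹`, so that stacking diagrams becomes matrix multiplication (`amp_comp`). A half-diagram
becomes the vector `psi` obtained by placing the sign `+` on all defects. These vectors are linearly
independent (`linearIndependent_psi`), and the cellular form is the standard dot product.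

*One colour.* Splitting off the last node of the top row gives an orthogonal decomposition and a
recursion for the nullity `defect` of the Gram matrix (`defect_succ`). For critical `l`, that is,
`q ^ (2 * (l + 1)) = 1` or `q` not a root of unity, the form is nondegenerate
(`defect_of_critical`): contracting neighbouring nodes reduces this to singular vectors, which are
multiples of the explicit vectors `chain`, whose norms are Gaussian binomials at a root of unity.
With this boundary condition, the recursion shows that the radicals for `l` and for its reflection
`l + 2 * t` have dimensions adding up to the dimension of the second cell module (`defect_add`).
Hence the radical for `l` contains a singular vector on `l + 2 * t` nodes (`exists_singular`), and
placing that vector on the defects is a homomorphism from the second cell module whose image is the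
radical for `l` and whose kernel is the radical for `l + 2 * t`, by counting dimensions
(`exists_splitting`).

*Several colours.* Once the colours of the top nodes are fixed, half-diagrams are families of
one-coloured half-diagrams (`glue`), and amplitudes and forms factor accordingly. Tensor products
of the one-coloured homomorphisms are linear over the bubble algebra (`tensorMap_smul`), because
they correspond to placing a tensor product of singular vectors on the defects. For each set of
`k` of the first `s + 1` colours this gives a homomorphism into the cell module of `lam`; let
`layerSum k` be the sum of the images. These homomorphisms map the radicals of the forms into
`layerSum (k + 1)` (`layerHom_formRad_le`), the images in `layerSum (k + 1)` arise in this way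
(`range_layerHom_raise_le`), and retractions separate the summands (`exists_layer_retraction`). So
`layerSum k / layerSum (k + 1)` is the direct sum of the heads (`nonempty_layer_equiv`). As each
proper submodule of a cell module lies in the radical of its form (`le_formRad`), these heads have
zero radical, and the radical of each cell module that occurs contains the radical of its form
(`formRad_le_jacobson`), so the `layerSum k` are the radical series (`radSeries_eq_layerSum`).
-/

namespace Bubble

/-! ### Diagrams as perfect matchings -/

section Partner

variable {m m' : ℕ} {X Y Z X' Y' : Type} [LinearOrder X] [LinearOrder Y] [LinearOrder Z]
  [LinearOrder X'] [LinearOrder Y']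

/-- The other end of the edge at a node of a bubble diagram. -/
noncomputable def Diagram.partner (a : Diagram m X Y) (p : X ⊕ Y) : X ⊕ Y :=
  (a.isBubble.two p).exists.choose

theorem Diagram.partner_ne (a : Diagram m X Y) (p : X ⊕ Y) : a.partner p ≠ p :=
  (a.isBubble.two p).exists.choose_spec.1

theorem Diagram.rel_partner (a : Diagram m X Y) (p : X ⊕ Y) : a.part.rel p (a.partner p) :=
  (a.isBubble.two p).exists.choose_spec.2

theorem Diagram.partner_eq {a : Diagram m X Y} {p q : X ⊕ Y} (h : q ≠ p) (h' : a.part.rel p q) :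
    a.partner p = q :=
  (a.isBubble.two p).unique ⟨a.partner_ne p, a.rel_partner p⟩ ⟨h, h'⟩

theorem Diagram.partner_partner (a : Diagram m X Y) (p : X ⊕ Y) :
    a.partner (a.partner p) = p :=
  partner_eq (a.partner_ne p).symm (a.part.rel.symm (a.rel_partner p))

theorem Diagram.partner_comm {a : Diagram m X Y} {p q : X ⊕ Y} (h : a.partner p = q) :
    a.partner q = p := by rw [← h, a.partner_partner]

theorem Diagram.partner_injective (a : Diagram m X Y) : Function.Injective a.partner :=
  Function.LeftInverse.injective a.partner_partner

theorem Diagram.colour_partner (a : Diagram m X Y) (p : X ⊕ Y) :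
    a.part.colour (a.partner p) = a.part.colour p :=
  (a.part.colour_eq _ _ (a.rel_partner p)).symm

theorem Diagram.rel_iff (a : Diagram m X Y) (p q : X ⊕ Y) :
    a.part.rel p q ↔ q = p ∨ q = a.partner p := by
  constructor
  · intro h
    by_cases e : q = p
    · exact Or.inl e
    · exact Or.inr (partner_eq e h).symm
  · rintro (rfl | rfl)
    · exact a.part.rel.refl _
    · exact a.rel_partner p

theorem Diagram.ext_partner {a b : Diagram m X Y} (hc : a.part.colour = b.part.colour)
    (h : ∀ p, a.part.rel p (b.partner p)) : a = b := by
  have h' : ∀ p, a.partner p = b.partner p := fun p => partner_eq (b.partner_ne p) (h p)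
  refine Diagram.ext (ColPart.ext hc (Setoid.ext fun p q => ?_))
  rw [a.rel_iff, b.rel_iff, h']

theorem Diagram.not_cross (a : Diagram m X Y) {p q : X ⊕ Y} (h1 : Before p q)
    (h2 : Before q (a.partner p)) (h3 : Before (a.partner p) (a.partner q))
    (hc : a.part.colour p = a.part.colour q) : False := by
  have h := a.isBubble.planar p q _ _ h1 h2 h3 (a.rel_partner p) (a.rel_partner q) hc
  rcases (a.rel_iff p q).1 h with rfl | rfl
  · exact Before.irrefl _ h1
  · exact Before.irrefl _ h2

theorem before_map {ι : X' → X} {κ : Y' → Y} (hι : StrictMono ι) (hκ : StrictMono κ)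
    {p q : X' ⊕ Y'} (h : Before p q) : Before (Sum.map ι κ p) (Sum.map ι κ q) := by
  rcases p with p | p <;> rcases q with q | q
  · exact hι h
  · trivial
  · exact h.elim
  · exact hκ h

/-- The diagram induced on a set of nodes that is closed under taking partners. The nodes are
given by order embeddings of the rows, and the colours may be renamed by `g` as long as nodes of
different colours stay distinguishable. -/
def Diagram.pull (a : Diagram m X Y) (ι : X' → X) (κ : Y' → Y) (hι : StrictMono ι)
    (hκ : StrictMono κ) (g : Fin m → Fin m')
    (hcl : ∀ p : X' ⊕ Y', ∃ q, a.partner (Sum.map ι κ p) = Sum.map ι κ q)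
    (hg : ∀ p q : X' ⊕ Y', g (a.part.colour (Sum.map ι κ p)) = g (a.part.colour (Sum.map ι κ q)) →
      a.part.colour (Sum.map ι κ p) = a.part.colour (Sum.map ι κ q)) : Diagram m' X' Y' where
  part :=
    { colour := fun p => g (a.part.colour (Sum.map ι κ p))
      rel := a.part.rel.comap (Sum.map ι κ)
      colour_eq := fun p q h => congrArg g (a.part.colour_eq _ _ h) }
  isBubble :=
    { two := by
        have hinj : Function.Injective (Sum.map ι κ) :=
          Sum.map_injective.2 ⟨hι.injective, hκ.injective⟩
        intro p
        obtain ⟨q, hq⟩ := hcl p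
        refine ⟨q, ⟨?_, ?_⟩, ?_⟩
        · rintro rfl
          exact a.partner_ne _ hq
        · change a.part.rel _ _
          rw [← hq]
          exact a.rel_partner _
        · rintro r ⟨h1, h2⟩
          exact hinj ((partner_eq (fun e => h1 (hinj e)) h2).symm.trans hq)
      planar := fun p q r s h1 h2 h3 h4 h5 hc =>
        a.isBubble.planar _ _ _ _ (before_map hι hκ h1) (before_map hι hκ h2)
          (before_map hι hκ h3) h4 h5 (hg _ _ hc) }

theorem Diagram.map_partner_pull (a : Diagram m X Y) {ι : X' → X} {κ : Y' → Y}
    (hι : StrictMono ι) (hκ : StrictMono κ) (g : Fin m → Fin m') (hcl hg) (p : X' ⊕ Y') :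
    Sum.map ι κ ((a.pull ι κ hι hκ g hcl hg).partner p) = a.partner (Sum.map ι κ p) := by
  have hinj : Function.Injective (Sum.map ι κ) :=
    Sum.map_injective.2 ⟨hι.injective, hκ.injective⟩
  refine (partner_eq (fun e => ?_) ?_).symm
  · exact (a.pull ι κ hι hκ g hcl hg).partner_ne p (hinj e)
  · exact (a.pull ι κ hι hκ g hcl hg).rel_partner p

end Partner

/-! ### The vertex model -/

section Amp

variable {m : ℕ} {X Y Z : Type} [LinearOrder X] [LinearOrder Y] [LinearOrder Z]

/-- The sign of an orientation. -/
def sgn : Bool → ℤ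
  | true => 1
  | false => -1

@[simp] theorem sgn_not (b : Bool) : sgn (!b) = -sgn b := by cases b <;> rfl

/-- The direction in which an edge leaves the node `p` to end in the node `q`: `1` to the right,
`-1` to the left, and `0` if the edge joins the two rows. -/
def turn : X ⊕ Y → X ⊕ Y → ℤ
  | Sum.inl x, Sum.inl x' => if x < x' then 1 else -1
  | Sum.inr y, Sum.inr y' => if y < y' then 1 else -1
  | _, _ => 0

/-- The signs of the nodes as seen from inside the frame. -/
def charge (x : X → Bool) (y : Y → Bool) : X ⊕ Y → Bool := Sum.elim x fun j => !y j

/-- A state is compatible with a diagram if each edge is consistently oriented: vertical edges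
join equal signs, arcs join opposite signs. -/
def Valid (a : Diagram m X Y) (x : X → Bool) (y : Y → Bool) : Prop :=
  ∀ p, charge x y (a.partner p) = !charge x y p

/-- The contribution of a node to the amplitude of a state. -/
noncomputable def nodeWt (ρ : Fin m → ℂ) (a : Diagram m X Y) (x : X → Bool) (y : Y → Bool)
    (p : X ⊕ Y) : ℂ :=
  ρ (a.part.colour p) ^ (turn p (a.partner p) * sgn (Sum.elim x y p))

open Classical in
/-- The matrix coefficient of a diagram in the vertex model on `(ℂ²)^{⊗ X}` and `(ℂ²)^{⊗ Y}`. The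
parameter `ρ i` is a fourth root of `q i`; each end of an arc contributes `ρ i` or its inverse. -/
noncomputable def amp [Fintype X] [Fintype Y] (ρ : Fin m → ℂ) (a : Diagram m X Y) (x : X → Bool)
    (y : Y → Bool) : ℂ :=
  if Valid a x y then ∏ p, nodeWt ρ a x y p else 0

theorem amp_of_valid [Fintype X] [Fintype Y] {ρ : Fin m → ℂ} {a : Diagram m X Y} {x : X → Bool}
    {y : Y → Bool} (h : Valid a x y) : amp ρ a x y = ∏ p, nodeWt ρ a x y p := if_pos h

theorem amp_of_not_valid [Fintype X] [Fintype Y] {ρ : Fin m → ℂ} {a : Diagram m X Y}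
    {x : X → Bool} {y : Y → Bool} (h : ¬ Valid a x y) : amp ρ a x y = 0 := if_neg h

theorem weight_eq_one (δ : Fin m → ℂ) {X Y Z : Type} {a : ColPart m X Y} {b : ColPart m Y Z}
    (h : ∀ y : Y, ∃ o : X ⊕ Z, stack a b (Sum.inr (Sum.inl y)) (outer o)) :
    weight δ a b = 1 := by
  refine Finset.prod_eq_one fun i _ => ?_
  have : IsEmpty (Closed a b {i}) := by
    refine ⟨fun K => ?_⟩
    obtain ⟨K, hK⟩ := K
    induction K using Quotient.inductionOn with
    | h u =>
      obtain ⟨y, rfl, -⟩ := hK u rfl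
      obtain ⟨o, ho⟩ := h y
      obtain ⟨y', hy', -⟩ := hK (outer o) (Quotient.sound ((stack a b).symm ho))
      rcases o with o | o <;> simp [outer] at hy'
  unfold loops
  rw [Nat.card_of_isEmpty, pow_zero]

theorem weight_eq_one_of_top (δ : Fin m → ℂ) {X Y Z : Type} {a : ColPart m X Y}
    {b : ColPart m Y Z} (h : ∀ y : Y, ∃ x, a.rel (Sum.inr y) (Sum.inl x)) :
    weight δ a b = 1 := by
  refine weight_eq_one δ fun y => ?_
  obtain ⟨x, hx⟩ := h y
  exact ⟨Sum.inl x, stack_up hx⟩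

theorem weight_eq_one_of_bot (δ : Fin m → ℂ) {X Y Z : Type} {a : ColPart m X Y}
    {b : ColPart m Y Z} (h : ∀ y : Y, ∃ z, b.rel (Sum.inl y) (Sum.inr z)) :
    weight δ a b = 1 := by
  refine weight_eq_one δ fun y => ?_
  obtain ⟨z, hz⟩ := h y
  exact ⟨Sum.inr z, stack_low hz⟩

variable [Fintype X] [Fintype Y]

/-- The vertex model turns stacking `a` on top of any diagram into multiplication by the matrix of
`a`. -/
def Functorial (δ ρ : Fin m → ℂ) (a : Diagram m X Y) : Prop :=
  ∀ (Z : Type) [LinearOrder Z] [Fintype Z] (b : Diagram m Y Z) (h : Match a.part b.part)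
    (x : X → Bool) (z : Z → Bool),
    ∑ y, amp ρ a x y * amp ρ b y z = weight δ a.part b.part * amp ρ (a.comp b h) x z

/-- If no arc of `a` lies on its bottom row, no loops arise, and a compatible state on the top row
of the composite has a unique extension to the middle row. -/
theorem functorial_of_no_cap (δ ρ : Fin m → ℂ) (a : Diagram m X Y)
    (ha : ∀ y, ∃ x, a.partner (Sum.inr y) = Sum.inl x) : Functorial δ ρ a := by
  classical
  intro Z _ _ b h x z
  rw [weight_eq_one_of_top δ fun y => ?_, one_mul]
  swap
  · obtain ⟨t, ht⟩ := ha y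
    exact ⟨t, ht ▸ a.rel_partner _⟩
  choose τ hτ using ha
  have hτ' : ∀ y, a.partner (Sum.inl (τ y)) = Sum.inr y := fun y => Diagram.partner_comm (hτ y)
  have hinj : Function.Injective τ := fun y y' e => by
    have := hτ' y
    rw [e, hτ'] at this
    exact (Sum.inr_injective this).symm
  have hcolτ : ∀ y, a.part.colour (Sum.inl (τ y)) = b.part.colour (Sum.inl y) := fun y => by
    rw [← h y, ← a.colour_partner (Sum.inr y), hτ]
  have hmono : ∀ y y', b.part.colour (Sum.inl y) = b.part.colour (Sum.inl y') → y < y' →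
      τ y < τ y' := by
    intro y y' hc hlt
    by_contra hcon
    have hlt' : τ y' < τ y := lt_of_le_of_ne (not_lt.1 hcon) fun e => hlt.ne' (hinj e)
    refine a.not_cross (p := Sum.inl (τ y')) (q := Sum.inl (τ y)) hlt' ?_ ?_ ?_
    · rw [hτ']; trivial
    · rw [hτ', hτ']; exact hlt
    · rw [hcolτ, hcolτ, hc]
  have hmono' : ∀ y y', b.part.colour (Sum.inl y) = b.part.colour (Sum.inl y') →
      (τ y < τ y' ↔ y < y') := by
    intro y y' hc
    refine ⟨fun hlt => ?_, hmono y y' hc⟩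
    by_contra hcon
    rcases (not_lt.1 hcon).eq_or_lt with e | e
    · rw [e] at hlt; exact lt_irrefl _ hlt
    · exact lt_asymm hlt (hmono _ _ hc.symm e)
  set c := a.comp b h with hcdef
  -- the nodes of `b` as nodes of the composite
  let σ : Y ⊕ Z → X ⊕ Z := Sum.map τ id
  have hσinj : Function.Injective σ := Sum.map_injective.2 ⟨hinj, Function.injective_id⟩
  have hσ : ∀ o, stack a.part b.part (outer (σ o)) (lower o) := by
    rintro (y | z)
    · have : a.part.rel (Sum.inl (τ y)) (Sum.inr y) := by
        rw [← hτ' y]; exact a.rel_partner _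
      exact stack_up this
    · exact (stack a.part b.part).refl _
  have hcσ : ∀ o, c.partner (σ o) = σ (b.partner o) := by
    intro o
    refine Diagram.partner_eq (fun e => b.partner_ne o (hσinj e)) ?_
    exact (stack a.part b.part).trans (hσ o) ((stack a.part b.part).trans
      (stack_low (b.rel_partner o)) ((stack a.part b.part).symm (hσ _)))
  have hctop : ∀ s s', a.partner (Sum.inl s) = Sum.inl s' → c.partner (Sum.inl s) = Sum.inl s' := by
    intro s s' e
    refine Diagram.partner_eq (fun e' => a.partner_ne (Sum.inl s) ?_) ?_
    · rw [e, Sum.inl_injective e']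
    · exact stack_up (a := a.part) (b := b.part) (e ▸ a.rel_partner (Sum.inl s))
  rw [Finset.sum_eq_single (x ∘ τ)]
  rotate_left
  · intro y _ hy
    rw [amp_of_not_valid, zero_mul]
    intro hv
    refine hy (funext fun s => ?_)
    have := hv (Sum.inr s)
    rw [hτ] at this
    simpa [charge] using this.symm
  · simp
  have hch : ∀ o, charge x z (σ o) = charge (x ∘ τ) z o := by rintro (o | o) <;> rfl
  have hval : Valid c x z ↔ Valid a x (x ∘ τ) ∧ Valid b (x ∘ τ) z := by
    constructor
    · intro hv
      refine ⟨?_, fun o => ?_⟩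
      · rintro (s | y)
        · rcases e : a.partner (Sum.inl s) with s' | y
          · have := hv (Sum.inl s)
            rw [hctop s s' e] at this
            exact this
          · have e' := Diagram.partner_comm e
            rw [hτ] at e'
            simp [charge, Sum.inl_injective e']
        · rw [hτ]
          simp [charge]
      · have := hv (σ o)
        rwa [hcσ, hch, hch] at this
    · rintro ⟨hva, hvb⟩
      have hb : ∀ o, charge x z (c.partner (σ o)) = !charge x z (σ o) := fun o => by
        rw [hcσ, hch, hch]; exact hvb o
      rintro (s | t)
      · rcases e : a.partner (Sum.inl s) with s' | y
        · have := hva (Sum.inl s)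
          rw [e] at this
          rw [hctop s s' e]
          exact this
        · have e' := Diagram.partner_comm e
          rw [hτ] at e'
          rw [← Sum.inl_injective e']
          exact hb (Sum.inl y)
      · exact hb (Sum.inr t)
  by_cases hv : Valid c x z
  · rw [amp_of_valid hv, amp_of_valid (hval.1 hv).1, amp_of_valid (hval.1 hv).2]
    have hwσ : ∀ o, nodeWt ρ c x z (σ o) = nodeWt ρ b (x ∘ τ) z o := by
      intro o
      unfold nodeWt
      rw [hcσ]
      have e1 : c.part.colour (σ o) = b.part.colour o := by
        rcases o with y | t
        · exact hcolτ y
        · rfl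
      have e2 : turn (σ o) (σ (b.partner o)) = turn o (b.partner o) := by
        have hcp := b.colour_partner o
        rcases e : b.partner o with y' | t' <;> rcases o with y | t
        · rw [e] at hcp
          simp only [σ, turn, Sum.map_inl, hmono' y y' hcp.symm]
        all_goals rfl
      have e3 : Sum.elim x z (σ o) = Sum.elim (x ∘ τ) z o := by rcases o with y | t <;> rfl
      rw [e1, e2, e3]
    rw [Fintype.prod_sum_type, Fintype.prod_sum_type, Fintype.prod_sum_type]
    have h1 : ∀ y, nodeWt ρ a x (x ∘ τ) (Sum.inr y) = 1 := fun y => by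
      unfold nodeWt
      rw [hτ]
      simp [turn]
    rw [Finset.prod_congr rfl fun y _ => h1 y, Finset.prod_const_one, mul_one, ← mul_assoc]
    congr 1
    · rw [← Finset.prod_fiberwise (s := (Finset.univ : Finset Y)) τ, ← Finset.prod_mul_distrib]
      refine Finset.prod_congr rfl fun s _ => ?_
      rcases e : a.partner (Sum.inl s) with s' | y
      · rw [Finset.filter_false_of_mem, Finset.prod_empty, mul_one]
        · unfold nodeWt
          rw [e, hctop s s' e]
          rfl
        · rintro y - rfl
          rw [hτ'] at e
          cases e
      · have e' := Diagram.partner_comm e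
        rw [hτ] at e'
        have e' := Sum.inl_injective e'
        have : ({y' ∈ (Finset.univ : Finset Y) | τ y' = s} : Finset Y) = {y} := by
          ext y'
          simp only [Finset.mem_filter, Finset.mem_univ, true_and, Finset.mem_singleton]
          rw [← e']
          exact hinj.eq_iff
        rw [this, Finset.prod_singleton, ← hwσ]
        have h2 : nodeWt ρ a x (x ∘ τ) (Sum.inl s) = 1 := by
          unfold nodeWt
          rw [e]
          simp [turn]
        rw [h2, one_mul, ← e']
        rfl
    · exact Finset.prod_congr rfl fun t _ => (hwσ (Sum.inr t)).symm
  · rw [amp_of_not_valid hv]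
    by_cases hva : Valid a x (x ∘ τ)
    · rw [amp_of_not_valid fun hvb => hv (hval.2 ⟨hva, hvb⟩), mul_zero]
    · rw [amp_of_not_valid hva, zero_mul]

end Amp

/-! ### Contracting two neighbouring nodes -/

section Cap

variable {m : ℕ} {X Y Z : Type} [LinearOrder X] [LinearOrder Y] [LinearOrder Z]

/-- The nodes other than `p` and `q`. -/
abbrev Rest (p q : Y) : Type := {y : Y // y ≠ p ∧ y ≠ q}

/-- Two nodes of a row with no node of their common colour between them. -/
structure Adjacent (c : Y → Fin m) (p q : Y) : Prop where
  lt : p < q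
  colour : c p = c q
  gap : ∀ y, p < y → y < q → c y ≠ c p

/-- The diagram whose only arc joins the neighbours `p` and `q` of the bottom row. -/
def capPart (c : Y → Fin m) {p q : Y} (h : Adjacent c p q) : ColPart m (Rest p q) Y where
  colour := Sum.elim (fun y => c y.1) c
  rel := Setoid.ker (Sum.elim Subtype.val fun y => if y = q then p else y)
  colour_eq := by
    have key : ∀ u : Rest p q ⊕ Y, Sum.elim (fun y : Rest p q => c y.1) c u =
        c (Sum.elim Subtype.val (fun y => if y = q then p else y) u) := by
      rintro (u | u)
      · rfl
      · change c u = c (if u = q then p else u)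
        split_ifs with hu
        · rw [hu, h.colour]
        · rfl
    intro u v huv
    rw [key, key]
    exact congrArg c huv

theorem capPart_isBubble (c : Y → Fin m) {p q : Y} (h : Adjacent c p q) :
    IsBubble (capPart c h) where
  two := by
    rintro (y | y)
    · refine ⟨Sum.inr y.1, ⟨by simp, ?_⟩, ?_⟩
      · change y.1 = if y.1 = q then p else y.1
        rw [if_neg y.2.2]
      · rintro (z | z) ⟨h1, h2⟩
        · exact absurd (congrArg Sum.inl (Subtype.ext (show y.1 = z.1 from h2)).symm) h1
        · have h2 : y.1 = if z = q then p else z := h2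
          split_ifs at h2 with hz
          · exact absurd h2 y.2.1
          · rw [h2]
    · by_cases hp : y = p
      · subst hp
        refine ⟨Sum.inr q, ⟨fun e => h.lt.ne' (Sum.inr_injective e), ?_⟩, ?_⟩
        · change (if y = q then y else y) = if q = q then y else q
          simp
        · rintro (z | z) ⟨h1, h2⟩
          · have h2 : (if y = q then y else y) = z.1 := h2
            rw [ite_self] at h2
            exact absurd h2.symm z.2.1
          · have h2 : (if y = q then y else y) = if z = q then y else z := h2
            rw [ite_self] at h2
            split_ifs at h2 with hz
            · rw [hz]
            · exact absurd (by rw [h2]) h1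
      · by_cases hq : y = q
        · subst hq
          refine ⟨Sum.inr p, ⟨fun e => h.lt.ne (Sum.inr_injective e), ?_⟩, ?_⟩
          · change (if y = y then p else y) = if p = y then p else p
            simp
          · rintro (z | z) ⟨h1, h2⟩
            · have h2 : (if y = y then p else y) = z.1 := h2
              rw [if_pos rfl] at h2
              exact absurd h2.symm z.2.1
            · have h2 : (if y = y then p else y) = if z = y then p else z := h2
              rw [if_pos rfl] at h2
              split_ifs at h2 with hz
              · exact absurd (by rw [hz]) h1
              · rw [h2]
        · refine ⟨Sum.inl ⟨y, hp, hq⟩, ⟨by simp, ?_⟩, ?_⟩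
          · change (if y = q then p else y) = y
            rw [if_neg hq]
          · rintro (z | z) ⟨h1, h2⟩
            · have h2 : (if y = q then p else y) = z.1 := h2
              rw [if_neg hq] at h2
              exact congrArg Sum.inl (Subtype.ext h2.symm)
            · have h2 : (if y = q then p else y) = if z = q then p else z := h2
              rw [if_neg hq] at h2
              split_ifs at h2 with hz
              · exact absurd h2 hp
              · exact absurd (by rw [h2]) h1
  planar := by
    have hlt := h.lt
    have hgap := h.gap
    have hcol := h.colour
    intro u v w x h1 h2 h3 h4 h5 hc
    change Sum.elim Subtype.val (fun y => if y = q then p else y) u =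
      Sum.elim Subtype.val (fun y => if y = q then p else y) w at h4
    change Sum.elim Subtype.val (fun y => if y = q then p else y) v =
      Sum.elim Subtype.val (fun y => if y = q then p else y) x at h5
    change Sum.elim Subtype.val (fun y => if y = q then p else y) u =
      Sum.elim Subtype.val (fun y => if y = q then p else y) v
    change Sum.elim (fun y : Rest p q => c y.1) c u = Sum.elim (fun y => c y.1) c v at hc
    rcases u with u | u <;> rcases v with v | v <;> rcases w with w | w <;>
      rcases x with x | x <;> simp only [Before] at h1 h2 h3 <;>
      simp only [Sum.elim_inl, Sum.elim_inr] at h4 h5 hc ⊢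
    all_goals try (obtain ⟨u, hu⟩ := u)
    all_goals try (obtain ⟨v, hv⟩ := v)
    all_goals try (obtain ⟨w, hw⟩ := w)
    all_goals try (obtain ⟨x, hx⟩ := x)
    all_goals try simp only [Subtype.mk_lt_mk] at *
    all_goals grind

/-- The diagram whose only arc joins the neighbours `p` and `q` of the bottom row. -/
def cap (c : Y → Fin m) {p q : Y} (h : Adjacent c p q) : Diagram m (Rest p q) Y :=
  ⟨capPart c h, capPart_isBubble c h⟩

theorem cap_rel_line (c : Y → Fin m) {p q : Y} (h : Adjacent c p q) (y : Rest p q) :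
    (cap c h).part.rel (Sum.inl y) (Sum.inr y.1) := by
  change y.1 = if y.1 = q then p else y.1
  rw [if_neg y.2.2]

theorem cap_rel_arc (c : Y → Fin m) {p q : Y} (h : Adjacent c p q) :
    (cap c h).part.rel (Sum.inr p) (Sum.inr q) := by
  change (if p = q then p else p) = if q = q then p else q
  simp

theorem cap_partner_inl (c : Y → Fin m) {p q : Y} (h : Adjacent c p q) (y : Rest p q) :
    (cap c h).partner (Sum.inl y) = Sum.inr y.1 :=
  Diagram.partner_eq (by simp) (cap_rel_line c h y)

theorem cap_partner_inr (c : Y → Fin m) {p q : Y} (h : Adjacent c p q) (y : Rest p q) :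
    (cap c h).partner (Sum.inr y.1) = Sum.inl y :=
  Diagram.partner_comm (cap_partner_inl c h y)

theorem cap_partner_left (c : Y → Fin m) {p q : Y} (h : Adjacent c p q) :
    (cap c h).partner (Sum.inr p) = Sum.inr q :=
  Diagram.partner_eq (fun e => h.lt.ne' (Sum.inr_injective e)) (cap_rel_arc c h)

theorem cap_partner_right (c : Y → Fin m) {p q : Y} (h : Adjacent c p q) :
    (cap c h).partner (Sum.inr q) = Sum.inr p :=
  Diagram.partner_comm (cap_partner_left c h)

/-- The state that extends `x` by opposite signs at `p` and `q`. -/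
def extState {p q : Y} (x : Rest p q → Bool) (t : Bool) (y : Y) : Bool :=
  if h : y ≠ p ∧ y ≠ q then x ⟨y, h⟩ else if y = p then t else !t

theorem extState_rest {p q : Y} (x : Rest p q → Bool) (t : Bool) (y : Rest p q) :
    extState x t y.1 = x y := dif_pos y.2

theorem extState_left {p q : Y} (x : Rest p q → Bool) (t : Bool) : extState x t p = t := by
  unfold extState
  rw [dif_neg (by simp), if_pos rfl]

theorem extState_right {p q : Y} (h : p < q) (x : Rest p q → Bool) (t : Bool) :
    extState x t q = !t := by
  unfold extState
  rw [dif_neg (by simp), if_neg h.ne']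

theorem eq_extState {p q : Y} (h : p < q) (y : Y → Bool) (hy : y q = !y p) :
    y = extState (fun r : Rest p q => y r.1) (y p) := by
  funext r
  by_cases hp : r = p
  · rw [hp, extState_left]
  · by_cases hq : r = q
    · rw [hq, extState_right h, hy]
    · exact (extState_rest (fun r : Rest p q => y r.1) (y p) ⟨r, hp, hq⟩).symm

theorem prod_rest {M : Type*} [CommMonoid M] [Fintype Y] {p q : Y} (h : p ≠ q) (f : Y → M) :
    ∏ y, f y = f p * f q * ∏ y : Rest p q, f y.1 := by
  classical
  rw [← Finset.mul_prod_erase Finset.univ f (Finset.mem_univ p),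
    ← Finset.mul_prod_erase (Finset.univ.erase p) f
      (Finset.mem_erase.2 ⟨h.symm, Finset.mem_univ q⟩), mul_assoc]
  congr 2
  refine Finset.prod_subtype _ (fun y => ?_) f
  simp [and_comm]

/-- Contracting two neighbours with opposite signs: the state is summed over the two choices of
signs, with weights `ρ ^ 2` and `ρ ^ (-2)`. -/
theorem cap_amp_sum [Fintype Y] (ρ : Fin m → ℂ) (hρ : ∀ i, ρ i ≠ 0) (c : Y → Fin m) {p q : Y}
    (h : Adjacent c p q) (x : Rest p q → Bool) (F : (Y → Bool) → ℂ) :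
    ∑ y, amp ρ (cap c h) x y * F y = ∑ t : Bool, ρ (c p) ^ (2 * sgn t) * F (extState x t) := by
  classical
  symm
  refine Fintype.sum_of_injective (fun t => extState x t) ?_ _ _ ?_ ?_
  · intro t t' e
    have := congrFun e p
    simpa only [extState_left] using this
  · intro y hy
    rw [amp_of_not_valid, zero_mul]
    intro hv
    refine hy ⟨y p, ?_⟩
    have h1 : y q = !y p := by
      have := hv (Sum.inr p)
      rw [cap_partner_left] at this
      simpa [charge] using this
    rw [eq_extState h.lt y h1]
    have h2 : (fun r : Rest p q => y r.1) = x := by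
      funext r
      have := hv (Sum.inl r)
      rw [cap_partner_inl] at this
      simpa [charge] using this
    simp only [extState_left, h2]
  · intro t
    have hv : Valid (cap c h) x (extState x t) := by
      rintro (r | y)
      · rw [cap_partner_inl]
        simp [charge, extState_rest]
      · by_cases hp : y = p
        · rw [hp, cap_partner_left]
          simp [charge, extState_left, extState_right h.lt]
        · by_cases hq : y = q
          · rw [hq, cap_partner_right]
            simp [charge, extState_left, extState_right h.lt]
          · have := cap_partner_inr c h ⟨y, hp, hq⟩
            rw [this]
            have := extState_rest x t ⟨y, hp, hq⟩
            simp [charge, this]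
    rw [amp_of_valid hv]
    congr 1
    rw [Fintype.prod_sum_type, prod_rest h.lt.ne]
    have h1 : ∀ r, nodeWt ρ (cap c h) x (extState x t) (Sum.inl r) = 1 := fun r => by
      unfold nodeWt
      rw [cap_partner_inl]
      simp [turn]
    have h2 : ∀ r : Rest p q, nodeWt ρ (cap c h) x (extState x t) (Sum.inr r.1) = 1 := fun r => by
      unfold nodeWt
      rw [cap_partner_inr]
      simp [turn]
    rw [Finset.prod_congr rfl fun r _ => h1 r, Finset.prod_congr rfl fun r _ => h2 r]
    unfold nodeWt
    rw [cap_partner_left, cap_partner_right]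
    have e1 : (cap c h).part.colour (Sum.inr p) = c p := rfl
    have e2 : (cap c h).part.colour (Sum.inr q) = c p := h.colour.symm
    rw [e1, e2]
    simp only [turn, if_pos h.lt, if_neg h.lt.asymm, Sum.elim_inr, extState_left,
      extState_right h.lt, sgn_not, Finset.prod_const_one, one_mul, mul_one]
    rw [← zpow_add₀ (hρ _)]
    congr 1
    ring

end Cap

/-! ### The vertex model is functorial -/

section Functor

variable {m : ℕ} {X Y Z : Type} [LinearOrder X] [LinearOrder Y] [LinearOrder Z]

/-- The turning numbers along the two strands through neighbouring nodes `p`, `q` that get joined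
add up to the turning number of the joined strand. -/
theorem turn_join (b : Diagram m Y Z) {p q : Y} (hlt : p < q)
    (hcol : b.part.colour (Sum.inl p) = b.part.colour (Sum.inl q))
    (hgap : ∀ y, p < y → y < q → b.part.colour (Sum.inl y) ≠ b.part.colour (Sum.inl p))
    {U V : Y ⊕ Z} (hU : b.partner (Sum.inl p) = U) (hV : b.partner (Sum.inl q) = V)
    (hUq : U ≠ Sum.inl q) (y : Y → Bool) (z : Z → Bool) (hyq : y q = !y p)
    (hcU : charge y z U = !y p) (hcV : charge y z V = y p) :
    turn (Sum.inl p) U * sgn (y p) + turn (Sum.inl q) V * sgn (y q) + 2 * sgn (y p) +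
      (turn U (Sum.inl p) * sgn (Sum.elim y z U) + turn V (Sum.inl q) * sgn (Sum.elim y z V)) =
    turn U V * sgn (Sum.elim y z U) + turn V U * sgn (Sum.elim y z V) := by
  have hUp : U ≠ Sum.inl p := hU ▸ b.partner_ne _
  have hVq : V ≠ Sum.inl q := hV ▸ b.partner_ne _
  have hVp : V ≠ Sum.inl p := by
    intro e
    rw [e] at hV
    exact hUq (hU.symm.trans (Diagram.partner_comm hV))
  have hUV : U ≠ V := by
    intro e
    rw [← hU, ← hV] at e
    exact hlt.ne (Sum.inl_injective (b.partner_injective e))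
  have hcolU : b.part.colour U = b.part.colour (Sum.inl p) := hU ▸ b.colour_partner _
  have hcolV : b.part.colour V = b.part.colour (Sum.inl p) := by
    rw [hcol]; exact hV ▸ b.colour_partner _
  have hU' := Diagram.partner_comm hU
  have hV' := Diagram.partner_comm hV
  have side : ∀ r, r ≠ p → r ≠ q → b.part.colour (Sum.inl r) = b.part.colour (Sum.inl p) →
      (r < p ∧ r < q) ∨ (p < r ∧ q < r) := by
    intro r hp hq hc
    rcases lt_or_gt_of_ne hp with h1 | h1
    · exact Or.inl ⟨h1, h1.trans hlt⟩
    · rcases lt_or_gt_of_ne hq with h2 | h2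
      · exact absurd hc (hgap r h1 h2)
      · exact Or.inr ⟨h1, h2⟩
  have hpq : Before (Sum.inl p : Y ⊕ Z) (Sum.inl q) := hlt
  rw [hyq, sgn_not]
  rcases U with u | u <;> rcases V with v | v
  · have hu := side u (fun e => hUp (congrArg _ e)) (fun e => hUq (congrArg _ e)) hcolU
    have hv := side v (fun e => hVp (congrArg _ e)) (fun e => hVq (congrArg _ e)) hcolV
    have huv : u ≠ v := fun e => hUV (congrArg _ e)
    change y u = _ at hcU
    change y v = _ at hcV
    simp only [Sum.elim_inl, hcU, hcV, sgn_not, turn]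
    rcases hu with ⟨hu1, hu2⟩ | ⟨hu1, hu2⟩ <;> rcases hv with ⟨hv1, hv2⟩ | ⟨hv1, hv2⟩
    · have : v < u := by
        rcases lt_or_gt_of_ne huv with e | e
        · exact (b.not_cross (p := Sum.inl u) (q := Sum.inl v) e (by rw [hU']; exact hv1)
            (by rw [hU', hV']; exact hpq) (hcolU.trans hcolV.symm)).elim
        · exact e
      simp only [if_neg hu1.asymm, if_pos hu1, if_neg hv2.asymm, if_pos hv2, if_pos this,
        if_neg this.asymm]
      ring
    · have : u < v := hu1.trans hv1
      simp only [if_neg hu1.asymm, if_pos hu1, if_neg hv2.asymm, if_pos hv2, if_pos this,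
        if_neg this.asymm]
      ring
    · exact (b.not_cross (p := Sum.inl v) (q := Sum.inl p) hv1 (by rw [hV']; exact hpq)
        (by rw [hV', hU]; exact hu2) hcolV).elim
    · have : v < u := by
        rcases lt_or_gt_of_ne huv with e | e
        · exact (b.not_cross (p := Sum.inl p) (q := Sum.inl q) hpq (by rw [hU]; exact hu2)
            (by rw [hU, hV]; exact e) hcol).elim
        · exact e
      simp only [if_neg hu1.asymm, if_pos hu1, if_neg hv2.asymm, if_pos hv2, if_pos this,
        if_neg this.asymm]
      ring
  · have hu := side u (fun e => hUp (congrArg _ e)) (fun e => hUq (congrArg _ e)) hcolU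
    change y u = _ at hcU
    simp only [Sum.elim_inl, hcU, sgn_not, turn]
    rcases hu with ⟨hu1, hu2⟩ | ⟨hu1, hu2⟩
    · simp only [if_neg hu1.asymm, if_pos hu1]
      ring
    · exact (b.not_cross (p := Sum.inl p) (q := Sum.inl q) hpq (by rw [hU]; exact hu2)
        (by rw [hU, hV]; trivial) hcol).elim
  · have hv := side v (fun e => hVp (congrArg _ e)) (fun e => hVq (congrArg _ e)) hcolV
    change y v = _ at hcV
    simp only [Sum.elim_inl, hcV, turn]
    rcases hv with ⟨hv1, hv2⟩ | ⟨hv1, hv2⟩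
    · exact (b.not_cross (p := Sum.inl v) (q := Sum.inl p) hv1 (by rw [hV']; exact hpq)
        (by rw [hV', hU]; trivial) hcolV).elim
    · simp only [if_neg hv2.asymm, if_pos hv2]
      ring
  · have huv : u ≠ v := fun e => hUV (congrArg _ e)
    have hcU' : z u = y p := by
      change (!z u) = _ at hcU
      simpa using hcU
    have hcV' : z v = !y p := by
      change (!z v) = _ at hcV
      rw [← hcV, Bool.not_not]
    have : u < v := by
      rcases lt_or_gt_of_ne huv with e | e
      · exact e
      · exact (b.not_cross (p := Sum.inl p) (q := Sum.inl q) hpq (by rw [hU]; trivial)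
            (by rw [hU, hV]; exact e) hcol).elim
    simp only [Sum.elim_inr, turn, if_pos this, if_neg this.asymm, hcU', hcV', sgn_not]
    ring

variable [Fintype X] [Fintype Y] [Fintype Z]

/-- If `p` and `q` are joined in the lower diagram, the contraction closes a loop, whose two
orientations contribute `ρ ^ 4 + ρ ^ (-4)`. Otherwise two strands are joined to one, and their
turning numbers add up by `turn_join`. -/
theorem functorial_cap (δ ρ : Fin m → ℂ) (hρ : ∀ i, ρ i ≠ 0)
    (hδ : ∀ i, δ i = ρ i ^ (4 : ℤ) + ρ i ^ (-4 : ℤ)) (c : Y → Fin m) {p q : Y}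
    (hpq : Adjacent c p q) : Functorial δ ρ (cap c hpq) := by
  classical
  intro Z _ _ b h x z
  have hc : ∀ y, c y = b.part.colour (Sum.inl y) := h
  set d := (cap c hpq).comp b h with hd
  let σ : Rest p q ⊕ Z → Y ⊕ Z := Sum.map Subtype.val id
  have hσinj : Function.Injective σ :=
    Sum.map_injective.2 ⟨Subtype.val_injective, Function.injective_id⟩
  have hσsurj : ∀ o, o ≠ Sum.inl p → o ≠ Sum.inl q → ∃ o', o = σ o' := by
    rintro (y | t) h1 h2
    · exact ⟨Sum.inl ⟨y, fun e => h1 (congrArg _ e), fun e => h2 (congrArg _ e)⟩, rfl⟩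
    · exact ⟨Sum.inr t, rfl⟩
  have hσp : ∀ o, σ o ≠ Sum.inl p := by
    rintro (y | t) e
    · exact y.2.1 (Sum.inl_injective e)
    · cases e
  have hσq : ∀ o, σ o ≠ Sum.inl q := by
    rintro (y | t) e
    · exact y.2.2 (Sum.inl_injective e)
    · cases e
  have sym := fun {u v} (huv : stack (cap c hpq).part b.part u v) => (stack _ _).symm huv
  have hσ : ∀ o, stack (cap c hpq).part b.part (outer o) (lower (σ o)) := by
    rintro (y | t)
    · exact stack_up (cap_rel_line c hpq y)
    · exact (stack _ _).refl _
  have harc : stack (cap c hpq).part b.part (lower (Sum.inl p)) (lower (Sum.inl q)) :=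
    stack_up (b := b.part) (cap_rel_arc c hpq)
  have hdpart : ∀ o o', b.partner (σ o) = σ o' → d.partner o = o' := by
    intro o o' e
    refine Diagram.partner_eq (fun e' => b.partner_ne (σ o) (by rw [e, e'])) ?_
    refine (stack _ _).trans (hσ o) ((stack _ _).trans ?_ (sym (hσ o')))
    rw [← e]
    exact stack_low (b.rel_partner _)
  have hcolσ : ∀ o, d.part.colour o = b.part.colour (σ o) := by
    rintro (y | t)
    · exact hc y.1
    · rfl
  have hturn : ∀ o o', turn (σ o) (σ o') = turn o o' := by
    rintro (y | t) (y' | t') <;> rfl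
  have hlab : ∀ s o, Sum.elim (extState x s) z (σ o) = Sum.elim x z o := by
    rintro s (y | t)
    · exact extState_rest x s y
    · rfl
  have hch : ∀ s o, charge (extState x s) z (σ o) = charge x z o := by
    rintro s (y | t)
    · exact extState_rest x s y
    · rfl
  rw [cap_amp_sum ρ hρ]
  have hprod : ∀ s, ∏ o, nodeWt ρ b (extState x s) z o =
      nodeWt ρ b (extState x s) z (Sum.inl p) * nodeWt ρ b (extState x s) z (Sum.inl q) *
        ∏ o, nodeWt ρ b (extState x s) z (σ o) := by
    intro s
    rw [Fintype.prod_sum_type, prod_rest hpq.lt.ne, Fintype.prod_sum_type, mul_assoc]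
    rfl
  have hcolp : b.part.colour (Sum.inl p) = c p := (hc p).symm
  have hcolq : b.part.colour (Sum.inl q) = c p := by rw [← hc, hpq.colour]
  have hnode : ∀ s o, (b.partner (σ o) = σ (d.partner o)) →
      nodeWt ρ b (extState x s) z (σ o) = nodeWt ρ d x z o := by
    intro s o e
    unfold nodeWt
    rw [e, hlab, hturn, hcolσ]
  by_cases hA : b.partner (Sum.inl p) = Sum.inl q
  · -- a loop is removed
    have hA' := Diagram.partner_comm hA
    have hpart : ∀ o, b.partner (σ o) = σ (d.partner o) := by
      intro o
      obtain ⟨o', ho'⟩ := hσsurj (b.partner (σ o))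
        (fun e => hσq o ((Diagram.partner_comm e).symm.trans hA))
        (fun e => hσp o ((Diagram.partner_comm e).symm.trans hA'))
      rw [ho', hdpart o o' ho']
    have hw : weight δ (cap c hpq).part b.part = δ (c p) := by
      have hrest : ∀ y, y ≠ p → y ≠ q → ∃ o : Rest p q ⊕ Z,
          stack (cap c hpq).part b.part (Sum.inr (Sum.inl y)) (outer o) := fun y h1 h2 =>
        ⟨Sum.inl ⟨y, h1, h2⟩, sym (hσ (Sum.inl ⟨y, h1, h2⟩))⟩
      have hsub : ∀ (i) (K : Closed (cap c hpq).part b.part {i}),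
          K.1 = Quotient.mk _ (Sum.inr (Sum.inl p)) ∧ i = c p := by
        rintro i ⟨K, hK⟩
        induction K using Quotient.inductionOn with
        | h u =>
          obtain ⟨y, rfl, hy⟩ := hK u rfl
          have hy : b.part.colour (Sum.inl y) = i := hy
          have hyo : ¬ ∃ o : Rest p q ⊕ Z,
              stack (cap c hpq).part b.part (Sum.inr (Sum.inl y)) (outer o) := by
            rintro ⟨o, ho⟩
            obtain ⟨y', hy', -⟩ := hK (outer o) (Quotient.sound (sym ho))
            rcases o with o | o <;> simp [outer] at hy'
          by_cases e1 : y = p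
          · subst e1
            exact ⟨rfl, by rw [← hy, hcolp]⟩
          · by_cases e2 : y = q
            · subst e2
              exact ⟨Quotient.sound (sym harc), by rw [← hy, hcolq]⟩
            · exact absurd (hrest y e1 e2) hyo
      have hclosed : ∀ u, stack (cap c hpq).part b.part u (Sum.inr (Sum.inl p)) →
          u = Sum.inr (Sum.inl p) ∨ u = Sum.inr (Sum.inl q) := by
        intro u hu
        let f : Rest p q ⊕ (Y ⊕ Z) → Prop := fun u => u = Sum.inr (Sum.inl p) ∨
          u = Sum.inr (Sum.inl q)
        have hf : f u = f (Sum.inr (Sum.inl p)) := by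
          refine stack_const f ?_ ?_ hu
          · intro o o' ho
            have key : ∀ o, f (upper o) ↔
                Sum.elim Subtype.val (fun y => if y = q then p else y) o = p := by
              rintro (y | y)
              · simp [f, upper, y.2.1]
              · simp only [f, upper, Sum.elim_inr, Sum.inr.injEq, Sum.inl.injEq]
                split_ifs with e <;> simp [e]
            exact propext ((key o).trans ((Eq.congr_left ho).trans (key o').symm))
          · intro o o' ho
            rcases (b.rel_iff o o').1 ho with rfl | rfl
            · rfl
            · have key : ∀ o, f (lower o) → f (lower (b.partner o)) := by
                rintro o (e | e)
                · rw [show o = Sum.inl p from Sum.inr_injective e, hA]; exact Or.inr rfl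
                · rw [show o = Sum.inl q from Sum.inr_injective e, hA']; exact Or.inl rfl
              refine propext ⟨key o, fun e => ?_⟩
              have := key _ e
              rwa [b.partner_partner] at this
        exact hf.mpr (Or.inl rfl)
      have hl : ∀ i, loops (cap c hpq).part b.part i = if i = c p then 1 else 0 := by
        intro i
        unfold loops
        split_ifs with e
        · rw [Nat.card_eq_one_iff_unique]
          refine ⟨⟨fun K K' => Subtype.ext ((hsub i K).1.trans (hsub i K').1.symm)⟩,
            ⟨⟨Quotient.mk _ (Sum.inr (Sum.inl p)), fun u hu => ?_⟩⟩⟩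
          rcases hclosed u (Quotient.exact hu) with rfl | rfl
          · exact ⟨p, rfl, by rw [hcolp, e]; rfl⟩
          · exact ⟨q, rfl, by rw [hcolq, e]; rfl⟩
        · have : IsEmpty (Closed (cap c hpq).part b.part {i}) := ⟨fun K => e (hsub i K).2⟩
          exact Nat.card_of_isEmpty
      unfold weight
      rw [Finset.prod_eq_single (c p)]
      · rw [hl, if_pos rfl, pow_one]
      · intro i _ hi
        rw [hl, if_neg hi, pow_zero]
      · simp
    have hvalid : ∀ s, Valid b (extState x s) z ↔ Valid d x z := by
      intro s
      constructor
      · intro hv o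
        have := hv (σ o)
        rwa [hpart, hch, hch] at this
      · intro hv o
        by_cases e1 : o = Sum.inl p
        · rw [e1, hA]
          simp [charge, extState_left, extState_right hpq.lt]
        · by_cases e2 : o = Sum.inl q
          · rw [e2, hA']
            simp [charge, extState_left, extState_right hpq.lt]
          · obtain ⟨o', rfl⟩ := hσsurj o e1 e2
            rw [hpart, hch, hch]
            exact hv o'
    have hamp : ∀ s, amp ρ b (extState x s) z = ρ (c p) ^ (2 * sgn s) * amp ρ d x z := by
      intro s
      by_cases hv : Valid d x z
      · rw [amp_of_valid hv, amp_of_valid ((hvalid s).2 hv), hprod,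
          Finset.prod_congr rfl fun o _ => hnode s o (hpart o)]
        congr 1
        unfold nodeWt
        rw [hA, hA', hcolp, hcolq]
        simp only [turn, if_pos hpq.lt, if_neg hpq.lt.asymm, Sum.elim_inl, extState_left,
          extState_right hpq.lt, sgn_not]
        rw [← zpow_add₀ (hρ _)]
        congr 1
        ring
      · rw [amp_of_not_valid hv, amp_of_not_valid fun h => hv ((hvalid s).1 h), mul_zero]
    rw [hw, hδ, Fintype.sum_bool, hamp, hamp, ← mul_assoc, ← mul_assoc, ← zpow_add₀ (hρ _),
      ← zpow_add₀ (hρ _), ← add_mul]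
    rfl
  · -- two strands are joined
    have hA' : b.partner (Sum.inl q) ≠ Sum.inl p := fun e => hA (Diagram.partner_comm e)
    obtain ⟨u, hu⟩ := hσsurj (b.partner (Sum.inl p)) (b.partner_ne _) hA
    obtain ⟨v, hv⟩ := hσsurj (b.partner (Sum.inl q)) hA' (b.partner_ne _)
    have hu' := Diagram.partner_comm hu
    have hv' := Diagram.partner_comm hv
    have huv : u ≠ v := by
      rintro rfl
      exact hpq.lt.ne (Sum.inl_injective (b.partner_injective (hu.trans hv.symm)))
    have hup : stack (cap c hpq).part b.part (lower (Sum.inl p)) (outer u) := by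
      refine (stack _ _).trans ?_ (sym (hσ u))
      rw [← hu]
      exact stack_low (b.rel_partner _)
    have hvq : stack (cap c hpq).part b.part (lower (Sum.inl q)) (outer v) := by
      refine (stack _ _).trans ?_ (sym (hσ v))
      rw [← hv]
      exact stack_low (b.rel_partner _)
    have hduv : d.partner u = v :=
      Diagram.partner_eq huv.symm ((stack _ _).trans (sym hup) ((stack _ _).trans harc hvq))
    have hdvu : d.partner v = u := Diagram.partner_comm hduv
    have hpart : ∀ o, o ≠ u → o ≠ v → b.partner (σ o) = σ (d.partner o) := by
      intro o h1 h2
      obtain ⟨o', ho'⟩ := hσsurj (b.partner (σ o))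
        (fun e => h1 (hσinj ((Diagram.partner_comm e).symm.trans hu)))
        (fun e => h2 (hσinj ((Diagram.partner_comm e).symm.trans hv)))
      rw [ho', hdpart o o' ho']
    have hw : weight δ (cap c hpq).part b.part = 1 := by
      refine weight_eq_one δ fun y => ?_
      by_cases e1 : y = p
      · exact ⟨u, e1 ▸ hup⟩
      · by_cases e2 : y = q
        · exact ⟨v, e2 ▸ hvq⟩
        · exact ⟨Sum.inl ⟨y, e1, e2⟩, sym (hσ (Sum.inl ⟨y, e1, e2⟩))⟩
    rw [hw, one_mul]
    have hbad : ∀ s, Valid b (extState x s) z → s = !charge x z u := by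
      intro s hs
      have := hs (Sum.inl p)
      rw [hu, hch] at this
      rw [this]
      simp [charge, extState_left]
    rw [Finset.sum_eq_single (!charge x z u)]
    rotate_left
    · intro s _ hs
      rw [amp_of_not_valid fun h => hs (hbad s h), mul_zero]
    · simp
    set s := !charge x z u with hs
    have hsu : charge x z u = !s := by rw [hs, Bool.not_not]
    have hvalid : Valid b (extState x s) z ↔ Valid d x z := by
      constructor
      · intro hval o
        have h1 : charge x z v = s := by
          have := hval (Sum.inl q)
          rw [hv, hch] at this
          rw [this]
          simp [charge, extState_right hpq.lt]
        by_cases e1 : o = u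
        · rw [e1, hduv, h1, hs]
        · by_cases e2 : o = v
          · rw [e2, hdvu, h1, hsu]
          · have := hval (σ o)
            rwa [hpart o e1 e2, hch, hch] at this
      · intro hval o
        have h1 : charge x z v = s := by
          have := hval u
          rwa [hduv] at this
        by_cases e1 : o = Sum.inl p
        · rw [e1, hu, hch, hsu]
          simp [charge, extState_left]
        · by_cases e2 : o = Sum.inl q
          · rw [e2, hv, hch, h1]
            simp [charge, extState_right hpq.lt]
          · obtain ⟨o', rfl⟩ := hσsurj o e1 e2
            by_cases e3 : o' = u
            · rw [e3, hu', hch, hsu]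
              simp [charge, extState_left]
            · by_cases e4 : o' = v
              · rw [e4, hv', hch, h1]
                simp [charge, extState_right hpq.lt]
              · rw [hpart o' e3 e4, hch, hch]
                exact hval o'
    by_cases hval : Valid d x z
    · rw [amp_of_valid hval, amp_of_valid (hvalid.2 hval), hprod]
      have h1 : charge x z v = s := by
        have := hval u
        rwa [hduv] at this
      have split : ∀ f : Rest p q ⊕ Z → ℂ,
          ∏ o, f o = f u * f v * ∏ o ∈ (Finset.univ.erase u).erase v, f o := by
        intro f
        rw [← Finset.mul_prod_erase Finset.univ f (Finset.mem_univ u),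
          ← Finset.mul_prod_erase (Finset.univ.erase u) f
            (Finset.mem_erase.2 ⟨huv.symm, Finset.mem_univ v⟩), mul_assoc]
      rw [split, split]
      have hrest : ∏ o ∈ (Finset.univ.erase u).erase v, nodeWt ρ b (extState x s) z (σ o) =
          ∏ o ∈ (Finset.univ.erase u).erase v, nodeWt ρ d x z o := by
        refine Finset.prod_congr rfl fun o ho => hnode s o (hpart o ?_ ?_)
        · exact (Finset.mem_erase.1 (Finset.mem_erase.1 ho).2).1
        · exact (Finset.mem_erase.1 ho).1
      rw [hrest, ← mul_assoc, ← mul_assoc]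
      congr 1
      have hcolu : b.part.colour (σ u) = c p := by rw [← hu, b.colour_partner, hcolp]
      have hcolv : b.part.colour (σ v) = c p := by rw [← hv, b.colour_partner, hcolq]
      have key := turn_join b hpq.lt (hcolp.trans hcolq.symm)
        (fun y h1 h2 => by rw [← hc, ← hc]; exact hpq.gap y h1 h2) hu hv (hσq u)
        (extState x s) z (by rw [extState_left, extState_right hpq.lt])
        (by rw [hch, extState_left, hsu]) (by rw [hch, extState_left, h1])
      rw [hlab, hlab, extState_left] at key
      unfold nodeWt
      rw [hduv, hdvu, hcolσ, hcolσ, hcolu, hcolv, hcolp, hcolq, hu, hv, hu', hv', hlab, hlab]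
      simp only [← zpow_add₀ (hρ _), Sum.elim_inl, extState_left]
      congr 1
      rw [hturn, hturn] at key
      linarith
    · rw [amp_of_not_valid hval, amp_of_not_valid fun h => hval (hvalid.1 h), mul_zero]

/-- Compatibility with the vertex model passes to composites in which no loop arises. -/
theorem Functorial.comp {δ ρ : Fin m → ℂ} {a : Diagram m X Y} {b : Diagram m Y Z}
    (ha : Functorial δ ρ a) (hb : Functorial δ ρ b) (h : Match a.part b.part)
    (hw : weight δ a.part b.part = 1) : Functorial δ ρ (a.comp b h) := by
  intro W _ _ e he x w
  have he' : Match b.part e.part := he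
  have h2 : Match a.part (b.comp e he').part := h
  have hassoc : (a.comp b h).comp e he = a.comp (b.comp e he') h2 :=
    Diagram.ext (comp_assoc a.part b.part e.part h he' he h2)
  have hwa : weight δ a.part b.part * weight δ (a.comp b h).part e.part =
      weight δ b.part e.part * weight δ a.part (b.comp e he').part :=
    weight_assoc δ a.part b.part e.part h he' he h2
  rw [hw, one_mul] at hwa
  have h1 : ∀ z, amp ρ (a.comp b h) x z = ∑ y, amp ρ a x y * amp ρ b y z := fun z => by
    rw [ha Z b h x z, hw, one_mul]
  simp only [h1, Finset.sum_mul]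
  rw [Finset.sum_comm]
  have h3 : ∀ y, ∑ z, amp ρ a x y * amp ρ b y z * amp ρ e z w =
      weight δ b.part e.part * (amp ρ a x y * amp ρ (b.comp e he') y w) := by
    intro y
    rw [mul_left_comm, ← hb W e he' y w, Finset.mul_sum]
    exact Finset.sum_congr rfl fun z _ => mul_assoc _ _ _
  rw [Finset.sum_congr rfl fun y _ => h3 y, ← Finset.mul_sum, ha W _ h2, hwa, hassoc, mul_assoc]

end Functor

section Arcs

variable {m : ℕ} {X Y Z : Type} [LinearOrder X] [LinearOrder Y] [LinearOrder Z]

/-- A diagram with an arc on the bottom row has one that joins neighbours. -/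
theorem exists_adjacent_arc [Finite Y] (a : Diagram m X Y) {y₀ y₁ : Y}
    (h₀ : a.partner (Sum.inr y₀) = Sum.inr y₁) :
    ∃ p q, Adjacent (fun y => a.part.colour (Sum.inr y)) p q ∧
      a.partner (Sum.inr p) = Sum.inr q := by
  classical
  have := Fintype.ofFinite Y
  let S : Finset (Y × Y) := {r | r.1 < r.2 ∧ a.partner (Sum.inr r.1) = Sum.inr r.2}
  have hS : S.Nonempty := by
    have hne : y₀ ≠ y₁ := by
      rintro rfl
      exact a.partner_ne _ h₀
    rcases lt_or_gt_of_ne hne with e | e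
    · exact ⟨(y₀, y₁), Finset.mem_filter.2 ⟨Finset.mem_univ _, e, h₀⟩⟩
    · exact ⟨(y₁, y₀), Finset.mem_filter.2 ⟨Finset.mem_univ _, e, Diagram.partner_comm h₀⟩⟩
  let w : Y × Y → ℕ := fun r => #{y : Y | r.1 < y ∧ y < r.2}
  obtain ⟨⟨p, q⟩, hr, hmin⟩ := Finset.exists_min_image S w hS
  obtain ⟨-, hlt, hpart⟩ := Finset.mem_filter.1 hr
  have hlt : p < q := hlt
  have hpart : a.partner (Sum.inr p) = Sum.inr q := hpart
  have hpart' := Diagram.partner_comm hpart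
  have hcpq : a.part.colour (Sum.inr p) = a.part.colour (Sum.inr q) := by
    rw [← hpart, a.colour_partner]
  refine ⟨p, q, ⟨hlt, hcpq, fun y h1 h2 hc => ?_⟩, hpart⟩
  have hc : a.part.colour (Sum.inr y) = a.part.colour (Sum.inr p) := hc
  -- the partner of `y` lies between `p` and `q`, too
  have n1 : ¬ Before (Sum.inr p) (a.partner (Sum.inr y)) := fun h3 =>
    a.not_cross (p := Sum.inr q) (q := Sum.inr y) h2 (by rw [hpart']; exact h1)
      (by rw [hpart']; exact h3) (hcpq.symm.trans hc.symm)
  have n2 : ¬ Before (a.partner (Sum.inr y)) (Sum.inr q) := fun h3 =>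
    a.not_cross (p := a.partner (Sum.inr y)) (q := Sum.inr q) h3
      (by rw [a.partner_partner]; exact h2) (by rw [a.partner_partner, hpart']; exact h1)
      (by rw [a.colour_partner, hc, hcpq])
  rcases e : a.partner (Sum.inr y) with x | y'
  · rw [e] at n2
    exact n2 trivial
  · rw [e] at n1 n2
    have hy'p : y' ≠ p := by
      rintro rfl
      have := Diagram.partner_comm e
      rw [hpart] at this
      exact h2.ne' (Sum.inr_injective this)
    have hy'q : y' ≠ q := by
      rintro rfl
      have := Diagram.partner_comm e
      rw [hpart'] at this
      exact h1.ne (Sum.inr_injective this)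
    have g1 : p < y' := lt_of_le_of_ne (not_lt.1 n1) hy'p.symm
    have g2 : y' < q := lt_of_le_of_ne (not_lt.1 n2) hy'q
    have hne : y ≠ y' := by
      rintro rfl
      exact a.partner_ne _ e
    have small : ∀ r : Y × Y, p < r.1 → r.2 < q → r.1 < r.2 → w r < w (p, q) := by
      intro r k1 k2 k3
      refine Finset.card_lt_card ((Finset.ssubset_iff_of_subset fun t ht => ?_).2 ⟨r.1, ?_, ?_⟩)
      · obtain ⟨-, j1, j2⟩ := Finset.mem_filter.1 ht
        exact Finset.mem_filter.2 ⟨Finset.mem_univ _, k1.trans j1, j2.trans k2⟩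
      · exact Finset.mem_filter.2 ⟨Finset.mem_univ _, k1, k3.trans k2⟩
      · intro ht
        exact lt_irrefl _ (Finset.mem_filter.1 ht).2.1
    rcases lt_or_gt_of_ne hne with k | k
    · exact absurd (hmin (y, y') (Finset.mem_filter.2 ⟨Finset.mem_univ _, k, e⟩))
        (not_le.2 (small (y, y') h1 g2 k))
    · exact absurd (hmin (y', y) (Finset.mem_filter.2
        ⟨Finset.mem_univ _, k, Diagram.partner_comm e⟩)) (not_le.2 (small (y', y) g1 h2 k))

/-- A diagram with an arc on the bottom row factors through the diagram that contracts two
neighbouring nodes. -/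
theorem exists_eq_comp_cap [Fintype X] [Fintype Y] (a : Diagram m X Y) {p q : Y}
    (h : Adjacent (fun y => a.part.colour (Sum.inr y)) p q)
    (hpq : a.partner (Sum.inr p) = Sum.inr q) :
    ∃ (a' : Diagram m X (Rest p q)) (hm : Match a'.part (cap _ h).part), a = a'.comp (cap _ h) hm := by
  have hqp := Diagram.partner_comm hpq
  have hcl : ∀ o : X ⊕ Rest p q, ∃ o' : X ⊕ Rest p q,
      a.partner (Sum.map id Subtype.val o) = Sum.map id Subtype.val o' := by
    intro o
    rcases e : a.partner (Sum.map id Subtype.val o) with x | y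
    · exact ⟨Sum.inl x, rfl⟩
    · refine ⟨Sum.inr ⟨y, ?_, ?_⟩, rfl⟩
      · rintro rfl
        have := Diagram.partner_comm e
        rw [hpq] at this
        rcases o with o | o
        · cases this
        · exact o.2.2 (Sum.inr_injective this).symm
      · rintro rfl
        have := Diagram.partner_comm e
        rw [hqp] at this
        rcases o with o | o
        · cases this
        · exact o.2.1 (Sum.inr_injective this).symm
  let a' : Diagram m X (Rest p q) := a.pull id Subtype.val strictMono_id
    (fun _ _ h => h) id hcl fun _ _ h => h
  have hm : Match a'.part (cap _ h).part := fun _ => rfl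
  refine ⟨a', hm, ?_⟩
  symm
  refine Diagram.ext_partner ?_ ?_
  · funext o
    rcases o with o | o <;> rfl
  · have hσ : ∀ o : X ⊕ Rest p q, stack a'.part (cap _ h).part
        (outer (Sum.map id Subtype.val o)) (upper o) := by
      rintro (o | o)
      · exact (stack _ _).refl _
      · exact (stack _ _).symm (stack_low (cap_rel_line _ h o))
    intro o
    by_cases e1 : o = Sum.inr p
    · rw [e1, hpq]
      exact stack_low (cap_rel_arc _ h)
    · by_cases e2 : o = Sum.inr q
      · rw [e2, hqp]
        exact (stack _ _).symm (stack_low (cap_rel_arc _ h))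
      · obtain ⟨o', rfl⟩ : ∃ o' : X ⊕ Rest p q, o = Sum.map id Subtype.val o' := by
          rcases o with x | y
          · exact ⟨Sum.inl x, rfl⟩
          · exact ⟨Sum.inr ⟨y, fun e => e1 (congrArg _ e), fun e => e2 (congrArg _ e)⟩, rfl⟩
        obtain ⟨o'', ho''⟩ := hcl o'
        have hrel : a'.part.rel o' o'' := by
          change a.part.rel _ _
          rw [← ho'']
          exact a.rel_partner _
        rw [ho'']
        exact (stack _ _).trans (hσ o') ((stack _ _).trans (stack_up hrel)
          ((stack _ _).symm (hσ o'')))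

end Arcs

/-- Stacking of diagrams becomes the multiplication of matrices in the vertex model. -/
theorem amp_comp {m : ℕ} {X Y Z : Type} [LinearOrder X] [LinearOrder Y] [LinearOrder Z]
    [Fintype X] [Fintype Y] [Fintype Z] {δ ρ : Fin m → ℂ} (hρ : ∀ i, ρ i ≠ 0)
    (hδ : ∀ i, δ i = ρ i ^ (4 : ℤ) + ρ i ^ (-4 : ℤ)) (a : Diagram m X Y) (b : Diagram m Y Z)
    (h : Match a.part b.part) (x : X → Bool) (z : Z → Bool) :
    ∑ y, amp ρ a x y * amp ρ b y z = weight δ a.part b.part * amp ρ (a.comp b h) x z := by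
  suffices hF : ∀ (N : ℕ) (Y : Type) [LinearOrder Y] [Fintype Y], Fintype.card Y = N →
      ∀ a : Diagram m X Y, Functorial δ ρ a from hF _ Y rfl a Z b h x z
  intro N
  induction N using Nat.strong_induction_on with
  | h N ih =>
  intro Y _ _ hN a
  by_cases ha : ∀ y, ∃ x, a.partner (Sum.inr y) = Sum.inl x
  · exact functorial_of_no_cap δ ρ a ha
  · push Not at ha
    obtain ⟨y₀, hy₀⟩ := ha
    rcases e : a.partner (Sum.inr y₀) with x | y₁
    · exact absurd e (hy₀ x)
    · obtain ⟨p, q, hadj, hpq⟩ := exists_adjacent_arc a e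
      obtain ⟨a', hm, ha'⟩ := exists_eq_comp_cap a hadj hpq
      rw [ha']
      refine Functorial.comp (ih _ ?_ (Rest p q) rfl a') (functorial_cap δ ρ hρ hδ _ _) hm ?_
      · rw [← hN]
        exact Fintype.card_subtype_lt (x := p) (by simp)
      · exact weight_eq_one_of_bot δ fun y => ⟨y.1, cap_rel_line _ _ y⟩

/-! ### Amplitudes of reflected, restricted and vertical diagrams -/

section Structure

variable {m : ℕ} {X Y : Type} [LinearOrder X] [LinearOrder Y]

instance [Finite X] [Finite Y] : Finite (Diagram m X Y) := by
  refine Finite.of_injective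
    (fun a : Diagram m X Y => ((a.part.colour, a.partner) : (X ⊕ Y → Fin m) × (X ⊕ Y → X ⊕ Y)))
    fun a b h => ?_
  have h1 := congrArg Prod.fst h
  have h2 := congrArg Prod.snd h
  refine Diagram.ext_partner h1 fun p => ?_
  rw [← show a.partner p = b.partner p from congrFun h2 p]
  exact a.rel_partner p

/-- The diagram with given colours and edges, the edges being given by the involution that
exchanges their ends. -/
def Diagram.ofPartner (colour : X ⊕ Y → Fin m) (σ : X ⊕ Y → X ⊕ Y) (hne : ∀ p, σ p ≠ p)
    (hinv : ∀ p, σ (σ p) = p) (hcol : ∀ p, colour (σ p) = colour p)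
    (hcross : ∀ p q, Before p q → Before q (σ p) → Before (σ p) (σ q) →
      colour p = colour q → False) : Diagram m X Y where
  part :=
    { colour := colour
      rel :=
        { r := fun p q => q = p ∨ q = σ p
          iseqv :=
            { refl := fun _ => Or.inl rfl
              symm := by
                rintro p q (rfl | rfl)
                · exact Or.inl rfl
                · exact Or.inr (hinv p).symm
              trans := by
                rintro p q r (rfl | rfl) (rfl | rfl)
                · exact Or.inl rfl
                · exact Or.inr rfl
                · exact Or.inr rfl
                · exact Or.inl (hinv p) } }
      colour_eq := by
        rintro p q (rfl | rfl)
        · rfl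
        · exact (hcol p).symm }
  isBubble :=
    { two := fun p => ⟨σ p, ⟨hne p, Or.inr rfl⟩, fun q hq => hq.2.resolve_left hq.1⟩
      planar := by
        rintro p q r s h1 h2 h3 (rfl | rfl) (rfl | rfl) hc
        · exact absurd (h1.trans h2) (Before.irrefl _)
        · exact absurd (h1.trans h2) (Before.irrefl _)
        · exact absurd (h2.trans h3) (Before.irrefl _)
        · exact (hcross p q h1 h2 h3 hc).elim }

theorem Diagram.partner_ofPartner (colour : X ⊕ Y → Fin m) (σ : X ⊕ Y → X ⊕ Y) (hne hinv hcol)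
    (hcross) (p : X ⊕ Y) :
    (Diagram.ofPartner colour σ hne hinv hcol hcross).partner p = σ p :=
  partner_eq (hne p) (Or.inr rfl)

/-- Every node of the bottom row is joined to the top row. -/
def NoCap (a : Diagram m X Y) : Prop := ∀ y, ∃ x, a.partner (Sum.inr y) = Sum.inl x

theorem exists_cap_of_not_noCap {a : Diagram m X Y} (h : ¬ NoCap a) :
    ∃ y y', a.partner (Sum.inr y) = Sum.inr y' := by
  unfold NoCap at h
  push Not at h
  obtain ⟨y, hy⟩ := h
  rcases e : a.partner (Sum.inr y) with x | y'
  · exact absurd e (hy x)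
  · exact ⟨y, y', e⟩

theorem noCap_iff_rel (a : Diagram m X Y) :
    NoCap a ↔ ∀ y, ∃ x, a.part.rel (Sum.inr y) (Sum.inl x) := by
  refine forall_congr' fun y => exists_congr fun x => ?_
  rw [a.rel_iff]
  simp [eq_comm]

theorem Diagram.through_lt (a : Diagram m X Y) {x x' : X} {y y' : Y}
    (h : a.partner (Sum.inr y) = Sum.inl x) (h' : a.partner (Sum.inr y') = Sum.inl x')
    (hc : a.part.colour (Sum.inr y) = a.part.colour (Sum.inr y')) (hlt : y < y') : x < x' := by
  have e := partner_comm h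
  have e' := partner_comm h'
  by_contra hcon
  have hlt' : x' < x := lt_of_le_of_ne (not_lt.1 hcon) fun k => by
    rw [k, e] at e'
    exact hlt.ne (Sum.inr_injective e')
  refine a.not_cross (p := Sum.inl x') (q := Sum.inl x) hlt' ?_ ?_ ?_
  · rw [e']; trivial
  · rw [e, e']; exact hlt
  · rw [← h, ← h', a.colour_partner, a.colour_partner, hc]

theorem NoCap.card_le [Fintype X] [Fintype Y] {a : Diagram m X Y} (h : NoCap a) :
    Fintype.card Y ≤ Fintype.card X := by
  choose τ hτ using h
  refine Fintype.card_le_of_injective τ fun y y' e => ?_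
  have h1 := hτ y
  rw [e, ← hτ y'] at h1
  exact Sum.inr_injective (a.partner_injective h1)

/-- A diagram without arcs whose rows carry the same colours is an identity diagram. -/
theorem NoCap.partner_eq_self [Finite Y] {a : Diagram m Y Y} (h : NoCap a)
    (hc : ∀ y, a.part.colour (Sum.inl y) = a.part.colour (Sum.inr y)) (y : Y) :
    a.partner (Sum.inr y) = Sum.inl y := by
  choose τ hτ using h
  have hcol : ∀ y, a.part.colour (Sum.inr (τ y)) = a.part.colour (Sum.inr y) := fun y => by
    rw [← hc, ← hτ, a.colour_partner]
  set i := a.part.colour (Sum.inr y) with hi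
  let S : Type := {z : Y // a.part.colour (Sum.inr z) = i}
  let f : S → S := fun z => ⟨τ z.1, (hcol z.1).trans z.2⟩
  have hf : StrictMono f := fun z z' hlt =>
    a.through_lt (hτ z.1) (hτ z'.1) (z.2.trans z'.2.symm) hlt
  have h1 : f ⟨y, rfl⟩ = ⟨y, rfl⟩ := le_antisymm hf.apply_le hf.le_apply
  have h2 : τ y = y := congrArg Subtype.val h1
  rw [hτ, h2]

theorem Diagram.partner_reflect (a : Diagram m X Y) (p : Y ⊕ X) :
    a.reflect.partner p = (a.partner p.swap).swap := by
  refine partner_eq (fun e => a.partner_ne p.swap ?_) ?_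
  · have := congrArg Sum.swap e
    rwa [Sum.swap_swap] at this
  · change a.part.rel p.swap (Sum.swap (Sum.swap _))
    rw [Sum.swap_swap]
    exact a.rel_partner _

variable [Fintype X] [Fintype Y]

theorem amp_reflect (ρ : Fin m → ℂ) (a : Diagram m X Y) (x : X → Bool) (y : Y → Bool) :
    amp ρ a.reflect y x = amp ρ a x y := by
  have hch : ∀ p, charge y x p = !charge x y p.swap := by rintro (p | p) <;> simp [charge]
  have hv : Valid a.reflect y x ↔ Valid a x y := by
    constructor
    · intro h p
      have := h p.swap
      rw [a.partner_reflect, hch, hch, Sum.swap_swap, Sum.swap_swap] at this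
      simpa using congrArg (fun b => !b) this
    · intro h p
      rw [a.partner_reflect, hch, hch, Sum.swap_swap, h]
  by_cases h : Valid a x y
  · rw [amp_of_valid h, amp_of_valid (hv.2 h), ← (Equiv.sumComm X Y).prod_comp]
    refine Finset.prod_congr rfl fun p _ => ?_
    unfold nodeWt
    rw [a.partner_reflect]
    have e1 : a.reflect.part.colour (Equiv.sumComm X Y p) = a.part.colour p := by
      change a.part.colour (p.swap.swap) = _
      rw [Sum.swap_swap]
    have e2 : (Equiv.sumComm X Y p) = p.swap := rfl
    have e3 : ∀ p q : X ⊕ Y, turn p.swap q.swap = turn p q := by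
      rintro (p | p) (q | q) <;> rfl
    have e4 : Sum.elim y x p.swap = Sum.elim x y p := by rcases p with p | p <;> rfl
    rw [e1, e2, Sum.swap_swap, e3, e4]
  · rw [amp_of_not_valid h, amp_of_not_valid fun h' => h (hv.1 h')]

/-- The amplitude of a diagram that is a disjoint union of pieces without common edges. -/
theorem amp_eq_prod {J : Type} [Fintype J] {M : J → ℕ} {X' Y' : J → Type}
    [∀ j, LinearOrder (X' j)] [∀ j, LinearOrder (Y' j)] [∀ j, Fintype (X' j)]
    [∀ j, Fintype (Y' j)] (ρ : Fin m → ℂ) (a : Diagram m X Y) (ρ' : ∀ j, Fin (M j) → ℂ)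
    (d : ∀ j, Diagram (M j) (X' j) (Y' j)) {ι : ∀ j, X' j → X} {κ : ∀ j, Y' j → Y}
    (hι : ∀ j, StrictMono (ι j)) (hκ : ∀ j, StrictMono (κ j))
    (hbij : Function.Bijective fun s : Σ j, X' j ⊕ Y' j => Sum.map (ι s.1) (κ s.1) s.2)
    (hpart : ∀ j p, Sum.map (ι j) (κ j) ((d j).partner p) = a.partner (Sum.map (ι j) (κ j) p))
    (hρ : ∀ j p, ρ' j ((d j).part.colour p) = ρ (a.part.colour (Sum.map (ι j) (κ j) p)))
    (x : X → Bool) (y : Y → Bool) :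
    amp ρ a x y = ∏ j, amp (ρ' j) (d j) (x ∘ ι j) (y ∘ κ j) := by
  have hch : ∀ j p, charge x y (Sum.map (ι j) (κ j) p) = charge (x ∘ ι j) (y ∘ κ j) p := by
    rintro j (p | p) <;> rfl
  have hv : Valid a x y ↔ ∀ j, Valid (d j) (x ∘ ι j) (y ∘ κ j) := by
    constructor
    · intro h j p
      rw [← hch, ← hch, hpart]
      exact h _
    · intro h p
      obtain ⟨⟨j, p⟩, rfl⟩ := hbij.2 p
      change charge x y (a.partner (Sum.map (ι j) (κ j) p)) = !charge x y (Sum.map (ι j) (κ j) p)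
      rw [← hpart, hch, hch]
      exact h j p
  by_cases h : Valid a x y
  · rw [amp_of_valid h, Finset.prod_congr rfl fun j _ => amp_of_valid (hv.1 h j),
      ← Fintype.prod_sigma', ← (Equiv.ofBijective _ hbij).prod_comp]
    refine Finset.prod_congr rfl fun s _ => ?_
    obtain ⟨j, p⟩ := s
    change nodeWt ρ a x y (Sum.map (ι j) (κ j) p) = nodeWt (ρ' j) (d j) (x ∘ ι j) (y ∘ κ j) p
    unfold nodeWt
    have e1 : ∀ p q : X' j ⊕ Y' j, turn (Sum.map (ι j) (κ j) p) (Sum.map (ι j) (κ j) q) =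
        turn p q := by
      rintro (p | p) (q | q)
      · simp only [turn, Sum.map_inl, (hι j).lt_iff_lt]
      · rfl
      · rfl
      · simp only [turn, Sum.map_inr, (hκ j).lt_iff_lt]
    have e2 : Sum.elim x y (Sum.map (ι j) (κ j) p) = Sum.elim (x ∘ ι j) (y ∘ κ j) p := by
      rcases p with p | p <;> rfl
    rw [← hpart, e1, e2, hρ]
  · rw [amp_of_not_valid h]
    symm
    have : ∃ j, ¬ Valid (d j) (x ∘ ι j) (y ∘ κ j) := by
      by_contra hcon
      push Not at hcon
      exact h (hv.2 hcon)
    obtain ⟨j, hj⟩ := this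
    exact Finset.prod_eq_zero (Finset.mem_univ j) (amp_of_not_valid hj)

theorem amp_true_of_not_noCap (ρ : Fin m → ℂ) {a : Diagram m X Y} (h : ¬ NoCap a)
    (x : X → Bool) : amp ρ a x (fun _ => true) = 0 := by
  obtain ⟨y, y', e⟩ := exists_cap_of_not_noCap h
  refine amp_of_not_valid fun hv => ?_
  have := hv (Sum.inr y)
  rw [e] at this
  simp [charge] at this

theorem amp_of_vertical (ρ : Fin m → ℂ) {a : Diagram m Y Y}
    (h : ∀ y, a.partner (Sum.inr y) = Sum.inl y) (x y : Y → Bool) :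
    amp ρ a x y = if x = y then 1 else 0 := by
  have h' : ∀ y, a.partner (Sum.inl y) = Sum.inr y := fun y => Diagram.partner_comm (h y)
  split_ifs with e
  · subst e
    rw [amp_of_valid]
    · refine Finset.prod_eq_one fun p _ => ?_
      unfold nodeWt
      rcases p with p | p
      · rw [h']; simp [turn]
      · rw [h]; simp [turn]
    · rintro (p | p)
      · rw [h']; simp [charge]
      · rw [h]; simp [charge]
  · refine amp_of_not_valid fun hv => e (funext fun t => ?_)
    have := hv (Sum.inr t)
    rw [h] at this
    simpa [charge] using this

open Classical in
theorem amp_true_true (ρ : Fin m → ℂ) (a : Diagram m Y Y) :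
    amp ρ a (fun _ => true) (fun _ => true) = if NoCap a then 1 else 0 := by
  split_ifs with h
  · have hbot : ∀ y, ∃ x, a.partner (Sum.inl y) = Sum.inr x := by
      choose τ hτ using h
      have hinj : Function.Injective τ := fun y y' e => by
        have h1 := hτ y
        rw [e, ← hτ y'] at h1
        exact Sum.inr_injective (a.partner_injective h1)
      intro y
      obtain ⟨z, rfl⟩ := Finite.surjective_of_injective hinj y
      exact ⟨z, Diagram.partner_comm (hτ z)⟩
    rw [amp_of_valid]
    · refine Finset.prod_eq_one fun p _ => ?_
      unfold nodeWt
      rcases p with p | p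
      · obtain ⟨x, hx⟩ := hbot p
        rw [hx]; simp [turn]
      · obtain ⟨x, hx⟩ := h p
        rw [hx]; simp [turn]
    · rintro (p | p)
      · obtain ⟨x, hx⟩ := hbot p
        rw [hx]; simp [charge]
      · obtain ⟨x, hx⟩ := h p
        rw [hx]; simp [charge]
  · exact amp_true_of_not_noCap ρ h _

/-- The signs on the top row of a state of nonzero amplitude add up to those on the bottom row. -/
theorem sum_sgn_of_amp_ne_zero {ρ : Fin m → ℂ} {a : Diagram m X Y} {x : X → Bool}
    {y : Y → Bool} (h : amp ρ a x y ≠ 0) : ∑ s, sgn (x s) = ∑ t, sgn (y t) := by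
  have hv : Valid a x y := by
    by_contra hv
    exact h (amp_of_not_valid hv)
  have h1 : ∑ p, sgn (charge x y p) = 0 := by
    refine Finset.sum_involution (fun p _ => a.partner p) (fun p _ => ?_)
      (fun p _ _ => a.partner_ne p) (fun _ _ => Finset.mem_univ _)
      fun p _ => a.partner_partner p
    rw [hv p, sgn_not]
    ring
  rw [Fintype.sum_sum_type] at h1
  simp only [charge, Sum.elim_inl, Sum.elim_inr, sgn_not, Finset.sum_neg_distrib] at h1
  linarith

end Structure

theorem form_single_eq {m n : ℕ} {lam : Fin m → ℕ} (δ : Fin m → ℂ) (x y : Half n lam) :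
    form δ n lam (Finsupp.single x 1) (Finsupp.single y 1) =
      propagating (diagMul δ x.diag.reflect y.diag) := by
  change halfForm δ (Finsupp.single x 1) (Finsupp.single y 1) = _
  unfold halfForm
  rw [Finsupp.linearCombination_single, one_smul, Finsupp.linearCombination_single, one_smul]

/-- The bilinear form on half-diagrams as a sum over states. -/
theorem form_single_single {m n : ℕ} {lam : Fin m → ℕ} {δ ρ : Fin m → ℂ} (hρ : ∀ i, ρ i ≠ 0)
    (hδ : ∀ i, δ i = ρ i ^ (4 : ℤ) + ρ i ^ (-4 : ℤ)) (x y : Half n lam)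
    (h : Match x.diag.reflect.part y.diag.part) :
    form δ n lam (Finsupp.single x 1) (Finsupp.single y 1) =
      ∑ s, amp ρ x.diag s (fun _ => true) * amp ρ y.diag s (fun _ => true) := by
  classical
  rw [form_single_eq]
  have e : diagMul δ x.diag.reflect y.diag = Finsupp.single (x.diag.reflect.comp y.diag h)
    (weight δ x.diag.reflect.part y.diag.part) := dif_pos h
  rw [e]
  simp only [← amp_reflect ρ x.diag]
  rw [amp_comp hρ hδ _ _ h, amp_true_true]
  unfold propagating
  rw [Finsupp.linearCombination_single, smul_eq_mul]
  congr 1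
  set d := x.diag.reflect.comp y.diag h
  refine if_congr ?_ rfl rfl
  rw [noCap_iff_rel]
  constructor
  · exact fun hp z => propagating_bottom hp z
  · intro hn z
    have h2 : NoCap d := (noCap_iff_rel d).2 hn
    have hd : NoCap d.reflect := by
      choose τ hτ using h2
      have hinj : Function.Injective τ := fun y y' e => by
        have h1 := hτ y
        rw [e, ← hτ y'] at h1
        exact Sum.inr_injective (d.partner_injective h1)
      intro y
      obtain ⟨z, rfl⟩ := Finite.surjective_of_injective hinj y
      refine ⟨z, ?_⟩
      rw [Diagram.partner_reflect]
      change (d.partner (Sum.inl (τ z))).swap = _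
      rw [Diagram.partner_comm (hτ z)]
      rfl
    obtain ⟨w, hw⟩ := (noCap_iff_rel _).1 hd z
    exact ⟨w, hw⟩

theorem form_single_single_of_not_match {m n : ℕ} {lam : Fin m → ℕ} {δ : Fin m → ℂ}
    (x y : Half n lam) (h : ¬ Match x.diag.reflect.part y.diag.part) :
    form δ n lam (Finsupp.single x 1) (Finsupp.single y 1) = 0 := by
  have e : diagMul δ x.diag.reflect y.diag = 0 := dif_neg h
  rw [form_single_eq, e, map_zero]

/-! ### One colour: the matrices of the vertex model -/

theorem match_one {X Y Z : Type} {a : ColPart 1 X Y} {b : ColPart 1 Y Z} : Match a b :=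
  fun _ => Subsingleton.elim _ _

section Mat

variable {X Y Z X' Y' : Type} [LinearOrder X] [LinearOrder Y] [LinearOrder Z] [LinearOrder X']
  [LinearOrder Y'] [Fintype X] [Fintype Y] [Fintype Z] [Fintype X'] [Fintype Y']

/-- The matrix of a one-coloured diagram in the vertex model. -/
noncomputable def ampMat (ρ : ℂ) (a : Diagram 1 X Y) : Matrix (X → Bool) (Y → Bool) ℂ :=
  fun x y => amp (fun _ => ρ) a x y

theorem ampMat_mul {ρ : ℂ} (hρ : ρ ≠ 0) (a : Diagram 1 X Y) (b : Diagram 1 Y Z) :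
    ampMat ρ a * ampMat ρ b = weight (fun _ => ρ ^ (4 : ℤ) + ρ ^ (-4 : ℤ)) a.part b.part •
      ampMat ρ (a.comp b match_one) := by
  ext x z
  exact amp_comp (fun _ => hρ) (fun _ => rfl) a b match_one x z

theorem ampMat_transpose (ρ : ℂ) (a : Diagram 1 X Y) :
    (ampMat ρ a).transpose = ampMat ρ a.reflect := by
  ext y x
  exact (amp_reflect _ a x y).symm

/-- The state in which all signs are positive. -/
noncomputable def plus (Y : Type) [Fintype Y] : (Y → Bool) → ℂ :=
  open Classical in Pi.single (fun _ => true) 1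

theorem ampMat_mulVec_plus (ρ : ℂ) (a : Diagram 1 X Y) (x : X → Bool) :
    (ampMat ρ a).mulVec (plus Y) x = amp (fun _ => ρ) a x fun _ => true := by
  classical
  unfold plus
  rw [Matrix.mulVec_single_one]
  rfl

theorem ampMat_mulVec_plus_of_not_noCap (ρ : ℂ) {a : Diagram 1 X Y} (h : ¬ NoCap a) :
    (ampMat ρ a).mulVec (plus Y) = 0 := by
  ext x
  rw [ampMat_mulVec_plus, amp_true_of_not_noCap _ h]
  rfl

/-- A diagram with its nodes renamed. -/
def Diagram.relabel {m : ℕ} (a : Diagram m X Y) (e : X' ≃o X) (f : Y' ≃o Y) : Diagram m X' Y' :=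
  a.pull e f e.strictMono f.strictMono id
    (fun p => ⟨Sum.map e.symm f.symm (a.partner (Sum.map e f p)), by
      rcases a.partner (Sum.map e f p) with q | q <;> simp⟩) fun _ _ h => h

theorem amp_relabel {m : ℕ} (ρ : Fin m → ℂ) (a : Diagram m X Y) (e : X' ≃o X) (f : Y' ≃o Y)
    (x : X → Bool) (y : Y → Bool) : amp ρ (a.relabel e f) (x ∘ e) (y ∘ f) = amp ρ a x y := by
  rw [amp_eq_prod (J := Unit) ρ a (fun _ => ρ) (fun _ => a.relabel e f) (ι := fun _ => e)
    (κ := fun _ => f) (fun _ => e.strictMono) (fun _ => f.strictMono)]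
  · simp
  · constructor
    · rintro ⟨⟨⟩, p⟩ ⟨⟨⟩, q⟩ h
      have : Function.Injective (Sum.map e f) :=
        Sum.map_injective.2 ⟨e.injective, f.injective⟩
      have h' : p = q := this h
      rw [h']
    · rintro (p | p)
      · exact ⟨⟨(), Sum.inl (e.symm p)⟩, by simp⟩
      · exact ⟨⟨(), Sum.inr (f.symm p)⟩, by simp⟩
  · intro _ p
    exact a.map_partner_pull _ _ _ _ _ p
  · intro _ p
    rfl

/-- The image of the cell module with `l` defects in the vertex model. -/
noncomputable def cellSpan (ρ : ℂ) (X : Type) [LinearOrder X] [Fintype X] (l : ℕ) :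
    Submodule ℂ ((X → Bool) → ℂ) :=
  Submodule.span ℂ (Set.range fun d : Diagram 1 X (Fin l) => (ampMat ρ d).mulVec (plus _))

theorem mulVec_plus_mem {ρ : ℂ} {l : ℕ} (hl : Fintype.card Y = l) (d : Diagram 1 X Y) :
    (ampMat ρ d).mulVec (plus Y) ∈ cellSpan ρ X l := by
  refine Submodule.subset_span ⟨d.relabel (OrderIso.refl X) (Fintype.orderIsoFinOfCardEq Y hl), ?_⟩
  ext x
  change (ampMat ρ _).mulVec (plus _) x = (ampMat ρ d).mulVec (plus Y) x
  rw [ampMat_mulVec_plus, ampMat_mulVec_plus]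
  exact amp_relabel _ d (OrderIso.refl X) (Fintype.orderIsoFinOfCardEq Y hl) x fun _ => true

theorem mulVec_mem_cellSpan {ρ : ℂ} (hρ : ρ ≠ 0) {l : ℕ} (d : Diagram 1 X Y)
    {f : (Y → Bool) → ℂ} (hf : f ∈ cellSpan ρ Y l) : (ampMat ρ d).mulVec f ∈ cellSpan ρ X l := by
  refine Submodule.span_induction (p := fun f _ => (ampMat ρ d).mulVec f ∈ cellSpan ρ X l)
    ?_ ?_ ?_ ?_ hf
  · rintro _ ⟨h, rfl⟩
    rw [Matrix.mulVec_mulVec, ampMat_mul hρ, Matrix.smul_mulVec]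
    exact Submodule.smul_mem _ _ (mulVec_plus_mem (by simp) _)
  · rw [Matrix.mulVec_zero]
    exact Submodule.zero_mem _
  · intro f g _ _ hf hg
    rw [Matrix.mulVec_add]
    exact Submodule.add_mem _ hf hg
  · intro c f _ hf
    rw [Matrix.mulVec_smul]
    exact Submodule.smul_mem _ _ hf

theorem comp_mem_cellSpan {ρ : ℂ} {l : ℕ} (e : X' ≃o X) {f : (X → Bool) → ℂ}
    (hf : f ∈ cellSpan ρ X l) : (fun s : X' → Bool => f (s ∘ e.symm)) ∈ cellSpan ρ X' l := by
  refine Submodule.span_induction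
    (p := fun f _ => (fun s : X' → Bool => f (s ∘ e.symm)) ∈ cellSpan ρ X' l) ?_ ?_ ?_ ?_ hf
  · rintro _ ⟨d, rfl⟩
    refine Submodule.subset_span ⟨d.relabel e (OrderIso.refl _), ?_⟩
    ext s
    change (ampMat ρ _).mulVec (plus _) s = (ampMat ρ d).mulVec (plus _) (s ∘ e.symm)
    rw [ampMat_mulVec_plus, ampMat_mulVec_plus,
      ← amp_relabel _ d e (OrderIso.refl (Fin l)) (s ∘ e.symm) fun _ => true]
    congr 1
    funext t
    simp
  · exact Submodule.zero_mem _
  · intro f g _ _ hf hg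
    exact Submodule.add_mem _ hf hg
  · intro c f _ hf
    exact Submodule.smul_mem _ c hf

/-- A vector is singular if it is killed by all contractions of neighbouring nodes. -/
def Singular (ρ : ℂ) (f : (Y → Bool) → ℂ) : Prop :=
  ∀ (c : Y → Fin 1) (p q : Y) (h : Adjacent c p q), (ampMat ρ (cap c h)).mulVec f = 0

theorem singular_iff {ρ : ℂ} (hρ : ρ ≠ 0) (f : (Y → Bool) → ℂ) :
    Singular ρ f ↔ ∀ (c : Y → Fin 1) (p q : Y) (_ : Adjacent c p q) (x : Rest p q → Bool),
      ∑ t : Bool, ρ ^ (2 * sgn t) * f (extState x t) = 0 := by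
  refine forall_congr' fun c => forall_congr' fun p => forall_congr' fun q =>
    forall_congr' fun h => ?_
  rw [funext_iff]
  refine forall_congr' fun x => ?_
  rw [← cap_amp_sum (fun _ : Fin 1 => ρ) (fun _ => hρ) c h x f]
  rfl

theorem Singular.mulVec_eq_zero {ρ : ℂ} (hρ : ρ ≠ 0) {f : (Y → Bool) → ℂ} (hf : Singular ρ f)
    {d : Diagram 1 X Y} (hd : ¬ NoCap d) : (ampMat ρ d).mulVec f = 0 := by
  obtain ⟨y, y', e⟩ := exists_cap_of_not_noCap hd
  obtain ⟨p, q, hadj, hpq⟩ := exists_adjacent_arc d e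
  obtain ⟨d', hm, hd'⟩ := exists_eq_comp_cap d hadj hpq
  have h1 := ampMat_mul hρ d' (cap _ hadj)
  rw [weight_eq_one_of_bot _ fun y => ⟨y.1, cap_rel_line _ hadj y⟩, one_smul] at h1
  have h2 := (congrArg (ampMat ρ) hd').trans h1.symm
  rw [h2, ← Matrix.mulVec_mulVec, hf, Matrix.mulVec_zero]

theorem singular_plus (ρ : ℂ) : Singular ρ (plus Y) := by
  intro c p q h
  refine ampMat_mulVec_plus_of_not_noCap ρ fun hn => ?_
  obtain ⟨x, hx⟩ := hn p
  rw [cap_partner_left] at hx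
  cases hx

/-- A diagram with fewer bottom nodes than top nodes has image orthogonal to singular vectors. -/
theorem Singular.dotProduct_eq_zero {ρ : ℂ} (hρ : ρ ≠ 0) {f : (Y → Bool) → ℂ}
    (hf : Singular ρ f) (d : Diagram 1 Y Z) (hd : Fintype.card Z < Fintype.card Y)
    (g : (Z → Bool) → ℂ) : dotProduct ((ampMat ρ d).mulVec g) f = 0 := by
  rw [dotProduct_comm, Matrix.dotProduct_mulVec, ← Matrix.mulVec_transpose, ampMat_transpose,
    hf.mulVec_eq_zero hρ fun hn => not_le.2 hd hn.card_le, zero_dotProduct]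

theorem Singular.dotProduct_cellSpan {ρ : ℂ} (hρ : ρ ≠ 0) {f : (Y → Bool) → ℂ}
    (hf : Singular ρ f) {l : ℕ} (hl : l < Fintype.card Y) {g : (Y → Bool) → ℂ}
    (hg : g ∈ cellSpan ρ Y l) : dotProduct g f = 0 := by
  refine Submodule.span_induction (p := fun g _ => dotProduct g f = 0) ?_ ?_ ?_ ?_ hg
  · rintro _ ⟨d, rfl⟩
    exact hf.dotProduct_eq_zero hρ d (by simpa using hl) _
  · exact zero_dotProduct _
  · intro g g' _ _ h h'
    rw [add_dotProduct, h, h', add_zero]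
  · intro c g _ h
    rw [smul_dotProduct, h, smul_zero]

theorem dotProduct_plus_plus : dotProduct (plus Y) (plus Y) = 1 := by
  classical
  unfold plus
  simp

theorem dotProduct_ampMat {ρ : ℂ} (hρ : ρ ≠ 0) (d : Diagram 1 X Y) (d' : Diagram 1 X Z)
    (f : (Y → Bool) → ℂ) (f' : (Z → Bool) → ℂ) :
    dotProduct ((ampMat ρ d).mulVec f) ((ampMat ρ d').mulVec f') =
      weight (fun _ => ρ ^ (4 : ℤ) + ρ ^ (-4 : ℤ)) d.reflect.part d'.part *
        dotProduct f ((ampMat ρ (d.reflect.comp d' match_one)).mulVec f') := by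
  have h1 := ampMat_mul hρ d.reflect d'
  rw [dotProduct_comm, Matrix.dotProduct_mulVec, ← Matrix.mulVec_transpose, ampMat_transpose,
    Matrix.mulVec_mulVec, h1, Matrix.smul_mulVec, smul_dotProduct, dotProduct_comm, smul_eq_mul]

/-- Diagrams act on singular vectors by similitudes. -/
theorem Singular.dotProduct_mulVec {ρ : ℂ} (hρ : ρ ≠ 0) {f f' : (Y → Bool) → ℂ}
    (hf' : Singular ρ f') (d d' : Diagram 1 X Y) :
    dotProduct ((ampMat ρ d).mulVec f) ((ampMat ρ d').mulVec f') =
      dotProduct ((ampMat ρ d).mulVec (plus Y)) ((ampMat ρ d').mulVec (plus Y)) *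
        dotProduct f f' := by
  rw [dotProduct_ampMat hρ, dotProduct_ampMat hρ]
  by_cases h : NoCap (d.reflect.comp d' match_one)
  · have h1 : ampMat ρ (d.reflect.comp d' match_one) = 1 := by
      ext x y
      rw [Matrix.one_apply]
      exact amp_of_vertical _ (h.partner_eq_self fun _ => Subsingleton.elim _ _) x y
    rw [h1, Matrix.one_mulVec, Matrix.one_mulVec, dotProduct_plus_plus, mul_one]
  · rw [hf'.mulVec_eq_zero hρ h, (singular_plus ρ).mulVec_eq_zero hρ h]
    simp

end Mat

/-! ### One colour: adding and bending strands -/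

section Bend

/-- The identification of the nodes of the two frames when the last node of the top row is moved
to the end of the bottom row. -/
def bendEquiv (n l : ℕ) : Fin (n + 1) ⊕ Fin l ≃ Fin n ⊕ Fin (l + 1) where
  toFun := Sum.elim (Fin.lastCases (Sum.inr (Fin.last l)) Sum.inl) fun j => Sum.inr j.castSucc
  invFun := Sum.elim (fun i => Sum.inl i.castSucc) (Fin.lastCases (Sum.inl (Fin.last n)) Sum.inr)
  left_inv := by
    rintro (i | j)
    · refine Fin.lastCases ?_ (fun i => ?_) i <;> simp
    · simp
  right_inv := by
    rintro (i | j)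
    · simp
    · refine Fin.lastCases ?_ (fun j => ?_) j <;> simp

theorem bendEquiv_last (n l : ℕ) : bendEquiv n l (Sum.inl (Fin.last n)) = Sum.inr (Fin.last l) := by
  simp [bendEquiv]

theorem bendEquiv_castSucc (n l : ℕ) (i : Fin n) :
    bendEquiv n l (Sum.inl i.castSucc) = Sum.inl i := by simp [bendEquiv]

theorem bendEquiv_inr (n l : ℕ) (j : Fin l) :
    bendEquiv n l (Sum.inr j) = Sum.inr j.castSucc := rfl

theorem frame_cases {n l : ℕ} {P : Fin (n + 1) ⊕ Fin l → Prop} (h1 : P (Sum.inl (Fin.last n)))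
    (h2 : ∀ i : Fin n, P (Sum.inl i.castSucc)) (h3 : ∀ j, P (Sum.inr j)) (p) : P p := by
  rcases p with i | j
  · exact Fin.lastCases h1 h2 i
  · exact h3 j

theorem bendEquiv_before {n l : ℕ} (p q : Fin (n + 1) ⊕ Fin l) :
    Before p q ↔ Before (bendEquiv n l p) (bendEquiv n l q) := by
  induction p using frame_cases <;> induction q using frame_cases <;>
    simp only [bendEquiv_last, bendEquiv_castSucc, bendEquiv_inr, Before, Fin.castSucc_lt_last,
      lt_irrefl, Fin.castSucc_lt_castSucc_iff]
  · exact ⟨fun h => not_lt.2 (Fin.le_last _) h, False.elim⟩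
  · exact ⟨False.elim, fun h => not_lt.2 (Fin.le_last _) h⟩

/-- A diagram drawn in another frame, the order of the nodes along the boundary being kept. -/
noncomputable def Diagram.reframe {m : ℕ} {X Y X' Y' : Type} [LinearOrder X] [LinearOrder Y] [LinearOrder X']
    [LinearOrder Y'] (a : Diagram m X Y) (e : X' ⊕ Y' ≃ X ⊕ Y)
    (he : ∀ p q, Before p q → Before (e p) (e q)) : Diagram m X' Y' :=
  Diagram.ofPartner (fun p => a.part.colour (e p)) (fun p => e.symm (a.partner (e p)))
    (fun p h => a.partner_ne (e p) (e.symm_apply_eq.1 h))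
    (fun p => by rw [e.apply_symm_apply, a.partner_partner, e.symm_apply_apply])
    (fun p => by rw [e.apply_symm_apply, a.colour_partner])
    (fun p q h1 h2 h3 h4 => a.not_cross (he _ _ h1)
      (by simpa using he _ _ h2) (by simpa using he _ _ h3) h4)

theorem Diagram.partner_reframe {m : ℕ} {X Y X' Y' : Type} [LinearOrder X] [LinearOrder Y]
    [LinearOrder X'] [LinearOrder Y'] (a : Diagram m X Y) (e : X' ⊕ Y' ≃ X ⊕ Y) (he) (p) :
    (a.reframe e he).partner p = e.symm (a.partner (e p)) :=
  Diagram.partner_ofPartner _ _ _ _ _ _ p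

variable {n l : ℕ}

/-- The last node of the top row is moved to the bottom row. -/
noncomputable def bendDown (d : Diagram 1 (Fin (n + 1)) (Fin l)) : Diagram 1 (Fin n) (Fin (l + 1)) :=
  d.reframe (bendEquiv n l).symm fun p q h => by
    rw [bendEquiv_before]; simpa using h

/-- The last node of the bottom row is moved to the top row. -/
noncomputable def bendUp (d : Diagram 1 (Fin n) (Fin (l + 1))) : Diagram 1 (Fin (n + 1)) (Fin l) :=
  d.reframe (bendEquiv n l) fun p q h => by
    rwa [← bendEquiv_before]

theorem partner_bendDown (d : Diagram 1 (Fin (n + 1)) (Fin l)) (p) :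
    (bendDown d).partner (bendEquiv n l p) = bendEquiv n l (d.partner p) := by
  unfold bendDown
  rw [Diagram.partner_reframe, Equiv.symm_symm, Equiv.symm_apply_apply]

theorem partner_bendUp (d : Diagram 1 (Fin n) (Fin (l + 1))) (p) :
    bendEquiv n l ((bendUp d).partner p) = d.partner (bendEquiv n l p) := by
  unfold bendUp
  rw [Diagram.partner_reframe, Equiv.apply_symm_apply]

theorem ext_one {X Y : Type} [LinearOrder X] [LinearOrder Y] {a b : Diagram 1 X Y}
    (h : ∀ p, a.partner p = b.partner p) : a = b :=
  Diagram.ext_partner (funext fun _ => Subsingleton.elim _ _) fun p => h p ▸ a.rel_partner p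

theorem bendDown_bendUp (d : Diagram 1 (Fin n) (Fin (l + 1))) : bendDown (bendUp d) = d := by
  refine ext_one fun p => ?_
  obtain ⟨p, rfl⟩ := (bendEquiv n l).surjective p
  rw [partner_bendDown, partner_bendUp]

theorem bendUp_bendDown (d : Diagram 1 (Fin (n + 1)) (Fin l)) : bendUp (bendDown d) = d := by
  refine ext_one fun p => (bendEquiv n l).injective ?_
  rw [partner_bendUp, partner_bendDown]

/-- Moving the last node of the top row to the bottom row reverses its sign and changes the
amplitude by a factor `ρ ^ (± 2)`, half of the exponent of a closed loop. -/
theorem amp_bendDown {ρ : ℂ} (hρ : ρ ≠ 0) (d : Diagram 1 (Fin (n + 1)) (Fin l))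
    (x : Fin n → Bool) (s : Bool) (z : Fin l → Bool) :
    amp (fun _ => ρ) d (Fin.snoc x s : Fin (n + 1) → Bool) z =
      ρ ^ (-2 * sgn s) *
        amp (fun _ => ρ) (bendDown d) x (Fin.snoc z (!s) : Fin (l + 1) → Bool) := by
  set e := bendEquiv n l with he
  have hch : ∀ p, charge x (Fin.snoc z (!s) : Fin (l + 1) → Bool) (e p) =
      charge (Fin.snoc x s : Fin (n + 1) → Bool) z p := by
    intro p
    induction p using frame_cases
    · rw [he, bendEquiv_last]; simp [charge]
    · rw [he, bendEquiv_castSucc]; simp [charge]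
    · rw [he, bendEquiv_inr]; simp [charge]
  have hv : Valid (bendDown d) x (Fin.snoc z (!s) : Fin (l + 1) → Bool) ↔
      Valid d (Fin.snoc x s : Fin (n + 1) → Bool) z := by
    constructor
    · intro h p
      have := h (e p)
      rwa [partner_bendDown, hch, hch] at this
    · intro h p
      obtain ⟨p, rfl⟩ := e.surjective p
      rw [partner_bendDown, hch, hch]
      exact h p
  by_cases h : Valid d (Fin.snoc x s : Fin (n + 1) → Bool) z
  swap
  · rw [amp_of_not_valid h, amp_of_not_valid fun h' => h (hv.1 h'), mul_zero]
  rw [amp_of_valid h, amp_of_valid (hv.2 h), ← e.prod_comp]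
  set L : Fin (n + 1) ⊕ Fin l := Sum.inl (Fin.last n) with hL
  set P := d.partner L with hP
  have hPL : P ≠ L := d.partner_ne L
  have split : ∀ f : Fin (n + 1) ⊕ Fin l → ℂ,
      ∏ p, f p = f L * f P * ∏ p ∈ (Finset.univ.erase L).erase P, f p := by
    intro f
    rw [← Finset.mul_prod_erase Finset.univ f (Finset.mem_univ L),
      ← Finset.mul_prod_erase (Finset.univ.erase L) f
        (Finset.mem_erase.2 ⟨hPL, Finset.mem_univ P⟩), mul_assoc]
  rw [split, split, ← mul_assoc]
  congr 1
  · -- the edge at the node that is moved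
    have hdP : d.partner P = L := Diagram.partner_comm hP.symm
    have hsP := h L
    rw [← hP] at hsP
    unfold nodeWt
    rw [partner_bendDown, partner_bendDown, ← hP, hdP, ← he]
    clear_value P
    induction P using frame_cases with
    | h1 => exact absurd rfl hPL
    | h2 i =>
      rw [hL, he, bendEquiv_last, bendEquiv_castSucc]
      rw [hL] at hsP
      simp only [charge, Sum.elim_inl, Fin.snoc_castSucc, Fin.snoc_last] at hsP
      simp only [turn, Sum.elim_inl, Fin.snoc_castSucc, Fin.snoc_last, hsP, Fin.castSucc_lt_last,
        if_true, (Fin.castSucc_lt_last i).asymm, if_false, sgn_not, zero_mul, zpow_zero, mul_one]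
      rw [← zpow_add₀ hρ]
      congr 1
      ring
    | h3 j =>
      rw [hL, he, bendEquiv_last, bendEquiv_inr]
      rw [hL] at hsP
      simp only [charge, Sum.elim_inl, Sum.elim_inr, Fin.snoc_last] at hsP
      have hz : z j = s := by simpa using hsP
      simp only [turn, Sum.elim_inr, Fin.snoc_castSucc, Fin.snoc_last, hz, Fin.castSucc_lt_last,
        if_true, (Fin.castSucc_lt_last j).asymm, if_false, sgn_not, zero_mul, zpow_zero, mul_one]
      rw [← zpow_add₀ hρ, ← zpow_add₀ hρ]
      symm
      convert zpow_zero ρ using 2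
      ring
  · refine Finset.prod_congr rfl fun p hp => ?_
    have hp1 : p ≠ P := (Finset.mem_erase.1 hp).1
    have hp2 : p ≠ L := (Finset.mem_erase.1 (Finset.mem_erase.1 hp).2).1
    have hq : d.partner p ≠ L := fun k => hp1 (by rw [hP, ← k, d.partner_partner])
    unfold nodeWt
    rw [partner_bendDown, ← he]
    have key : ∀ p q : Fin (n + 1) ⊕ Fin l, p ≠ L → q ≠ L → turn (e p) (e q) = turn p q := by
      intro p q hp hq
      induction p using frame_cases <;> induction q using frame_cases <;>
        first
          | exact absurd rfl hp
          | exact absurd rfl hq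
          | (simp only [he, bendEquiv_castSucc, bendEquiv_inr, turn,
              Fin.castSucc_lt_castSucc_iff])
    have key2 : Sum.elim x (Fin.snoc z (!s) : Fin (l + 1) → Bool) (e p) =
        Sum.elim (Fin.snoc x s : Fin (n + 1) → Bool) z p := by
      clear hp hp1 hq
      induction p using frame_cases
      · exact absurd rfl hp2
      · rw [he, bendEquiv_castSucc]; simp
      · rw [he, bendEquiv_inr]; simp
    rw [key _ _ hp2 hq, key2]

theorem frame_cases' {n l : ℕ} {P : Fin (n + 1) ⊕ Fin (l + 1) → Prop}
    (h1 : P (Sum.inl (Fin.last n))) (h2 : P (Sum.inr (Fin.last l)))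
    (h3 : ∀ p : Fin n ⊕ Fin l, P (Sum.map Fin.castSucc Fin.castSucc p)) (p) : P p := by
  rcases p with i | j
  · exact Fin.lastCases h1 (fun i => h3 (Sum.inl i)) i
  · exact Fin.lastCases h2 (fun j => h3 (Sum.inr j)) j

/-- The partner function of `addLine`. -/
noncomputable def linePartner (d : Diagram 1 (Fin n) (Fin l)) :
    Fin (n + 1) ⊕ Fin (l + 1) → Fin (n + 1) ⊕ Fin (l + 1) :=
  Sum.elim
    (Fin.lastCases (Sum.inr (Fin.last l))
      fun i => Sum.map Fin.castSucc Fin.castSucc (d.partner (Sum.inl i)))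
    (Fin.lastCases (Sum.inl (Fin.last n))
      fun j => Sum.map Fin.castSucc Fin.castSucc (d.partner (Sum.inr j)))

theorem linePartner_inl (d : Diagram 1 (Fin n) (Fin l)) :
    linePartner d (Sum.inl (Fin.last n)) = Sum.inr (Fin.last l) := by simp [linePartner]

theorem linePartner_inr (d : Diagram 1 (Fin n) (Fin l)) :
    linePartner d (Sum.inr (Fin.last l)) = Sum.inl (Fin.last n) := by simp [linePartner]

theorem linePartner_map (d : Diagram 1 (Fin n) (Fin l)) (p) :
    linePartner d (Sum.map Fin.castSucc Fin.castSucc p) =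
      Sum.map Fin.castSucc Fin.castSucc (d.partner p) := by
  rcases p with p | p <;> simp [linePartner]

theorem castSucc_map_injective :
    Function.Injective (Sum.map (Fin.castSucc : Fin n → _) (Fin.castSucc : Fin l → _)) :=
  Sum.map_injective.2 ⟨Fin.castSucc_injective _, Fin.castSucc_injective _⟩

theorem castSucc_map_before (p q : Fin n ⊕ Fin l) :
    Before (Sum.map (Fin.castSucc : Fin n → _) (Fin.castSucc : Fin l → _) p)
      (Sum.map Fin.castSucc Fin.castSucc q) ↔ Before p q := by
  rcases p with p | p <;> rcases q with q | q <;> simp [Before]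

/-- A vertical line is added to the right of a diagram. -/
noncomputable def addLine (d : Diagram 1 (Fin n) (Fin l)) : Diagram 1 (Fin (n + 1)) (Fin (l + 1)) :=
  Diagram.ofPartner (fun _ => 0) (linePartner d)
    (fun p => by
      induction p using frame_cases' with
      | h1 => rw [linePartner_inl]; simp
      | h2 => rw [linePartner_inr]; simp
      | h3 p =>
        rw [linePartner_map]
        exact fun h => d.partner_ne p (castSucc_map_injective h))
    (fun p => by
      induction p using frame_cases' with
      | h1 => rw [linePartner_inl, linePartner_inr]
      | h2 => rw [linePartner_inr, linePartner_inl]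
      | h3 p => rw [linePartner_map, linePartner_map, d.partner_partner])
    (fun _ => rfl)
    (fun p q h1 h2 h3 _ => by
      induction p using frame_cases' with
      | h1 =>
        rw [linePartner_inl] at h2
        rcases q with q | q
        · exact not_lt.2 (Fin.le_last q) h1
        · exact not_lt.2 (Fin.le_last q) h2
      | h2 =>
        rw [linePartner_inr] at h2
        rcases q with q | q <;> [exact h1; exact h2]
      | h3 p =>
        rw [linePartner_map] at h2 h3
        induction q using frame_cases' with
        | h1 =>
          rw [linePartner_inl] at h3
          generalize d.partner p = p' at *
          rcases p' with p' | p'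
          · exact (Fin.castSucc_lt_last p').asymm h2
          · exact (Fin.castSucc_lt_last p').asymm h3
        | h2 =>
          rw [linePartner_inr] at h3
          generalize d.partner p = p' at *
          rcases p' with p' | p' <;> [exact h2; exact h3]
        | h3 q =>
          rw [linePartner_map] at h3
          rw [castSucc_map_before] at h1 h2 h3
          exact d.not_cross h1 h2 h3 (Subsingleton.elim _ _))

theorem partner_addLine (d : Diagram 1 (Fin n) (Fin l)) (p) :
    (addLine d).partner p = linePartner d p := Diagram.partner_ofPartner _ _ _ _ _ _ p

theorem amp_addLine (ρ : ℂ) (d : Diagram 1 (Fin n) (Fin l)) (x : Fin n → Bool) (s : Bool)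
    (z : Fin l → Bool) (t : Bool) :
    amp (fun _ => ρ) (addLine d) (Fin.snoc x s : Fin (n + 1) → Bool)
      (Fin.snoc z t : Fin (l + 1) → Bool) = if s = t then amp (fun _ => ρ) d x z else 0 := by
  have hch : ∀ p, charge (Fin.snoc x s : Fin (n + 1) → Bool) (Fin.snoc z t : Fin (l + 1) → Bool)
      (Sum.map Fin.castSucc Fin.castSucc p) = charge x z p := by
    rintro (p | p) <;> simp [charge]
  have hv : Valid (addLine d) (Fin.snoc x s : Fin (n + 1) → Bool)
      (Fin.snoc z t : Fin (l + 1) → Bool) ↔ Valid d x z ∧ s = t := by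
    constructor
    · intro h
      refine ⟨fun p => ?_, ?_⟩
      · have := h (Sum.map Fin.castSucc Fin.castSucc p)
        rwa [partner_addLine, linePartner_map, hch, hch] at this
      · have := h (Sum.inl (Fin.last n))
        rw [partner_addLine, linePartner_inl] at this
        simpa [charge, eq_comm] using this
    · rintro ⟨h, rfl⟩ p
      rw [partner_addLine]
      induction p using frame_cases' with
      | h1 => rw [linePartner_inl]; simp [charge]
      | h2 => rw [linePartner_inr]; simp [charge]
      | h3 p => rw [linePartner_map, hch, hch, h]
  by_cases h : Valid d x z
  swap
  · rw [amp_of_not_valid h, amp_of_not_valid fun h' => h (hv.1 h').1, ite_self]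
  by_cases hst : s = t
  swap
  · rw [if_neg hst, amp_of_not_valid fun h' => hst (hv.1 h').2]
  rw [if_pos hst, amp_of_valid h, amp_of_valid (hv.2 ⟨h, hst⟩), Fintype.prod_sum_type,
    Fintype.prod_sum_type, Fin.prod_univ_castSucc, Fin.prod_univ_castSucc]
  have hturn : ∀ p q : Fin n ⊕ Fin l, turn (Sum.map Fin.castSucc Fin.castSucc p)
      (Sum.map Fin.castSucc Fin.castSucc q) = turn p q := by
    rintro (p | p) (q | q) <;> simp [turn]
  have hlab : ∀ p, Sum.elim (Fin.snoc x s : Fin (n + 1) → Bool) (Fin.snoc z t : Fin (l + 1) → Bool)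
      (Sum.map Fin.castSucc Fin.castSucc p) = Sum.elim x z p := by
    rintro (p | p) <;> simp
  have hw : ∀ p, nodeWt (fun _ => ρ) (addLine d) (Fin.snoc x s : Fin (n + 1) → Bool)
      (Fin.snoc z t : Fin (l + 1) → Bool) (Sum.map Fin.castSucc Fin.castSucc p) =
      nodeWt (fun _ => ρ) d x z p := by
    intro p
    unfold nodeWt
    rw [partner_addLine, linePartner_map, hturn, hlab]
  have h1 := fun i => hw (Sum.inl i)
  have h2 := fun j => hw (Sum.inr j)
  simp only [Sum.map_inl, Sum.map_inr] at h1 h2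
  rw [Finset.prod_congr rfl fun i _ => h1 i, Finset.prod_congr rfl fun j _ => h2 j]
  have h3 : nodeWt (fun _ => ρ) (addLine d) (Fin.snoc x s : Fin (n + 1) → Bool)
      (Fin.snoc z t : Fin (l + 1) → Bool) (Sum.inl (Fin.last n)) = 1 := by
    unfold nodeWt
    rw [partner_addLine, linePartner_inl]
    simp [turn]
  have h4 : nodeWt (fun _ => ρ) (addLine d) (Fin.snoc x s : Fin (n + 1) → Bool)
      (Fin.snoc z t : Fin (l + 1) → Bool) (Sum.inr (Fin.last l)) = 1 := by
    unfold nodeWt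
    rw [partner_addLine, linePartner_inr]
    simp [turn]
  rw [h3, h4, mul_one, mul_one]

/-- A diagram in which the two last nodes are joined arises by adding a line. -/
theorem exists_addLine (d : Diagram 1 (Fin (n + 1)) (Fin (l + 1)))
    (h : d.partner (Sum.inl (Fin.last n)) = Sum.inr (Fin.last l)) : ∃ d', d = addLine d' := by
  have h' := Diagram.partner_comm h
  have hcl : ∀ p : Fin n ⊕ Fin l, ∃ q : Fin n ⊕ Fin l,
      d.partner (Sum.map Fin.castSucc Fin.castSucc p) = Sum.map Fin.castSucc Fin.castSucc q := by
    intro p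
    generalize hq : d.partner (Sum.map Fin.castSucc Fin.castSucc p) = q
    have hq' := Diagram.partner_comm hq
    induction q using frame_cases' with
    | h1 =>
      rw [h] at hq'
      rcases p with p | p
      · cases hq'
      · exact absurd (Sum.inr_injective hq').symm (Fin.castSucc_lt_last p).ne
    | h2 =>
      rw [h'] at hq'
      rcases p with p | p
      · exact absurd (Sum.inl_injective hq').symm (Fin.castSucc_lt_last p).ne
      · cases hq'
    | h3 q => exact ⟨q, rfl⟩
  refine ⟨d.pull Fin.castSucc Fin.castSucc (Fin.strictMono_castSucc) (Fin.strictMono_castSucc)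
    id hcl fun _ _ h => h, ext_one fun p => ?_⟩
  rw [partner_addLine]
  induction p using frame_cases' with
  | h1 => rw [linePartner_inl, h]
  | h2 => rw [linePartner_inr, h']
  | h3 p => rw [linePartner_map, Diagram.map_partner_pull]

theorem addLine_injective :
    Function.Injective (addLine : Diagram 1 (Fin n) (Fin l) → _) := by
  intro d d' h
  refine ext_one fun p => castSucc_map_injective ?_
  rw [← linePartner_map, ← partner_addLine, h, partner_addLine, linePartner_map]

theorem noCap_addLine {d : Diagram 1 (Fin n) (Fin l)} (h : NoCap d) : NoCap (addLine d) := by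
  intro y
  rw [partner_addLine]
  refine Fin.lastCases ?_ (fun j => ?_) y
  · exact ⟨_, linePartner_inr d⟩
  · obtain ⟨x, hx⟩ := h j
    refine ⟨x.castSucc, ?_⟩
    have := linePartner_map d (Sum.inr j)
    rw [hx] at this
    exact this

theorem noCap_of_addLine {d : Diagram 1 (Fin n) (Fin l)} (h : NoCap (addLine d)) : NoCap d := by
  intro j
  obtain ⟨x, hx⟩ := h j.castSucc
  have h1 := linePartner_map d (Sum.inr j)
  rw [Sum.map_inr, ← partner_addLine, hx] at h1
  rcases e : d.partner (Sum.inr j) with x' | y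
  · exact ⟨x', rfl⟩
  · rw [e] at h1
    cases h1

theorem noCap_bendUp {d : Diagram 1 (Fin n) (Fin (l + 1))} (h : NoCap d) : NoCap (bendUp d) := by
  intro j
  obtain ⟨x, hx⟩ := h j.castSucc
  refine ⟨x.castSucc, (bendEquiv n l).injective ?_⟩
  rw [partner_bendUp, bendEquiv_inr, hx, bendEquiv_castSucc]

/-- In a diagram without arcs on the bottom row, the last node of the top row is either joined to
the last node of the bottom row or to another node of the top row. -/
theorem noCap_bendDown_or {d : Diagram 1 (Fin (n + 1)) (Fin l)} (h : NoCap d) :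
    NoCap (bendDown d) ∨
      ∃ (l' : ℕ) (e : l = l' + 1), d.partner (Sum.inl (Fin.last n)) =
        Sum.inr (Fin.cast e.symm (Fin.last l')) := by
  rcases e : d.partner (Sum.inl (Fin.last n)) with x | y
  · left
    have hx : ∃ i : Fin n, x = i.castSucc := by
      induction x using Fin.lastCases with
      | last => exact absurd e (d.partner_ne _)
      | cast i => exact ⟨i, rfl⟩
    obtain ⟨i, rfl⟩ := hx
    intro y
    induction y using Fin.lastCases with
    | last =>
      refine ⟨i, ?_⟩
      rw [← bendEquiv_last n l, partner_bendDown, e, bendEquiv_castSucc]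
    | cast j =>
      obtain ⟨x, hx⟩ := h j
      induction x using Fin.lastCases with
      | last =>
        have := Diagram.partner_comm hx
        rw [e] at this
        cases this
      | cast k =>
        refine ⟨k, ?_⟩
        rw [← bendEquiv_inr n l, partner_bendDown, hx, bendEquiv_castSucc]
  · right
    obtain ⟨l', rfl⟩ : ∃ l', l = l' + 1 := Nat.exists_eq_succ_of_ne_zero (by
      rintro rfl
      exact y.elim0)
    refine ⟨l', rfl, ?_⟩
    congr 1
    change y = Fin.last l'
    by_contra hy
    have hlt : y < Fin.last l' := lt_of_le_of_ne (Fin.le_last y) hy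
    obtain ⟨x, hx⟩ := h (Fin.last l')
    exact not_lt.2 (Fin.le_last x)
      (d.through_lt (Diagram.partner_comm e) hx (Subsingleton.elim _ _) hlt)

end Bend

/-! ### Gram matrices and radicals -/

section Gram

variable {S ι κ : Type*} [Fintype S] [Fintype ι] [Fintype κ]

/-- The Gram matrix of a family of vectors with respect to the standard bilinear form. -/
def gram {ι : Type*} (v : ι → S → ℂ) : Matrix ι ι ℂ := fun i j => dotProduct (v i) (v j)

/-- The dimension of the kernel of a matrix. -/
noncomputable def nullity (M : Matrix ι ι ℂ) : ℕ := Module.finrank ℂ (LinearMap.ker M.mulVecLin)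

/-- The radical of the restriction of the standard bilinear form to a subspace. -/
def radical (U : Submodule ℂ (S → ℂ)) : Submodule ℂ (S → ℂ) where
  carrier := {w | w ∈ U ∧ ∀ u ∈ U, dotProduct u w = 0}
  zero_mem' := ⟨U.zero_mem, fun u _ => dotProduct_zero u⟩
  add_mem' := fun ha hb => ⟨U.add_mem ha.1 hb.1, fun u hu => by
    rw [dotProduct_add, ha.2 u hu, hb.2 u hu, add_zero]⟩
  smul_mem' := fun c _ ha => ⟨U.smul_mem c ha.1, fun u hu => by
    rw [dotProduct_smul, ha.2 u hu, smul_zero]⟩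

theorem gram_mulVec (v : ι → S → ℂ) (c : ι → ℂ) (i : ι) :
    (gram v).mulVec c i = dotProduct (v i) (∑ j, c j • v j) := by
  rw [dotProduct_sum]
  refine Finset.sum_congr rfl fun j _ => ?_
  rw [dotProduct_smul, smul_eq_mul, mul_comm]
  rfl

theorem dotProduct_span_eq_zero {ι : Type*} {v : ι → S → ℂ} {w : S → ℂ} (h : ∀ i, dotProduct (v i) w = 0)
    {u : S → ℂ} (hu : u ∈ Submodule.span ℂ (Set.range v)) : dotProduct u w = 0 := by
  refine Submodule.span_induction (p := fun u _ => dotProduct u w = 0) ?_ ?_ ?_ ?_ hu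
  · rintro _ ⟨i, rfl⟩
    exact h i
  · exact zero_dotProduct _
  · intro a b _ _ ha hb
    rw [add_dotProduct, ha, hb, add_zero]
  · intro c a _ ha
    rw [smul_dotProduct, ha, smul_zero]

theorem finrank_radical {v : ι → S → ℂ} (hv : LinearIndependent ℂ v) :
    Module.finrank ℂ (radical (Submodule.span ℂ (Set.range v))) = nullity (gram v) := by
  have hinj : Function.Injective (Fintype.linearCombination ℂ v) :=
    hv.fintypeLinearCombination_injective
  have hmap : (LinearMap.ker (gram v).mulVecLin).map (Fintype.linearCombination ℂ v) =
      radical (Submodule.span ℂ (Set.range v)) := by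
    ext w
    constructor
    · rintro ⟨c, hc, rfl⟩
      have hc : (gram v).mulVec c = 0 := hc
      refine ⟨?_, fun u hu => dotProduct_span_eq_zero (fun i => ?_) hu⟩
      · rw [← Fintype.range_linearCombination ℂ v]
        exact ⟨c, rfl⟩
      · rw [Fintype.linearCombination_apply, ← gram_mulVec, hc]
        rfl
    · rintro ⟨hw, hw'⟩
      rw [← Fintype.range_linearCombination ℂ v] at hw
      obtain ⟨c, rfl⟩ := hw
      refine ⟨c, ?_, rfl⟩
      change (gram v).mulVec c = 0
      funext i
      rw [gram_mulVec]
      exact hw' _ (Submodule.subset_span ⟨i, rfl⟩)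
  rw [← hmap]
  exact (Submodule.equivMapOfInjective _ hinj _).finrank_eq.symm

theorem nullity_smul {c : ℂ} (hc : c ≠ 0) (M : Matrix ι ι ℂ) : nullity (c • M) = nullity M := by
  have h : LinearMap.ker (c • M).mulVecLin = LinearMap.ker M.mulVecLin := by
    ext x
    change (c • M).mulVec x = 0 ↔ M.mulVec x = 0
    rw [Matrix.smul_mulVec, smul_eq_zero, or_iff_right hc]
  unfold nullity
  rw [h]

theorem nullity_zero : nullity (0 : Matrix ι ι ℂ) = Fintype.card ι := by
  unfold nullity
  rw [Matrix.mulVecLin_zero, LinearMap.ker_zero, finrank_top, Module.finrank_fintype_fun_eq_card]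

/-- The nullity of a Gram matrix is additive for orthogonal families. -/
theorem nullity_gram_sum (v : ι → S → ℂ) (w : κ → S → ℂ)
    (h : ∀ i j, dotProduct (v i) (w j) = 0) :
    nullity (gram (Sum.elim v w)) = nullity (gram v) + nullity (gram w) := by
  have h1 : ∀ c : ι ⊕ κ → ℂ, ∀ i, (gram (Sum.elim v w)).mulVec c (Sum.inl i) =
      (gram v).mulVec (fun i => c (Sum.inl i)) i := by
    intro c i
    change ∑ k, _ = ∑ k, _
    rw [Fintype.sum_sum_type]
    change _ + ∑ j, dotProduct (v i) (w j) * _ = _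
    simp only [h, zero_mul, Finset.sum_const_zero, add_zero]
    rfl
  have h2 : ∀ c : ι ⊕ κ → ℂ, ∀ j, (gram (Sum.elim v w)).mulVec c (Sum.inr j) =
      (gram w).mulVec (fun j => c (Sum.inr j)) j := by
    intro c j
    change ∑ k, _ = ∑ k, _
    rw [Fintype.sum_sum_type]
    change ∑ i, dotProduct (w j) (v i) * _ + _ = _
    simp only [dotProduct_comm (w j), h, zero_mul, Finset.sum_const_zero, zero_add]
    rfl
  have key : ∀ c : ι ⊕ κ → ℂ, (gram (Sum.elim v w)).mulVec c = 0 ↔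
      (gram v).mulVec (fun i => c (Sum.inl i)) = 0 ∧
        (gram w).mulVec (fun j => c (Sum.inr j)) = 0 := by
    intro c
    constructor
    · intro hc
      exact ⟨funext fun i => by rw [← h1, hc]; rfl, funext fun j => by rw [← h2, hc]; rfl⟩
    · rintro ⟨ha, hb⟩
      funext k
      rcases k with i | j
      · rw [h1, ha]; rfl
      · rw [h2, hb]; rfl
  unfold nullity
  rw [← Module.finrank_prod]
  refine LinearEquiv.finrank_eq
    { toFun := fun c => (⟨fun i => c.1 (Sum.inl i), ((key c.1).1 c.2).1⟩,
        ⟨fun j => c.1 (Sum.inr j), ((key c.1).1 c.2).2⟩)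
      invFun := fun p => ⟨Sum.elim p.1.1 p.2.1, (key _).2 ⟨p.1.2, p.2.2⟩⟩
      map_add' := fun _ _ => rfl
      map_smul' := fun _ _ => rfl
      left_inv := fun c => Subtype.ext (funext fun k => by rcases k with i | j <;> rfl)
      right_inv := fun p => rfl }

end Gram

/-! ### Half-diagrams in one colour -/

/-- Half-diagrams in one colour with `n` nodes and `l` defects. -/
abbrev HalfOne (n l : ℕ) : Type := {d : Diagram 1 (Fin n) (Fin l) // NoCap d}

noncomputable instance (n l : ℕ) : Fintype (HalfOne n l) := Fintype.ofFinite _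

/-- The vector of a half-diagram in the vertex model. -/
noncomputable def psi (ρ : ℂ) {n l : ℕ} (d : HalfOne n l) : (Fin n → Bool) → ℂ :=
  (ampMat ρ d.1).mulVec (plus _)

theorem psi_apply (ρ : ℂ) {n l : ℕ} (d : HalfOne n l) (x : Fin n → Bool) :
    psi ρ d x = amp (fun _ => ρ) d.1 x fun _ => true := ampMat_mulVec_plus _ _ _

theorem span_psi (ρ : ℂ) (n l : ℕ) :
    Submodule.span ℂ (Set.range (psi ρ : HalfOne n l → _)) = cellSpan ρ (Fin n) l := by
  refine le_antisymm (Submodule.span_le.2 ?_) (Submodule.span_le.2 ?_)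
  · rintro _ ⟨d, rfl⟩
    exact Submodule.subset_span ⟨d.1, rfl⟩
  · rintro _ ⟨d, rfl⟩
    by_cases h : NoCap d
    · exact Submodule.subset_span ⟨⟨d, h⟩, rfl⟩
    · rw [SetLike.mem_coe]
      change (ampMat ρ d).mulVec (plus _) ∈ _
      rw [ampMat_mulVec_plus_of_not_noCap ρ h]
      exact Submodule.zero_mem _

theorem HalfOne.le {n l : ℕ} (d : HalfOne n l) : l ≤ n := by
  simpa using d.2.card_le

/-- The half-diagrams with one node and one defect less. -/
def LowerHalf (n : ℕ) : ℕ → Type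
  | 0 => Empty
  | l + 1 => HalfOne n l

noncomputable instance (n l : ℕ) : Fintype (LowerHalf n l) := by
  cases l <;> unfold LowerHalf <;> infer_instance

/-- A line is added on the right. -/
noncomputable def raise (n : ℕ) : ∀ l, LowerHalf n l → HalfOne (n + 1) l
  | 0 => Empty.elim
  | _ + 1 => fun d : HalfOne n _ => ⟨addLine d.1, noCap_addLine d.2⟩

/-- The vectors of the half-diagrams in `LowerHalf`. -/
noncomputable def lowerPsi (ρ : ℂ) (n : ℕ) : ∀ l, LowerHalf n l → (Fin n → Bool) → ℂ
  | 0 => Empty.elim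
  | _ + 1 => fun d : HalfOne n _ => psi ρ d

/-- The last defect is bent up to the top row. -/
noncomputable def bend {n l : ℕ} (d : HalfOne n (l + 1)) : HalfOne (n + 1) l :=
  ⟨bendUp d.1, noCap_bendUp d.2⟩

theorem psi_raise_true (ρ : ℂ) (n l : ℕ) (d : LowerHalf n l) (x : Fin n → Bool) :
    psi ρ (raise n l d) (Fin.snoc x true : Fin (n + 1) → Bool) = lowerPsi ρ n l d x := by
  cases l with
  | zero => exact d.elim
  | succ l =>
    refine (psi_apply ρ _ _).trans (Eq.trans ?_ (psi_apply ρ (show HalfOne n l from d) x).symm)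
    change amp _ (addLine (show HalfOne n l from d).1) _ _ = _
    have h : (fun _ => true : Fin (l + 1) → Bool) = Fin.snoc (fun _ => true : Fin l → Bool) true := by
      funext i
      refine Fin.lastCases ?_ (fun j => ?_) i <;> simp
    rw [h, amp_addLine, if_pos rfl]

theorem psi_raise_false (ρ : ℂ) (n l : ℕ) (d : LowerHalf n l) (x : Fin n → Bool) :
    psi ρ (raise n l d) (Fin.snoc x false : Fin (n + 1) → Bool) = 0 := by
  cases l with
  | zero => exact d.elim
  | succ l =>
    refine (psi_apply ρ _ _).trans ?_
    change amp _ (addLine (show HalfOne n l from d).1) _ _ = _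
    have h : (fun _ => true : Fin (l + 1) → Bool) = Fin.snoc (fun _ => true : Fin l → Bool) true := by
      funext i
      refine Fin.lastCases ?_ (fun j => ?_) i <;> simp
    rw [h, amp_addLine, if_neg (by simp)]

/-- The state with a single negative sign, at the node `i`. -/
noncomputable def minusAt {N : ℕ} (i : Fin N) : (Fin N → Bool) → ℂ :=
  Pi.single (Function.update (fun _ => true) i false) 1

theorem snoc_true_false (l : ℕ) :
    (Fin.snoc (fun _ => true : Fin l → Bool) false : Fin (l + 1) → Bool) =
      Function.update (fun _ => true) (Fin.last l) false := by
  funext i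
  refine Fin.lastCases ?_ (fun j => ?_) i
  · simp
  · simp [(Fin.castSucc_lt_last j).ne]

theorem snoc_true_true (l : ℕ) :
    (Fin.snoc (fun _ => true : Fin l → Bool) true : Fin (l + 1) → Bool) = fun _ => true := by
  funext i
  refine Fin.lastCases ?_ (fun j => ?_) i <;> simp

theorem psi_bend_false {ρ : ℂ} (hρ : ρ ≠ 0) {n l : ℕ} (d : HalfOne n (l + 1))
    (x : Fin n → Bool) :
    psi ρ (bend d) (Fin.snoc x false : Fin (n + 1) → Bool) = ρ ^ (2 : ℤ) * psi ρ d x := by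
  rw [psi_apply, psi_apply]
  change amp _ (bendUp d.1) _ _ = _
  rw [amp_bendDown hρ, bendDown_bendUp, Bool.not_false, snoc_true_true]
  rfl

theorem psi_bend_true {ρ : ℂ} (hρ : ρ ≠ 0) {n l : ℕ} (d : HalfOne n (l + 1))
    (x : Fin n → Bool) :
    psi ρ (bend d) (Fin.snoc x true : Fin (n + 1) → Bool) =
      ρ ^ (-2 : ℤ) * (ampMat ρ d.1).mulVec (minusAt (Fin.last l)) x := by
  rw [psi_apply]
  change amp _ (bendUp d.1) _ _ = _
  rw [amp_bendDown hρ, bendDown_bendUp, Bool.not_true, snoc_true_false]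
  unfold minusAt
  rw [Matrix.mulVec_single_one]
  rfl

/-- A half-diagram with `n + 1` nodes either ends in a line or comes from bending. -/
noncomputable def halfEquiv (n l : ℕ) : LowerHalf n l ⊕ HalfOne n (l + 1) ≃ HalfOne (n + 1) l :=
  Equiv.ofBijective (Sum.elim (raise n l) bend) (by
    have hpart : ∀ (l : ℕ) (d : HalfOne n l), (addLine d.1).partner (Sum.inl (Fin.last n)) =
        Sum.inr (Fin.last l) := fun l d => by rw [partner_addLine, linePartner_inl]
    have hbend : ∀ d : HalfOne n (l + 1), ∀ y,
        (bendUp d.1).partner (Sum.inl (Fin.last n)) ≠ Sum.inr y := by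
      intro d y e
      obtain ⟨x, hx⟩ := d.2 (Fin.last l)
      have := partner_bendUp d.1 (Sum.inl (Fin.last n))
      rw [bendEquiv_last, hx, e, bendEquiv_inr] at this
      cases this
    constructor
    · rintro (d | d) (d' | d') h
      · cases l with
        | zero => exact d.elim
        | succ l =>
          have h' : addLine d.1 = addLine d'.1 := congrArg Subtype.val h
          exact congrArg Sum.inl (Subtype.ext (addLine_injective h'))
      · cases l with
        | zero => exact d.elim
        | succ l =>
          have h' : addLine d.1 = bendUp d'.1 := congrArg Subtype.val h
          exact absurd (h' ▸ hpart l d) (hbend d' _)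
      · cases l with
        | zero => exact d'.elim
        | succ l =>
          have h' : bendUp d.1 = addLine d'.1 := congrArg Subtype.val h
          exact absurd (h'.symm ▸ hpart l d') (hbend d _)
      · have h' : bendUp d.1 = bendUp d'.1 := congrArg Subtype.val h
        refine congrArg Sum.inr (Subtype.ext ?_)
        rw [← bendDown_bendUp d.1, h', bendDown_bendUp]
    · intro d
      rcases noCap_bendDown_or d.2 with h | ⟨l', rfl, h⟩
      · exact ⟨Sum.inr ⟨bendDown d.1, h⟩, Subtype.ext (bendUp_bendDown d.1)⟩
      · obtain ⟨d', hd'⟩ := exists_addLine d.1 h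
        have hn : NoCap d' := noCap_of_addLine (hd' ▸ d.2)
        exact ⟨Sum.inl (show HalfOne n l' from ⟨d', hn⟩), Subtype.ext hd'.symm⟩)

theorem card_halfOne_succ (n l : ℕ) : Fintype.card (HalfOne (n + 1) l) =
    Fintype.card (LowerHalf n l) + Fintype.card (HalfOne n (l + 1)) := by
  rw [← Fintype.card_congr (halfEquiv n l), Fintype.card_sum]

/-- A family of vectors whose components for the last sign `-` are proportional to those of an
independent family remains independent when it is joined to an independent family of vectors
supported on the last sign `+`. -/
theorem linearIndependent_snoc {ι κ : Type*} [Fintype ι] [Fintype κ] {n : ℕ}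
    {u : ι → (Fin n → Bool) → ℂ} {u' : κ → (Fin n → Bool) → ℂ} (hu : LinearIndependent ℂ u)
    (hu' : LinearIndependent ℂ u') {v : ι → (Fin (n + 1) → Bool) → ℂ}
    {v' : κ → (Fin (n + 1) → Bool) → ℂ} {C : ℂ} (hC : C ≠ 0)
    (h1 : ∀ i x, v i (Fin.snoc x true : Fin (n + 1) → Bool) = u i x)
    (h2 : ∀ i x, v i (Fin.snoc x false : Fin (n + 1) → Bool) = 0)
    (h3 : ∀ j x, v' j (Fin.snoc x false : Fin (n + 1) → Bool) = C * u' j x) :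
    LinearIndependent ℂ (Sum.elim v v') := by
  rw [Fintype.linearIndependent_iff] at hu hu' ⊢
  intro g hg
  rw [Fintype.sum_sum_type] at hg
  have hev : ∀ s, ∑ i, g (Sum.inl i) * v i s + ∑ j, g (Sum.inr j) * v' j s = 0 := by
    intro s
    have := congrFun hg s
    simpa [Finset.sum_apply] using this
  have hb : ∀ j, g (Sum.inr j) = 0 := by
    refine hu' _ (funext fun x => ?_)
    have := hev (Fin.snoc x false)
    simp only [h2, h3, mul_zero, Finset.sum_const_zero, zero_add, mul_left_comm _ C] at this
    rw [← Finset.mul_sum, mul_eq_zero, or_iff_right hC] at this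
    simpa [Finset.sum_apply] using this
  have ha : ∀ i, g (Sum.inl i) = 0 := by
    refine hu _ (funext fun x => ?_)
    have := hev (Fin.snoc x true)
    simp only [h1, hb, zero_mul, Finset.sum_const_zero, add_zero] at this
    simpa [Finset.sum_apply] using this
  rintro (i | j)
  · exact ha i
  · exact hb j

theorem linearIndependent_lowerPsi {ρ : ℂ} {n : ℕ}
    (h : ∀ l, LinearIndependent ℂ (psi ρ : HalfOne n l → _)) :
    ∀ l, LinearIndependent ℂ (lowerPsi ρ n l)
  | 0 => by
    have : IsEmpty (LowerHalf n 0) := inferInstanceAs (IsEmpty Empty)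
    exact linearIndependent_empty_type
  | l + 1 => h l

theorem psi_halfEquiv (ρ : ℂ) (n l : ℕ) :
    psi ρ ∘ halfEquiv n l = Sum.elim (fun d => psi ρ (raise n l d)) fun d => psi ρ (bend d) := by
  funext d
  rcases d with d | d <;> rfl

/-- By induction on the number of nodes: the half-diagrams that end in a line have no component
with last sign `-`, and the bent ones have such a component proportional to a smaller half-diagram.
-/
theorem linearIndependent_psi {ρ : ℂ} (hρ : ρ ≠ 0) (n : ℕ) :
    ∀ l, LinearIndependent ℂ (psi ρ : HalfOne n l → _) := by
  induction n with
  | zero =>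
    intro l
    have hsub : Subsingleton (HalfOne 0 l) := ⟨fun a b => by
      obtain rfl : l = 0 := Nat.le_zero.1 a.le
      refine Subtype.ext (ext_one fun p => ?_)
      rcases p with p | p <;> exact p.elim0⟩
    rw [linearIndependent_subsingleton_index_iff]
    intro d h
    obtain rfl : l = 0 := Nat.le_zero.1 d.le
    have h1 := congrFun h fun _ => true
    rw [psi_apply, amp_true_true, if_pos d.2] at h1
    exact one_ne_zero h1
  | succ n ih =>
    intro l
    rw [← linearIndependent_equiv (halfEquiv n l), psi_halfEquiv]
    exact linearIndependent_snoc (linearIndependent_lowerPsi ih l) (ih (l + 1))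
      (zpow_ne_zero 2 hρ) (psi_raise_true ρ n l) (psi_raise_false ρ n l) (psi_bend_false hρ)

/-! ### Singular vectors and Gaussian binomials -/

theorem snoc_induction {n : ℕ} {P : (Fin (n + 1) → Bool) → Prop}
    (h : ∀ (x : Fin n → Bool) (t : Bool), P (Fin.snoc x t : Fin (n + 1) → Bool)) (s) : P s := by
  have := h (Fin.init s) (s (Fin.last n))
  rwa [Fin.snoc_init_self] at this

theorem sum_snoc {n : ℕ} (F : (Fin (n + 1) → Bool) → ℂ) :
    ∑ s, F s = ∑ x : Fin n → Bool, F (Fin.snoc x true : Fin (n + 1) → Bool) +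
      ∑ x : Fin n → Bool, F (Fin.snoc x false : Fin (n + 1) → Bool) := by
  rw [← (Fin.snocEquiv fun _ => Bool).sum_comp, Fintype.sum_prod_type, Fintype.sum_bool]
  rfl

open Polynomial in
/-- The polynomial whose coefficients are the values of the singular vectors `chain`. -/
noncomputable def chainPoly (μ : ℂ) {N : ℕ} (s : Fin N → Bool) : ℂ[X] :=
  ∏ i, if s i then 1 else C (μ ^ (i : ℕ)) * X

/-- The singular vector with `k` negative signs; a negative sign at the node `i` contributes
`μ ^ i`. -/
noncomputable def chain (μ : ℂ) (N k : ℕ) (s : Fin N → Bool) : ℂ := (chainPoly μ s).coeff k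

theorem chainPoly_snoc_true (μ : ℂ) {N : ℕ} (s : Fin N → Bool) :
    chainPoly μ (Fin.snoc s true : Fin (N + 1) → Bool) = chainPoly μ s := by
  unfold chainPoly
  rw [Fin.prod_univ_castSucc]
  simp

open Polynomial in
theorem chainPoly_snoc_false (μ : ℂ) {N : ℕ} (s : Fin N → Bool) :
    chainPoly μ (Fin.snoc s false : Fin (N + 1) → Bool) = chainPoly μ s * (C (μ ^ N) * X) := by
  unfold chainPoly
  rw [Fin.prod_univ_castSucc]
  simp

theorem chain_snoc_true (μ : ℂ) (N k : ℕ) (s : Fin N → Bool) :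
    chain μ (N + 1) k (Fin.snoc s true : Fin (N + 1) → Bool) = chain μ N k s := by
  unfold chain
  rw [chainPoly_snoc_true]

theorem chain_snoc_false (μ : ℂ) (N k : ℕ) (s : Fin N → Bool) :
    chain μ (N + 1) (k + 1) (Fin.snoc s false : Fin (N + 1) → Bool) = μ ^ N * chain μ N k s := by
  unfold chain
  rw [chainPoly_snoc_false, ← mul_assoc, Polynomial.coeff_mul_X, mul_comm, Polynomial.coeff_C_mul]

theorem chain_snoc_false_zero (μ : ℂ) (N : ℕ) (s : Fin N → Bool) :
    chain μ (N + 1) 0 (Fin.snoc s false : Fin (N + 1) → Bool) = 0 := by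
  unfold chain
  rw [chainPoly_snoc_false, ← mul_assoc, Polynomial.coeff_mul_X_zero]

theorem chain_zero (μ : ℂ) (N : ℕ) : chain μ N 0 = plus (Fin N) := by
  classical
  unfold plus
  induction N with
  | zero =>
    funext s
    have : s = fun _ => true := funext fun i => i.elim0
    subst this
    simp [chain, chainPoly]
  | succ N ih =>
    funext s
    induction s using snoc_induction with
    | h x t =>
      cases t with
      | false =>
        rw [chain_snoc_false_zero, Pi.single_apply, if_neg]
        intro h
        simpa using congrFun h (Fin.last N)
      | true =>
        rw [chain_snoc_true, ih, Pi.single_apply, Pi.single_apply]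
        refine if_congr ?_ rfl rfl
        constructor
        · rintro rfl
          exact snoc_true_true N
        · intro h
          funext i
          simpa using congrFun h i.castSucc

/-- The parameter of the singular vectors. -/
noncomputable def mu (ρ : ℂ) : ℂ := -ρ ^ (-4 : ℤ)

theorem mu_ne_zero {ρ : ℂ} (hρ : ρ ≠ 0) : mu ρ ≠ 0 := neg_ne_zero.2 (zpow_ne_zero _ hρ)

theorem rho_zpow {ρ : ℂ} (hρ : ρ ≠ 0) : ρ ^ (2 : ℤ) * mu ρ + ρ ^ (-2 : ℤ) = 0 := by
  unfold mu
  rw [mul_neg, ← zpow_add₀ hρ]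
  norm_num

theorem adjacent_fin {N : ℕ} {c : Fin N → Fin 1} {p q : Fin N} (h : Adjacent c p q) :
    (q : ℕ) = p + 1 := by
  have h1 : (p : ℕ) < q := h.lt
  by_contra hne
  have h2 : (p : ℕ) + 1 < q := by omega
  exact h.gap ⟨p + 1, h2.trans q.2⟩ (by simp [Fin.lt_def]) (by simpa [Fin.lt_def] using h2)
    (Subsingleton.elim _ _)

open Polynomial in
/-- A contraction compares neighbouring states in which a negative sign moves by one place; these
have values with ratio `μ = -ρ ^ (-4)`, and the two terms cancel. -/
theorem singular_chain {ρ : ℂ} (hρ : ρ ≠ 0) (N k : ℕ) : Singular ρ (chain (mu ρ) N k) := by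
  rw [singular_iff hρ]
  intro c p q h x
  set R : ℂ[X] := ∏ y : Rest p q, if x y then 1 else C (mu ρ ^ (y.1 : ℕ)) * X with hR
  have key : ∀ t, chainPoly (mu ρ) (extState x t) =
      C (mu ρ ^ (p : ℕ)) * (C (if t then mu ρ else 1) * (X * R)) := by
    intro t
    unfold chainPoly
    rw [prod_rest h.lt.ne]
    have : ∏ y : Rest p q, (if extState x t y.1 then (1 : ℂ[X]) else C (mu ρ ^ (y.1 : ℕ)) * X) =
        R := Finset.prod_congr rfl fun y _ => by rw [extState_rest]
    rw [this, extState_left, extState_right h.lt, adjacent_fin h]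
    cases t
    · simp [mul_assoc]
    · simp [pow_succ, mul_assoc]
  rw [Fintype.sum_bool]
  unfold chain
  simp only [key, Polynomial.coeff_C_mul, sgn, if_true, mul_one]
  simp only [Bool.false_eq_true, if_false]
  norm_num only
  linear_combination (mu ρ ^ (p : ℕ) * (X * R).coeff k) * rho_zpow hρ

theorem extState_true_true {Y : Type} [LinearOrder Y] {p q : Y} (h : p < q) :
    extState (fun _ : Rest p q => true) true = Function.update (fun _ => true) q false := by
  funext y
  by_cases h1 : y = q
  · subst h1
    rw [extState_right h, Function.update_self]
    rfl
  · rw [Function.update_of_ne h1]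
    by_cases h2 : y = p
    · subst h2
      exact extState_left _ _
    · exact extState_rest _ _ ⟨y, h2, h1⟩

theorem extState_true_false {Y : Type} [LinearOrder Y] {p q : Y} :
    extState (fun _ : Rest p q => true) false = Function.update (fun _ => true) p false := by
  funext y
  by_cases h1 : y = p
  · subst h1
    rw [extState_left, Function.update_self]
  · rw [Function.update_of_ne h1]
    unfold extState
    simp [h1]

theorem minusAt_castSucc_true {N : ℕ} (i : Fin N) (x : Fin N → Bool) :
    minusAt i.castSucc (Fin.snoc x true : Fin (N + 1) → Bool) = minusAt i x := by
  unfold minusAt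
  rw [Pi.single_apply, Pi.single_apply]
  refine if_congr ?_ rfl rfl
  rw [← snoc_true_true, ← Fin.snoc_update, Fin.snoc_inj]
  simp

theorem minusAt_castSucc_false {N : ℕ} (i : Fin N) (x : Fin N → Bool) :
    minusAt i.castSucc (Fin.snoc x false : Fin (N + 1) → Bool) = 0 := by
  unfold minusAt
  rw [Pi.single_apply, if_neg]
  rw [← snoc_true_true, ← Fin.snoc_update, Fin.snoc_inj]
  simp

theorem minusAt_last_true {N : ℕ} (x : Fin N → Bool) :
    minusAt (Fin.last N) (Fin.snoc x true : Fin (N + 1) → Bool) = 0 := by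
  unfold minusAt
  rw [Pi.single_apply, if_neg]
  rw [← snoc_true_false, Fin.snoc_inj]
  simp

theorem minusAt_last_false {N : ℕ} (x : Fin N → Bool) :
    minusAt (Fin.last N) (Fin.snoc x false : Fin (N + 1) → Bool) = plus (Fin N) x := by
  classical
  unfold minusAt plus
  rw [Pi.single_apply, Pi.single_apply]
  refine if_congr ?_ rfl rfl
  rw [← snoc_true_false, Fin.snoc_inj]
  simp

theorem chain_one (μ : ℂ) (N : ℕ) : chain μ N 1 = ∑ i : Fin N, μ ^ (i : ℕ) • minusAt i := by
  induction N with
  | zero =>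
    funext s
    simp [chain, chainPoly, Polynomial.coeff_one]
  | succ N ih =>
    funext s
    rw [Fin.sum_univ_castSucc]
    induction s using snoc_induction with
    | h x t =>
      cases t with
      | true =>
        rw [chain_snoc_true, ih]
        simp [Finset.sum_apply, minusAt_castSucc_true, minusAt_last_true]
      | false =>
        rw [chain_snoc_false, chain_zero]
        simp [Finset.sum_apply, minusAt_castSucc_false, minusAt_last_false]

/-- The Gaussian binomial coefficient, multiplied by `ζ ^ (j * (j - 1) / 2)`: the sum of `ζ` to the
sum of the elements over the `j`-element subsets of `{0, …, N - 1}`. It is the dot product of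
`chain` with itself. -/
noncomputable def gauss (ζ : ℂ) : ℕ → ℕ → ℂ
  | _, 0 => 1
  | 0, _ + 1 => 0
  | N + 1, j + 1 => gauss ζ N (j + 1) + ζ ^ N * gauss ζ N j

theorem gauss_zero (ζ : ℂ) (N : ℕ) : gauss ζ N 0 = 1 := by cases N <;> rfl

theorem dotProduct_chain (μ : ℂ) (N j : ℕ) :
    dotProduct (chain μ N j) (chain μ N j) = gauss (μ ^ 2) N j := by
  induction N generalizing j with
  | zero =>
    unfold dotProduct
    cases j with
    | zero => simp [chain, chainPoly, gauss]
    | succ j => simp [chain, chainPoly, gauss, Polynomial.coeff_one]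
  | succ N ih =>
    unfold dotProduct
    rw [sum_snoc]
    cases j with
    | zero =>
      simp only [chain_snoc_true, chain_snoc_false_zero, mul_zero, Finset.sum_const_zero, add_zero]
      exact (ih 0).trans (gauss_zero _ _)
    | succ j =>
      simp only [chain_snoc_true, chain_snoc_false]
      rw [gauss, ← ih, ← ih]
      unfold dotProduct
      rw [Finset.mul_sum]
      congr 1
      refine Finset.sum_congr rfl fun x _ => ?_
      ring

/-- The dot product with itself of `chain` with one negative sign on `l + 1` nodes. -/
noncomputable def quantumInt (ρ : ℂ) (l : ℕ) : ℂ := ∑ i ∈ Finset.range (l + 1), (mu ρ ^ 2) ^ i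

theorem gauss_one (ζ : ℂ) (N : ℕ) : gauss ζ N 1 = ∑ i ∈ Finset.range N, ζ ^ i := by
  induction N with
  | zero => simp [gauss]
  | succ N ih => rw [gauss, ih, gauss_zero, mul_one, Finset.sum_range_succ]

theorem dotProduct_chain_one (ρ : ℂ) (l : ℕ) :
    dotProduct (chain (mu ρ) (l + 1) 1) (chain (mu ρ) (l + 1) 1) = quantumInt ρ l := by
  rw [dotProduct_chain, gauss_one]
  rfl

/-! ### The Gram matrix of a cell module, recursively -/

/-- The vectors that are a multiple of those of `LowerHalf`. -/
noncomputable def lowerSpan (ρ : ℂ) (n l : ℕ) : Submodule ℂ ((Fin n → Bool) → ℂ) :=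
  Submodule.span ℂ (Set.range (lowerPsi ρ n l))

theorem lowerSpan_succ (ρ : ℂ) (n l : ℕ) : lowerSpan ρ n (l + 1) = cellSpan ρ (Fin n) l :=
  span_psi ρ n l

theorem mulVec_mem_lowerSpan {ρ : ℂ} (hρ : ρ ≠ 0) {n N : ℕ} (d : Diagram 1 (Fin n) (Fin N)) :
    ∀ {l : ℕ} {f : (Fin N → Bool) → ℂ}, f ∈ lowerSpan ρ N l →
      (ampMat ρ d).mulVec f ∈ lowerSpan ρ n l
  | 0, f, hf => by
    have h : lowerSpan ρ N 0 = ⊥ := by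
      refine Submodule.span_eq_bot.2 ?_
      rintro _ ⟨i, _⟩
      exact i.elim
    rw [h, Submodule.mem_bot] at hf
    rw [hf, Matrix.mulVec_zero]
    exact Submodule.zero_mem _
  | l + 1, f, hf => by
    rw [lowerSpan_succ] at hf ⊢
    exact mulVec_mem_cellSpan hρ d hf

theorem adjacent_castSucc {N : ℕ} (i : Fin N) :
    Adjacent (fun _ : Fin (N + 1) => (0 : Fin 1)) i.castSucc i.succ :=
  ⟨Fin.castSucc_lt_succ, rfl, fun y h1 h2 => by
    rw [Fin.lt_def] at h1 h2
    simp at h1 h2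
    omega⟩

/-- Modulo the vectors with an arc, moving the negative sign one place to the right multiplies a
state by `μ`, since an arc on neighbouring nodes is a combination of two such states. -/
theorem minusAt_sub_mem {ρ : ℂ} (hρ : ρ ≠ 0) (l : ℕ) (i : Fin (l + 1)) :
    mu ρ ^ l • minusAt i - mu ρ ^ (i : ℕ) • minusAt (Fin.last l) ∈ lowerSpan ρ (l + 1) l := by
  cases l with
  | zero =>
    obtain rfl : i = Fin.last 0 := Subsingleton.elim (α := Fin 1) _ _
    simp
  | succ l =>
    have step : ∀ i : Fin (l + 1), ρ ^ (2 : ℤ) • minusAt i.succ + ρ ^ (-2 : ℤ) • minusAt i.castSucc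
        ∈ lowerSpan ρ (l + 2) (l + 1) := by
      intro i
      have hadj := adjacent_castSucc i
      rw [lowerSpan_succ]
      have hcard : Fintype.card (Rest i.castSucc i.succ) = l := by
        have h1 : Fintype.card (Rest i.castSucc i.succ) =
            #(((Finset.univ : Finset (Fin (l + 2))).erase i.castSucc).erase i.succ) := by
          rw [Fintype.card_subtype]
          congr 1
          ext y
          simp [and_comm]
        rw [h1, Finset.card_erase_of_mem, Finset.card_erase_of_mem (Finset.mem_univ _)]
        · simp
        · simp [hadj.lt.ne']
      have h := mulVec_plus_mem (ρ := ρ) hcard (cap _ hadj).reflect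
      convert h using 1
      funext s
      rw [ampMat_mulVec_plus, amp_reflect]
      have h1 := cap_amp_sum (fun _ : Fin 1 => ρ) (fun _ => hρ) _ hadj (fun _ => true)
        (Pi.single s 1)
      simp only [Pi.single_apply, mul_ite, mul_one, mul_zero, Finset.sum_ite_eq',
        Finset.mem_univ, if_true] at h1
      rw [h1, Fintype.sum_bool]
      rw [extState_true_true hadj.lt, extState_true_false]
      unfold minusAt
      simp [Pi.single_apply, sgn, eq_comm]
    have hμ := mu_ne_zero hρ
    induction i using Fin.reverseInduction with
    | last => simp
    | cast i ih =>
      have h := Submodule.add_mem _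
        (Submodule.smul_mem _ (mu ρ ^ (l + 1) * ρ ^ (2 : ℤ)) (step i))
        (Submodule.smul_mem _ (mu ρ)⁻¹ ih)
      convert h using 1
      have h1 : ρ ^ (2 : ℤ) * ρ ^ (-2 : ℤ) = 1 := by
        rw [← zpow_add₀ hρ]
        simp
      have h2 : ρ ^ (2 : ℤ) * ρ ^ (2 : ℤ) = -(mu ρ)⁻¹ := by
        unfold mu
        rw [inv_neg, neg_neg, ← zpow_neg, ← zpow_add₀ hρ]
        norm_num
      match_scalars
      · linear_combination (-mu ρ ^ (l + 1)) * h1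
      · rw [Fin.val_castSucc, Fin.val_succ, pow_succ]
        field_simp
      · linear_combination (-mu ρ ^ (l + 1)) * h2

section Recursion

/-- Tensoring a vector with a basis vector of the last factor. -/
def snocExt {n : ℕ} (t : Bool) : ((Fin n → Bool) → ℂ) →ₗ[ℂ] ((Fin (n + 1) → Bool) → ℂ) where
  toFun f s := if s (Fin.last n) = t then f (Fin.init s) else 0
  map_add' f g := by
    funext s
    simp only [Pi.add_apply]
    split_ifs <;> simp
  map_smul' c f := by
    funext s
    simp only [Pi.smul_apply, RingHom.id_apply]
    split_ifs <;> simp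

theorem snocExt_snoc {n : ℕ} (t t' : Bool) (f : (Fin n → Bool) → ℂ) (x : Fin n → Bool) :
    snocExt t f (Fin.snoc x t' : Fin (n + 1) → Bool) = if t' = t then f x else 0 := by
  change (if (Fin.snoc x t' : Fin (n + 1) → Bool) (Fin.last n) = t then
    f (Fin.init (Fin.snoc x t' : Fin (n + 1) → Bool)) else 0) = _
  rw [Fin.snoc_last, Fin.init_snoc]

theorem dotProduct_snocExt_add {n : ℕ} (f f' g g' : (Fin n → Bool) → ℂ) :
    dotProduct (snocExt true f + snocExt false f') (snocExt true g + snocExt false g') =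
      dotProduct f g + dotProduct f' g' := by
  unfold dotProduct
  rw [sum_snoc]
  simp [snocExt_snoc]

theorem psi_raise (ρ : ℂ) (n l : ℕ) (d : LowerHalf n l) :
    psi ρ (raise n l d) = snocExt true (lowerPsi ρ n l d) := by
  funext s
  induction s using snoc_induction with
  | h x t =>
    rw [snocExt_snoc]
    cases t with
    | true => rw [psi_raise_true, if_pos rfl]
    | false => rw [psi_raise_false, if_neg (by simp)]

theorem psi_bend {ρ : ℂ} (hρ : ρ ≠ 0) {n l : ℕ} (d : HalfOne n (l + 1)) :
    psi ρ (bend d) = snocExt true (ρ ^ (-2 : ℤ) • (ampMat ρ d.1).mulVec (minusAt (Fin.last l))) +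
      snocExt false (ρ ^ (2 : ℤ) • psi ρ d) := by
  funext s
  induction s using snoc_induction with
  | h x t =>
    rw [Pi.add_apply, snocExt_snoc, snocExt_snoc]
    cases t with
    | true => simp [psi_bend_true hρ]
    | false => simp [psi_bend_false hρ]

/-- Modulo `lowerSpan`, the singular vector `chain` with one negative sign is `quantumInt ρ l` times
the state with the negative sign in the last place, up to a power of `μ`. -/
theorem mulVec_chain_sub_mem {ρ : ℂ} (hρ : ρ ≠ 0) {n l : ℕ} (d : HalfOne n (l + 1)) :
    mu ρ ^ l • (ampMat ρ d.1).mulVec (chain (mu ρ) (l + 1) 1) -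
      quantumInt ρ l • (ampMat ρ d.1).mulVec (minusAt (Fin.last l)) ∈ lowerSpan ρ n l := by
  have h : mu ρ ^ l • chain (mu ρ) (l + 1) 1 - quantumInt ρ l • minusAt (Fin.last l) ∈
      lowerSpan ρ (l + 1) l := by
    have h1 := Submodule.sum_mem (lowerSpan ρ (l + 1) l) (t := Finset.univ)
      fun (i : Fin (l + 1)) _ => Submodule.smul_mem _ (mu ρ ^ (i : ℕ)) (minusAt_sub_mem hρ l i)
    convert h1 using 1
    simp only [smul_sub, Finset.sum_sub_distrib, smul_smul]
    rw [chain_one, Finset.smul_sum, quantumInt, Finset.sum_range, Finset.sum_smul]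
    congr 1
    · refine Finset.sum_congr rfl fun i _ => ?_
      rw [smul_smul, mul_comm]
    · refine Finset.sum_congr rfl fun i _ => ?_
      rw [← pow_mul, ← pow_add, two_mul]
  have h2 := mulVec_mem_lowerSpan hρ d.1 h
  rwa [Matrix.mulVec_sub, Matrix.mulVec_smul, Matrix.mulVec_smul] at h2

/-- The vector of a bent half-diagram, corrected to be orthogonal to the half-diagrams that end
in a line. -/
noncomputable def bentVec (ρ : ℂ) {n l : ℕ} (d : HalfOne n (l + 1)) : (Fin (n + 1) → Bool) → ℂ :=
  snocExt true (mu ρ ^ l • (ampMat ρ d.1).mulVec (chain (mu ρ) (l + 1) 1)) +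
    snocExt false ((ρ ^ (4 : ℤ) * quantumInt ρ l) • psi ρ d)

/-- Passing to `bentVec` is a triangular change of basis as long as `quantumInt ρ l` does not
vanish. -/
theorem bentVec_eq {ρ : ℂ} (hρ : ρ ≠ 0) {n l : ℕ} (d : HalfOne n (l + 1)) :
    ∃ y ∈ lowerSpan ρ n l,
      bentVec ρ d = (ρ ^ (2 : ℤ) * quantumInt ρ l) • psi ρ (bend d) + snocExt true y := by
  refine ⟨_, mulVec_chain_sub_mem hρ d, ?_⟩
  have h1 : ρ ^ (2 : ℤ) * ρ ^ (-2 : ℤ) = 1 := by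
    rw [← zpow_add₀ hρ]
    simp
  have h2 : ρ ^ (4 : ℤ) = ρ ^ (2 : ℤ) * ρ ^ (2 : ℤ) := by
    rw [← zpow_add₀ hρ]
    norm_num
  rw [psi_bend hρ, bentVec, map_sub, map_smul, map_smul, map_smul, map_smul, map_smul, h2]
  match_scalars
  · ring
  · ring
  · linear_combination -quantumInt ρ l * h1

theorem psi_raise_dotProduct_bentVec {ρ : ℂ} (hρ : ρ ≠ 0) {n l : ℕ} (d : LowerHalf n l)
    (d' : HalfOne n (l + 1)) : dotProduct (psi ρ (raise n l d)) (bentVec ρ d') = 0 := by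
  have h0 : psi ρ (raise n l d) = snocExt true (lowerPsi ρ n l d) + snocExt false 0 := by
    rw [psi_raise, map_zero, add_zero]
  rw [h0, bentVec, dotProduct_snocExt_add, zero_dotProduct, add_zero, dotProduct_smul]
  cases l with
  | zero => exact d.elim
  | succ l =>
    have h1 : dotProduct ((ampMat ρ (show HalfOne n l from d).1).mulVec (plus _))
        ((ampMat ρ d'.1).mulVec (chain (mu ρ) (l + 2) 1)) = 0 := by
      rw [dotProduct_ampMat hρ, (singular_chain hρ (l + 2) 1).mulVec_eq_zero hρ, dotProduct_zero,
        mul_zero]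
      intro h
      have := h.card_le
      simp at this
    rw [smul_eq_mul]
    exact mul_eq_zero_of_right _ h1

/-- The corrected bent half-diagrams reproduce the Gram matrix of the cell module with one defect
more, up to the factor that can vanish at a root of unity. -/
theorem dotProduct_bentVec {ρ : ℂ} (hρ : ρ ≠ 0) {n l : ℕ} (d d' : HalfOne n (l + 1)) :
    dotProduct (bentVec ρ d) (bentVec ρ d') =
      ρ ^ (8 : ℤ) * quantumInt ρ l * quantumInt ρ (l + 1) * dotProduct (psi ρ d) (psi ρ d') := by
  have h1 : dotProduct ((ampMat ρ d.1).mulVec (chain (mu ρ) (l + 1) 1))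
      ((ampMat ρ d'.1).mulVec (chain (mu ρ) (l + 1) 1)) =
      dotProduct (psi ρ d) (psi ρ d') * quantumInt ρ l := by
    rw [(singular_chain hρ (l + 1) 1).dotProduct_mulVec hρ, dotProduct_chain_one]
    rfl
  have h2 : ρ ^ (4 : ℤ) * ρ ^ (4 : ℤ) = ρ ^ (8 : ℤ) := by
    rw [← zpow_add₀ hρ]
    norm_num
  have h3 : ρ ^ (8 : ℤ) * mu ρ ^ 2 = 1 := by
    unfold mu
    rw [neg_sq, ← zpow_natCast, ← zpow_mul, ← zpow_add₀ hρ]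
    norm_num
  have h4 : quantumInt ρ (l + 1) = quantumInt ρ l + (mu ρ ^ 2) ^ (l + 1) := by
    unfold quantumInt
    rw [Finset.sum_range_succ _ (l + 1)]
  rw [bentVec, bentVec, dotProduct_snocExt_add]
  simp only [dotProduct_smul, smul_dotProduct, smul_eq_mul]
  rw [h1, h4, pow_succ (mu ρ ^ 2), ← pow_mul, mul_comm 2 l, pow_mul, sq (mu ρ ^ l)]
  linear_combination (quantumInt ρ l ^ 2 * dotProduct (psi ρ d) (psi ρ d')) * h2 -
    (mu ρ ^ l * mu ρ ^ l * quantumInt ρ l * dotProduct (psi ρ d) (psi ρ d')) * h3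

/-- The dimension of the radical of a cell module in one colour. -/
noncomputable def defect (ρ : ℂ) (n l : ℕ) : ℕ := nullity (gram (psi ρ : HalfOne n l → _))

theorem snocExt_mem {ρ : ℂ} {n l : ℕ} {y : (Fin n → Bool) → ℂ} (hy : y ∈ lowerSpan ρ n l) :
    snocExt true y ∈ Submodule.span ℂ (Set.range fun d => psi ρ (raise n l d)) := by
  have h := Submodule.mem_map_of_mem (f := snocExt true) hy
  unfold lowerSpan at h
  rw [Submodule.map_span, ← Set.range_comp] at h
  convert h using 3
  funext d
  exact psi_raise ρ n l d

theorem span_raise_bentVec {ρ : ℂ} (hρ : ρ ≠ 0) {n l : ℕ} (hl : quantumInt ρ l ≠ 0) :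
    Submodule.span ℂ (Set.range
      (Sum.elim (fun d => psi ρ (raise n l d)) (bentVec ρ : HalfOne n (l + 1) → _))) =
      Submodule.span ℂ (Set.range (psi ρ : HalfOne (n + 1) l → _)) := by
  have hC : ρ ^ (2 : ℤ) * quantumInt ρ l ≠ 0 := mul_ne_zero (zpow_ne_zero _ hρ) hl
  refine le_antisymm (Submodule.span_le.2 ?_) (Submodule.span_le.2 ?_)
  · rintro _ ⟨d | d, rfl⟩
    · exact Submodule.subset_span ⟨_, rfl⟩
    · obtain ⟨y, hy, h⟩ := bentVec_eq hρ d
      change bentVec ρ d ∈ _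
      rw [h]
      refine Submodule.add_mem _ (Submodule.smul_mem _ _ (Submodule.subset_span ⟨_, rfl⟩)) ?_
      refine Submodule.span_mono ?_ (snocExt_mem hy)
      rintro _ ⟨d', rfl⟩
      exact ⟨_, rfl⟩
  · rintro _ ⟨d, rfl⟩
    obtain ⟨d, rfl⟩ := (halfEquiv n l).surjective d
    rcases d with d | d
    · exact Submodule.subset_span ⟨Sum.inl d, rfl⟩
    · obtain ⟨y, hy, h⟩ := bentVec_eq hρ d
      have h' : psi ρ (bend d) =
          (ρ ^ (2 : ℤ) * quantumInt ρ l)⁻¹ • (bentVec ρ d - snocExt true y) := by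
        rw [h, add_sub_cancel_right, smul_smul, inv_mul_cancel₀ hC, one_smul]
      change psi ρ (bend d) ∈ _
      rw [h']
      refine Submodule.smul_mem _ _ (Submodule.sub_mem _ (Submodule.subset_span ⟨Sum.inr d, rfl⟩) ?_)
      refine Submodule.span_mono ?_ (snocExt_mem hy)
      rintro _ ⟨d', rfl⟩
      exact ⟨Sum.inl d', rfl⟩

/-- The half-diagrams on `n + 1` nodes that end in a line and the corrected bent ones span
orthogonal complements. The Gram matrix of the former is that for `l - 1` defects on `n` nodes, and
that of the latter is a multiple of the one for `l + 1` defects, the factor being zero exactly if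
`quantumInt ρ (l + 1)` is. -/
theorem defect_succ {ρ : ℂ} (hρ : ρ ≠ 0) {n l : ℕ} (hl : quantumInt ρ l ≠ 0) :
    defect ρ (n + 1) l = nullity (gram (lowerPsi ρ n l)) +
      if quantumInt ρ (l + 1) = 0 then Fintype.card (HalfOne n (l + 1))
      else defect ρ n (l + 1) := by
  have hind : LinearIndependent ℂ
      (Sum.elim (fun d => psi ρ (raise n l d)) (bentVec ρ : HalfOne n (l + 1) → _)) :=
    linearIndependent_snoc (linearIndependent_lowerPsi (linearIndependent_psi hρ n) l)
      (linearIndependent_psi hρ n (l + 1)) (mul_ne_zero (zpow_ne_zero 4 hρ) hl)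
      (psi_raise_true ρ n l) (psi_raise_false ρ n l) fun d x => by
        unfold bentVec
        simp [snocExt_snoc]
  unfold defect
  rw [← finrank_radical (linearIndependent_psi hρ (n + 1) l), ← span_raise_bentVec hρ hl,
    finrank_radical hind, nullity_gram_sum _ _ (psi_raise_dotProduct_bentVec hρ)]
  have h1 : gram (fun d => psi ρ (raise n l d)) = gram (lowerPsi ρ n l) := by
    funext d d'
    have h := dotProduct_snocExt_add (lowerPsi ρ n l d) 0 (lowerPsi ρ n l d') 0
    rw [map_zero, add_zero, add_zero, zero_dotProduct, add_zero] at h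
    refine Eq.trans ?_ h
    rw [← psi_raise, ← psi_raise]
    rfl
  have h2 : gram (bentVec ρ : HalfOne n (l + 1) → _) =
      (ρ ^ (8 : ℤ) * quantumInt ρ l * quantumInt ρ (l + 1)) • gram (psi ρ) := by
    funext d d'
    exact dotProduct_bentVec hρ d d'
  rw [h1, h2]
  congr 1
  split_ifs with h
  · rw [h, mul_zero, zero_smul, nullity_zero]
  · exact nullity_smul (mul_ne_zero (mul_ne_zero (zpow_ne_zero _ hρ) hl) h) _

theorem defect_low_zero (ρ : ℂ) (n : ℕ) : nullity (gram (lowerPsi ρ n 0)) = 0 := by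
  have : IsEmpty (LowerHalf n 0) := inferInstanceAs (IsEmpty Empty)
  unfold nullity
  exact Module.finrank_zero_of_subsingleton

theorem defect_low_succ (ρ : ℂ) (n l : ℕ) :
    nullity (gram (lowerPsi ρ n (l + 1))) = defect ρ n l := rfl

end Recursion

/-! ### Gaussian binomials at roots of unity -/

section Gauss

theorem gauss_succ (ζ : ℂ) (N j : ℕ) :
    gauss ζ (N + 1) (j + 1) = gauss ζ N (j + 1) + ζ ^ N * gauss ζ N j := rfl

theorem gauss_succ' (ζ : ℂ) (N j : ℕ) :
    gauss ζ (N + 1) (j + 1) = ζ ^ (j + 1) * gauss ζ N (j + 1) + ζ ^ j * gauss ζ N j := by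
  induction N generalizing j with
  | zero => cases j <;> simp [gauss]
  | succ N ih =>
    cases j with
    | zero =>
      have h := ih 0
      have h' := gauss_succ ζ N 0
      rw [gauss_succ ζ (N + 1)]
      rw [gauss_zero] at h h' ⊢
      linear_combination h - ζ * h'
    | succ j =>
      rw [gauss_succ ζ (N + 1)]
      linear_combination ih (j + 1) + ζ ^ (N + 1) * ih j - ζ ^ (j + 2) * gauss_succ ζ N (j + 1) -
        ζ ^ (j + 1) * gauss_succ ζ N j

/-- The relation between consecutive coefficients of the `q`-binomial theorem. -/
theorem gauss_ratio (ζ : ℂ) (N j : ℕ) :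
    (ζ ^ (j + 1) - 1) * gauss ζ N (j + 1) = (ζ ^ N - ζ ^ j) * gauss ζ N j := by
  have h := gauss_succ' ζ N j
  rw [gauss_succ] at h
  linear_combination -h

variable {ζ : ℂ} {L : ℕ}

theorem pow_ne_one_of_lt_orderOf' {j : ℕ} (hj : j + 1 < orderOf ζ) : ζ ^ (j + 1) - 1 ≠ 0 :=
  sub_ne_zero.2 (pow_ne_one_of_lt_orderOf (Nat.succ_ne_zero j) hj)

theorem gauss_of_dvd {N : ℕ} (hN : ζ ^ (N + 1) = 1) {j : ℕ} (hj : j < orderOf ζ) :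
    gauss ζ N j = (-ζ ^ N) ^ j := by
  induction j with
  | zero => rw [gauss_zero, pow_zero]
  | succ j ih =>
    refine mul_left_cancel₀ (pow_ne_one_of_lt_orderOf' hj) ?_
    rw [gauss_ratio, ih (Nat.lt_of_succ_lt hj)]
    have h1 : ζ ^ N - ζ ^ j = -ζ ^ N * (ζ ^ (j + 1) - 1) := by
      linear_combination ζ ^ j * hN
    rw [h1]
    ring

theorem gauss_eq_zero {N r : ℕ} (hr : ζ ^ N = ζ ^ r) {j : ℕ} (hrj : r < j) (hj : j < orderOf ζ) :
    gauss ζ N j = 0 := by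
  induction j with
  | zero => omega
  | succ j ih =>
    refine mul_left_cancel₀ (pow_ne_one_of_lt_orderOf' hj) ?_
    rw [gauss_ratio, mul_zero]
    rcases Nat.lt_succ_iff_lt_or_eq.1 hrj with h | rfl
    · rw [ih h (Nat.lt_of_succ_lt hj), mul_zero]
    · rw [hr, sub_self, zero_mul]

/-- At a root of unity whose order is the lower index, the coefficient is, up to sign, the number of
complete blocks of that length among `N` nodes. -/
theorem gauss_orderOf (hL : orderOf ζ = L + 1) (N : ℕ) :
    gauss ζ N (L + 1) = (-1) ^ L * (N / (L + 1) : ℕ) := by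
  have hone : ζ ^ (L + 1) = 1 := hL ▸ pow_orderOf_eq_one ζ
  induction N with
  | zero => simp [gauss]
  | succ N ih =>
    rw [gauss, ih, Nat.succ_div]
    split_ifs with h
    · have hN : ζ ^ (N + 1) = 1 := orderOf_dvd_iff_pow_eq_one.1 (hL ▸ h)
      rw [gauss_of_dvd hN (by omega), neg_pow (ζ ^ N)]
      have : ζ ^ N * (ζ ^ N) ^ L = 1 := by
        rw [← pow_mul, ← pow_add, show N + N * L = (L + 1) * N by ring, pow_mul, hone, one_pow]
      push_cast
      linear_combination (-1) ^ L * this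
    · have hr : ζ ^ N = ζ ^ (N % (L + 1)) := by rw [← hL, pow_mod_orderOf]
      have hlt : N % (L + 1) < L := by
        have h1 : N % (L + 1) < L + 1 := Nat.mod_lt N (Nat.succ_pos L)
        have h2 : N % (L + 1) ≠ L := by
          intro h2
          apply h
          have h3 := Nat.div_add_mod N (L + 1)
          exact ⟨N / (L + 1) + 1, by rw [mul_add]; omega⟩
        omega
      rw [gauss_eq_zero hr hlt (by omega)]
      simp

/-- A singular vector in the radical of a critical cell module would make all these coefficients
vanish. For `j = 1` this forces the order of `ζ` to divide `k`, and for `j` equal to this order the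
coefficient is a nonzero integer. -/
theorem gauss_contradiction {l k : ℕ} (hk : 1 ≤ k)
    (hl : orderOf ζ = 0 ∨ orderOf ζ ∣ l + 1)
    (h : ∀ j, 1 ≤ j → j ≤ k → gauss ζ (l + k + j) j = 0) : False := by
  have h1 := h 1 le_rfl hk
  rw [gauss_one] at h1
  have hpow : ζ ^ (l + k + 1) = 1 := by
    have := geom_sum_mul ζ (l + k + 1)
    rw [h1, zero_mul] at this
    exact (sub_eq_zero.1 this.symm)
  have hdvd := orderOf_dvd_of_pow_eq_one hpow
  have hpos : orderOf ζ ≠ 0 := fun h0 => by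
    rw [h0, zero_dvd_iff] at hdvd
    omega
  have hl' := hl.resolve_left hpos
  have hk' : orderOf ζ ∣ k := by
    have : l + k + 1 = (l + 1) + k := by ring
    rw [this] at hdvd
    exact (Nat.dvd_add_right hl').1 hdvd
  obtain ⟨L, hL⟩ := Nat.exists_eq_succ_of_ne_zero hpos
  have h2 := h (L + 1) (by omega) (by rw [← Nat.succ_eq_add_one, ← hL]; exact Nat.le_of_dvd hk hk')
  rw [gauss_orderOf hL] at h2
  have h3 : L + 1 ≤ l + k + (L + 1) := by omega
  have h4 : 0 < (l + k + (L + 1)) / (L + 1) := Nat.div_pos h3 (Nat.succ_pos L)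
  rcases mul_eq_zero.1 h2 with h5 | h5
  · exact pow_ne_zero L (by norm_num) h5
  · exact h4.ne' (Nat.cast_eq_zero.1 h5)

end Gauss

/-! ### Uniqueness of singular vectors -/

/-- The number of negative signs. -/
def minuses {N : ℕ} (s : Fin N → Bool) : ℕ := ∑ i, if s i then 0 else 1

/-- The nonzero values of the vectors `chain`. -/
noncomputable def chainWt (μ : ℂ) {N : ℕ} (s : Fin N → Bool) : ℂ :=
  ∏ i, if s i then 1 else μ ^ (i : ℕ)

theorem chain_eq (μ : ℂ) (N k : ℕ) (s : Fin N → Bool) :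
    chain μ N k s = if minuses s = k then chainWt μ s else 0 := by
  have h : chainPoly μ s = Polynomial.C (chainWt μ s) * Polynomial.X ^ minuses s := by
    unfold chainPoly chainWt minuses
    rw [← Finset.prod_pow_eq_pow_sum, map_prod, ← Finset.prod_mul_distrib]
    refine Finset.prod_congr rfl fun i _ => ?_
    cases s i <;> simp
  unfold chain
  rw [h, Polynomial.coeff_C_mul_X_pow]
  simp only [eq_comm]

/-- Amplitudes conserve the total sign, so vectors of the cell module with `l` defects live on
states with a fixed number of negative signs. -/
theorem minuses_of_mem {ρ : ℂ} {n l : ℕ} {f : (Fin n → Bool) → ℂ}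
    (hf : f ∈ cellSpan ρ (Fin n) l) {s : Fin n → Bool} (hs : f s ≠ 0) :
    l + 2 * minuses s = n := by
  have hsum : ∑ i, sgn (s i) = n - 2 * (minuses s : ℤ) := by
    have h : ∀ i, sgn (s i) = 1 - 2 * (if s i then 0 else 1 : ℤ) := fun i => by
      cases s i <;> rfl
    simp only [h, Finset.sum_sub_distrib, ← Finset.mul_sum]
    simp [minuses]
  have key : (∑ i, sgn (s i) = l) ∨ f s = 0 := by
    refine Submodule.span_induction (p := fun f _ => (∑ i, sgn (s i) = l) ∨ f s = 0)
      ?_ (Or.inr rfl) ?_ ?_ hf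
    · rintro _ ⟨d, rfl⟩
      by_cases h : amp (fun _ => ρ) d s (fun _ => true) = 0
      · right
        exact (ampMat_mulVec_plus ρ d s).trans h
      · left
        rw [sum_sgn_of_amp_ne_zero h]
        simp [sgn]
    · rintro f g _ _ (h | h) (h' | h')
      · exact Or.inl h
      · exact Or.inl h
      · exact Or.inl h'
      · right
        rw [Pi.add_apply, h, h', add_zero]
    · rintro c f _ (h | h)
      · exact Or.inl h
      · right
        rw [Pi.smul_apply, h, smul_zero]
  have := key.resolve_right hs
  omega

/-- The values of a singular vector at neighbouring states determine each other. -/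
theorem Singular.swap {ρ : ℂ} (hρ : ρ ≠ 0) {N : ℕ} {f : (Fin (N + 1) → Bool) → ℂ}
    (hf : Singular ρ f) (i : Fin N) (s : Fin (N + 1) → Bool) :
    f (s ∘ Equiv.swap i.castSucc i.succ) * chainWt (mu ρ) s =
      f s * chainWt (mu ρ) (s ∘ Equiv.swap i.castSucc i.succ) := by
  have hadj := adjacent_castSucc i
  set s' := s ∘ Equiv.swap i.castSucc i.succ with hs'
  have hl : s' i.castSucc = s i.succ := by simp [hs']
  have hr : s' i.succ = s i.castSucc := by simp [hs']
  have hrest : ∀ y : Rest i.castSucc i.succ, s' y.1 = s y.1 := fun y => by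
    simp [hs', Equiv.swap_apply_of_ne_of_ne y.2.1 y.2.2]
  by_cases h : s i.succ = s i.castSucc
  · have : s' = s := by
      funext y
      by_cases h1 : y = i.castSucc
      · rw [h1, hl, h]
      · by_cases h2 : y = i.succ
        · rw [h2, hr, h]
        · exact hrest ⟨y, h1, h2⟩
    rw [this]
  have h : s i.succ = !s i.castSucc := by
    cases h1 : s i.succ <;> cases h2 : s i.castSucc <;> simp_all
  set x : Rest i.castSucc i.succ → Bool := fun y => s y.1 with hx
  have e : s = extState x (s i.castSucc) := eq_extState hadj.lt s h
  have e' : s' = extState x (!s i.castSucc) := by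
    have h1 := eq_extState hadj.lt s' (by rw [hr, hl, h, Bool.not_not])
    rw [hl, h] at h1
    rw [h1, hx]
    congr 1
    exact funext hrest
  have hsing := (singular_iff hρ f).1 hf _ _ _ hadj x
  rw [Fintype.sum_bool] at hsing
  have hwt : ∀ t, chainWt (mu ρ) (extState x t) = mu ρ ^ (i : ℕ) * (if t then mu ρ else 1) *
      ∏ y : Rest i.castSucc i.succ, if x y then 1 else mu ρ ^ (y.1 : ℕ) := by
    intro t
    unfold chainWt
    rw [prod_rest hadj.lt.ne, extState_left, extState_right hadj.lt]
    congr 1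
    · cases t <;> simp [pow_succ]
    · exact Finset.prod_congr rfl fun y _ => by rw [extState_rest]
  have hrel : f (extState x false) * mu ρ = f (extState x true) := by
    have h1 := rho_zpow hρ
    refine mul_left_cancel₀ (zpow_ne_zero (2 : ℤ) hρ) ?_
    have h2 : ρ ^ (2 : ℤ) * f (extState x true) + ρ ^ (-2 : ℤ) * f (extState x false) = 0 := hsing
    linear_combination f (extState x false) * h1 - h2
  rw [e', e, extState_left, hwt, hwt]
  generalize (∏ y : Rest i.castSucc i.succ, if x y then (1 : ℂ) else mu ρ ^ (y.1 : ℕ)) = R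
  cases s i.castSucc with
  | false =>
    simp only [Bool.not_false, if_true, Bool.false_eq_true, if_false]
    linear_combination (-mu ρ ^ (i : ℕ) * R) * hrel
  | true =>
    simp only [Bool.not_true, if_true, Bool.false_eq_true, if_false]
    linear_combination (mu ρ ^ (i : ℕ) * R) * hrel

/-- The ratio of a singular vector to the vector `chain` is invariant under all permutations of the
nodes, as these are generated by swaps of neighbours. -/
theorem Singular.perm {ρ : ℂ} (hρ : ρ ≠ 0) {N : ℕ} {f : (Fin N → Bool) → ℂ}
    (hf : Singular ρ f) (σ : Equiv.Perm (Fin N)) (s : Fin N → Bool) :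
    f (s ∘ σ) * chainWt (mu ρ) s = f s * chainWt (mu ρ) (s ∘ σ) := by
  cases N with
  | zero =>
    have : s ∘ σ = s := funext fun i => i.elim0
    rw [this]
  | succ N =>
    have hwt : ∀ s : Fin (N + 1) → Bool, chainWt (mu ρ) s ≠ 0 := fun s =>
      Finset.prod_ne_zero_iff.2 fun i _ => by
        split_ifs
        · exact one_ne_zero
        · exact pow_ne_zero _ (mu_ne_zero hρ)
    have hσ : σ ∈ Submonoid.closure
        (Set.range fun i : Fin N => Equiv.swap i.castSucc i.succ) := by
      rw [Equiv.Perm.mclosure_swap_castSucc_succ]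
      exact Submonoid.mem_top σ
    induction hσ using Submonoid.closure_induction generalizing s with
    | mem σ h =>
      obtain ⟨i, rfl⟩ := h
      exact hf.swap hρ i s
    | one => rfl
    | mul σ τ _ _ h1 h2 =>
      refine mul_left_cancel₀ (hwt (s ∘ σ)) ?_
      have e1 := h1 s
      have e2 := h2 (s ∘ σ)
      rw [Equiv.Perm.coe_mul, ← Function.comp_assoc]
      linear_combination chainWt (mu ρ) s * e2 + chainWt (mu ρ) ((s ∘ σ) ∘ τ) * e1

theorem exists_perm_of_minuses_eq {N : ℕ} {s s' : Fin N → Bool} (h : minuses s = minuses s') :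
    ∃ σ : Equiv.Perm (Fin N), s' = s ∘ σ := by
  have hc : ∀ s : Fin N → Bool, Fintype.card {i // s i = false} = minuses s := by
    intro s
    rw [Fintype.card_subtype, Finset.card_filter]
    refine Finset.sum_congr rfl fun i _ => ?_
    cases s i <;> rfl
  have e : {i // s' i = false} ≃ {i // s i = false} :=
    Fintype.equivOfCardEq (by rw [hc, hc, h])
  refine ⟨e.extendSubtype, funext fun i => ?_⟩
  cases hi : s' i with
  | false => exact (e.extendSubtype_mem i hi).symm
  | true =>
    have := e.extendSubtype_not_mem i (by simp [hi])
    exact (eq_true_of_ne_false this).symm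

/-! ### Critical colours -/

/-- The number `l` of defects is critical for `ρ` if the form on each cell module with `l` defects
is nondegenerate because `q ^ (2 * (l + 1)) = 1` or because `q` is not a root of unity. -/
def Critical (ρ : ℂ) (l : ℕ) : Prop := orderOf (mu ρ ^ 2) = 0 ∨ orderOf (mu ρ ^ 2) ∣ l + 1

/-- Up to scalars there is only one singular vector with a given number of negative signs. -/
theorem Singular.exists_eq_smul_chain {ρ : ℂ} (hρ : ρ ≠ 0) {N : ℕ} {f : (Fin N → Bool) → ℂ}
    (hf : Singular ρ f) {s : Fin N → Bool} (hs : ∀ s', f s' ≠ 0 → minuses s' = minuses s) :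
    f = (f s * (chainWt (mu ρ) s)⁻¹) • chain (mu ρ) N (minuses s) := by
  have hwt : chainWt (mu ρ) s ≠ 0 := Finset.prod_ne_zero_iff.2 fun i _ => by
    split_ifs
    · exact one_ne_zero
    · exact pow_ne_zero _ (mu_ne_zero hρ)
  funext s'
  rw [Pi.smul_apply, chain_eq, smul_eq_mul]
  split_ifs with h
  · obtain ⟨σ, rfl⟩ := exists_perm_of_minuses_eq h.symm
    have := hf.perm hρ σ s
    field_simp
    linear_combination this
  · rw [mul_zero]
    by_contra h0
    exact h (hs s' h0)

/-- The component with last sign `-` sees a half-diagram through its bent version. -/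
theorem snoc_false_mem {ρ : ℂ} (hρ : ρ ≠ 0) {n l : ℕ} {f : (Fin (n + 1) → Bool) → ℂ}
    (hf : f ∈ cellSpan ρ (Fin (n + 1)) l) :
    (fun x : Fin n → Bool => f (Fin.snoc x false : Fin (n + 1) → Bool)) ∈
      cellSpan ρ (Fin n) (l + 1) := by
  refine Submodule.span_induction (p := fun f _ => (fun x : Fin n → Bool =>
    f (Fin.snoc x false : Fin (n + 1) → Bool)) ∈ cellSpan ρ (Fin n) (l + 1)) ?_ ?_ ?_ ?_ hf
  · rintro _ ⟨d, rfl⟩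
    have h : (fun x : Fin n → Bool => (ampMat ρ d).mulVec (plus _)
        (Fin.snoc x false : Fin (n + 1) → Bool)) =
        ρ ^ (2 : ℤ) • (ampMat ρ (bendDown d)).mulVec (plus _) := by
      funext x
      rw [Pi.smul_apply, ampMat_mulVec_plus, ampMat_mulVec_plus, amp_bendDown hρ, Bool.not_false,
        snoc_true_true]
      rfl
    change (fun x : Fin n → Bool => (ampMat ρ d).mulVec (plus _)
        (Fin.snoc x false : Fin (n + 1) → Bool)) ∈ _
    rw [h]
    exact Submodule.smul_mem _ _ (Submodule.subset_span ⟨_, rfl⟩)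
  · exact Submodule.zero_mem _
  · intro f g _ _ hf hg
    exact Submodule.add_mem _ hf hg
  · intro c f _ hf
    exact Submodule.smul_mem _ c hf

/-- Cutting off the last nodes, with negative signs on them, turns a singular vector `chain` in a
cell module into shorter ones in the cell modules with more defects. -/
theorem chain_mem {ρ : ℂ} (hρ : ρ ≠ 0) {n j l : ℕ} (i : ℕ)
    (h : chain (mu ρ) (n + i) (j + i) ∈ cellSpan ρ (Fin (n + i)) l) :
    chain (mu ρ) n j ∈ cellSpan ρ (Fin n) (l + i) := by
  induction i generalizing l with
  | zero => exact h
  | succ i ih =>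
    have h1 := snoc_false_mem hρ (n := n + i) h
    have h2 : (fun x : Fin (n + i) → Bool => chain (mu ρ) (n + i + 1) (j + i + 1)
        (Fin.snoc x false : Fin (n + i + 1) → Bool)) =
        mu ρ ^ (n + i) • chain (mu ρ) (n + i) (j + i) :=
      funext fun x => chain_snoc_false _ _ _ x
    have h3 : mu ρ ^ (n + i) • chain (mu ρ) (n + i) (j + i) ∈ cellSpan ρ (Fin (n + i)) (l + 1) :=
      h2 ▸ h1
    have h4 := ih ((Submodule.smul_mem_iff _ (pow_ne_zero _ (mu_ne_zero hρ))).1 h3)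
    rwa [add_assoc, add_comm 1 i] at h4

/-- A critical cell module contains no nonzero singular vector that is orthogonal to it. -/
theorem eq_zero_of_singular {ρ : ℂ} (hρ : ρ ≠ 0) {l : ℕ} (hl : Critical ρ l) {n : ℕ}
    {f : (Fin n → Bool) → ℂ} (hf : f ∈ radical (cellSpan ρ (Fin n) l)) (hs : Singular ρ f) :
    f = 0 := by
  by_contra hne
  obtain ⟨s, hfs⟩ := Function.ne_iff.1 hne
  have hn := minuses_of_mem hf.1 hfs
  have hsupp : ∀ s', f s' ≠ 0 → minuses s' = minuses s := fun s' h => by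
    have := minuses_of_mem hf.1 h
    omega
  have hfc := hs.exists_eq_smul_chain hρ hsupp
  set k := minuses s with hk
  set C := f s * (chainWt (mu ρ) s)⁻¹ with hC
  have hC0 : C ≠ 0 := fun h => hne (by rw [hfc, h, zero_smul])
  have hmem : chain (mu ρ) n k ∈ cellSpan ρ (Fin n) l :=
    (Submodule.smul_mem_iff _ hC0).1 (hfc ▸ hf.1)
  have hself : gauss (mu ρ ^ 2) n k = 0 := by
    have h1 := hf.2 _ hmem
    rw [hfc, dotProduct_smul, dotProduct_chain, smul_eq_mul] at h1
    exact (mul_eq_zero.1 h1).resolve_left hC0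
  rcases Nat.eq_zero_or_pos k with h0 | hpos
  · rw [h0, gauss_zero] at hself
    exact one_ne_zero hself
  · refine gauss_contradiction hpos hl fun j hj hjk => ?_
    clear_value k C
    obtain ⟨i, rfl⟩ := Nat.exists_eq_add_of_le hjk
    have hn' : n = l + (j + i) + j + i := by omega
    subst hn'
    have h1 := chain_mem hρ (n := l + (j + i) + j) i hmem
    rw [← dotProduct_chain]
    exact (singular_chain hρ _ j).dotProduct_cellSpan hρ (by simp; omega) h1

theorem dotProduct_comp {X X' : Type} [Fintype X] [Fintype X'] [DecidableEq X] [DecidableEq X']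
    (e : X' ≃ X) (f g : (X → Bool) → ℂ) :
    dotProduct (fun s : X' → Bool => f (s ∘ e.symm)) (fun s : X' → Bool => g (s ∘ e.symm)) =
      dotProduct f g := by
  unfold dotProduct
  exact (Equiv.arrowCongr e (Equiv.refl Bool)).sum_comp fun s => f s * g s

/-- Contractions map the radical of a cell module to the radical of a smaller cell module. -/
theorem mulVec_mem_radical {ρ : ℂ} (hρ : ρ ≠ 0) {X Y : Type} [LinearOrder X] [LinearOrder Y]
    [Fintype X] [Fintype Y] {l : ℕ} (d : Diagram 1 X Y) {f : (Y → Bool) → ℂ}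
    (hf : f ∈ radical (cellSpan ρ Y l)) : (ampMat ρ d).mulVec f ∈ radical (cellSpan ρ X l) := by
  refine ⟨mulVec_mem_cellSpan hρ d hf.1, fun u hu => ?_⟩
  rw [Matrix.dotProduct_mulVec, ← Matrix.mulVec_transpose, ampMat_transpose]
  exact hf.2 _ (mulVec_mem_cellSpan hρ d.reflect hu)

theorem comp_mem_radical {ρ : ℂ} {X X' : Type} [LinearOrder X] [LinearOrder X'] [Fintype X]
    [Fintype X'] {l : ℕ} (e : X' ≃o X) {f : (X → Bool) → ℂ} (hf : f ∈ radical (cellSpan ρ X l)) :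
    (fun s : X' → Bool => f (s ∘ e.symm)) ∈ radical (cellSpan ρ X' l) := by
  refine ⟨comp_mem_cellSpan e hf.1, fun u hu => ?_⟩
  have h1 := hf.2 _ (comp_mem_cellSpan e.symm hu)
  rw [← dotProduct_comp e.toEquiv] at h1
  convert h1 using 2
  · funext s
    congr 1
    funext i
    change s i = s (e.symm (e i))
    rw [e.symm_apply_apply]
  · rfl

theorem radical_eq_bot_of_orderIso {ρ : ℂ} {X X' : Type} [LinearOrder X] [LinearOrder X']
    [Fintype X] [Fintype X'] {l : ℕ} (e : X' ≃o X) (h : radical (cellSpan ρ X' l) = ⊥) :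
    radical (cellSpan ρ X l) = ⊥ := by
  rw [eq_bot_iff]
  intro f hf
  have h0 := comp_mem_radical e hf
  rw [h, Submodule.mem_bot] at h0
  rw [Submodule.mem_bot]
  funext x
  have := congrFun h0 (x ∘ e)
  have hx : (x ∘ e) ∘ e.symm = x := funext fun i => congrArg x (e.apply_symm_apply i)
  rwa [hx] at this

theorem card_rest_lt {N : ℕ} (p q : Fin N) : Fintype.card (Rest p q) < N := by
  have := Fintype.card_subtype_lt (p := fun y : Fin N => y ≠ p ∧ y ≠ q) (x := p) (by simp)
  rwa [Fintype.card_fin] at this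

/-- By induction on the number of nodes, all contractions of a vector of the radical vanish, so that
it is singular. -/
theorem radical_eq_bot {ρ : ℂ} (hρ : ρ ≠ 0) {l : ℕ} (hl : Critical ρ l) (N : ℕ) :
    radical (cellSpan ρ (Fin N) l) = ⊥ := by
  induction N using Nat.strong_induction_on with
  | h N ih =>
  rw [eq_bot_iff]
  intro f hf
  have hs : Singular ρ f := by
    intro c p q h
    have := mulVec_mem_radical hρ (cap c h) hf
    rwa [radical_eq_bot_of_orderIso (Fintype.orderIsoFinOfCardEq (Rest p q) rfl)
      (ih _ (card_rest_lt p q)), Submodule.mem_bot] at this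
  exact eq_zero_of_singular hρ hl hf hs

/-- The form on a critical cell module is nondegenerate. -/
theorem defect_of_critical {ρ : ℂ} (hρ : ρ ≠ 0) {l : ℕ} (hl : Critical ρ l) (n : ℕ) :
    defect ρ n l = 0 := by
  unfold defect
  rw [← finrank_radical (linearIndependent_psi hρ n l), span_psi,
    radical_eq_bot hρ hl n, finrank_bot]

/-! ### Reflections of a noncritical number of defects -/

theorem quantumInt_eq_zero {ρ : ℂ} {l : ℕ} (h : quantumInt ρ l = 0) :
    orderOf (mu ρ ^ 2) ∣ l + 1 := by
  have := geom_sum_mul (mu ρ ^ 2) (l + 1)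
  rw [show ∑ i ∈ Finset.range (l + 1), (mu ρ ^ 2) ^ i = 0 from h, zero_mul] at this
  exact orderOf_dvd_of_pow_eq_one (sub_eq_zero.1 this.symm)

theorem quantumInt_eq_zero_iff {ρ : ℂ} (hL : 2 ≤ orderOf (mu ρ ^ 2)) (l : ℕ) :
    quantumInt ρ l = 0 ↔ orderOf (mu ρ ^ 2) ∣ l + 1 := by
  refine ⟨quantumInt_eq_zero, fun h => ?_⟩
  have h1 := geom_sum_mul (mu ρ ^ 2) (l + 1)
  rw [orderOf_dvd_iff_pow_eq_one.1 h, sub_self] at h1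
  refine (mul_eq_zero.1 h1).resolve_right fun h2 => ?_
  rw [sub_eq_zero] at h2
  rw [h2, orderOf_one] at hL
  omega

theorem card_halfOne_of_lt {n l : ℕ} (h : n < l) : Fintype.card (HalfOne n l) = 0 :=
  Fintype.card_eq_zero_iff.2 ⟨fun d => not_le.2 h d.le⟩

theorem ampMat_self (ρ : ℂ) {n : ℕ} {d : Diagram 1 (Fin n) (Fin n)} (hd : NoCap d) :
    ampMat ρ d = 1 := by
  ext x y
  rw [Matrix.one_apply]
  exact amp_of_vertical _ (hd.partner_eq_self fun _ => Subsingleton.elim _ _) x y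

theorem halfOne_self_eq {n : ℕ} (d d' : HalfOne n n) : d = d' := by
  have h := fun d : HalfOne n n => d.2.partner_eq_self fun _ => Subsingleton.elim _ _
  refine Subtype.ext (ext_one fun p => ?_)
  rcases p with p | p
  · rw [Diagram.partner_comm (h d p), Diagram.partner_comm (h d' p)]
  · rw [h d, h d']

theorem gram_self (ρ : ℂ) {n : ℕ} (d d' : HalfOne n n) : gram (psi ρ) d d' = 1 := by
  change dotProduct (psi ρ d) (psi ρ d') = 1
  rw [halfOne_self_eq d' d, psi, ampMat_self ρ d.2, Matrix.one_mulVec, dotProduct_plus_plus]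

/-- With as many defects as nodes there is only the identity diagram, of norm `1`. -/
theorem defect_self (ρ : ℂ) (n : ℕ) : defect ρ n n = 0 := by
  have h : LinearMap.ker (gram (psi ρ : HalfOne n n → _)).mulVecLin = ⊥ := by
    rw [eq_bot_iff]
    intro c hc
    have hc : (gram (psi ρ : HalfOne n n → _)).mulVec c = 0 := hc
    rw [Submodule.mem_bot]
    funext d
    have h1 := congrFun hc d
    change ∑ d', gram (psi ρ) d d' * c d' = 0 at h1
    rw [Finset.sum_eq_single d (fun d' _ h => absurd (halfOne_self_eq d' d) h)
      (fun h => absurd (Finset.mem_univ d) h), gram_self, one_mul] at h1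
    exact h1
  unfold defect nullity
  rw [h, finrank_bot]

/-- The cell modules for `l` and its reflection `l + 2 * t` have radicals whose dimensions add up
to the dimension of the second one. -/
theorem defect_add {ρ : ℂ} (hρ : ρ ≠ 0) (n : ℕ) : ∀ l t : ℕ, 0 < t → t < orderOf (mu ρ ^ 2) →
    orderOf (mu ρ ^ 2) ∣ l + t + 1 →
      defect ρ n l + defect ρ n (l + 2 * t) = Fintype.card (HalfOne n (l + 2 * t)) := by
  set L := orderOf (mu ρ ^ 2) with hLdef
  induction n with
  | zero =>
    intro l t ht htL hd
    rw [card_halfOne_of_lt (by omega)]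
    have hle : ∀ n l, defect ρ n l ≤ Fintype.card (HalfOne n l) := fun n l => by
      unfold defect nullity
      have := Submodule.finrank_le (LinearMap.ker (gram (psi ρ : HalfOne n l → _)).mulVecLin)
      rwa [Module.finrank_fintype_fun_eq_card] at this
    have h1 := hle 0 (l + 2 * t)
    rw [card_halfOne_of_lt (by omega)] at h1
    have h2 : defect ρ 0 l = 0 := by
      rcases Nat.eq_zero_or_pos l with rfl | hl
      · exact defect_self ρ 0
      · have := hle 0 l
        rw [card_halfOne_of_lt hl] at this
        omega
    omega
  | succ n ih =>
    intro l t ht htL hd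
    have hL : 2 ≤ orderOf (mu ρ ^ 2) := by omega
    have key : ∀ l t, 0 < t → t < L → L ∣ l + t + 1 → ¬ L ∣ l + 1 := fun l t h1 h2 h3 h4 => by
      have : l + t + 1 = (l + 1) + t := by ring
      rw [this] at h3
      exact absurd (Nat.le_of_dvd h1 ((Nat.dvd_add_right h4).1 h3)) (by omega)
    have key' : ∀ l t, 0 < t → t < L → L ∣ l + t + 1 → ¬ L ∣ l + 2 * t + 1 := fun l t h1 h2 h3 h4 => by
      have : l + 2 * t + 1 = (l + t + 1) + t := by ring
      rw [this] at h4
      exact absurd (Nat.le_of_dvd h1 ((Nat.dvd_add_right h3).1 h4)) (by omega)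
    have hΓ := fun l => quantumInt_eq_zero_iff hL l
    have e1 := defect_succ hρ (n := n) (l := l) (fun h => key l t ht htL hd ((hΓ l).1 h))
    have e2 := defect_succ hρ (n := n) (l := l + 2 * t)
      (fun h => key' l t ht htL hd ((hΓ _).1 h))
    rw [e1, e2, card_halfOne_succ]
    simp only [hΓ, ← hLdef]
    -- the pair `(l + 1, l + 2 * t - 1)`
    have inner : (if L ∣ l + 1 + 1 then Fintype.card (HalfOne n (l + 1)) else defect ρ n (l + 1)) +
        nullity (gram (lowerPsi ρ n (l + 2 * t))) = Fintype.card (LowerHalf n (l + 2 * t)) := by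
      obtain ⟨t, rfl⟩ := Nat.exists_eq_succ_of_ne_zero ht.ne'
      have h2 : l + 2 * (t + 1) = (l + 2 * t + 1) + 1 := by ring
      change (if L ∣ l + 1 + 1 then Fintype.card (HalfOne n (l + 1)) else defect ρ n (l + 1)) +
        nullity (gram (lowerPsi ρ n (l + 2 * (t + 1)))) =
          Fintype.card (LowerHalf n (l + 2 * (t + 1)))
      rw [h2, defect_low_succ]
      change _ = Fintype.card (HalfOne n (l + 2 * t + 1))
      have hd' : L ∣ (l + 1) + t + 1 := by convert hd using 1; omega
      rcases Nat.eq_zero_or_pos t with rfl | ht'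
      · have hc : L ∣ l + 1 + 1 := hd'
        rw [if_pos hc, mul_zero, add_zero, defect_of_critical hρ (Or.inr hc), add_zero]
      · rw [if_neg (key _ t ht' (by omega) hd')]
        have := ih (l + 1) t ht' (by omega) hd'
        rwa [show l + 1 + 2 * t = l + 2 * t + 1 by ring] at this
    -- the pair `(l - 1, l + 2 * t + 1)`
    have outer : nullity (gram (lowerPsi ρ n l)) +
        (if L ∣ l + 2 * t + 1 + 1 then Fintype.card (HalfOne n (l + 2 * t + 1))
          else defect ρ n (l + 2 * t + 1)) = Fintype.card (HalfOne n (l + 2 * t + 1)) := by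
      have hiff : L ∣ l + 2 * t + 1 + 1 ↔ t + 1 = L := by
        have : l + 2 * t + 1 + 1 = (l + t + 1) + (t + 1) := by ring
        rw [this, Nat.dvd_add_right hd]
        exact ⟨fun h => le_antisymm htL (Nat.le_of_dvd (Nat.succ_pos t) h), fun h => h ▸ dvd_rfl⟩
      simp only [hiff]
      rcases l with _ | l
      · have : t + 1 = L := le_antisymm htL (Nat.le_of_dvd (Nat.succ_pos t) (by simpa using hd))
        rw [if_pos this, defect_low_zero, zero_add]
      · rw [defect_low_succ]
        have hd' : L ∣ l + (t + 1) + 1 := by convert hd using 1; omega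
        split_ifs with h
        · have hc : L ∣ l + 1 := by
            rw [show l + (t + 1) + 1 = (l + 1) + (t + 1) by ring, h] at hd'
            exact (Nat.dvd_add_left dvd_rfl).1 hd'
          rw [defect_of_critical hρ (Or.inr hc), zero_add]
        · have := ih l (t + 1) (Nat.succ_pos t) (by omega) hd'
          rwa [show l + 2 * (t + 1) = l + 1 + 2 * t + 1 by ring] at this
    omega

/-! ### Homomorphisms given by singular vectors -/

theorem finrank_radical_cellSpan {ρ : ℂ} (hρ : ρ ≠ 0) (n l : ℕ) :
    Module.finrank ℂ (radical (cellSpan ρ (Fin n) l)) = defect ρ n l := by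
  unfold defect
  rw [← finrank_radical (linearIndependent_psi hρ n l), span_psi]

theorem card_halfOne_self (n : ℕ) : Fintype.card (HalfOne n n) = 1 := by
  rw [Fintype.card_eq_one_iff]
  let d : Diagram 1 (Fin n) (Fin n) := ⟨idPart fun _ => 0, idPart_isBubble _⟩
  exact ⟨⟨d, (noCap_iff_rel d).2 fun y => ⟨y, rfl⟩⟩, fun d' => halfOne_self_eq _ _⟩

/-- The radical of the cell module for `l` contains a singular vector in the number `l + 2 * t` of
nodes, where it lies for the first time. -/
theorem exists_singular {ρ : ℂ} (hρ : ρ ≠ 0) {l t : ℕ} (ht : 0 < t)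
    (htL : t < orderOf (mu ρ ^ 2)) (hd : orderOf (mu ρ ^ 2) ∣ l + t + 1) :
    ∃ f ∈ radical (cellSpan ρ (Fin (l + 2 * t)) l), f ≠ 0 ∧ Singular ρ f := by
  have h1 := defect_add hρ (l + 2 * t) l t ht htL hd
  rw [defect_self, card_halfOne_self, add_zero, ← finrank_radical_cellSpan hρ] at h1
  have hne : radical (cellSpan ρ (Fin (l + 2 * t)) l) ≠ ⊥ := fun h => by
    rw [h, finrank_bot] at h1
    exact one_ne_zero h1.symm
  obtain ⟨f, hf, hf0⟩ := Submodule.exists_mem_ne_zero_of_ne_bot hne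
  refine ⟨f, hf, hf0, fun c p q h => ?_⟩
  have hlt := card_rest_lt p q
  have h2 := defect_add hρ (Fintype.card (Rest p q)) l t ht htL hd
  rw [card_halfOne_of_lt hlt, ← finrank_radical_cellSpan hρ] at h2
  have h3 : radical (cellSpan ρ (Fin (Fintype.card (Rest p q))) l) = ⊥ :=
    Submodule.finrank_eq_zero.1 (by omega)
  have := mulVec_mem_radical hρ (cap c h) hf
  rwa [radical_eq_bot_of_orderIso (Fintype.orderIsoFinOfCardEq (Rest p q) rfl) h3,
    Submodule.mem_bot] at this

section Linear

variable {ι κ τ : Type*}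

/-- Every matrix `A` has a generalized inverse `N`, so that `N * A` is idempotent with the kernel of
`A`. -/
theorem exists_generalized_inverse [Fintype ι] [Fintype κ] (A : Matrix ι κ ℂ) :
    ∃ N : Matrix κ ι ℂ, A * (N * A) = A := by
  classical
  obtain ⟨g, hg⟩ := A.mulVecLin.rangeRestrict.exists_rightInverse_of_surjective
    (LinearMap.range_rangeRestrict _)
  obtain ⟨g', hg'⟩ := LinearMap.exists_extend g
  refine ⟨LinearMap.toMatrix' g', ?_⟩
  refine Matrix.ext_of_mulVec_single fun k => ?_
  rw [← Matrix.mulVec_mulVec, ← Matrix.mulVec_mulVec, LinearMap.toMatrix'_mulVec]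
  have h1 : g' (A.mulVec (Pi.single k 1)) = g (A.mulVecLin.rangeRestrict (Pi.single k 1)) :=
    LinearMap.congr_fun hg' (A.mulVecLin.rangeRestrict (Pi.single k 1))
  rw [h1]
  exact congrArg Subtype.val (LinearMap.congr_fun hg (A.mulVecLin.rangeRestrict (Pi.single k 1)))

theorem exists_mul_eq_of_range_le [Fintype ι] [Fintype κ] (A : Matrix τ ι ℂ) (B : Matrix τ κ ℂ)
    (h : LinearMap.range B.mulVecLin ≤ LinearMap.range A.mulVecLin) :
    ∃ X : Matrix ι κ ℂ, B = A * X := by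
  classical
  have h1 : ∀ k, ∃ x : ι → ℂ, A.mulVec x = B.mulVec (Pi.single k 1) := fun k =>
    h ⟨Pi.single k 1, rfl⟩
  choose x hx using h1
  refine ⟨fun i k => x k i, ?_⟩
  ext i k
  have := congrFun (hx k) i
  rw [Matrix.mulVec_single_one] at this
  exact this.symm

theorem mul_eq_zero_of_ker_le [Fintype τ] (A : Matrix ι τ ℂ) (B : Matrix κ τ ℂ)
    (h : LinearMap.ker A.mulVecLin ≤ LinearMap.ker B.mulVecLin) (C : Matrix τ τ ℂ)
    (hC : A * C = 0) : B * C = 0 := by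
  classical
  refine Matrix.ext_of_mulVec_single fun k => ?_
  rw [Matrix.zero_mulVec, ← Matrix.mulVec_mulVec]
  refine h (x := C.mulVec (Pi.single k 1)) ?_
  change A.mulVec _ = 0
  rw [Matrix.mulVec_mulVec, hC, Matrix.zero_mulVec]

end Linear

noncomputable instance (n l : ℕ) : DecidableEq (HalfOne n l) := Classical.decEq _

/-- The matrices, with respect to the bases of half-diagrams, of the maps between one-coloured cell
modules that are used to split the multi-coloured ones: `G` and `G'` are the Gram matrices for `l`
and `l'` defects, `N * G` and `N' * G'` are idempotents with the kernels of `G` and `G'`, and `Θ` is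
a homomorphism with image the kernel of `G` and kernel the kernel of `G'`. -/
structure Splitting {ι ι' : Type*} [Fintype ι] [Fintype ι'] [DecidableEq ι] [DecidableEq ι']
    (G : Matrix ι ι ℂ) (G' : Matrix ι' ι' ℂ) (Θ : Matrix ι ι' ℂ) where
  N : Matrix ι ι ℂ
  N' : Matrix ι' ι' ℂ
  lift : Matrix ι' ι ℂ
  retract : Matrix ι' ι ℂ
  gram_mul : G * (N * G) = G
  gram_mul' : G' * (N' * G') = G'
  mul_lift : Θ * lift = 1 - N * G
  retract_mul : retract * Θ = N' * G'
  mul_theta : N * G * Θ = 0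
  theta_mul : Θ * (N' * G') = Θ

theorem exists_splitting_of_ker {ι ι' : Type*} [Fintype ι] [Fintype ι'] [DecidableEq ι]
    [DecidableEq ι'] {G : Matrix ι ι ℂ} {G' : Matrix ι' ι' ℂ} {Θ : Matrix ι ι' ℂ}
    (h1 : LinearMap.range Θ.mulVecLin = LinearMap.ker G.mulVecLin)
    (h2 : LinearMap.ker Θ.mulVecLin = LinearMap.ker G'.mulVecLin) : Nonempty (Splitting G G' Θ) := by
  obtain ⟨N, hN⟩ := exists_generalized_inverse G
  obtain ⟨N', hN'⟩ := exists_generalized_inverse G'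
  obtain ⟨M, hM⟩ := exists_generalized_inverse Θ
  have hG : G * (1 - N * G) = 0 := by rw [mul_sub, mul_one, hN, sub_self]
  have hG' : G' * (1 - N' * G') = 0 := by rw [mul_sub, mul_one, hN', sub_self]
  obtain ⟨X, hX⟩ := exists_mul_eq_of_range_le Θ (1 - N * G) (by
    rw [h1]
    rintro _ ⟨x, rfl⟩
    change G.mulVec ((1 - N * G).mulVec x) = 0
    rw [Matrix.mulVec_mulVec, hG, Matrix.zero_mulVec])
  have hΘ : Θ * (1 - M * Θ) = 0 := by rw [Matrix.mul_sub, Matrix.mul_one, hM, sub_self]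
  have hY := mul_eq_zero_of_ker_le Θ G' h2.le _ hΘ
  have hGΘ : G * Θ = 0 := by
    refine Matrix.ext_of_mulVec_single fun k => ?_
    rw [Matrix.zero_mulVec, ← Matrix.mulVec_mulVec]
    exact h1.le ⟨Pi.single k 1, rfl⟩
  have hΘ' := mul_eq_zero_of_ker_le G' Θ h2.ge _ hG'
  rw [Matrix.mul_sub, Matrix.mul_one, sub_eq_zero] at hY hΘ'
  exact ⟨⟨N, N', X, N' * G' * M, hN, hN', hX.symm, by
    rw [Matrix.mul_assoc, Matrix.mul_assoc, ← hY], by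
    rw [Matrix.mul_assoc, hGΘ, Matrix.mul_zero], hΘ'.symm⟩⟩

/-- In one colour, the radical of the cell module for `l` is the image of the cell module for
`l + 2 * t` under a homomorphism given by a singular vector. -/
theorem exists_splitting {ρ : ℂ} (hρ : ρ ≠ 0) {l t : ℕ} (ht : 0 < t)
    (htL : t < orderOf (mu ρ ^ 2)) (hd : orderOf (mu ρ ^ 2) ∣ l + t + 1) :
    ∃ (f : (Fin (l + 2 * t) → Bool) → ℂ)
      (Θ : ∀ n, Matrix (HalfOne n l) (HalfOne n (l + 2 * t)) ℂ), Singular ρ f ∧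
      (∀ n h, ∑ g, Θ n g h • psi ρ g = (ampMat ρ h.1).mulVec f) ∧
      ∀ n, Nonempty (Splitting (gram (psi ρ)) (gram (psi ρ)) (Θ n)) := by
  obtain ⟨f, hf, hf0, hfs⟩ := exists_singular hρ ht htL hd
  have hrad : ∀ n (h : HalfOne n (l + 2 * t)), (ampMat ρ h.1).mulVec f ∈
      radical (cellSpan ρ (Fin n) l) := fun n h => mulVec_mem_radical hρ h.1 hf
  have hex : ∀ n (h : HalfOne n (l + 2 * t)), ∃ c : HalfOne n l → ℂ,
      ∑ g, c g • psi ρ g = (ampMat ρ h.1).mulVec f := fun n h => by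
    have := (hrad n h).1
    rwa [← span_psi, Submodule.mem_span_range_iff_exists_fun] at this
  choose c hc using hex
  refine ⟨f, fun n g h => c n h g, hfs, hc, fun n => ?_⟩
  set Θ : Matrix (HalfOne n l) (HalfOne n (l + 2 * t)) ℂ := fun g h => c n h g with hΘ
  change Nonempty (Splitting _ _ Θ)
  have hle1 : LinearMap.range Θ.mulVecLin ≤
      LinearMap.ker (gram (psi ρ : HalfOne n l → _)).mulVecLin := by
    rintro _ ⟨x, rfl⟩
    change (gram (psi ρ : HalfOne n l → _)).mulVec (Θ.mulVec x) = 0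
    rw [Matrix.mulVec_mulVec]
    have : gram (psi ρ : HalfOne n l → _) * Θ = 0 := by
      ext g h
      change (gram (psi ρ : HalfOne n l → _)).mulVec (c n h) g = 0
      rw [gram_mulVec, hc]
      exact (hrad n h).2 _ (Submodule.subset_span ⟨g.1, rfl⟩)
    rw [this, Matrix.zero_mulVec]
  have hle2 : LinearMap.ker Θ.mulVecLin ≤
      LinearMap.ker (gram (psi ρ : HalfOne n (l + 2 * t) → _)).mulVecLin := by
    intro x hx
    have hx : Θ.mulVec x = 0 := hx
    change (gram (psi ρ : HalfOne n (l + 2 * t) → _)).mulVec x = 0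
    have hsum : ∑ h, x h • (ampMat ρ h.1).mulVec f = 0 := by
      simp only [← hc, Finset.smul_sum, smul_smul]
      rw [Finset.sum_comm]
      refine Finset.sum_eq_zero fun g _ => ?_
      rw [← Finset.sum_smul]
      have := congrFun hx g
      change ∑ h, c n h g * x h = 0 at this
      simp only [mul_comm (x _), this, zero_smul]
    obtain ⟨s, hs⟩ := Function.ne_iff.1 hf0
    funext h
    have h1 : dotProduct ((ampMat ρ h.1).mulVec (Pi.single s 1))
        (∑ h', x h' • (ampMat ρ h'.1).mulVec f) = 0 := by rw [hsum, dotProduct_zero]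
    rw [dotProduct_sum] at h1
    simp only [dotProduct_smul, hfs.dotProduct_mulVec hρ, single_one_dotProduct, smul_eq_mul,
      ← mul_assoc, ← Finset.sum_mul] at h1
    have h2 := (mul_eq_zero.1 h1).resolve_right hs
    refine Eq.trans ?_ h2
    exact Finset.sum_congr rfl fun h' _ => mul_comm _ _
  have hadd := defect_add hρ n l t ht htL hd
  have hrk := LinearMap.finrank_range_add_finrank_ker Θ.mulVecLin
  rw [Module.finrank_fintype_fun_eq_card] at hrk
  have e1 := Submodule.finrank_mono hle1
  have e2 := Submodule.finrank_mono hle2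
  have d1 : Module.finrank ℂ (LinearMap.ker (gram (psi ρ : HalfOne n l → _)).mulVecLin) =
    defect ρ n l := rfl
  have d2 : Module.finrank ℂ
    (LinearMap.ker (gram (psi ρ : HalfOne n (l + 2 * t) → _)).mulVecLin) =
    defect ρ n (l + 2 * t) := rfl
  exact exists_splitting_of_ker (Submodule.eq_of_le_of_finrank_le hle1 (by omega))
    (Submodule.eq_of_le_of_finrank_le hle2 (by omega))

/-- For critical `l` the generalized inverse of the Gram matrix is an inverse. -/
theorem exists_inverse_gram {ρ : ℂ} (hρ : ρ ≠ 0) {l : ℕ} (hl : Critical ρ l) (n : ℕ) :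
    ∃ N : Matrix (HalfOne n l) (HalfOne n l) ℂ, N * gram (psi ρ) = 1 := by
  obtain ⟨N, hN⟩ := exists_generalized_inverse (gram (psi ρ : HalfOne n l → _))
  have hker : LinearMap.ker (gram (psi ρ : HalfOne n l → _)).mulVecLin = ⊥ :=
    Submodule.finrank_eq_zero.1 (defect_of_critical hρ hl n)
  refine ⟨N, sub_eq_zero.1 (Matrix.ext_of_mulVec_single fun k => ?_)⟩
  rw [Matrix.zero_mulVec]
  have : (N * gram (psi ρ) - 1).mulVec (Pi.single k 1) ∈
      LinearMap.ker (gram (psi ρ : HalfOne n l → _)).mulVecLin := by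
    change (gram (psi ρ)).mulVec ((N * gram (psi ρ) - 1).mulVec (Pi.single k 1)) = 0
    rw [Matrix.mulVec_mulVec, mul_sub, mul_one, hN, sub_self, Matrix.zero_mulVec]
  rwa [hker, Submodule.mem_bot] at this

/-- With one defect there is nothing to correct: bending the defect multiplies the form by a nonzero
multiple of `quantumInt ρ 1`. -/
theorem dotProduct_psi_bend_ne_zero {ρ : ℂ} (hρ : ρ ≠ 0) (h : quantumInt ρ 1 ≠ 0) {n : ℕ}
    {g g' : HalfOne n 1} (hg : dotProduct (psi ρ g) (psi ρ g') ≠ 0) :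
    dotProduct (psi ρ (bend g)) (psi ρ (bend g')) ≠ 0 := by
  have h0 : quantumInt ρ 0 = 1 := by simp [quantumInt]
  have hb : ∀ g : HalfOne n 1, bentVec ρ g = ρ ^ (2 : ℤ) • psi ρ (bend g) := fun g => by
    obtain ⟨y, hy, e⟩ := bentVec_eq hρ g
    have hbot : lowerSpan ρ n 0 = ⊥ := by
      refine Submodule.span_eq_bot.2 ?_
      rintro _ ⟨i, _⟩
      exact i.elim
    rw [hbot, Submodule.mem_bot] at hy
    rw [e, hy, map_zero, add_zero, h0, mul_one]
  intro hcon
  have h1 := dotProduct_bentVec hρ g g'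
  rw [hb, hb, smul_dotProduct, dotProduct_smul, hcon, smul_zero, smul_zero, h0, mul_one] at h1
  exact mul_ne_zero (mul_ne_zero (zpow_ne_zero _ hρ) h) hg h1.symm

/-- The form on a one-coloured cell module with at least one defect is not zero. -/
theorem exists_dotProduct_ne_zero {ρ : ℂ} (hρ : ρ ≠ 0) (v l : ℕ) :
    ∀ n, n = l + 1 + 2 * v → ∃ g g' : HalfOne n (l + 1), dotProduct (psi ρ g) (psi ρ g') ≠ 0 := by
  have step : ∀ (n l : ℕ) (d d' : LowerHalf n l),
      dotProduct (lowerPsi ρ n l d) (lowerPsi ρ n l d') ≠ 0 →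
        dotProduct (psi ρ (raise n l d)) (psi ρ (raise n l d')) ≠ 0 := by
    intro n l d d' h
    have h1 := dotProduct_snocExt_add (lowerPsi ρ n l d) 0 (lowerPsi ρ n l d') 0
    rw [map_zero, add_zero, add_zero, zero_dotProduct, add_zero] at h1
    rw [psi_raise, psi_raise, h1]
    exact h
  induction l with
  | zero =>
    induction v with
    | zero =>
      rintro _ rfl
      obtain ⟨d, _⟩ := Fintype.card_eq_one_iff.1 (card_halfOne_self 1)
      exact ⟨d, d, fun h => one_ne_zero ((gram_self ρ d d).symm.trans h)⟩
    | succ v ih =>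
      rintro _ rfl
      obtain ⟨g, g', h⟩ := ih _ rfl
      have hn : 0 + 1 + 2 * (v + 1) = (0 + 1 + 2 * v) + 1 + 1 := by ring
      rw [hn]
      by_cases h1 : quantumInt ρ 1 = 0
      · by_contra! hcon
        obtain ⟨N, hN⟩ := exists_inverse_gram hρ (l := 1) (Or.inr (quantumInt_eq_zero h1))
          (0 + 1 + 2 * v + 1 + 1)
        have hz : gram (psi ρ : HalfOne (0 + 1 + 2 * v + 1 + 1) 1 → _) = 0 :=
          Matrix.ext fun a b => hcon a b
        rw [hz, Matrix.mul_zero] at hN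
        have d : HalfOne (0 + 1 + 2 * v + 1 + 1) 1 := raise _ 1 (bend g)
        have := congrFun (congrFun hN d) d
        rw [Matrix.one_apply_eq] at this
        exact zero_ne_one this
      · exact ⟨_, _, step _ 1 (bend g) (bend g') (dotProduct_psi_bend_ne_zero hρ h1 h)⟩
  | succ l ih =>
    rintro _ rfl
    obtain ⟨g, g', h⟩ := ih _ rfl
    have hn : l + 1 + 1 + 2 * v = l + 1 + 2 * v + 1 := by ring
    rw [hn]
    exact ⟨_, _, step _ (l + 2) g g' h⟩

/-! ### Half-diagrams as families of one-coloured half-diagrams -/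

theorem before_of_map {X Y X' Y' : Type} [LinearOrder X] [LinearOrder Y] [LinearOrder X']
    [LinearOrder Y'] {ι : X' → X} {κ : Y' → Y} (hι : StrictMono ι) (hκ : StrictMono κ)
    {p q : X' ⊕ Y'} (h : Before (Sum.map ι κ p) (Sum.map ι κ q)) : Before p q := by
  by_cases e : p = q
  · rw [e] at h
    exact absurd h (Before.irrefl _)
  · exact (Before.total e).resolve_right fun h' =>
      Before.irrefl _ (h.trans (before_map hι hκ h'))

section Glue

variable {n m : ℕ}

/-- The number of nodes of a given colour. -/
abbrev fibreCard (c : Fin n → Fin m) (j : Fin m) : ℕ := Fintype.card {x // c x = j}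

/-- The nodes of a given colour, in their order. -/
noncomputable def topEmb (c : Fin n → Fin m) (j : Fin m) (i : Fin (fibreCard c j)) : Fin n :=
  (Fintype.orderIsoFinOfCardEq {x // c x = j} rfl i).1

theorem topEmb_strictMono (c : Fin n → Fin m) (j : Fin m) : StrictMono (topEmb c j) :=
  fun _ _ h => (Fintype.orderIsoFinOfCardEq {x // c x = j} rfl).strictMono h

theorem colour_topEmb (c : Fin n → Fin m) (j : Fin m) (i) : c (topEmb c j i) = j :=
  (Fintype.orderIsoFinOfCardEq {x // c x = j} rfl i).2

theorem exists_topEmb (c : Fin n → Fin m) {j : Fin m} {x : Fin n} (h : c x = j) :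
    ∃ i, topEmb c j i = x := by
  obtain ⟨i, hi⟩ := (Fintype.orderIsoFinOfCardEq {x // c x = j} rfl).surjective ⟨x, h⟩
  exact ⟨i, congrArg Subtype.val hi⟩

/-- The cut points of a given colour, in their order. -/
def botEmb (lam : Fin m → ℕ) (j : Fin m) (i : Fin (lam j)) : Cut lam := toLex ⟨j, i⟩

theorem botEmb_strictMono (lam : Fin m → ℕ) (j : Fin m) : StrictMono (botEmb lam j) :=
  fun _ _ h => Sigma.Lex.right _ _ h

/-- The nodes of the frame of a half-diagram, sorted by colour. -/
noncomputable def node (c : Fin n → Fin m) (lam : Fin m → ℕ)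
    (s : Σ j, Fin (fibreCard c j) ⊕ Fin (lam j)) : Fin n ⊕ Cut lam :=
  Sum.map (topEmb c s.1) (botEmb lam s.1) s.2

/-- The colours of the nodes of the frame of a half-diagram. -/
def frameColour (c : Fin n → Fin m) (lam : Fin m → ℕ) : Fin n ⊕ Cut lam → Fin m :=
  Sum.elim c fun y => (ofLex y).1

theorem frameColour_node (c : Fin n → Fin m) (lam : Fin m → ℕ) (s) :
    frameColour c lam (node c lam s) = s.1 := by
  rcases s with ⟨j, i | i⟩
  · exact colour_topEmb c j i
  · rfl

theorem exists_node (c : Fin n → Fin m) (lam : Fin m → ℕ) {j : Fin m} {p : Fin n ⊕ Cut lam}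
    (h : frameColour c lam p = j) : ∃ u, node c lam ⟨j, u⟩ = p := by
  rcases p with x | y
  · obtain ⟨i, hi⟩ := exists_topEmb c (x := x) h
    exact ⟨Sum.inl i, congrArg Sum.inl hi⟩
  · subst h
    exact ⟨Sum.inr (ofLex y).2, rfl⟩

theorem node_injective_right (c : Fin n → Fin m) (lam : Fin m → ℕ) (j : Fin m) :
    Function.Injective (Sum.map (topEmb c j) (botEmb lam j)) :=
  Sum.map_injective.2 ⟨(topEmb_strictMono c j).injective, (botEmb_strictMono lam j).injective⟩

theorem node_bijective (c : Fin n → Fin m) (lam : Fin m → ℕ) :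
    Function.Bijective (node c lam) := by
  constructor
  · rintro ⟨j, u⟩ ⟨j', u'⟩ h
    have h1 := congrArg (frameColour c lam) h
    rw [frameColour_node, frameColour_node] at h1
    obtain rfl : j = j' := h1
    exact congrArg (Sigma.mk j) (node_injective_right c lam j h)
  · intro p
    obtain ⟨u, hu⟩ := exists_node c lam (p := p) rfl
    exact ⟨_, hu⟩

/-- The nodes of the frame of a half-diagram, sorted by colour. -/
noncomputable def nodeEquiv (c : Fin n → Fin m) (lam : Fin m → ℕ) :
    (Σ j, Fin (fibreCard c j) ⊕ Fin (lam j)) ≃ Fin n ⊕ Cut lam :=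
  Equiv.ofBijective _ (node_bijective c lam)

variable {c : Fin n → Fin m} {lam : Fin m → ℕ}

/-- The partner function of `glue`. -/
noncomputable def gluePartner (d : ∀ j, HalfOne (fibreCard c j) (lam j)) (p : Fin n ⊕ Cut lam) :
    Fin n ⊕ Cut lam :=
  node c lam ⟨_, (d _).1.partner ((nodeEquiv c lam).symm p).2⟩

theorem gluePartner_node (d : ∀ j, HalfOne (fibreCard c j) (lam j)) (j : Fin m) (u) :
    gluePartner d (node c lam ⟨j, u⟩) = node c lam ⟨j, (d j).1.partner u⟩ := by
  have h : (nodeEquiv c lam).symm (node c lam ⟨j, u⟩) = ⟨j, u⟩ :=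
    (nodeEquiv c lam).symm_apply_apply ⟨j, u⟩
  unfold gluePartner
  rw [h]

/-- The diagram of the half-diagram `glue`. -/
noncomputable def glueDiag (d : ∀ j, HalfOne (fibreCard c j) (lam j)) :
    Diagram m (Fin n) (Cut lam) :=
  Diagram.ofPartner (frameColour c lam) (gluePartner d)
    (fun p => by
      obtain ⟨⟨j, u⟩, rfl⟩ := (node_bijective c lam).2 p
      rw [gluePartner_node]
      exact fun h => (d j).1.partner_ne u (node_injective_right c lam j h))
    (fun p => by
      obtain ⟨⟨j, u⟩, rfl⟩ := (node_bijective c lam).2 p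
      rw [gluePartner_node, gluePartner_node, Diagram.partner_partner])
    (fun p => by
      obtain ⟨⟨j, u⟩, rfl⟩ := (node_bijective c lam).2 p
      rw [gluePartner_node, frameColour_node, frameColour_node])
    (fun p q h1 h2 h3 hc => by
      obtain ⟨⟨j, u⟩, rfl⟩ := (node_bijective c lam).2 p
      obtain ⟨⟨j', u'⟩, rfl⟩ := (node_bijective c lam).2 q
      rw [frameColour_node, frameColour_node] at hc
      obtain rfl : j = j' := hc
      rw [gluePartner_node] at h2 h3
      rw [gluePartner_node] at h3
      have hι := topEmb_strictMono c j
      have hκ := botEmb_strictMono lam j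
      exact (d j).1.not_cross (before_of_map hι hκ h1) (before_of_map hι hκ h2)
        (before_of_map hι hκ h3) (Subsingleton.elim _ _))

theorem partner_glueDiag (d : ∀ j, HalfOne (fibreCard c j) (lam j)) (j : Fin m) (u) :
    (glueDiag d).partner (node c lam ⟨j, u⟩) = node c lam ⟨j, (d j).1.partner u⟩ :=
  (Diagram.partner_ofPartner _ _ _ _ _ _ _).trans (gluePartner_node d j u)

/-- The half-diagram whose nodes are coloured by `c` and whose edges of colour `j` are those of
`d j`. -/
noncomputable def glue (d : ∀ j, HalfOne (fibreCard c j) (lam j)) : Half n lam where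
  diag := glueDiag d
  isHalf := by
    refine ⟨fun y => rfl, (noCap_iff_rel _).1 fun y => ?_⟩
    obtain ⟨j, i⟩ := y
    obtain ⟨x, hx⟩ := (d j).2 i
    refine ⟨topEmb c j x, (partner_glueDiag d j (Sum.inr i)).trans ?_⟩
    rw [hx]
    rfl

theorem glue_eq_glue {d d' : ∀ j, HalfOne (fibreCard c j) (lam j)} (h : glue d = glue d') :
    d = d' := by
  funext j
  refine Subtype.ext (ext_one fun u => node_injective_right c lam j ?_)
  have h1 := partner_glueDiag d j u
  rw [show glueDiag d = glueDiag d' from congrArg Half.diag h, partner_glueDiag] at h1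
  exact h1.symm

theorem glue_bijective : Function.Bijective
    fun s : Σ c : Fin n → Fin m, ∀ j, HalfOne (fibreCard c j) (lam j) => glue s.2 := by
  constructor
  · rintro ⟨c, d⟩ ⟨c', d'⟩ h
    have hc : c = c' := by
      funext x
      exact congrArg (fun a : Half n lam => a.diag.part.colour (Sum.inl x)) h
    subst hc
    exact congrArg (Sigma.mk c) (glue_eq_glue h)
  · intro a
    set c : Fin n → Fin m := fun x => a.diag.part.colour (Sum.inl x) with hc
    have hcol : ∀ p, a.diag.part.colour p = frameColour c lam p := by
      rintro (x | y)
      · rfl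
      · exact a.isHalf.1 y
    have hcl : ∀ j (u : Fin (fibreCard c j) ⊕ Fin (lam j)), ∃ u',
        a.diag.partner (Sum.map (topEmb c j) (botEmb lam j) u) =
          Sum.map (topEmb c j) (botEmb lam j) u' := by
      intro j u
      have h1 : frameColour c lam (a.diag.partner (node c lam ⟨j, u⟩)) = j := by
        rw [← hcol, a.diag.colour_partner, hcol, frameColour_node]
      obtain ⟨u', hu'⟩ := exists_node c lam h1
      exact ⟨u', hu'.symm⟩
    let d0 : ∀ j, Diagram 1 (Fin (fibreCard c j)) (Fin (lam j)) := fun j =>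
      a.diag.pull (topEmb c j) (botEmb lam j) (topEmb_strictMono c j) (botEmb_strictMono lam j)
        (fun _ => 0) (hcl j) fun p q _ => by
          rw [hcol, hcol]
          exact (frameColour_node c lam ⟨j, p⟩).trans (frameColour_node c lam ⟨j, q⟩).symm
    have hd0 : ∀ j u, node c lam ⟨j, (d0 j).partner u⟩ = a.diag.partner (node c lam ⟨j, u⟩) :=
      fun j u => a.diag.map_partner_pull _ _ _ _ _ u
    let d : ∀ j, HalfOne (fibreCard c j) (lam j) := fun j => ⟨d0 j, fun i => by
      obtain ⟨x, hx⟩ := (noCap_iff_rel a.diag).2 a.isHalf.2 (botEmb lam j i)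
      have h1 := hd0 j (Sum.inr i)
      rw [show node c lam ⟨j, Sum.inr i⟩ = Sum.inr (botEmb lam j i) from rfl, hx] at h1
      rcases h2 : (d0 j).partner (Sum.inr i) with x' | y'
      · exact ⟨x', rfl⟩
      · rw [h2] at h1
        cases h1⟩
    refine ⟨⟨c, d⟩, ?_⟩
    have : (glue d).diag = a.diag := by
      refine Diagram.ext_partner (funext fun p => (hcol p).symm) fun p => ?_
      obtain ⟨⟨j, u⟩, rfl⟩ := (node_bijective c lam).2 p
      rw [← hd0]
      exact partner_glueDiag d j u ▸ (glueDiag d).rel_partner _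
    cases a
    cases hg : glue d
    rw [hg] at this
    cases this
    exact hg

theorem amp_glue (ρ : Fin m → ℂ) (d : ∀ j, HalfOne (fibreCard c j) (lam j)) (x : Fin n → Bool)
    (y : Cut lam → Bool) : amp ρ (glue d).diag x y =
      ∏ j, amp (fun _ => ρ j) (d j).1 (x ∘ topEmb c j) (y ∘ botEmb lam j) :=
  amp_eq_prod ρ (glueDiag d) (fun j _ => ρ j) (fun j => (d j).1) (topEmb_strictMono c)
    (botEmb_strictMono lam) (node_bijective c lam) (fun j u => (partner_glueDiag d j u).symm)
    (fun j u => congrArg ρ (frameColour_node c lam ⟨j, u⟩).symm) x y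

end Glue

/-! ### Tensor products of linear maps between one-coloured cell modules -/

theorem sum_prod_restrict {J X : Type} {X' : J → Type} [Fintype J] [DecidableEq J] [Fintype X]
    [DecidableEq X] [∀ j, Fintype (X' j)] [∀ j, DecidableEq (X' j)] (e : ∀ j, X' j → X)
    (h : Function.Bijective fun s : Σ j, X' j => e s.1 s.2) (f : ∀ j, (X' j → Bool) → ℂ) :
    ∑ s : X → Bool, ∏ j, f j (s ∘ e j) = ∏ j, ∑ t, f j t := by
  rw [Fintype.prod_sum]
  let E : (X → Bool) ≃ ∀ j, X' j → Bool :=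
    (Equiv.arrowCongr (Equiv.ofBijective _ h).symm (Equiv.refl Bool)).trans (Equiv.piCurry fun _ _ => Bool)
  exact E.sum_comp fun t => ∏ j, f j (t j)

section Model

variable {n m : ℕ} {lam : Fin m → ℕ}

theorem topEmb_bijective (c : Fin n → Fin m) :
    Function.Bijective fun s : Σ j, Fin (fibreCard c j) => topEmb c s.1 s.2 := by
  constructor
  · rintro ⟨j, i⟩ ⟨j', i'⟩ h
    have h1 : c (topEmb c j i) = c (topEmb c j' i') := congrArg c h
    obtain rfl : j = j' := (colour_topEmb c j i).symm.trans (h1.trans (colour_topEmb c j' i'))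
    exact congrArg (Sigma.mk j) ((topEmb_strictMono c j).injective h)
  · intro x
    obtain ⟨i, hi⟩ := exists_topEmb c (x := x) rfl
    exact ⟨⟨_, i⟩, hi⟩

theorem botEmb_bijective (lam : Fin m → ℕ) :
    Function.Bijective fun s : Σ j, Fin (lam j) => botEmb lam s.1 s.2 :=
  toLex.bijective

/-- The families of one-coloured half-diagrams that make up the half-diagrams with the colouring
`c` of the nodes. -/
abbrev Pieces (lam : Fin m → ℕ) (c : Fin n → Fin m) : Type :=
  ∀ j, HalfOne (fibreCard c j) (lam j)

/-- Half-diagrams are families of one-coloured half-diagrams. -/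
noncomputable def glueEquiv (n : ℕ) (lam : Fin m → ℕ) :
    (Σ c : Fin n → Fin m, Pieces lam c) ≃ Half n lam :=
  Equiv.ofBijective _ glue_bijective

theorem glueEquiv_symm_glue {c : Fin n → Fin m} (d : Pieces lam c) :
    (glueEquiv n lam).symm (glue d) = ⟨c, d⟩ := (glueEquiv n lam).symm_apply_apply ⟨c, d⟩

instance : Finite (Half n lam) := Finite.of_equiv _ (glueEquiv n lam)

/-- The coordinates of an element of a cell module, sorted by the colourings of the nodes. -/
noncomputable def coords (δ : Fin m → ℂ) (n : ℕ) (lam : Fin m → ℕ) :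
    Cell δ n lam ≃ₗ[ℂ] (∀ c : Fin n → Fin m, Pieces lam c → ℂ) where
  toFun x c d := (show Half n lam →₀ ℂ from x) (glue d)
  map_add' _ _ := rfl
  map_smul' _ _ := rfl
  invFun f := Finsupp.equivFunOnFinite.symm fun h =>
    f ((glueEquiv n lam).symm h).1 ((glueEquiv n lam).symm h).2
  left_inv x := by
    refine Finsupp.ext fun h => ?_
    change (show Half n lam →₀ ℂ from x) (glueEquiv n lam ((glueEquiv n lam).symm h)) = _
    rw [Equiv.apply_symm_apply]
  right_inv f := by
    funext c d
    change f ((glueEquiv n lam).symm (glue d)).1 ((glueEquiv n lam).symm (glue d)).2 = f c d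
    rw [glueEquiv_symm_glue]

/-- A basis vector of a cell module. -/
noncomputable def basisVec (δ : Fin m → ℂ) (h : Half n lam) : Cell δ n lam :=
  (Finsupp.single h 1 : Half n lam →₀ ℂ)

theorem coords_basisVec (δ : Fin m → ℂ) {c : Fin n → Fin m} (d d' : Pieces lam c) :
    coords δ n lam (basisVec δ (glue d)) c d' = if d' = d then 1 else 0 := by
  classical
  change (Finsupp.single (glue d) 1 : Half n lam →₀ ℂ) (glue d') = _
  rw [Finsupp.single_apply]
  exact if_congr ⟨fun h => (glue_eq_glue h).symm, fun h => h ▸ rfl⟩ rfl rfl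

theorem coords_basisVec_of_ne (δ : Fin m → ℂ) {c c' : Fin n → Fin m} (h : c' ≠ c)
    (d : Pieces lam c) (d' : Pieces lam c') :
    coords δ n lam (basisVec δ (glue d)) c' d' = 0 := by
  classical
  change (Finsupp.single (glue d) 1 : Half n lam →₀ ℂ) (glue d') = _
  rw [Finsupp.single_apply, if_neg]
  intro e
  exact h (congrArg Sigma.fst ((glue_bijective (lam := lam)).1
    (a₁ := ⟨c, d⟩) (a₂ := ⟨c', d'⟩) e)).symm

/-- An induction principle for statements on cell modules. -/
theorem cell_ext {δ : Fin m → ℂ} {V : Type*} [AddCommGroup V] [Module ℂ V]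
    {f g : Cell δ n lam →ₗ[ℂ] V}
    (h : ∀ (c : Fin n → Fin m) (d : Pieces lam c), f (basisVec δ (glue d)) =
      g (basisVec δ (glue d))) : f = g := by
  refine Finsupp.lhom_ext' fun a => LinearMap.ext_ring ?_
  obtain ⟨⟨c, d⟩, rfl⟩ := (glueEquiv n lam).surjective a
  exact h c d

variable {μ ν τ : Fin m → ℕ}

/-- Families of matrices between one-coloured cell modules, for each number of nodes. -/
abbrev MatFamily (μ ν : Fin m → ℕ) : Type :=
  ∀ (j : Fin m) (k : ℕ), Matrix (HalfOne k (μ j)) (HalfOne k (ν j)) ℂ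

/-- The tensor product of linear maps between one-coloured cell modules. -/
noncomputable def tensorMap (δ : Fin m → ℂ) (n : ℕ) (A : MatFamily μ ν) :
    Cell δ n ν →ₗ[ℂ] Cell δ n μ :=
  (coords δ n μ).symm.toLinearMap ∘ₗ
    { toFun := fun f c y => ∑ x, (∏ j, A j (fibreCard c j) (y j) (x j)) * f c x
      map_add' := fun f g => by
        funext c y
        simp [mul_add, Finset.sum_add_distrib]
      map_smul' := fun r f => by
        funext c y
        simp [Finset.mul_sum, mul_left_comm] } ∘ₗ (coords δ n ν).toLinearMap

theorem coords_tensorMap (δ : Fin m → ℂ) (A : MatFamily μ ν) (x : Cell δ n ν)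
    (c : Fin n → Fin m) (y : Pieces μ c) :
    coords δ n μ (tensorMap δ n A x) c y =
      ∑ d, (∏ j, A j (fibreCard c j) (y j) (d j)) * coords δ n ν x c d := by
  unfold tensorMap
  rw [LinearMap.comp_apply, LinearMap.comp_apply, LinearEquiv.coe_coe, LinearEquiv.apply_symm_apply]
  rfl

theorem coords_ext {δ : Fin m → ℂ} {x y : Cell δ n lam}
    (h : ∀ c d, coords δ n lam x c d = coords δ n lam y c d) : x = y :=
  (coords δ n lam).injective (funext fun c => funext fun d => h c d)

theorem tensorMap_comp (δ : Fin m → ℂ) (A : MatFamily μ ν) (B : MatFamily ν τ) (x : Cell δ n τ) :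
    tensorMap δ n A (tensorMap δ n B x) = tensorMap δ n (fun j k => A j k * B j k) x := by
  refine coords_ext fun c y => ?_
  rw [coords_tensorMap, coords_tensorMap]
  simp only [coords_tensorMap, Finset.mul_sum]
  rw [Finset.sum_comm]
  refine Finset.sum_congr rfl fun z _ => ?_
  simp only [← mul_assoc]
  rw [← Finset.sum_mul]
  congr 1
  simp only [← Finset.prod_mul_distrib]
  exact (Fintype.prod_sum fun j (g : HalfOne (fibreCard c j) (ν j)) =>
    A j (fibreCard c j) (y j) g * B j (fibreCard c j) g (z j)).symm

theorem tensorMap_congr (δ : Fin m → ℂ) {A B : MatFamily μ ν} (h : ∀ j k, A j k = B j k)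
    (x : Cell δ n ν) : tensorMap δ n A x = tensorMap δ n B x := by
  rw [show A = B from funext fun j => funext fun k => h j k]

theorem tensorMap_one (δ : Fin m → ℂ) (x : Cell δ n ν) :
    tensorMap δ n (fun _ _ => 1 : MatFamily ν ν) x = x := by
  refine coords_ext fun c y => ?_
  rw [coords_tensorMap, Finset.sum_eq_single y]
  · simp
  · intro d _ hd
    obtain ⟨j, hj⟩ := Function.ne_iff.1 hd
    have h0 : ∏ j, (1 : Matrix (HalfOne (fibreCard c j) (ν j)) (HalfOne (fibreCard c j) (ν j)) ℂ)
        (y j) (d j) = 0 :=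
      Finset.prod_eq_zero (Finset.mem_univ j) (Matrix.one_apply_ne hj.symm)
    exact mul_eq_zero_of_left h0 _
  · simp

theorem tensorMap_eq_zero (δ : Fin m → ℂ) {A : MatFamily μ ν} {j : Fin m} (h : ∀ k, A j k = 0)
    (x : Cell δ n ν) : tensorMap δ n A x = 0 := by
  refine coords_ext fun c y => ?_
  rw [coords_tensorMap, map_zero]
  refine Finset.sum_eq_zero fun d _ => ?_
  rw [Finset.prod_eq_zero (Finset.mem_univ j), zero_mul]
  rw [h]
  rfl

theorem tensorMap_sub (δ : Fin m → ℂ) {A B C : MatFamily μ ν} {j : Fin m}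
    (hj : ∀ k, C j k = A j k - B j k) (hA : ∀ i ≠ j, C i = A i) (hB : ∀ i ≠ j, C i = B i)
    (x : Cell δ n ν) : tensorMap δ n C x = tensorMap δ n A x - tensorMap δ n B x := by
  refine coords_ext fun c y => ?_
  rw [map_sub]
  change _ = coords δ n μ (tensorMap δ n A x) c y - coords δ n μ (tensorMap δ n B x) c y
  rw [coords_tensorMap, coords_tensorMap, coords_tensorMap, ← Finset.sum_sub_distrib]
  refine Finset.sum_congr rfl fun d _ => ?_
  rw [← sub_mul]
  congr 1
  rw [← Finset.mul_prod_erase _ _ (Finset.mem_univ j), ← Finset.mul_prod_erase _ _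
    (Finset.mem_univ j), ← Finset.mul_prod_erase _ (fun i => B i _ _ _) (Finset.mem_univ j), hj]
  have h1 : ∀ D : MatFamily μ ν, (∀ i ≠ j, C i = D i) →
      ∏ i ∈ Finset.univ.erase j, C i (fibreCard c i) (y i) (d i) =
        ∏ i ∈ Finset.univ.erase j, D i (fibreCard c i) (y i) (d i) := fun D hD =>
    Finset.prod_congr rfl fun i hi => by rw [hD i (Finset.ne_of_mem_erase hi)]
  rw [← h1 A hA, ← h1 B hB, ← sub_mul]
  rfl

end Model

/-! ### Tensor products of intertwiners are homomorphisms over the bubble algebra -/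

section Intertwiner

variable {n m : ℕ} {ν μ : Fin m → ℕ}

/-- The tensor product of vectors attached to the cut points of the different colours. -/
noncomputable def tensorVec (f : ∀ j, (Fin (ν j) → Bool) → ℂ) (y : Cut ν → Bool) : ℂ :=
  ∏ j, f j (y ∘ botEmb ν j)

theorem sum_extState_tensorVec {ρ : Fin m → ℂ} (hρ : ∀ i, ρ i ≠ 0)
    {f : ∀ j, (Fin (ν j) → Bool) → ℂ} (hf : ∀ j, Singular (ρ j) (f j)) {p q : Cut ν}
    (h : Adjacent (fun y : Cut ν => (ofLex y).1) p q) (x : Rest p q → Bool) :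
    ∑ t : Bool, ρ (ofLex p).1 ^ (2 * sgn t) * tensorVec f (extState x t) = 0 := by
  obtain ⟨j, p', rfl⟩ : ∃ j p', p = botEmb ν j p' := ⟨(ofLex p).1, (ofLex p).2, rfl⟩
  obtain ⟨q', rfl⟩ : ∃ q', q = botEmb ν j q' := by
    obtain ⟨i, q'⟩ := q
    obtain rfl : j = i := h.colour
    exact ⟨q', rfl⟩
  have hinj := (botEmb_strictMono ν j).injective
  have hlt : p' < q' := (botEmb_strictMono ν j).lt_iff_lt.1 h.lt
  have hadj : Adjacent (fun _ : Fin (ν j) => (0 : Fin 1)) p' q' :=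
    ⟨hlt, rfl, fun y h1 h2 _ => h.gap (botEmb ν j y) (botEmb_strictMono ν j h1)
      (botEmb_strictMono ν j h2) rfl⟩
  let x' : Rest p' q' → Bool := fun y =>
    x ⟨botEmb ν j y.1, fun e => y.2.1 (hinj e), fun e => y.2.2 (hinj e)⟩
  have hj : ∀ t, extState x t ∘ botEmb ν j = extState x' t := by
    intro t
    funext y
    change extState x t (botEmb ν j y) = _
    by_cases e1 : y = p'
    · rw [e1, extState_left, extState_left]
    by_cases e2 : y = q'
    · rw [e2, extState_right h.lt, extState_right hlt]
    exact (extState_rest x t ⟨botEmb ν j y, fun e => e1 (hinj e), fun e => e2 (hinj e)⟩).trans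
      (extState_rest x' t ⟨y, e1, e2⟩).symm
  have hi : ∀ i ≠ j, ∀ t, extState x t ∘ botEmb ν i = extState x true ∘ botEmb ν i := by
    intro i hi t
    funext y
    have hne : ∀ r : Fin (ν j), botEmb ν i y ≠ botEmb ν j r := fun r e =>
      hi (congrArg (fun z : Cut ν => (ofLex z).1) e)
    exact (extState_rest x t ⟨botEmb ν i y, hne _, hne _⟩).trans
      (extState_rest x true ⟨botEmb ν i y, hne _, hne _⟩).symm
  have h1 := (singular_iff (hρ j) (f j)).1 (hf j) _ p' q' hadj x'
  have h2 : ∀ t, tensorVec f (extState x t) = f j (extState x' t) *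
      ∏ i ∈ Finset.univ.erase j, f i (extState x true ∘ botEmb ν i) := by
    intro t
    unfold tensorVec
    rw [← Finset.mul_prod_erase _ _ (Finset.mem_univ j), hj]
    exact congrArg _ (Finset.prod_congr rfl fun i h => by rw [hi i (Finset.ne_of_mem_erase h)])
  simp only [h2, ← mul_assoc]
  rw [← Finset.sum_mul]
  exact mul_eq_zero_of_left h1 _

/-- A vector that is killed by all contractions of neighbouring nodes is killed by all diagrams
with an arc on the bottom row. -/
theorem sum_amp_mul_eq_zero {X Y : Type} [LinearOrder X] [Fintype X] [LinearOrder Y] [Fintype Y]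
    {ρ : Fin m → ℂ} (hρ : ∀ i, ρ i ≠ 0) {d : Diagram m X Y} (hd : ¬ NoCap d)
    {F : (Y → Bool) → ℂ} (hF : ∀ p q, Adjacent (fun y => d.part.colour (Sum.inr y)) p q →
      ∀ x : Rest p q → Bool, ∑ t : Bool,
        ρ (d.part.colour (Sum.inr p)) ^ (2 * sgn t) * F (extState x t) = 0)
    (s : X → Bool) : ∑ y, amp ρ d s y * F y = 0 := by
  obtain ⟨y, y', e⟩ := exists_cap_of_not_noCap hd
  obtain ⟨p, q, hadj, hpq⟩ := exists_adjacent_arc d e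
  obtain ⟨d', hm, hd'⟩ := exists_eq_comp_cap d hadj hpq
  have h1 : ∀ y, amp ρ d s y = ∑ z, amp ρ d' s z * amp ρ (cap _ hadj) z y := by
    intro y
    have h := amp_comp hρ (fun _ => rfl) d' (cap _ hadj) hm s y
    rw [weight_eq_one_of_bot _ fun y => ⟨y.1, cap_rel_line _ hadj y⟩, one_mul, ← hd'] at h
    exact h.symm
  have h2 : ∀ z, ∑ y, amp ρ (cap _ hadj) z y * F y = 0 := fun z =>
    (cap_amp_sum ρ hρ _ hadj z F).trans (hF p q hadj z)
  simp only [h1, Finset.sum_mul]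
  rw [Finset.sum_comm]
  refine Finset.sum_eq_zero fun z _ => ?_
  simp only [mul_assoc]
  rw [← Finset.mul_sum, h2, mul_zero]

/-- Tensor products of singular vectors are killed by the diagrams with an arc on the cut. -/
theorem sum_amp_tensorVec_eq_zero {X : Type} [LinearOrder X] [Fintype X] {ρ : Fin m → ℂ}
    (hρ : ∀ i, ρ i ≠ 0) {f : ∀ j, (Fin (ν j) → Bool) → ℂ} (hf : ∀ j, Singular (ρ j) (f j))
    {d : Diagram m X (Cut ν)} (hcol : ∀ y, d.part.colour (Sum.inr y) = (ofLex y).1)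
    (hd : ¬ NoCap d) (s : X → Bool) : ∑ y, amp ρ d s y * tensorVec f y = 0 := by
  refine sum_amp_mul_eq_zero hρ hd (fun p q h x => ?_) s
  rw [hcol]
  rw [funext hcol] at h
  exact sum_extState_tensorVec hρ hf h x

/-- The colours of the top nodes of a half-diagram. -/
def topColour (h : Half n ν) (x : Fin n) : Fin m := h.diag.part.colour (Sum.inl x)

open Classical in
/-- The realization of the cell module in the vertex model, with the vector `F` placed on the
cut. -/
noncomputable def vertexMap (δ ρ : Fin m → ℂ) (n : ℕ) (F : (Cut ν → Bool) → ℂ) :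
    Cell δ n ν →ₗ[ℂ] ((Fin n → Fin m) → (Fin n → Bool) → ℂ) :=
  Finsupp.linearCombination ℂ fun h : Half n ν => fun c s =>
    if c = topColour h then ∑ y, amp ρ h.diag s y * F y else 0

open Classical in
/-- The action of a diagram on the vertex model. -/
noncomputable def vertexAct (ρ : Fin m → ℂ) (a : Diagram m (Fin n) (Fin n)) :
    ((Fin n → Fin m) → (Fin n → Bool) → ℂ) →ₗ[ℂ] ((Fin n → Fin m) → (Fin n → Bool) → ℂ) where
  toFun g c s := if c = fun x => a.part.colour (Sum.inl x) then
    ∑ s', amp ρ a s s' * g (fun x => a.part.colour (Sum.inr x)) s' else 0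
  map_add' g g' := by
    funext c s
    by_cases h : c = fun x => a.part.colour (Sum.inl x) <;>
      simp [h, mul_add, Finset.sum_add_distrib]
  map_smul' r g := by
    funext c s
    by_cases h : c = fun x => a.part.colour (Sum.inl x) <;>
      simp [h, Finset.mul_sum, mul_left_comm]

open Classical in
theorem vertexMap_basisVec (δ ρ : Fin m → ℂ) (F : (Cut ν → Bool) → ℂ) (h : Half n ν)
    (c : Fin n → Fin m) (s : Fin n → Bool) : vertexMap δ ρ n F (basisVec δ h) c s =
      if c = topColour h then ∑ y, amp ρ h.diag s y * F y else 0 := by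
  have e : vertexMap δ ρ n F (basisVec δ h) = fun c s =>
      if c = topColour h then ∑ y, amp ρ h.diag s y * F y else 0 :=
    (Finsupp.linearCombination_single ℂ (1 : ℂ) h).trans (one_smul _ _)
  rw [e]

/-- A diagram as an element of the bubble algebra. -/
noncomputable def diagVec (δ : Fin m → ℂ) (a : Diagram m (Fin n) (Fin n)) : Alg δ n :=
  (Finsupp.single a 1 : Diagram m (Fin n) (Fin n) →₀ ℂ)

theorem diagVec_smul_basisVec (δ : Fin m → ℂ) (a : Diagram m (Fin n) (Fin n)) (h : Half n ν) :
    diagVec δ a • basisVec δ h = (show Cell δ n ν from halfProj (diagMul δ a h.diag)) := by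
  change halfProj (mulL δ (Finsupp.single a 1) (halfIncl (Finsupp.single h 1))) = _
  rw [halfIncl_single, mulL_single, one_mul, one_smul]

theorem isHalf_iff_noCap {d : Diagram m (Fin n) (Cut ν)}
    (hcol : ∀ y, d.part.colour (Sum.inr y) = (ofLex y).1) : IsHalf d ↔ NoCap d :=
  ⟨fun h => (noCap_iff_rel d).2 h.2, fun h => ⟨hcol, (noCap_iff_rel d).1 h⟩⟩

/-- The vertex model with a tensor product of singular vectors on the cut is a representation. -/
theorem vertexMap_smul {δ ρ : Fin m → ℂ} (hρ : ∀ i, ρ i ≠ 0)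
    (hδ : ∀ i, δ i = ρ i ^ (4 : ℤ) + ρ i ^ (-4 : ℤ)) {f : ∀ j, (Fin (ν j) → Bool) → ℂ}
    (hf : ∀ j, Singular (ρ j) (f j)) (a : Diagram m (Fin n) (Fin n)) (x : Cell δ n ν) :
    vertexMap δ ρ n (tensorVec f) (diagVec δ a • x) =
      vertexAct ρ a (vertexMap δ ρ n (tensorVec f) x) := by
  classical
  suffices h : vertexMap δ ρ n (tensorVec f) ∘ₗ act δ (diagVec δ a) =
      vertexAct ρ a ∘ₗ vertexMap δ ρ n (tensorVec f) from LinearMap.congr_fun h x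
  refine Finsupp.lhom_ext' fun h => LinearMap.ext_ring ?_
  change vertexMap δ ρ n (tensorVec f) (diagVec δ a • basisVec δ h) =
    vertexAct ρ a (vertexMap δ ρ n (tensorVec f) (basisVec δ h))
  rw [diagVec_smul_basisVec]
  funext c s
  change _ = if c = fun x => a.part.colour (Sum.inl x) then ∑ s', amp ρ a s s' *
    vertexMap δ ρ n (tensorVec f) (basisVec δ h) (fun x => a.part.colour (Sum.inr x)) s' else 0
  simp only [vertexMap_basisVec]
  by_cases hm : Match a.part h.diag.part
  · have e : diagMul δ a h.diag = Finsupp.single (a.comp h.diag hm)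
      (weight δ a.part h.diag.part) := dif_pos hm
    have hc : (fun x => a.part.colour (Sum.inr x)) = topColour h := funext hm
    have hcol : ∀ y, (a.comp h.diag hm).part.colour (Sum.inr y) = (ofLex y).1 := h.isHalf.1
    have hsum : ∑ s', amp ρ a s s' * ∑ y, amp ρ h.diag s' y * tensorVec f y =
        weight δ a.part h.diag.part *
          ∑ y, amp ρ (a.comp h.diag hm) s y * tensorVec f y := by
      simp only [Finset.mul_sum, ← mul_assoc, ← amp_comp hρ hδ a h.diag hm, Finset.sum_mul]
      rw [Finset.sum_comm]
    simp only [if_pos hc]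
    rw [e, hsum]
    by_cases hh : IsHalf (a.comp h.diag hm)
    · rw [halfProj_single ⟨_, hh⟩]
      have e' : vertexMap δ ρ n (tensorVec f) (Finsupp.single ⟨_, hh⟩
          (weight δ a.part h.diag.part)) = weight δ a.part h.diag.part • fun c s =>
            if c = topColour ⟨_, hh⟩ then
              ∑ y, amp ρ (a.comp h.diag hm) s y * tensorVec f y else 0 :=
        Finsupp.linearCombination_single ℂ _ _
      refine (congrFun (congrFun e' c) s).trans ?_
      exact mul_ite_zero _ _ _
    · rw [halfProj_single_of_not hh, sum_amp_tensorVec_eq_zero hρ hf hcol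
        (fun hn => hh ((isHalf_iff_noCap hcol).2 hn)), mul_zero, ite_self]
      exact congrFun (congrFun (map_zero (vertexMap δ ρ n (tensorVec f))) c) s
  · have e : diagMul δ a h.diag = 0 := dif_neg hm
    rw [e, map_zero]
    have hc : ¬ (fun x => a.part.colour (Sum.inr x)) = topColour h := fun e => hm (congrFun e)
    simp only [if_neg hc, mul_zero, Finset.sum_const_zero, ite_self]
    exact congrFun (congrFun (map_zero (vertexMap δ ρ n (tensorVec f))) c) s

theorem sum_amp_glue_tensorVec (ρ : Fin m → ℂ) (f : ∀ j, (Fin (ν j) → Bool) → ℂ)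
    {c : Fin n → Fin m} (d : Pieces ν c) (s : Fin n → Bool) :
    ∑ y, amp ρ (glue d).diag s y * tensorVec f y =
      ∏ j, (ampMat (ρ j) (d j).1).mulVec (f j) (s ∘ topEmb c j) := by
  simp only [amp_glue, tensorVec, ← Finset.prod_mul_distrib]
  exact sum_prod_restrict (botEmb ν) (botEmb_bijective ν)
    fun j t => amp (fun _ => ρ j) (d j).1 (s ∘ topEmb c j) t * f j t

theorem vertexMap_apply (δ ρ : Fin m → ℂ) (f : ∀ j, (Fin (ν j) → Bool) → ℂ) (x : Cell δ n ν)
    (c : Fin n → Fin m) (s : Fin n → Bool) : vertexMap δ ρ n (tensorVec f) x c s =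
      ∑ d, (∏ j, (ampMat (ρ j) (d j).1).mulVec (f j) (s ∘ topEmb c j)) * coords δ n ν x c d := by
  classical
  let R : Cell δ n ν →ₗ[ℂ] ℂ :=
    { toFun := fun x => ∑ d, (∏ j, (ampMat (ρ j) (d j).1).mulVec (f j) (s ∘ topEmb c j)) *
        coords δ n ν x c d
      map_add' := fun x y => by simp [mul_add, Finset.sum_add_distrib]
      map_smul' := fun r x => by simp [Finset.mul_sum, mul_left_comm] }
  suffices h : (LinearMap.proj s ∘ₗ LinearMap.proj c) ∘ₗ vertexMap δ ρ n (tensorVec f) = R from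
    LinearMap.congr_fun h x
  refine cell_ext fun c' d' => ?_
  change vertexMap δ ρ n (tensorVec f) (basisVec δ (glue d')) c s =
    ∑ d, (∏ j, (ampMat (ρ j) (d j).1).mulVec (f j) (s ∘ topEmb c j)) *
      coords δ n ν (basisVec δ (glue d')) c d
  rw [vertexMap_basisVec]
  change (if c = c' then _ else _) = _
  by_cases hc : c = c'
  · subst hc
    simp [coords_basisVec, sum_amp_glue_tensorVec]
  · simp [coords_basisVec_of_ne δ hc, hc]

theorem exists_psi_leftInverse {ρ : ℂ} (hρ : ρ ≠ 0) (k l : ℕ) :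
    ∃ L : HalfOne k l → (Fin k → Bool) → ℂ,
      ∀ g h, ∑ s, L g s * psi ρ h s = if g = h then 1 else 0 := by
  obtain ⟨φ, hφ⟩ := LinearMap.exists_leftInverse_of_injective
    (Fintype.linearCombination ℂ (psi ρ : HalfOne k l → (Fin k → Bool) → ℂ))
    (LinearMap.ker_eq_bot.2 (linearIndependent_psi hρ k l).fintypeLinearCombination_injective)
  refine ⟨fun g s => φ (Pi.single s 1) g, fun g h => ?_⟩
  have h1 := congrFun (LinearMap.congr_fun hφ (Pi.single h 1)) g
  rw [LinearMap.comp_apply, Fintype.linearCombination_apply_single, one_smul] at h1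
  rw [LinearMap.id_apply, Pi.single_apply] at h1
  rw [← h1]
  conv_rhs => rw [pi_eq_sum_univ' (psi ρ h), map_sum, Finset.sum_apply]
  refine Finset.sum_congr rfl fun s _ => ?_
  rw [map_smul, Pi.smul_apply, smul_eq_mul, mul_comm]

/-- The vertex model with all cut points positive is faithful on the cell module. -/
theorem vertexMap_plus_injective (δ : Fin m → ℂ) {ρ : Fin m → ℂ} (hρ : ∀ i, ρ i ≠ 0) :
    Function.Injective (vertexMap δ ρ n (tensorVec fun j => plus (Fin (ν j)))) := by
  rw [injective_iff_map_eq_zero]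
  intro x hx
  refine coords_ext fun c g => ?_
  rw [map_zero]
  choose L hL using fun j => exists_psi_leftInverse (hρ j) (fibreCard c j) (ν j)
  have h1 : ∑ s, (∏ j, L j (g j) (s ∘ topEmb c j)) *
      vertexMap δ ρ n (tensorVec fun j => plus (Fin (ν j))) x c s = coords δ n ν x c g := by
    simp only [vertexMap_apply, Finset.mul_sum]
    rw [Finset.sum_comm]
    have h2 : ∀ d : Pieces ν c, ∑ s, (∏ j, L j (g j) (s ∘ topEmb c j)) *
        ((∏ j, (ampMat (ρ j) (d j).1).mulVec (plus (Fin (ν j))) (s ∘ topEmb c j)) *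
          coords δ n ν x c d) = (∏ j, if g j = d j then 1 else 0) * coords δ n ν x c d := by
      intro d
      simp only [← mul_assoc, ← Finset.sum_mul, ← Finset.prod_mul_distrib]
      rw [sum_prod_restrict (topEmb c) (topEmb_bijective c) fun j t =>
        L j (g j) t * (ampMat (ρ j) (d j).1).mulVec (plus (Fin (ν j))) t]
      congr 1
      exact Finset.prod_congr rfl fun j _ => hL j (g j) (d j)
    rw [Finset.sum_congr rfl fun d _ => h2 d, Finset.sum_eq_single g]
    · simp
    · intro d _ hd
      obtain ⟨j, hj⟩ := Function.ne_iff.1 hd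
      rw [Finset.prod_eq_zero (Finset.mem_univ j) (if_neg hj.symm), zero_mul]
    · simp
  rw [← h1, hx]
  exact Finset.sum_eq_zero fun s _ => mul_zero _

/-- A family of matrices that expresses the action of the half-diagrams on a singular vector by
the vertex model. -/
def IsIntertwiner (ρ : ℂ) {l l' : ℕ} (Θ : ∀ k, Matrix (HalfOne k l) (HalfOne k l') ℂ) : Prop :=
  ∃ f, Singular ρ f ∧ ∀ k (h : HalfOne k l'), ∑ g, Θ k g h • psi ρ g = (ampMat ρ h.1).mulVec f

theorem isIntertwiner_one (ρ : ℂ) (l : ℕ) :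
    IsIntertwiner ρ (fun k => (1 : Matrix (HalfOne k l) (HalfOne k l) ℂ)) := by
  refine ⟨plus _, singular_plus ρ, fun k h => ?_⟩
  rw [Finset.sum_eq_single h]
  · exact (congrArg (· • psi ρ h) (Matrix.one_apply_eq h)).trans (one_smul _ _)
  · intro g _ hg
    exact (congrArg (· • psi ρ g) (Matrix.one_apply_ne hg)).trans (zero_smul _ _)
  · simp

theorem alg_ext {δ : Fin m → ℂ} {V : Type*} [AddCommGroup V] [Module ℂ V]
    {f g : Alg δ n →ₗ[ℂ] V} (h : ∀ a, f (diagVec δ a) = g (diagVec δ a)) : f = g :=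
  Finsupp.lhom_ext' fun a => LinearMap.ext_ring (h a)

theorem tensorMap_smul {δ ρ : Fin m → ℂ} (hρ : ∀ i, ρ i ≠ 0)
    (hδ : ∀ i, δ i = ρ i ^ (4 : ℤ) + ρ i ^ (-4 : ℤ)) {Θ : MatFamily μ ν}
    (hΘ : ∀ j, IsIntertwiner (ρ j) (Θ j)) (a : Alg δ n) (x : Cell δ n ν) :
    tensorMap δ n Θ (a • x) = a • tensorMap δ n Θ x := by
  choose f hf hfΘ using hΘ
  have key : ∀ x, vertexMap δ ρ n (tensorVec fun j => plus (Fin (μ j))) (tensorMap δ n Θ x) =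
      vertexMap δ ρ n (tensorVec f) x := by
    intro x
    funext c s
    rw [vertexMap_apply, vertexMap_apply]
    simp only [coords_tensorMap, Finset.mul_sum]
    rw [Finset.sum_comm]
    refine Finset.sum_congr rfl fun d _ => ?_
    simp only [← mul_assoc, ← Finset.sum_mul, ← Finset.prod_mul_distrib]
    congr 1
    rw [← Fintype.prod_sum fun j (g : HalfOne (fibreCard c j) (μ j)) =>
      (ampMat (ρ j) g.1).mulVec (plus (Fin (μ j))) (s ∘ topEmb c j) * Θ j (fibreCard c j) g (d j)]
    refine Finset.prod_congr rfl fun j _ => ?_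
    rw [← hfΘ j, Finset.sum_apply]
    exact Finset.sum_congr rfl fun g _ => mul_comm _ _
  suffices h : tensorMap δ n Θ ∘ₗ (act δ).flip x = (act δ).flip (tensorMap δ n Θ x) from
    LinearMap.congr_fun h a
  refine alg_ext fun a => vertexMap_plus_injective δ hρ ?_
  change vertexMap δ ρ n _ (tensorMap δ n Θ (diagVec δ a • x)) =
    vertexMap δ ρ n _ (diagVec δ a • tensorMap δ n Θ x)
  rw [key, vertexMap_smul hρ hδ hf, vertexMap_smul hρ hδ fun j => singular_plus (ρ j), key]

/-- The homomorphism of cell modules given by one-coloured intertwiners. -/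
noncomputable def tensorHom {δ ρ : Fin m → ℂ} (hρ : ∀ i, ρ i ≠ 0)
    (hδ : ∀ i, δ i = ρ i ^ (4 : ℤ) + ρ i ^ (-4 : ℤ)) (n : ℕ) {Θ : MatFamily μ ν}
    (hΘ : ∀ j, IsIntertwiner (ρ j) (Θ j)) : Cell δ n ν →ₗ[Alg δ n] Cell δ n μ where
  toFun := tensorMap δ n Θ
  map_add' := map_add _
  map_smul' := tensorMap_smul hρ hδ hΘ

end Intertwiner

/-! ### The bilinear form and the simple heads -/

section Form

variable {n m : ℕ} {ν : Fin m → ℕ}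

/-- The Gram matrices of the one-coloured cell modules. -/
noncomputable def gramFamily (ρ : Fin m → ℂ) (ν : Fin m → ℕ) : MatFamily ν ν :=
  fun j _ => gram (psi (ρ j))

theorem form_glue {δ ρ : Fin m → ℂ} (hρ : ∀ i, ρ i ≠ 0)
    (hδ : ∀ i, δ i = ρ i ^ (4 : ℤ) + ρ i ^ (-4 : ℤ)) {c : Fin n → Fin m} (d d' : Pieces ν c) :
    form δ n ν (basisVec δ (glue d)) (basisVec δ (glue d')) =
      ∏ j, dotProduct (psi (ρ j) (d j)) (psi (ρ j) (d' j)) := by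
  refine (form_single_single hρ hδ (glue d) (glue d') fun _ => rfl).trans ?_
  simp only [amp_glue, ← Finset.prod_mul_distrib]
  refine (sum_prod_restrict (topEmb c) (topEmb_bijective c) fun j t =>
    amp (fun _ => ρ j) (d j).1 t (fun _ => true) *
      amp (fun _ => ρ j) (d' j).1 t (fun _ => true)).trans ?_
  refine Finset.prod_congr rfl fun j _ => Finset.sum_congr rfl fun s _ => ?_
  rw [psi_apply, psi_apply]

theorem form_glue_of_ne {δ : Fin m → ℂ} {c c' : Fin n → Fin m} (h : c ≠ c') (d : Pieces ν c)
    (d' : Pieces ν c') : form δ n ν (basisVec δ (glue d)) (basisVec δ (glue d')) = 0 :=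
  form_single_single_of_not_match _ _ fun hm => h (funext hm)

/-- The form on the cell module is the tensor product of the one-coloured Gram matrices. -/
theorem form_basisVec {δ ρ : Fin m → ℂ} (hρ : ∀ i, ρ i ≠ 0)
    (hδ : ∀ i, δ i = ρ i ^ (4 : ℤ) + ρ i ^ (-4 : ℤ)) {c : Fin n → Fin m} (d : Pieces ν c)
    (x : Cell δ n ν) : form δ n ν (basisVec δ (glue d)) x =
      coords δ n ν (tensorMap δ n (gramFamily ρ ν) x) c d := by
  suffices h : form δ n ν (basisVec δ (glue d)) = (LinearMap.proj d ∘ₗ LinearMap.proj c) ∘ₗ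
      (coords δ n ν).toLinearMap ∘ₗ tensorMap δ n (gramFamily ρ ν) from LinearMap.congr_fun h x
  refine cell_ext fun c' d' => ?_
  change _ = coords δ n ν (tensorMap δ n (gramFamily ρ ν) (basisVec δ (glue d'))) c d
  rw [coords_tensorMap]
  by_cases hc : c = c'
  · subst hc
    rw [form_glue hρ hδ]
    simp [coords_basisVec, gramFamily, gram]
  · simp [form_glue_of_ne hc, coords_basisVec_of_ne δ hc]

theorem mem_formRad_iff_basisVec {δ : Fin m → ℂ} {x : Cell δ n ν} :
    x ∈ formRad δ n ν ↔ ∀ h, form δ n ν (basisVec δ h) x = 0 := by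
  refine ⟨fun hx h => hx _, fun hx y => ?_⟩
  suffices h : (form δ n ν).flip x = 0 from LinearMap.congr_fun h y
  exact Finsupp.lhom_ext' fun h => LinearMap.ext_ring (hx h)

theorem mem_formRad_iff {δ ρ : Fin m → ℂ} (hρ : ∀ i, ρ i ≠ 0)
    (hδ : ∀ i, δ i = ρ i ^ (4 : ℤ) + ρ i ^ (-4 : ℤ)) {x : Cell δ n ν} :
    x ∈ formRad δ n ν ↔ tensorMap δ n (gramFamily ρ ν) x = 0 := by
  rw [mem_formRad_iff_basisVec]
  constructor
  · intro h
    refine coords_ext fun c d => ?_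
    rw [← form_basisVec hρ hδ, h, map_zero]
    rfl
  · intro h a
    obtain ⟨⟨c, d⟩, rfl⟩ := (glueEquiv n ν).surjective a
    refine (form_basisVec hρ hδ d x).trans ?_
    rw [h, map_zero]
    rfl

theorem propagating_of_colour {e : Diagram m (Cut ν) (Cut ν)}
    (hc : ∀ y, e.part.colour (Sum.inl y) = e.part.colour (Sum.inr y)) (r : ℂ) [Decidable (NoCap e)] :
    propagating (Finsupp.single e r) = if NoCap e then r else 0 := by
  classical
  unfold propagating
  rw [Finsupp.linearCombination_single, smul_eq_mul]
  split_ifs with h1 h2 h2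
  · exact mul_one r
  · exact absurd ((noCap_iff_rel e).2 fun y => propagating_bottom h1 y) h2
  · exact absurd (fun y => ⟨y, e.part.rel.symm ((h2.partner_eq_self hc y) ▸ e.rel_partner _)⟩) h1
  · exact mul_zero r

theorem NoCap.eq_idPart {Y : Type} [LinearOrder Y] [Finite Y] {e : Diagram m Y Y} (h : NoCap e)
    {c : Y → Fin m} (hl : ∀ y, e.part.colour (Sum.inl y) = c y)
    (hr : ∀ y, e.part.colour (Sum.inr y) = c y) : e = ⟨idPart c, idPart_isBubble c⟩ := by
  have h1 := h.partner_eq_self fun y => (hl y).trans (hr y).symm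
  symm
  refine Diagram.ext_partner (funext fun p => ?_) fun p => ?_
  · rcases p with y | y
    · exact (hl y).symm
    · exact (hr y).symm
  · rcases p with y | y
    · rw [Diagram.partner_comm (h1 y)]
      exact rfl
    · rw [h1]
      exact rfl

/-- The product of a half-diagram and the reflection of another one acts on the cell module by an
operator of rank at most one, which is given by the form. -/
theorem diagVec_comp_reflect_smul (δ : Fin m → ℂ) (z y : Half n ν)
    (hzy : Match z.diag.part y.diag.reflect.part) (x : Cell δ n ν) :
    diagVec δ (z.diag.comp y.diag.reflect hzy) • x = form δ n ν (basisVec δ y) x • basisVec δ z := by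
  classical
  suffices h : act δ (diagVec δ (z.diag.comp y.diag.reflect hzy)) =
      (form δ n ν (basisVec δ y)).smulRight (basisVec δ z) from LinearMap.congr_fun h x
  refine Finsupp.lhom_ext' fun h => LinearMap.ext_ring ?_
  change halfProj (mulL δ (Finsupp.single (z.diag.comp y.diag.reflect hzy) 1)
    (halfIncl (Finsupp.single h 1))) = form δ n ν (Finsupp.single y 1) (Finsupp.single h 1) •
      Finsupp.single z 1
  have h1 : (Finsupp.single (z.diag.comp y.diag.reflect hzy) 1 :
      Diagram m (Fin n) (Fin n) →₀ ℂ) =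
      mulL δ (Finsupp.single z.diag 1) (Finsupp.single y.diag.reflect 1) := by
    have e : diagMul δ z.diag y.diag.reflect = Finsupp.single (z.diag.comp y.diag.reflect hzy)
      (weight δ z.diag.part y.diag.reflect.part) := dif_pos hzy
    rw [mulL_single, e, weight_eq_one_of_top δ z.isHalf.2]
    simp
  rw [h1, mulL_assoc, halfIncl_single, mulL_single, form_single_eq, one_mul, one_smul]
  by_cases hm : Match y.diag.reflect.part h.diag.part
  · have e : diagMul δ y.diag.reflect h.diag = Finsupp.single (y.diag.reflect.comp h.diag hm)
      (weight δ y.diag.reflect.part h.diag.part) := dif_pos hm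
    have hl : ∀ u, (y.diag.reflect.comp h.diag hm).part.colour (Sum.inl u) = (ofLex u).1 :=
      y.isHalf.1
    have hr : ∀ u, (y.diag.reflect.comp h.diag hm).part.colour (Sum.inr u) = (ofLex u).1 :=
      h.isHalf.1
    have hm' : Match z.diag.part (y.diag.reflect.comp h.diag hm).part := fun u =>
      (z.isHalf.1 u).trans (hl u).symm
    have e' : diagMul δ z.diag (y.diag.reflect.comp h.diag hm) =
        Finsupp.single (z.diag.comp _ hm')
          (weight δ z.diag.part (y.diag.reflect.comp h.diag hm).part) := dif_pos hm'
    rw [e, propagating_of_colour fun u => (hl u).trans (hr u).symm, mulL_single, e',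
      weight_eq_one_of_top δ z.isHalf.2, one_mul, map_smul]
    by_cases hn : NoCap (y.diag.reflect.comp h.diag hm)
    · have e2 : z.diag.comp _ hm' = z.diag := by
        have e3 := hn.eq_idPart (fun u => (hl u).trans (z.isHalf.1 u).symm)
          fun u => (hr u).trans (z.isHalf.1 u).symm
        generalize y.diag.reflect.comp h.diag hm = w at hm' e3
        subst e3
        exact Diagram.ext (comp_id z.diag.part hm')
      rw [if_pos hn, e2, halfProj_single]
    · rw [if_neg hn, zero_smul, halfProj_single_of_not, smul_zero]
      refine fun hh => hn ((noCap_iff_rel _).2 fun u => ?_)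
      obtain ⟨x, hx⟩ := hh.2 u
      exact low_of_stack (x := x) hx
  · have e : diagMul δ y.diag.reflect h.diag = 0 := dif_neg hm
    rw [e]
    simp

/-- Every proper submodule of a cell module lies in the radical of the form. -/
theorem le_formRad {δ : Fin m → ℂ} {M : Submodule (Alg δ n) (Cell δ n ν)} (hM : M ≠ ⊤) :
    M ≤ formRad δ n ν := by
  by_contra hcon
  obtain ⟨x, hx, hx'⟩ := SetLike.not_le_iff_exists.1 hcon
  rw [mem_formRad_iff_basisVec] at hx'
  push Not at hx'
  obtain ⟨y, hy⟩ := hx'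
  refine hM ((Submodule.eq_top_iff').2 fun w => ?_)
  have hz : ∀ (z : Half n ν) (r : ℂ), (show Cell δ n ν from Finsupp.single z r) ∈ M := by
    intro z r
    have hzy : Match z.diag.part y.diag.reflect.part := fun u =>
      (z.isHalf.1 u).trans (y.isHalf.1 u).symm
    have h1 := M.smul_mem (algebraMap ℂ (Alg δ n) (r * (form δ n ν (basisVec δ y) x)⁻¹) *
      diagVec δ (z.diag.comp y.diag.reflect hzy)) hx
    rw [mul_smul, diagVec_comp_reflect_smul, algebraMap_smul, smul_smul, mul_assoc,
      inv_mul_cancel₀ hy, mul_one] at h1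
    have h2 : (Finsupp.single z r : Half n ν →₀ ℂ) = r • Finsupp.single z 1 := by simp
    rw [h2]
    exact h1
  induction w using Finsupp.induction_linear with
  | zero => exact M.zero_mem
  | add w w' h h' => exact M.add_mem h h'
  | single z r => exact hz z r

/-- The quotient by the radical of the form is simple or zero. -/
theorem jacobson_simple (δ : Fin m → ℂ) (n : ℕ) (ν : Fin m → ℕ) :
    Module.jacobson (Alg δ n) (Simple δ n ν) = ⊥ := by
  by_cases h : formRad δ n ν = ⊤
  · have : Subsingleton (Simple δ n ν) := Submodule.Quotient.subsingleton_iff.2 h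
    exact Subsingleton.elim _ _
  · have : IsSimpleModule (Alg δ n) (Simple δ n ν) :=
      isSimpleModule_iff_isCoatom.2 ⟨h, fun M hM => by
        by_contra hne
        exact not_le_of_gt hM (le_formRad hne)⟩
    exact IsSimpleModule.jacobson_eq_bot _ _

/-- By `le_formRad`, the only possible maximal submodule of a cell module with nonzero form is the
radical of the form. -/
theorem formRad_le_jacobson {δ : Fin m → ℂ} (h : formRad δ n ν = ⊤ → Subsingleton (Cell δ n ν)) :
    formRad δ n ν ≤ Module.jacobson (Alg δ n) (Cell δ n ν) := by
  refine le_sInf fun M hM => ?_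
  have h1 := le_formRad hM.1
  rcases h1.lt_or_eq with h2 | h2
  · have := h (hM.2 _ h2)
    exact absurd (Subsingleton.elim _ _) hM.1
  · exact h2.ge

theorem exists_colouring {κ : Fin m → ℕ} (h : ∑ j, κ j = n) :
    ∃ c : Fin n → Fin m, ∀ j, fibreCard c j = κ j := by
  let e : (Σ j, Fin (κ j)) ≃ Fin n := Fintype.equivFinOfCardEq (by simp [h])
  refine ⟨fun x => (e.symm x).1, fun j => ?_⟩
  rw [fibreCard, ← Fintype.card_fin (κ j)]
  refine Fintype.card_congr (Equiv.trans ?_ (Equiv.sigmaSubtype (β := fun j => Fin (κ j)) j))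
  exact e.symm.subtypeEquiv fun x => Iff.rfl

/-- The form on a cell module with a defect is not zero. -/
theorem formRad_ne_top {δ ρ : Fin m → ℂ} (hρ : ∀ i, ρ i ≠ 0)
    (hδ : ∀ i, δ i = ρ i ^ (4 : ℤ) + ρ i ^ (-4 : ℤ)) {v : ℕ} (hn : ∑ j, ν j + 2 * v = n)
    {i : Fin m} (hi : 0 < ν i) : formRad δ n ν ≠ ⊤ := by
  obtain ⟨c, hc⟩ := exists_colouring (n := n) (κ := fun j => ν j + if j = i then 2 * v else 0) (by
    rw [Finset.sum_add_distrib, ← hn]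
    simp)
  have h1 : ∀ j, ∃ g g' : HalfOne (fibreCard c j) (ν j),
      dotProduct (psi (ρ j) g) (psi (ρ j) g') ≠ 0 := by
    intro j
    by_cases hj : j = i
    · subst hj
      obtain ⟨l, hl⟩ := Nat.exists_eq_add_of_lt hi
      have h2 := hc j
      rw [if_pos rfl] at h2
      rw [zero_add] at hl
      rw [hl] at h2 ⊢
      exact exists_dotProduct_ne_zero (hρ j) v l _ h2
    · have h2 := hc j
      rw [if_neg hj, add_zero] at h2
      rw [h2]
      obtain ⟨g⟩ : Nonempty (HalfOne (ν j) (ν j)) := Fintype.card_pos_iff.1 (by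
        rw [card_halfOne_self]
        exact one_pos)
      exact ⟨g, g, by
        change gram (psi (ρ j)) g g ≠ 0
        rw [gram_self]
        exact one_ne_zero⟩
  choose g g' hg using h1
  intro h
  have h2 : basisVec δ (glue g') ∈ formRad δ n ν := h ▸ Submodule.mem_top
  have h3 := h2 (basisVec δ (glue g))
  rw [form_glue hρ hδ] at h3
  exact Finset.prod_ne_zero_iff.2 (fun j _ => hg j) h3

theorem subsingleton_cell (δ : Fin m → ℂ) (h : n < ∑ j, ν j) : Subsingleton (Cell δ n ν) := by
  have : IsEmpty (Half n ν) := ⟨fun a => by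
    have h1 := ((noCap_iff_rel a.diag).2 a.isHalf.2).card_le
    have h2 : Fintype.card (Cut ν) = ∑ j, ν j := by
      change Fintype.card (Σ j, Fin (ν j)) = _
      simp
    rw [Fintype.card_fin] at h1
    omega⟩
  exact inferInstanceAs (Subsingleton (Half n ν →₀ ℂ))

end Form

/-! ### The layers of a cell module -/

/-- One-coloured data that describe the radical of the cell module for `l false`: an intertwiner
`theta` from the cell module for `l true` with image the radical of the form (`mul_lift`,
`mul_theta`) that factors over the quotient by the radical of the form (`theta_mul`). The matrices
`inv` are generalized inverses of the Gram matrices. For critical colours, `theta` is zero. -/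
structure Ladder (ρ : ℂ) (l : Bool → ℕ) where
  theta : ∀ k, Matrix (HalfOne k (l false)) (HalfOne k (l true)) ℂ
  isIntertwiner : IsIntertwiner ρ theta
  inv : ∀ β k, Matrix (HalfOne k (l β)) (HalfOne k (l β)) ℂ
  lift : ∀ k, Matrix (HalfOne k (l true)) (HalfOne k (l false)) ℂ
  gram_mul : ∀ β k, gram (psi ρ) * (inv β k * gram (psi ρ)) = gram (psi ρ)
  mul_lift : ∀ k, theta k * lift k = 1 - inv false k * gram (psi ρ)
  mul_theta : ∀ k, inv false k * gram (psi ρ) * theta k = 0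
  theta_mul : ∀ k, theta k * (inv true k * gram (psi ρ)) = theta k

namespace Ladder

variable {ρ : ℂ} {l : Bool → ℕ} (D : Ladder ρ l)

/-- The matrices of a ladder, indexed by its two rungs: identities, `theta` and `lift`. -/
noncomputable def trans : ∀ β β' k, Matrix (HalfOne k (l β)) (HalfOne k (l β')) ℂ
  | false, false, _ => 1
  | true, true, _ => 1
  | false, true, k => D.theta k
  | true, false, k => D.lift k

theorem trans_self (β : Bool) (k : ℕ) : D.trans β β k = 1 := by cases β <;> rfl

theorem isIntertwiner_trans (β : Bool) : IsIntertwiner ρ (D.trans false β) := by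
  cases β
  · exact isIntertwiner_one ρ _
  · exact D.isIntertwiner

/-- The projection along the radical of the form. -/
noncomputable def proj (β : Bool) (k : ℕ) : Matrix (HalfOne k (l β)) (HalfOne k (l β)) ℂ :=
  D.inv β k * gram (psi ρ)

/-- The kernel of `theta` is the radical of the form on the cell module for `l true`: a matrix `R`
recovers the projection along it. -/
def HasRetraction : Prop :=
  ∀ k, ∃ R : Matrix (HalfOne k (l true)) (HalfOne k (l false)) ℂ, R * D.theta k = D.proj true k

theorem gram_mul_theta (k : ℕ) :
    (gram (psi ρ) : Matrix (HalfOne k (l false)) (HalfOne k (l false)) ℂ) * D.theta k = 0 := by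
  rw [← D.gram_mul, Matrix.mul_assoc, D.mul_theta, Matrix.mul_zero]

theorem trans_mul_trans_of_eq {β β' : Bool} (h : β' = β) (k : ℕ) :
    D.trans false β k * D.trans β β' k = D.trans false β' k := by
  subst h
  rw [D.trans_self, Matrix.mul_one]

theorem trans_mul_trans_raise {β β' : Bool} (h : β = false) (h' : β' = true) (k : ℕ) :
    D.trans false β k * D.trans β β' k = D.trans false β' k := by
  subst h h'
  exact Matrix.one_mul _

theorem trans_mul_trans_lower {β β' : Bool} (h : β = false) (h' : β' = true) (k : ℕ) :
    D.trans false β' k * D.trans β' β k =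
      D.trans false β k - D.trans false β k * D.proj β k := by
  subst h h'
  rw [D.trans_self, Matrix.one_mul]
  exact D.mul_lift k

theorem gram_mul_trans {β β' : Bool} (h : β = false) (h' : β' = true) (k : ℕ) :
    (gram (psi ρ) : Matrix (HalfOne k (l β)) (HalfOne k (l β)) ℂ) * D.trans β β' k = 0 := by
  subst h h'
  exact D.gram_mul_theta k

theorem trans_mul_proj {β : Bool} {k : ℕ} (h : β = true ∨ D.theta k = 0) :
    D.trans false β k * D.proj β k = D.trans false β k := by
  cases β
  · have h1 := D.mul_lift k
    rw [h.resolve_left (by simp), Matrix.zero_mul] at h1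
    exact (Matrix.one_mul _).trans (sub_eq_zero.1 h1.symm).symm
  · exact D.theta_mul k

/-- A ladder of length zero, for a nondegenerate form. -/
theorem exists_of_inverse {N : ∀ k, Matrix (HalfOne k (l false)) (HalfOne k (l false)) ℂ}
    (hN : ∀ k, N k * gram (psi ρ) = 1) : ∃ D : Ladder ρ l, ∀ k, D.theta k = 0 := by
  choose N' hN' using fun k => exists_generalized_inverse (gram (psi ρ : HalfOne k (l true) → _))
  refine ⟨⟨fun k => 0, ⟨0, fun c p q h => Matrix.mulVec_zero _, fun k h => ?_⟩,
    fun β => match β with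
      | false => N
      | true => N', fun k => 0, ?_, fun k => ?_, fun k => Matrix.mul_zero _,
      fun k => Matrix.zero_mul _⟩, fun k => rfl⟩
  · rw [Matrix.mulVec_zero]
    exact Finset.sum_eq_zero fun g _ => zero_smul _ _
  · rintro (_ | _) k
    · exact (congrArg _ (hN k)).trans (Matrix.mul_one _)
    · exact hN' k
  · exact (Matrix.zero_mul _).trans (sub_eq_zero.2 (hN k).symm).symm

end Ladder

section Layers

variable {n m : ℕ} {δ ρ : Fin m → ℂ} (hρ : ∀ i, ρ i ≠ 0)
  (hδ : ∀ i, δ i = ρ i ^ (4 : ℤ) + ρ i ^ (-4 : ℤ)) {L : Fin m → Bool → ℕ}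
  (D : ∀ j, Ladder (ρ j) (L j))

/-- The weight with the lower value in the colours with `b j = false` and the upper one in the
others. -/
abbrev shift (L : Fin m → Bool → ℕ) (b : Fin m → Bool) : Fin m → ℕ := fun j => L j (b j)

/-- The homomorphism into the lowest cell module of a family of ladders. -/
noncomputable def layerHom (n : ℕ) (b : Fin m → Bool) :
    Cell δ n (shift L b) →ₗ[Alg δ n] Cell δ n (shift L fun _ => false) :=
  tensorHom hρ hδ n (Θ := fun j => (D j).trans false (b j)) fun j => (D j).isIntertwiner_trans (b j)

theorem layerHom_apply (b : Fin m → Bool) (x : Cell δ n (shift L b)) :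
    layerHom hρ hδ D n b x = tensorMap δ n (fun j => (D j).trans false (b j)) x := rfl

/-- The choices of `k` raised colours from the set `A`. -/
def Choice (A : Finset (Fin m)) (k : ℕ) : Type :=
  {b : Fin m → Bool // (∀ j, b j = true → j ∈ A) ∧ #{j | b j = true} = k}

instance (A : Finset (Fin m)) (k : ℕ) : Finite (Choice A k) :=
  inferInstanceAs (Finite {b : Fin m → Bool // (∀ j, b j = true → j ∈ A) ∧ #{j | b j = true} = k})

/-- The sum of the images of the cell modules with `k` raised colours. -/
noncomputable def layerSum (n : ℕ) (A : Finset (Fin m)) (k : ℕ) :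
    Submodule (Alg δ n) (Cell δ n (shift L fun _ => false)) :=
  ⨆ b : Choice A k, LinearMap.range (layerHom hρ hδ D n b.1)

/-- The choice with one more raised colour. -/
def raiseChoice {A : Finset (Fin m)} {k : ℕ} (b : Choice A k) {i : Fin m} (hi : i ∈ A)
    (hb : b.1 i = false) : Choice A (k + 1) :=
  ⟨Function.update b.1 i true, fun j hj => by
    by_cases h : j = i
    · exact h ▸ hi
    · rw [Function.update_of_ne h] at hj
      exact b.2.1 j hj, by
    have h : ({j | Function.update b.1 i true j = true} : Finset (Fin m)) =
        insert i ({j | b.1 j = true} : Finset (Fin m)) := by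
      ext j
      by_cases h : j = i
      · simp [h]
      · simp [h]
    rw [h, Finset.card_insert_of_notMem (by simp [hb]), b.2.2]⟩

/-- The radical of the form is mapped into the next layer. The projections along the radicals of
the one-coloured forms are introduced one colour at a time, and each step changes the image by an
element of the image of one of the cell modules of the next layer. -/
theorem layerHom_formRad_le {A : Finset (Fin m)} (hA : ∀ j ∉ A, ∀ k, (D j).theta k = 0) {k : ℕ}
    (b : Choice A k) {x : Cell δ n (shift L b.1)} (hx : x ∈ formRad δ n (shift L b.1)) :
    layerHom hρ hδ D n b.1 x ∈ layerSum hρ hδ D n A (k + 1) := by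
  let C (J : Finset (Fin m)) : MatFamily (shift L fun _ => false) (shift L b.1) := fun j r =>
    (D j).trans false (b.1 j) r * if j ∈ J then (D j).proj (b.1 j) r else 1
  have hC : ∀ J : Finset (Fin m), tensorMap δ n (C ∅) x - tensorMap δ n (C J) x ∈
      layerSum hρ hδ D n A (k + 1) := by
    intro J
    induction J using Finset.induction_on with
    | empty =>
      rw [sub_self]
      exact Submodule.zero_mem _
    | insert i J hi ih =>
      have hne : ∀ j ≠ i, C (insert i J) j = C J j := by
        intro j hj
        funext r
        simp only [C, Finset.mem_insert, hj, false_or]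
      suffices h : tensorMap δ n (C J) x - tensorMap δ n (C (insert i J)) x ∈
          layerSum hρ hδ D n A (k + 1) by
        have := Submodule.add_mem _ ih h
        rwa [sub_add_sub_cancel] at this
      by_cases hcase : i ∈ A ∧ b.1 i = false
      · obtain ⟨hiA, hbi⟩ := hcase
        let b' := raiseChoice b hiA hbi
        have hb'i : b'.1 i = true := Function.update_self i _ _
        have hb' : ∀ j ≠ i, b'.1 j = b.1 j := fun j hj => Function.update_of_ne hj _ _
        let E : MatFamily (shift L b'.1) (shift L b.1) := fun j r =>
          (D j).trans (b'.1 j) (b.1 j) r * if j ∈ J then (D j).proj (b.1 j) r else 1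
        have h1 : tensorMap δ n (fun j r => (D j).trans false (b'.1 j) r * E j r) x =
            tensorMap δ n (C J) x - tensorMap δ n (C (insert i J)) x := by
          refine tensorMap_sub δ (j := i) (fun r => ?_) (fun j hj => ?_) (fun j hj => ?_) x
          · simp only [C, E, hi, if_false, Finset.mem_insert_self, if_true, Matrix.mul_one]
            exact (D i).trans_mul_trans_lower hbi hb'i r
          · funext r
            simp only [C, E, ← Matrix.mul_assoc]
            congr 1
            exact (D j).trans_mul_trans_of_eq (hb' j hj).symm r
          · rw [hne j hj]
            funext r
            simp only [C, E, ← Matrix.mul_assoc]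
            congr 1
            exact (D j).trans_mul_trans_of_eq (hb' j hj).symm r
        rw [← h1, ← tensorMap_comp]
        exact Submodule.mem_iSup_of_mem b' ⟨tensorMap δ n E x, rfl⟩
      · have h1 : tensorMap δ n (C J) x = tensorMap δ n (C (insert i J)) x := by
          refine tensorMap_congr δ (fun j r => ?_) x
          by_cases hj : j = i
          · subst hj
            simp only [C, hi, if_false, Finset.mem_insert_self, if_true, Matrix.mul_one]
            have h2 : b.1 j = true ∨ (D j).theta r = 0 := by
              by_cases hb : b.1 j = true
              · exact Or.inl hb
              · exact Or.inr (hA j (fun h => hcase ⟨h, by simpa using hb⟩) r)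
            exact ((D j).trans_mul_proj h2).symm
          · rw [hne j hj]
        rw [h1, sub_self]
        exact Submodule.zero_mem _
  have h0 : tensorMap δ n (C ∅) x = layerHom hρ hδ D n b.1 x := by
    rw [layerHom_apply]
    refine tensorMap_congr δ (fun j r => ?_) x
    simp only [C, Finset.notMem_empty, if_false, Matrix.mul_one]
  have h1 : tensorMap δ n (C Finset.univ) x = 0 := by
    have h2 : tensorMap δ n (C Finset.univ) x =
        tensorMap δ n (fun j r => (D j).trans false (b.1 j) r * (D j).inv (b.1 j) r *
          gramFamily ρ (shift L b.1) j r) x := by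
      refine tensorMap_congr δ (fun j r => ?_) x
      simp only [C, Finset.mem_univ, if_true, Matrix.mul_assoc]
      rfl
    rw [h2, ← tensorMap_comp, (mem_formRad_iff hρ hδ).1 hx, map_zero]
  have := hC Finset.univ
  rwa [h0, h1, sub_zero] at this

/-- The image of a cell module of the next layer comes from the radical of a form. -/
theorem range_layerHom_raise_le {A : Finset (Fin m)} {k : ℕ} (b : Choice A k) {i : Fin m}
    (hi : i ∈ A) (hb : b.1 i = false) :
    LinearMap.range (layerHom hρ hδ D n (raiseChoice b hi hb).1) ≤
      (formRad δ n (shift L b.1)).map (layerHom hρ hδ D n b.1) := by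
  set b' := raiseChoice b hi hb
  have hb'i : b'.1 i = true := Function.update_self i _ _
  have hb' : ∀ j ≠ i, b'.1 j = b.1 j := fun j hj => Function.update_of_ne hj _ _
  rintro _ ⟨x, rfl⟩
  refine ⟨tensorMap δ n (fun j => (D j).trans (b.1 j) (b'.1 j)) x, ?_, ?_⟩
  · refine (mem_formRad_iff hρ hδ).2 ?_
    rw [tensorMap_comp]
    refine tensorMap_eq_zero δ (j := i) (fun r => ?_) x
    exact (D i).gram_mul_trans hb hb'i r
  · rw [layerHom_apply, layerHom_apply, tensorMap_comp]
    refine tensorMap_congr δ (fun j r => ?_) x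
    by_cases hj : j = i
    · subst hj
      exact (D j).trans_mul_trans_raise hb hb'i r
    · exact (D j).trans_mul_trans_of_eq (hb' j hj) r

/-- The retraction on a cell module of a layer: it kills the other cell modules of the layer and
the next layer, and it is the projection along the radical of the form on the given one. -/
theorem exists_layer_retraction {A : Finset (Fin m)}
    (hA : ∀ j ∈ A, (D j).HasRetraction)
    {k : ℕ} (b : Choice A k) :
    ∃ R : Cell δ n (shift L fun _ => false) →ₗ[ℂ] Cell δ n (shift L b.1),
      (∀ x, R (layerHom hρ hδ D n b.1 x) = 0 → x ∈ formRad δ n (shift L b.1)) ∧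
      ∀ (k' : ℕ) (b' : Choice A k'), k ≤ k' → b'.1 ≠ b.1 → ∀ x,
        R (layerHom hρ hδ D n b'.1 x) = 0 := by
  have h1 : ∀ j r, ∃ M : Matrix (HalfOne r (L j (b.1 j))) (HalfOne r (L j false)) ℂ,
      M * (D j).trans false (b.1 j) r = (D j).proj (b.1 j) r ∧
        ∀ β, b.1 j = false → β = true → M * (D j).trans false β r = 0 := by
    intro j r
    have h2 := b.2.1 j
    generalize b.1 j = β at *
    -- in a colour that is not raised, the projection along the radical kills the image of `theta`
    cases β
    · exact ⟨(D j).proj false r, Matrix.mul_one _, fun β _ hβ => hβ ▸ (D j).mul_theta r⟩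
    · obtain ⟨R, hR⟩ := hA j (h2 rfl) r
      exact ⟨R, hR, by simp⟩
  choose M hM hM' using h1
  refine ⟨tensorMap δ n M, fun x hx => ?_, fun k' b' hk hb x => ?_⟩
  · rw [layerHom_apply, tensorMap_comp] at hx
    refine (mem_formRad_iff hρ hδ).2 ?_
    have h2 : tensorMap δ n (gramFamily ρ (shift L b.1)) x = tensorMap δ n
        (fun j r => gramFamily ρ (shift L b.1) j r * (M j r * (D j).trans false (b.1 j) r)) x := by
      refine tensorMap_congr δ (fun j r => ?_) x
      rw [hM]
      exact ((D j).gram_mul (b.1 j) r).symm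
    rw [h2, ← tensorMap_comp, hx, map_zero]
  · obtain ⟨j, hj, hj'⟩ : ∃ j, b'.1 j = true ∧ b.1 j = false := by
      by_contra! hcon
      have hsub : ({j | b'.1 j = true} : Finset (Fin m)) ⊆
          ({j | b.1 j = true} : Finset (Fin m)) := by
        intro j hj
        have := hcon j (by simpa using hj)
        simpa using this
      have heq := Finset.eq_of_subset_of_card_le hsub (by rw [b.2.2, b'.2.2]; exact hk)
      refine hb (funext fun j => ?_)
      have h3 : b'.1 j = true ↔ b.1 j = true := by
        simpa using Finset.ext_iff.1 heq j
      exact Bool.eq_iff_iff.2 h3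
    rw [layerHom_apply, tensorMap_comp]
    refine tensorMap_eq_zero δ (j := j) (fun r => ?_) x
    exact hM' j r _ hj' hj

/-- The sum of the homomorphisms of a layer. -/
noncomputable def layerSumHom (n : ℕ) (A : Finset (Fin m)) (k : ℕ) :
    (⨁ b : Choice A k, Cell δ n (shift L b.1)) →ₗ[Alg δ n] Cell δ n (shift L fun _ => false) :=
  open Classical in DirectSum.toModule _ _ _ fun b => layerHom hρ hδ D n b.1

theorem layerSumHom_apply {A : Finset (Fin m)} {k : ℕ} [Fintype (Choice A k)]
    (x : ⨁ b : Choice A k, Cell δ n (shift L b.1)) :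
    layerSumHom hρ hδ D n A k x = ∑ b, layerHom hρ hδ D n b.1 (x b) := by
  classical
  conv_lhs => rw [← DirectSum.sum_univ_of x]
  rw [map_sum]
  exact Finset.sum_congr rfl fun b _ => DirectSum.toModule_lof _ _ _

theorem range_layerSumHom (A : Finset (Fin m)) (k : ℕ) :
    LinearMap.range (layerSumHom hρ hδ D n A k) = layerSum hρ hδ D n A k := by
  classical
  have := Fintype.ofFinite (Choice A k)
  refine le_antisymm ?_ (iSup_le fun b => ?_)
  · rintro _ ⟨x, rfl⟩
    rw [layerSumHom_apply]
    exact Submodule.sum_mem _ fun b _ => Submodule.mem_iSup_of_mem b ⟨x b, rfl⟩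
  · rintro _ ⟨x, rfl⟩
    exact ⟨DirectSum.lof (Alg δ n) _ _ b x, DirectSum.toModule_lof _ _ _⟩

/-- An element of the direct sum of the cell modules of a layer is mapped to the next layer exactly
if its components lie in the radicals of the forms. -/
theorem layerSumHom_mem_iff {A : Finset (Fin m)} (hA : ∀ j ∉ A, ∀ k, (D j).theta k = 0)
    (hA' : ∀ j ∈ A, (D j).HasRetraction) {k : ℕ}
    (x : ⨁ b : Choice A k, Cell δ n (shift L b.1)) :
    layerSumHom hρ hδ D n A k x ∈ layerSum hρ hδ D n A (k + 1) ↔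
      ∀ b, x b ∈ formRad δ n (shift L b.1) := by
  classical
  have := Fintype.ofFinite (Choice A k)
  rw [layerSumHom_apply]
  constructor
  · intro h b
    obtain ⟨R, hR, hR'⟩ := exists_layer_retraction (n := n) hρ hδ D hA' b
    have h1 : ∀ y ∈ layerSum hρ hδ D n A (k + 1), R y = 0 := by
      intro y hy
      refine Submodule.iSup_induction _ (motive := fun y => R y = 0) hy ?_ (map_zero R) ?_
      · rintro b' _ ⟨z, rfl⟩
        refine hR' (k + 1) b' (Nat.le_succ k) (fun e => ?_) z
        have h2 := b'.2.2
        rw [e, b.2.2] at h2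
        exact absurd h2 (Nat.succ_ne_self k).symm
      · intro y z hy hz
        rw [map_add, hy, hz, add_zero]
    refine hR _ ?_
    have h2 := h1 _ h
    rwa [map_sum, Finset.sum_eq_single b (fun b' _ hb' => hR' k b' le_rfl
      (fun e => hb' (Subtype.ext e)) _) (fun hb => absurd (Finset.mem_univ b) hb)] at h2
  · exact fun h => Submodule.sum_mem _ fun b _ => layerHom_formRad_le hρ hδ D hA b (h b)

/-- Each cell module of the next layer is obtained by raising one more colour, so its image lies in
the image of the radical of a form. -/
theorem layerSum_succ_le {A : Finset (Fin m)} {k : ℕ} (b' : Choice A (k + 1)) :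
    ∃ b : Choice A k, LinearMap.range (layerHom hρ hδ D n b'.1) ≤
      (formRad δ n (shift L b.1)).map (layerHom hρ hδ D n b.1) := by
  obtain ⟨i, hi⟩ : ∃ i, b'.1 i = true := by
    have h : 0 < #{j | b'.1 j = true} := by rw [b'.2.2]; exact Nat.succ_pos k
    obtain ⟨i, hi⟩ := Finset.card_pos.1 h
    exact ⟨i, by simpa using hi⟩
  have hcard : #{j | Function.update b'.1 i false j = true} = k := by
    have h : ({j | Function.update b'.1 i false j = true} : Finset (Fin m)) =
        ({j | b'.1 j = true} : Finset (Fin m)).erase i := by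
      ext j
      by_cases h : j = i
      · simp [h]
      · simp [h]
    rw [h, Finset.card_erase_of_mem (by simp [hi]), b'.2.2, Nat.add_sub_cancel]
  let b : Choice A k := ⟨Function.update b'.1 i false, fun j hj => by
    by_cases h : j = i
    · rw [h, Function.update_self] at hj
      cases hj
    · rw [Function.update_of_ne h] at hj
      exact b'.2.1 j hj, hcard⟩
  have hb : b.1 i = false := Function.update_self i _ _
  refine ⟨b, ?_⟩
  have h1 : b' = raiseChoice b (b'.2.1 i hi) hb := by
    refine Subtype.ext (funext fun j => ?_)
    by_cases h : j = i
    · subst h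
      exact hi.trans (Function.update_self j true b.1).symm
    · exact ((Function.update_of_ne h _ _).trans (Function.update_of_ne h _ _)).symm
  rw [h1]
  exact range_layerHom_raise_le hρ hδ D b _ hb

/-- The layers are direct sums of heads of cell modules. -/
theorem nonempty_layer_equiv {A : Finset (Fin m)} (hA : ∀ j ∉ A, ∀ k, (D j).theta k = 0)
    (hA' : ∀ j ∈ A, (D j).HasRetraction) (k : ℕ) :
    Nonempty ((layerSum hρ hδ D n A k ⧸
      (layerSum hρ hδ D n A (k + 1)).submoduleOf (layerSum hρ hδ D n A k)) ≃ₗ[Alg δ n]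
        ⨁ b : Choice A k, Simple δ n (shift L b.1)) := by
  have hmem : ∀ x, layerSumHom hρ hδ D n A k x ∈ layerSum hρ hδ D n A k := fun x =>
    range_layerSumHom hρ hδ D A k ▸ LinearMap.mem_range_self _ x
  let φ := ((layerSum hρ hδ D n A (k + 1)).submoduleOf (layerSum hρ hδ D n A k)).mkQ ∘ₗ
    (layerSumHom hρ hδ D n A k).codRestrict (layerSum hρ hδ D n A k) hmem
  have hφ : Function.Surjective φ := by
    refine (Submodule.mkQ_surjective _).comp ?_
    rintro ⟨y, hy⟩
    rw [← range_layerSumHom] at hy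
    obtain ⟨x, rfl⟩ := hy
    exact ⟨x, rfl⟩
  let π : (⨁ b : Choice A k, Cell δ n (shift L b.1)) →ₗ[Alg δ n]
      ⨁ b : Choice A k, Simple δ n (shift L b.1) :=
    DirectSum.lmap fun b => (formRad δ n (shift L b.1)).mkQ
  have hπ : Function.Surjective π :=
    (DirectSum.lmap_surjective _).2 fun b => Submodule.mkQ_surjective _
  have hker : LinearMap.ker φ = LinearMap.ker π := by
    ext x
    have h1 : x ∈ LinearMap.ker φ ↔
        layerSumHom hρ hδ D n A k x ∈ layerSum hρ hδ D n A (k + 1) := by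
      rw [LinearMap.mem_ker]
      exact Submodule.Quotient.mk_eq_zero _
    rw [h1, layerSumHom_mem_iff hρ hδ D hA hA', LinearMap.mem_ker]
    constructor
    · intro h
      refine DFinsupp.ext fun b => ?_
      exact (Submodule.Quotient.mk_eq_zero _).2 (h b)
    · intro h b
      exact (Submodule.Quotient.mk_eq_zero _).1 (DFinsupp.ext_iff.1 h b)
  exact ⟨(φ.quotKerEquivOfSurjective hφ).symm.trans
    ((Submodule.quotEquivOfEq _ _ hker).trans (π.quotKerEquivOfSurjective hπ))⟩

theorem jacobson_directSum {ι : Type} {R : Type*} [Ring R] {M : ι → Type*}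
    [∀ i, AddCommGroup (M i)] [∀ i, Module R (M i)] (h : ∀ i, Module.jacobson R (M i) = ⊥) :
    Module.jacobson R (⨁ i, M i) = ⊥ :=
  Module.jacobson_eq_bot_of_injective (DirectSum.coeFnLinearMap R) DFunLike.coe_injective
    (Module.jacobson_pi_eq_bot R M h)

/-- The layers filter the cell module by its radical series. -/
theorem radSeries_eq_layerSum {A : Finset (Fin m)} (hA : ∀ j ∉ A, ∀ k, (D j).theta k = 0)
    (hA' : ∀ j ∈ A, (D j).HasRetraction)
    (hrad : ∀ k (b : Choice A k), formRad δ n (shift L b.1) = ⊤ →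
      Subsingleton (Cell δ n (shift L b.1))) (k : ℕ) :
    radSeries (Alg δ n) (Cell δ n (shift L fun _ => false)) k = layerSum hρ hδ D n A k := by
  induction k with
  | zero =>
    symm
    rw [radSeries, eq_top_iff]
    intro x _
    let b : Choice A 0 := ⟨fun _ => false, by simp, by simp⟩
    refine Submodule.mem_iSup_of_mem b ⟨x, ?_⟩
    exact tensorMap_one δ x
  | succ k ih =>
    rw [radSeries, ih]
    refine le_antisymm ?_ (iSup_le fun b' => ?_)
    · obtain ⟨e⟩ := nonempty_layer_equiv (n := n) hρ hδ D hA hA' k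
      have h1 := Module.jacobson_le_of_eq_bot (Module.jacobson_eq_bot_of_injective e.toLinearMap
        e.injective (jacobson_directSum fun b => jacobson_simple δ n _))
      refine (Submodule.map_mono h1).trans ?_
      rintro _ ⟨x, hx, rfl⟩
      exact hx
    · obtain ⟨b, hb⟩ := layerSum_succ_le (n := n) hρ hδ D b'
      refine hb.trans ?_
      let ψ := (layerHom hρ hδ D n b.1).codRestrict (layerSum hρ hδ D n A k)
        fun x => Submodule.mem_iSup_of_mem b ⟨x, rfl⟩
      rintro _ ⟨x, hx, rfl⟩
      exact ⟨ψ x, Module.map_jacobson_le ψ ⟨x, formRad_le_jacobson (hrad k b) hx, rfl⟩, rfl⟩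

theorem layerSum_eq_bot {A : Finset (Fin m)} {k : ℕ} (hk : #A < k) :
    layerSum hρ hδ D n A k = ⊥ := by
  refine iSup_eq_bot.2 fun b => ?_
  have h : #{j | b.1 j = true} ≤ #A := Finset.card_le_card fun j hj => b.2.1 j (by simpa using hj)
  rw [b.2.2] at h
  omega

end Layers

/-! ### The radical series of the cell modules -/

/-- The number `a` of defects and its reflection `a + b`, indexed by `Bool` for use in `Ladder`. -/
def rungs (a b : ℕ) : Bool → ℕ
  | false => a
  | true => a + b

/-- The homomorphism between reflected one-coloured cell modules, as a ladder. -/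
theorem Ladder.exists_of_splitting {ρ : ℂ} (hρ : ρ ≠ 0) {l t : ℕ} (ht : 0 < t)
    (htL : t < orderOf (mu ρ ^ 2)) (hd : orderOf (mu ρ ^ 2) ∣ l + t + 1) :
    ∃ D : Ladder ρ (rungs l (2 * t)), D.HasRetraction := by
  obtain ⟨f, Θ, hf, hΘ, hS⟩ := exists_splitting hρ ht htL hd
  let S := fun k => (hS k).some
  refine ⟨⟨Θ, ⟨f, hf, hΘ⟩, fun β => match β with
      | false => fun k => (S k).N
      | true => fun k => (S k).N', fun k => (S k).lift, ?_, fun k => (S k).mul_lift,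
      fun k => (S k).mul_theta, fun k => (S k).theta_mul⟩,
    fun k => ⟨(S k).retract, (S k).retract_mul⟩⟩
  rintro (_ | _) k
  · exact (S k).gram_mul
  · exact (S k).gram_mul'

/-- The parameter `μ ^ 2` of the Gaussian binomials is the inverse of `q ^ 2`. -/
theorem orderOf_mu_sq {ρ q : ℂ} (h : ρ ^ 4 = q) : orderOf (mu ρ ^ 2) = orderOf (q ^ 2) := by
  have h1 : mu ρ ^ 2 = (q ^ 2)⁻¹ := by
    rw [← h]
    unfold mu
    rw [neg_sq, zpow_neg, inv_pow]
    norm_cast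
  rw [h1, orderOf_eq_orderOf_iff]
  intro k
  rw [inv_pow, inv_eq_one]

end Bubble

open Bubble

theorem theorem7p4 (n m : ℕ) (q δ : Fin m → ℂ) (hq : ∀ i, q i ≠ 0)
    (hδ : ∀ i, δ i = q i + (q i)⁻¹) (v : ℕ) (lam : Fin m → ℕ) (hlam : ∑ i, lam i + 2 * v = n)
    (hform : Bubble.form δ n lam ≠ 0) (s : ℕ) (hs : s < m) (t : Fin m → ℕ)
    (hlow : ∀ j : Fin m, (j : ℕ) ≤ s →
      0 < t j ∧ t j < orderOf (q j ^ 2) ∧ lam j + t j + 1 ≡ 0 [MOD orderOf (q j ^ 2)])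
    (hhigh : ∀ i : Fin m, s < (i : ℕ) →
      (∀ k : ℕ, 0 < k → q i ^ k ≠ 1) ∨ lam i + 1 ≡ 0 [MOD orderOf (q i ^ 2)]) :
    Bubble.radSeries (Bubble.Alg δ n) (Bubble.Cell δ n lam) (s + 2) = ⊥ ∧
    ∀ k ≤ s + 1, Nonempty
      (Bubble.RadLayer (Bubble.Alg δ n) (Bubble.Cell δ n lam) k ≃ₗ[Bubble.Alg δ n]
        ⨁ lam' : Bubble.Xi s t lam k, Bubble.Simple δ n lam'.1) := by
  classical
  choose ρ hρq using fun i => IsAlgClosed.exists_pow_nat_eq (q i) (n := 4) (by norm_num)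
  have hρ : ∀ i, ρ i ≠ 0 := fun i h => hq i (by rw [← hρq, h]; norm_num)
  have hδ' : ∀ i, δ i = ρ i ^ (4 : ℤ) + ρ i ^ (-4 : ℤ) := fun i => by
    rw [hδ, ← hρq, zpow_neg]
    norm_cast
  have hord := fun i => orderOf_mu_sq (hρq i)
  -- the colours in `A` can be raised; the others are critical and get ladders with `theta = 0`
  let A : Finset (Fin m) := {j | (j : ℕ) ≤ s}
  have hmem : ∀ {j : Fin m}, j ∈ A ↔ (j : ℕ) ≤ s := by simp [A]
  have hD : ∀ j, ∃ D : Ladder (ρ j) (rungs (lam j) (2 * t j)),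
      (j ∉ A → ∀ k, D.theta k = 0) ∧ (j ∈ A → D.HasRetraction) := by
    intro j
    by_cases hj : j ∈ A
    · obtain ⟨h1, h2, h3⟩ := hlow j (hmem.1 hj)
      rw [← hord] at h2 h3
      obtain ⟨D, hD⟩ := Ladder.exists_of_splitting (hρ j) h1 h2 ((Nat.modEq_zero_iff_dvd).1 h3)
      exact ⟨D, fun h => absurd hj h, fun _ => hD⟩
    · have hcrit : Critical (ρ j) (lam j) := by
        unfold Critical
        rw [hord]
        rcases hhigh j (not_le.1 fun h => hj (hmem.2 h)) with h | h
        · -- Mathlib's `orderOf` is zero for elements of infinite order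
          left
          rw [orderOf_eq_zero_iff']
          intro k hk h'
          rw [← pow_mul] at h'
          exact h _ (by omega) h'
        · exact Or.inr ((Nat.modEq_zero_iff_dvd).1 h)
      choose N hN using exists_inverse_gram (hρ j) hcrit
      obtain ⟨D, hD⟩ := Ladder.exists_of_inverse (l := rungs (lam j) (2 * t j)) hN
      exact ⟨D, fun _ => hD, fun h => absurd h hj⟩
  choose D hD0 hD1 using hD
  let L : Fin m → Bool → ℕ := fun j => rungs (lam j) (2 * t j)
  -- the form on a nonzero cell module is not zero: a raised colour provides a defect, and if no
  -- colour is raised, this is the assumption on the form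
  have hrad : ∀ k (b : Choice A k), formRad δ n (shift L b.1) = ⊤ →
      Subsingleton (Cell δ n (shift L b.1)) := by
    intro k b htop
    have hsum : ∑ j, shift L b.1 j = ∑ j, lam j + 2 * ∑ j, (if b.1 j = true then t j else 0) := by
      rw [Finset.mul_sum, ← Finset.sum_add_distrib]
      refine Finset.sum_congr rfl fun j _ => ?_
      change rungs (lam j) (2 * t j) (b.1 j) = _
      cases b.1 j <;> simp [rungs]
    rcases lt_or_ge n (∑ j, shift L b.1 j) with h | h
    · exact subsingleton_cell δ h
    · exfalso
      by_cases hb : ∃ i, b.1 i = true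
      · obtain ⟨i, hi⟩ := hb
        have hpos : 0 < shift L b.1 i := by
          change 0 < rungs (lam i) (2 * t i) (b.1 i)
          rw [hi]
          have := (hlow i (hmem.1 (b.2.1 i hi))).1
          change 0 < lam i + 2 * t i
          omega
        refine formRad_ne_top hρ hδ' (v := v - ∑ j, (if b.1 j = true then t j else 0)) ?_ hpos htop
        omega
      · have hb' : b.1 = fun _ => false := funext fun j => by
          simpa using fun h => hb ⟨j, h⟩
        rw [hb'] at htop
        have hzero : ∀ y x, form δ n (shift L fun _ => false) y x = 0 := fun y x =>
          (htop ▸ Submodule.mem_top : x ∈ formRad δ n (shift L fun _ => false)) y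
        exact hform (LinearMap.ext fun y => LinearMap.ext fun x => hzero y x)
  have hser := radSeries_eq_layerSum (n := n) hρ hδ' D hD0 hD1 hrad
  have hlayer := nonempty_layer_equiv (n := n) hρ hδ' D hD0 hD1
  have hA : #A = s + 1 := by
    have h1 : A = (Finset.Iic (⟨s, hs⟩ : Fin m)) := by
      ext j
      rw [hmem, Finset.mem_Iic]
      exact Iff.rfl
    rw [h1, Fin.card_Iic]
  refine ⟨?_, fun k _ => ?_⟩
  · refine (hser (s + 2)).trans (layerSum_eq_bot hρ hδ' D ?_)
    omega
  · obtain ⟨e⟩ := hlayer k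
    rw [← hser, ← hser] at e
    -- the summands are indexed by the tuples, which are determined by the set of raised colours
    -- since `t j` is positive
    let g : Choice A k → Xi s t lam k := fun b => ⟨shift L b.1,
      Finset.univ.filter fun j => b.1 j = true, fun j hj => hmem.1 (b.2.1 j (by simpa using hj)),
      b.2.2, fun j hj => by
        change rungs (lam j) (2 * t j) (b.1 j) = _
        rw [show b.1 j = true by simpa using hj]
        rfl, fun j hj => by
        change rungs (lam j) (2 * t j) (b.1 j) = _
        rw [show b.1 j = false by simpa using hj]
        rfl⟩
    have hg : Function.Bijective g := by
      constructor
      · intro b b' h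
        refine Subtype.ext (funext fun j => ?_)
        have h1 : rungs (lam j) (2 * t j) (b.1 j) = rungs (lam j) (2 * t j) (b'.1 j) :=
          congrFun (congrArg Subtype.val h) j
        by_cases hj : j ∈ A
        · have := (hlow j (hmem.1 hj)).1
          revert h1
          cases b.1 j <;> cases b'.1 j <;> simp [rungs] <;> omega
        · have h2 : ∀ b : Choice A k, b.1 j = false := fun b => by
            simpa using fun h => hj (b.2.1 j h)
          rw [h2, h2]
      · rintro ⟨lam', S, h1, h2, h3, h4⟩
        refine ⟨⟨fun j => decide (j ∈ S), fun j hj => hmem.2 (h1 j (by simpa using hj)),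
          by simpa using h2⟩, Subtype.ext (funext fun j => ?_)⟩
        change rungs (lam j) (2 * t j) (decide (j ∈ S)) = lam' j
        by_cases hj : j ∈ S
        · rw [h3 j hj, decide_eq_true hj]
          rfl
        · rw [h4 j hj, decide_eq_false hj]
          rfl
    let E := Equiv.ofBijective g hg
    exact ⟨e.trans (DirectSum.lequivCongrLeft (Alg δ n)
      (M := fun lam' : Xi s t lam k => Simple δ n lam'.1) E.symm).symm⟩
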